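/- Let $k$ be a field and let $i\colon X\hookrightarrow Y$ be a closed embedding of $k$-schemes that is a local complete intersection: every point of $X$ has an affine open neighbourhood in $Y$ on which the ideal sheaf $I$ of $X$ is generated by a regular sequence (the length of which is the codimension of $i$ at that point). Assume that $\operatorname{char} k=0$ or that $\operatorname{char} k$ is greater than the codimension of $i$ at every point of $X$. Let $N=(i^*I)^\vee=(I/I^2)^\vee$ be the normal bundle, and let $X'\subset Y$ be the first infinitesimal neighbourhood of $X$, i.e. the closed subscheme with ideal sheaf $I^2$. Assume condition $(*)$: there is a vector bundle $\overline N$ on $X'$ whose restriction to $X$ is isomorphic to $N$. Let $i^*\colon \mathbf D(Y)\to\mathbf D(X)$ denote derived pull-back, left adjoint to $i_*$ (only its value $i^*i_*\mathscr O_X$ is needed; this is an object of $\mathbf D(X)$ with $\operatorname{Hom}_{\mathbf D(X)}(i^*i_*\mathscr O_X,G)\cong\operatorname{Hom}_{\mathbf D(Y)}(i_*\mathscr O_X,i_*G)$ naturally in $G$, it exists, and it is unique up to isomorphism). The filtration of $i^*i_*\mathscr O_X$ by its truncations, with subquotients $\mathscr H^{-q}(i^*i_*\mathscr O_X)[q]$,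 gives after applying $\operatorname{Hom}_{\mathbf D(X)}(-,\mathscr O_X)$ the hypercohomology spectral sequence of $k$-vector spaces \[ {}^2E^{p,q}=\operatorname{Hom}_{\mathbf D(X)}\bigl(\mathscr H^{-q}(i^*i_*\mathscr O_X)[q],\mathscr O_X[p+q]\bigr)\cong H^p(X,\wedge^qN)\ \Rightarrow\ \operatorname{Hom}^{p+q}_{\mathbf D(X)}(i^*i_*\mathscr O_X,\mathscr O_X)\cong\operatorname{Ext}^{p+q}_Y(i_*\mathscr O_X,i_*\mathscr O_X), \] where ${}^2E^{p,q}=0$ if $p<0$ or $q<0$. This spectral sequence degenerates at the ${}^2E$-page: all differentials on the pages ${}^rE$ with $r\ge 2$ vanish. It converges: for every $n$ let $F_q\operatorname{Hom}^n_{\mathbf D(X)}(i^*i_*\mathscr O_X,\mathscr O_X)$ be the image of $\operatorname{Hom}^n_{\mathbf D(X)}(\tau^{\ge -q}i^*i_*\mathscr O_X,\mathscr O_X)$; then $F_{-1}=0$, $F_n$ is everything, and $F_q/F_{q-1}\cong {}^2E^{n-q,q}$ for all $q$. Consequently, for every $n\ge 0$ there is an isomorphism of $k$-vector spaces \[ \operatorname{Ext}^n_Y(i_*\mathscr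 O_X,i_*\mathscr O_X)\cong\bigoplus_{p+q=n}H^p(X,\wedge^qN). \] -/

import Mathlib

universe u v w

set_option linter.unusedSectionVars false

open CategoryTheory Limits Opposite TopologicalSpace

namespace AlgebraicGeometry.Scheme.Modules

noncomputable section

variable {X Y : Scheme.{u}}

/-- Multiplication by a global function, as an endomorphism of an `𝒪_X`-module. -/
def globalScalar (r : Γ(X, ⊤)) (M : X.Modules) : M ⟶ M where
  val := PresheafOfModules.homMk
    { app U := M.smul (X.presheaf.map (homOfLE le_top : unop U ⟶ ⊤).op r)
      naturality U V i := by
        obtain ⟨i⟩ := i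
        refine Eq.trans ?_ (M.map_comp_smul i _).symm
        rw [← CommRingCat.comp_apply, ← X.presheaf.map_comp]
        rfl }
    (fun U s x ↦ smul_comm (M := Γ(X, unop U)) (N := Γ(X, unop U)) (α := Γ(M, unop U)) _ s x)

lemma globalScalar_app_apply (r : Γ(X, ⊤)) (M : X.Modules) (U : X.Opens) (x : Γ(M, U)) :
    (globalScalar r M).app U x = X.presheaf.map (homOfLE le_top : U ⟶ ⊤).op r • x := rfl

lemma globalScalar_one (M : X.Modules) : globalScalar 1 M = 𝟙 M := by
  ext U x
  rw [globalScalar_app_apply, map_one]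
  exact one_smul Γ(X, U) x

lemma globalScalar_zero (M : X.Modules) : globalScalar 0 M = 0 := by
  ext U x
  rw [globalScalar_app_apply, map_zero]
  exact zero_smul Γ(X, U) x

lemma globalScalar_add (r s : Γ(X, ⊤)) (M : X.Modules) :
    globalScalar (r + s) M = globalScalar r M + globalScalar s M := by
  ext U x
  rw [globalScalar_app_apply, map_add]
  exact add_smul (R := Γ(X, U)) _ _ x

lemma globalScalar_mul (r s : Γ(X, ⊤)) (M : X.Modules) :
    globalScalar (r * s) M = globalScalar s M ≫ globalScalar r M := by
  ext U x
  rw [globalScalar_app_apply, map_mul]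
  exact mul_smul (α := Γ(X, U)) _ _ x

/-- The ring `Γ(X, 𝒪_X)` acts on the category of `𝒪_X`-modules. -/
def globalScalarCenter (X : Scheme.{u}) : Γ(X, ⊤) →+* CatCenter X.Modules where
  toFun r :=
    { app M := globalScalar r M
      naturality M N f := by
        ext U x
        exact (f.app_smul _ _).symm }
  map_one' := NatTrans.ext (funext globalScalar_one)
  map_zero' := NatTrans.ext (funext globalScalar_zero)
  map_add' r s := NatTrans.ext (funext (globalScalar_add r s))
  map_mul' r s := NatTrans.ext (funext (globalScalar_mul r s))

variable (k : Type u) [Field k]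

/-- The structure map `k → Γ(X, 𝒪_X)` of a `k`-scheme. -/
def scalars (X : Scheme.{u}) [X.Over (Spec (.of k))] : k →+* Γ(X, ⊤) :=
  ((Scheme.ΓSpecIso (.of k)).inv ≫ (X ↘ Spec (.of k)).appTop).hom

/-- The category of `𝒪_X`-modules on a `k`-scheme `X` is `k`-linear. -/
instance linear [X.Over (Spec (.of k))] : Linear k X.Modules :=
  Linear.ofRingMorphism ((globalScalarCenter X).comp (scalars k X))

variable (X) in
/-- The abelian sheaf underlying an `𝒪_X`-module. -/
def toAbSheaf : X.Modules ⥤ Sheaf (Opens.grothendieckTopology X) AddCommGrpCat.{u} :=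
  SheafOfModules.toSheaf X.ringCatSheaf

instance : (toAbSheaf X).Additive := inferInstanceAs (SheafOfModules.toSheaf _).Additive

/-- `Hᵖ(X, M)`: the cohomology of the abelian sheaf underlying an `𝒪_X`-module `M`. -/
def Cohomology (M : X.Modules) (p : ℕ) : Type u := Sheaf.H ((toAbSheaf X).obj M) p

instance (M : X.Modules) (p : ℕ) : AddCommGroup (M.Cohomology p) :=
  inferInstanceAs (AddCommGroup (Sheaf.H ((toAbSheaf X).obj M) p))

/-- The action of `k` on cohomology, given by functoriality in `M`. -/
def cohomologyScalar [X.Over (Spec (.of k))] (M : X.Modules) (p : ℕ) :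
    k →+* AddMonoid.End (Sheaf.H ((toAbSheaf X).obj M) p) where
  toFun c := Sheaf.H.map ((toAbSheaf X).map (c • 𝟙 M)) p
  map_one' := AddMonoidHom.ext fun x ↦ by
    rw [one_smul, CategoryTheory.Functor.map_id]
    exact Sheaf.H.map_id_apply x
  map_zero' := AddMonoidHom.ext fun x ↦ by
    rw [zero_smul, Functor.map_zero]
    exact (Sheaf.H.map_apply _ x).trans (by simp; rfl)
  map_add' a b := AddMonoidHom.ext fun x ↦ by
    rw [add_smul, Functor.map_add]
    exact Sheaf.H.map_add_apply _ _ x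
  map_mul' a b := AddMonoidHom.ext fun x ↦ by
    have : (a * b) • 𝟙 M = (b • 𝟙 M) ≫ (a • 𝟙 M) := by simp [smul_smul]
    rw [this, Functor.map_comp]
    exact Sheaf.H.map_comp_apply _ _ x

instance [X.Over (Spec (.of k))] (M : X.Modules) (p : ℕ) : Module k (M.Cohomology p) :=
  Module.compHom (Sheaf.H ((toAbSheaf X).obj M) p) (cohomologyScalar k M p)

instance : HasDerivedCategory.{u + 1} X.Modules := HasDerivedCategory.standard _
instance : HasExt.{u + 1} X.Modules := HasExt.standard _

end

end AlgebraicGeometry.Scheme.Modules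

namespace exteriorPower
noncomputable section
variable {R S T : Type*} [CommRing R] [CommRing S] [CommRing T]
  {M N P : Type*} [AddCommGroup M] [Module R M] [AddCommGroup N] [Module S N]
  [AddCommGroup P] [Module T P]

/-- A map that is semilinear along a ring map `R → S` induces a semilinear map of exterior powers. -/
def mapₛₗ (q : ℕ) {ρ : R →+* S} (f : M →ₛₗ[ρ] N) : ⋀[R]^q M →ₛₗ[ρ] ⋀[S]^q N :=
  letI : Module R (⋀[S]^q N) := Module.compHom _ ρ
  letI g : M [⋀^Fin q]→ₗ[R] ⋀[S]^q N :=
    { toFun m := ιMulti S q (f ∘ m)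
      map_update_add' m i x y := by
        simp only [Function.comp_update, map_add]
        exact (ιMulti S q).map_update_add (f ∘ m) i (f x) (f y)
      map_update_smul' m i c x := by
        simp only [Function.comp_update, map_smulₛₗ]
        exact (ιMulti S q).map_update_smul (f ∘ m) i (ρ c) (f x)
      map_eq_zero_of_eq' m i j h hij :=
        (ιMulti S q).map_eq_zero_of_eq (f ∘ m) (congrArg f h) hij }
  { toFun := alternatingMapLinearEquiv g
    map_add' := map_add _
    map_smul' c x := (alternatingMapLinearEquiv g).map_smul c x }

@[simp]
lemma mapₛₗ_ιMulti (q : ℕ) {ρ : R →+* S} (f : M →ₛₗ[ρ] N) (m : Fin q → M) :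
    mapₛₗ q f (ιMulti R q m) = ιMulti S q (f ∘ m) :=
  letI : Module R (⋀[S]^q N) := Module.compHom _ ρ
  alternatingMapLinearEquiv_apply_ιMulti _ m

lemma mapₛₗ_smul_ιMulti (q : ℕ) {ρ : R →+* S} (f : M →ₛₗ[ρ] N) (c : R) (m : Fin q → M) :
    (mapₛₗ q f).toAddMonoidHom (c • ιMulti R q m) = ρ c • ιMulti S q (f ∘ m) :=
  ((mapₛₗ q f).map_smulₛₗ c _).trans (congrArg (ρ c • ·) (mapₛₗ_ιMulti q f m))

lemma addHom_ext (q : ℕ) {Q : Type*} [AddCommGroup Q] {f g : ⋀[R]^q M →+ Q}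
    (h : ∀ (c : R) m, f (c • ιMulti R q m) = g (c • ιMulti R q m)) : f = g := by
  ext x
  have hx : x ∈ Submodule.span R (Set.range (ιMulti R q (M := M))) := by
    rw [ιMulti_span]; trivial
  induction hx using Submodule.closure_induction with
  | zero => simp
  | add _ _ _ _ h₁ h₂ => simp [h₁, h₂]
  | smul_mem c _ h' => obtain ⟨m, rfl⟩ := h'; exact h c m

end
end exteriorPower

namespace AlgebraicGeometry.Scheme.Modules

noncomputable section

variable {X Y : Scheme.{u}}

/-- Restriction of sections of an `𝒪_X`-module, as a semilinear map. -/
def res (M : X.Modules) {U V : X.Opens} (h : V ≤ U) :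
    Γ(M, U) →ₛₗ[(X.presheaf.map (homOfLE h).op).hom] Γ(M, V) where
  toFun x := M.presheaf.map (homOfLE h).op x
  map_add' := map_add _
  map_smul' r x := M.map_smul (homOfLE h) r x

/-- The presheaf `U ↦ ⋀^q M(U)`. -/
def exteriorPowerPresheaf (M : X.Modules) (q : ℕ) : X.PresheafOfModules :=
  letI (U : X.Opensᵒᵖ) : Module (X.ringCatSheaf.obj.obj U)
      (AddCommGrpCat.of (⋀[Γ(X, unop U)]^q Γ(M, unop U))) :=
    inferInstanceAs (Module Γ(X, unop U) (⋀[Γ(X, unop U)]^q Γ(M, unop U)))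
  PresheafOfModules.ofPresheaf
    { obj U := AddCommGrpCat.of (⋀[Γ(X, unop U)]^q Γ(M, unop U))
      map {U V} i := AddCommGrpCat.ofHom
        (exteriorPower.mapₛₗ q (M.res (leOfHom i.unop))).toAddMonoidHom
      map_id U := by
        refine AddCommGrpCat.hom_ext (exteriorPower.addHom_ext (R := Γ(X, unop U)) q
          (f := (exteriorPower.mapₛₗ q (M.res (le_refl (unop U)))).toAddMonoidHom)
          (g := AddMonoidHom.id _) ?_)
        intro c m
        have : M.res (le_refl (unop U)) ∘ m = m := by
          funext i
          exact DFunLike.congr_fun (congrArg AddCommGrpCat.Hom.hom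
            (M.presheaf.map_id U)) (m i)
        have h' : (X.presheaf.map (homOfLE (le_refl (unop U))).op).hom c = c :=
          DFunLike.congr_fun (congrArg CommRingCat.Hom.hom (X.presheaf.map_id U)) c
        rw [exteriorPower.mapₛₗ_smul_ιMulti, this, h', AddMonoidHom.id_apply]
      map_comp {U V W} i j := by
        refine AddCommGrpCat.hom_ext (exteriorPower.addHom_ext (R := Γ(X, unop U)) q
          (f := (exteriorPower.mapₛₗ q (M.res (leOfHom (i ≫ j).unop))).toAddMonoidHom)
          (g := (exteriorPower.mapₛₗ q (M.res (leOfHom j.unop))).toAddMonoidHom.comp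
            (exteriorPower.mapₛₗ q (M.res (leOfHom i.unop))).toAddMonoidHom) ?_)
        intro c m
        have : M.res (leOfHom (i ≫ j).unop) ∘ m =
            M.res (leOfHom j.unop) ∘ M.res (leOfHom i.unop) ∘ m := by
          funext a
          exact DFunLike.congr_fun (congrArg AddCommGrpCat.Hom.hom
            (M.presheaf.map_comp i j)) (m a)
        have h' : (X.presheaf.map (homOfLE (leOfHom (i ≫ j).unop)).op).hom c =
            (X.presheaf.map (homOfLE (leOfHom j.unop)).op).hom
              ((X.presheaf.map (homOfLE (leOfHom i.unop)).op).hom c) :=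
          DFunLike.congr_fun (congrArg CommRingCat.Hom.hom (X.presheaf.map_comp i j)) c
        rw [AddMonoidHom.comp_apply, exteriorPower.mapₛₗ_smul_ιMulti,
          exteriorPower.mapₛₗ_smul_ιMulti, exteriorPower.mapₛₗ_smul_ιMulti, this, h'] }
    (fun U V i r x ↦ (exteriorPower.mapₛₗ q (M.res (leOfHom i.unop))).map_smul' r x)

/-- The sheafification of a presheaf of `𝒪_X`-modules. -/
abbrev sheafify (P : X.PresheafOfModules) : X.Modules :=
  (PresheafOfModules.sheafification (𝟙 X.ringCatSheaf.obj)).obj P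

/-- The `q`-th exterior power `⋀^q M` of an `𝒪_X`-module. -/
def exteriorPower (M : X.Modules) (q : ℕ) : X.Modules := sheafify (M.exteriorPowerPresheaf q)

lemma map_map_eq {U V W : X.Opens} (h : V ≤ U) (h' : W ≤ V) (r : Γ(X, U)) :
    X.presheaf.map (homOfLE h').op (X.presheaf.map (homOfLE h).op r) =
      X.presheaf.map (homOfLE (h'.trans h)).op r := by
  rw [← CommRingCat.comp_apply, ← X.presheaf.map_comp]
  rfl

/-- The sections over `U` of the sheaf of homomorphisms `M → N`: families of linear maps
`M(V) → N(V)` for `V ⊆ U`, compatible with restriction. -/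
def homSections (M N : X.Modules) (U : X.Opens) :
    AddSubgroup (∀ V : Set.Iic U, Γ(M, V.1) →ₗ[Γ(X, V.1)] Γ(N, V.1)) where
  carrier := {φ | ∀ (V W : Set.Iic U) (h : W ≤ V) (m : Γ(M, V.1)),
    φ W (M.res h m) = N.res h (φ V m)}
  zero_mem' := by intro V W h m; simp
  add_mem' := by
    intro a b ha hb V W h m
    simp [ha V W h, hb V W h]
  neg_mem' := by
    intro a ha V W h m
    simp [ha V W h]

instance (M N : X.Modules) (U : X.Opens) : SMul Γ(X, U) (homSections M N U) where
  smul r φ := ⟨fun V ↦ X.presheaf.map (homOfLE V.2).op r • φ.1 V, fun V W h m ↦ by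
    rw [LinearMap.smul_apply, LinearMap.smul_apply, φ.2 V W h m, map_smulₛₗ]
    exact congrArg (· • N.res h (φ.1 V m)) (map_map_eq V.2 h r).symm⟩

lemma homSections_smul_apply {M N : X.Modules} {U : X.Opens} (r : Γ(X, U))
    (φ : homSections M N U) (V : Set.Iic U) :
    (r • φ).1 V = X.presheaf.map (homOfLE V.2).op r • φ.1 V := rfl

instance (M N : X.Modules) (U : X.Opens) : Module Γ(X, U) (homSections M N U) where
  one_smul φ := by
    ext V : 2
    rw [homSections_smul_apply, map_one, one_smul]
  mul_smul r s φ := by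
    ext V : 2
    rw [homSections_smul_apply, map_mul, mul_smul, homSections_smul_apply,
      homSections_smul_apply]
  smul_zero r := by
    ext V : 2
    exact smul_zero _
  smul_add r φ ψ := by
    ext V : 2
    exact smul_add _ _ _
  add_smul r s φ := by
    ext V : 2
    rw [homSections_smul_apply, map_add, add_smul]
    rfl
  zero_smul φ := by
    ext V : 2
    rw [homSections_smul_apply, map_zero, zero_smul]
    rfl

/-- Restriction of homomorphisms to a smaller open subset. -/
def homRes (M N : X.Modules) {U V : X.Opens} (h : V ≤ U) :
    homSections M N U →+ homSections M N V where
  toFun φ := ⟨fun W ↦ φ.1 ⟨W.1, W.2.trans h⟩,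
    fun W W' h' m ↦ φ.2 ⟨W.1, W.2.trans h⟩ ⟨W'.1, W'.2.trans h⟩ h' m⟩
  map_zero' := rfl
  map_add' _ _ := rfl

/-- The presheaf of homomorphisms `U ↦ Hom(M|_U, N|_U)`. -/
def homPresheaf (M N : X.Modules) : X.PresheafOfModules :=
  letI (U : X.Opensᵒᵖ) : Module (X.ringCatSheaf.obj.obj U)
      (AddCommGrpCat.of (homSections M N (unop U))) :=
    inferInstanceAs (Module Γ(X, unop U) (homSections M N (unop U)))
  PresheafOfModules.ofPresheaf
    { obj U := AddCommGrpCat.of (homSections M N (unop U))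
      map {U V} i := AddCommGrpCat.ofHom (homRes M N (leOfHom i.unop))
      map_id U := rfl
      map_comp _ _ := rfl }
    (fun U V i r φ ↦ by
      refine Subtype.ext (funext fun W ↦ ?_)
      exact congrArg (· • φ.1 ⟨W.1, W.2.trans (leOfHom i.unop)⟩)
        (map_map_eq (leOfHom i.unop) W.2 r).symm)

variable (X) in
/-- The structure sheaf `𝒪_X` as an `𝒪_X`-module. -/
abbrev structureSheaf : X.Modules := SheafOfModules.unit X.ringCatSheaf

/-- The dual of `M`, i.e. the sheaf of homomorphisms from `M` to `𝒪_X`. -/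
def dual (M : X.Modules) : X.Modules := sheafify (homPresheaf M (structureSheaf X))

end

end AlgebraicGeometry.Scheme.Modules

namespace AlgebraicGeometry.Scheme.Modules

noncomputable section
variable {X Y : Scheme.{u}}

/-- Every section of `N` lifts locally along `φ`. -/
def LocallySurjective {M N : X.Modules} (φ : M ⟶ N) : Prop :=
  ∀ (U : X.Opens) (s : Γ(N, U)) (x : X), x ∈ U →
    ∃ (V : X.Opens) (h : V ≤ U), x ∈ V ∧ ∃ t : Γ(M, V), φ.app V t = N.presheaf.map (homOfLE h).op s

lemma LocallySurjective.epi {M N : X.Modules} {φ : M ⟶ N} (h : LocallySurjective φ) : Epi φ where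
  left_cancellation {K} a b hab := by
    ext U s
    refine TopCat.Presheaf.section_ext ⟨K.presheaf, K.isSheaf⟩ U _ _ fun x hx ↦ ?_
    obtain ⟨V, hV, hxV, t, ht⟩ := h U s x hx
    have key : ∀ c : N ⟶ K, K.presheaf.map (homOfLE hV).op (c.app U s) = (φ ≫ c).app V t := by
      intro c
      rw [Hom.comp_app, AddCommGrpCat.comp_apply, ht]
      exact (ConcreteCategory.congr_hom (c.mapPresheaf.naturality (homOfLE hV).op) s).symm
    have := (key a).trans ((congrArg (fun c : M ⟶ K ↦ c.app V t) hab).trans (key b).symm)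
    exact TopCat.Presheaf.germ_ext K.presheaf V hxV (homOfLE hV) (homOfLE hV) this

lemma locallySurjective_of_epi {M N : X.Modules} (φ : M ⟶ N) [Epi φ] : LocallySurjective φ := by
  intro U s x hx
  let C := cokernel φ.val
  let η := (PresheafOfModules.sheafificationAdjunction (𝟙 X.ringCatSheaf.obj)).unit.app C
  let g : N ⟶ sheafify C := ⟨cokernel.π φ.val ≫ η⟩
  have hg : φ ≫ g = 0 := by
    apply SheafOfModules.hom_ext
    exact (cokernel.condition_assoc φ.val η).trans zero_comp
  have hg0 : g = 0 := (cancel_epi φ).1 (hg.trans comp_zero.symm)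
  have h1 : (toSheafify (Opens.grothendieckTopology X) C.presheaf).app (op U)
    ((cokernel.π φ.val).app (op U) s) = 0 := congrArg (fun c : N ⟶ sheafify C ↦ c.app U s) hg0
  have h2 := Presheaf.equalizerSieve_mem (Opens.grothendieckTopology X)
    (toSheafify (Opens.grothendieckTopology X) C.presheaf)
    (X := op U) ((cokernel.π φ.val).app (op U) s) 0 (h1.trans (map_zero _).symm)
  obtain ⟨V, i, hi, hxV⟩ := h2 x hx
  refine ⟨V, leOfHom i, hxV, ?_⟩
  have h3 : (cokernel.π φ.val).app (op V) (N.presheaf.map i.op s) = 0 := by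
    refine (PresheafOfModules.naturality_apply (cokernel.π φ.val) i.op s).trans ?_
    exact hi.trans (map_zero (C.presheaf.map i.op).hom)
  let ev := PresheafOfModules.evaluation X.ringCatSheaf.obj (op V)
  have h4 := (ShortComplex.exact_cokernel φ.val).map ev
  exact (ShortComplex.moduleCat_exact_iff _).1 h4 (N.presheaf.map i.op s) h3

lemma LocallySurjective.pushforward {M N : X.Modules} {φ : M ⟶ N} (h : LocallySurjective φ)
    (f : X ⟶ Y) (hf : Topology.IsClosedEmbedding f) :
    LocallySurjective ((Scheme.Modules.pushforward f).map φ) := by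
  intro U s y hy
  by_cases hy' : y ∈ Set.range f
  · obtain ⟨x, rfl⟩ := hy'
    obtain ⟨V, hV, hxV, t, ht⟩ := h (f ⁻¹ᵁ U) s x hy
    obtain ⟨W, hW, hWV⟩ := hf.isInducing.isOpen_iff.mp V.2
    have hWV' : f ⁻¹ᵁ (U ⊓ ⟨W, hW⟩) ≤ V := fun z hz ↦ by
      have : z ∈ f ⁻¹' W := hz.2
      rw [hWV] at this; exact this
    refine ⟨U ⊓ ⟨W, hW⟩, inf_le_left, ⟨hy, ?_⟩, M.presheaf.map (homOfLE hWV').op t, ?_⟩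
    · have : x ∈ f ⁻¹' W := hWV ▸ hxV
      exact this
    · refine (ConcreteCategory.congr_hom (φ.mapPresheaf.naturality (homOfLE hWV').op) t).trans ?_
      refine (congrArg (N.presheaf.map (homOfLE hWV').op) ht).trans ?_
      exact (ConcreteCategory.congr_hom (N.presheaf.map_comp (homOfLE hV).op (homOfLE hWV').op) s).symm
  · have hemp : f ⁻¹ᵁ (U ⊓ ⟨(Set.range f)ᶜ, hf.isClosed_range.isOpen_compl⟩) = ⊥ := by
      ext z
      simp
    refine ⟨U ⊓ ⟨(Set.range f)ᶜ, hf.isClosed_range.isOpen_compl⟩, inf_le_left, ⟨hy, hy'⟩, 0, ?_⟩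
    refine TopCat.Presheaf.section_ext ⟨N.presheaf, N.isSheaf⟩ _ _ _ fun x hx ↦ ?_
    rw [hemp] at hx
    exact hx.elim

instance (f : X ⟶ Y) [IsClosedImmersion f] :
    PreservesFiniteColimits (Scheme.Modules.pushforward f) := by
  have : (Scheme.Modules.pushforward f).PreservesEpimorphisms := ⟨fun φ _ ↦
    ((locallySurjective_of_epi φ).pushforward f f.isClosedEmbedding).epi⟩
  have hL : PreservesFiniteLimits (Scheme.Modules.pushforward f) := inferInstance
  rw [Functor.preservesFiniteLimits_iff_forall_exact_map_and_mono] at hL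
  refine ((Scheme.Modules.pushforward f).preservesFiniteColimits_tfae.out 0 3).mp ?_
  intro S hS
  have := hS.epi_g
  exact ⟨(hL S hS).1, inferInstance⟩

/-- A derived inverse image `Lf^* F` of an object `F` of `D(Y)` along a closed immersion `f`:
an object `A` of `D(X)` together with bijections `Hom(A, G) ≃ Hom(F, f_* G)` that are natural in
the object `G` of `D(X)`. (The functor `f_*` is exact, hence passes to derived categories.) -/
abbrev DerivedPullback (f : X ⟶ Y) [IsClosedImmersion f] (F : DerivedCategory Y.Modules)
    (A : DerivedCategory X.Modules) :=
  ((Scheme.Modules.pushforward f).mapDerivedCategory ⋙ coyoneda.obj (op F)).CorepresentableBy A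

/-- The `𝒪_X`-module `M`, as a complex concentrated in degree `0`. -/
abbrev single₀ (M : X.Modules) : DerivedCategory X.Modules :=
  (DerivedCategory.singleFunctor X.Modules 0).obj M

end
end AlgebraicGeometry.Scheme.Modules

namespace AlgebraicGeometry

noncomputable section

namespace Scheme.Modules

variable {X : Scheme.{u}}

/-- `M` is a vector bundle: it is locally isomorphic to `𝒪^n` for some natural number `n`. -/
def IsVectorBundle (M : X.Modules) : Prop :=
  ∀ x : X, ∃ U : X.Opens, x ∈ U ∧ ∃ n : ℕ,
    Nonempty (M.restrict U.ι ≅ SheafOfModules.free (R := U.toScheme.ringCatSheaf) (ULift.{u} (Fin n)))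

end Scheme.Modules

open Scheme.Modules

variable {X Y : Scheme.{u}} (i : X ⟶ Y)

/-- The map `𝒪_Y ⟶ i_* 𝒪_X`. -/
def structureMap : structureSheaf Y ⟶ (Scheme.Modules.pushforward i).obj (structureSheaf X) :=
  SheafOfModules.unitToPushforwardObjUnit i.toRingCatSheafHom

/-- The ideal sheaf `I` of `X` in `Y`, as an `𝒪_Y`-module. -/
def idealModule : Y.Modules := kernel (structureMap i)

/-- The conormal sheaf `i^* I = I / I²` of `X` in `Y`. -/
def conormalSheaf : X.Modules := (Scheme.Modules.pullback i).obj (idealModule i)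

/-- The normal sheaf `N`, the dual of the conormal sheaf. -/
def normalSheaf : X.Modules := (conormalSheaf i).dual

/-- The first infinitesimal neighbourhood of `X` in `Y`: the closed subscheme cut out by `I²`. -/
def firstNeighborhood : Scheme.{u} := (i.ker ^ 2).subscheme

/-- The inclusion of the first infinitesimal neighbourhood into `Y`. -/
def firstNeighborhoodι : firstNeighborhood i ⟶ Y := (i.ker ^ 2).subschemeι

instance : IsClosedImmersion (firstNeighborhoodι i) :=
  inferInstanceAs (IsClosedImmersion (i.ker ^ 2).subschemeι)

lemma ker_firstNeighborhoodι_le [QuasiCompact i] : (firstNeighborhoodι i).ker ≤ i.ker := by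
  have : (firstNeighborhoodι i).ker = i.ker ^ 2 := Scheme.IdealSheafData.ker_subschemeι _
  rw [this]
  exact fun U ↦ Ideal.pow_le_self two_ne_zero

/-- The inclusion of `X` into its first infinitesimal neighbourhood. -/
def toFirstNeighborhood [QuasiCompact i] : X ⟶ firstNeighborhood i :=
  IsClosedImmersion.lift (firstNeighborhoodι i) i (ker_firstNeighborhoodι_le i)

/-- The normal sheaf `N` of `X` extends to a vector bundle on the first infinitesimal
neighbourhood of `X` in `Y`. -/
def NormalBundleExtends [QuasiCompact i] : Prop :=
  ∃ V : (firstNeighborhood i).Modules, V.IsVectorBundle ∧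
    Nonempty ((Scheme.Modules.pullback (toFirstNeighborhood i)).obj V ≅ normalSheaf i)

/-- Near the point `x`, the ideal of `X` in `Y` is generated by a regular sequence of length `c`,
i.e. `i` is a local complete intersection of codimension `c` at `x`. -/
def HasCodimAt (x : X) (c : ℕ) : Prop :=
  ∃ U : Y.affineOpens, i x ∈ U.1 ∧ ∃ rs : List Γ(Y, U.1),
    RingTheory.Sequence.IsRegular Γ(Y, U.1) rs ∧ rs.length = c ∧ i.ker.ideal U = Ideal.ofList rs

/-- `i` is a local complete intersection: locally on `Y`, the ideal of `X` is generated by a regular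
sequence. -/
def IsLCI : Prop := ∀ x : X, ∃ c, HasCodimAt i x c

end
end AlgebraicGeometry

noncomputable section

open Pretriangulated Triangulated ComposableArrows

namespace EInt

/-- The order-reversing involution `a ↦ 1 - a` of `[-∞, ∞]`. -/
def rev (a : EInt) : EInt := WithBotTop.rec (motive := fun _ ↦ EInt) ⊤ (fun a ↦ ((1 - a : ℤ) : EInt)) ⊥ a

lemma rev_le_rev {a b : EInt} (h : a ≤ b) : rev b ≤ rev a := by
  induction a using WithBotTop.rec with
  | bot => exact le_top
  | top => obtain rfl := top_le_iff.mp h; exact le_rfl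
  | coe a =>
    induction b using WithBotTop.rec with
    | bot => exact absurd (le_bot_iff.mp h) (WithBotTop.coe_ne_bot a)
    | top => exact bot_le
    | coe b =>
      exact WithBotTop.coe_le_coe.mpr (by have := WithBotTop.coe_le_coe.mp h; omega)

/-- The functor on arrows of `[-∞, ∞]` that sends `a ≤ b` to `1 - b ≤ 1 - a`. -/
def revArrows : ComposableArrows EInt 1 ⥤ (ComposableArrows EInt 1)ᵒᵖ where
  obj D := op (mk₁ (homOfLE (rev_le_rev (leOfHom (D.map' 0 1)))))
  map {D D'} φ := (homMk₁ (homOfLE (rev_le_rev (leOfHom (φ.app 1))))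
    (homOfLE (rev_le_rev (leOfHom (φ.app 0)))) : mk₁ (homOfLE (rev_le_rev (leOfHom (D'.map' 0 1)))) ⟶ mk₁ (homOfLE (rev_le_rev (leOfHom (D.map' 0 1))))).op
  map_id D := Quiver.Hom.unop_inj (NatTrans.ext (funext fun _ ↦ Subsingleton.elim _ _))
  map_comp _ _ := Quiver.Hom.unop_inj (NatTrans.ext (funext fun _ ↦ Subsingleton.elim _ _))

end EInt

namespace CategoryTheory.Triangulated.TStructure

variable {C : Type u} [Category.{v} C] [Preadditive C] [HasZeroObject C] [HasShift C ℤ]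
  [∀ n : ℤ, (shiftFunctor C n).Additive] [Pretriangulated C] [IsTriangulated C]
  (k : Type w) [Ring k] [Linear k C] [∀ n : ℤ, (shiftFunctor C n).Linear k]
  (t : TStructure C) (A B : C)

/-- The functor that sends `a ≤ b` to the `k`-module `Hom(τ A, B[n])` where `τ A` is the truncation
of `A` to degrees in `[1 - b, 1 - a)`, i.e. to degrees `-q` with `a ≤ q < b`. -/
def homTrunc (n : ℤ) : ComposableArrows EInt 1 ⥤ ModuleCat.{v} k :=
  EInt.revArrows ⋙ (t.ω₁ ⋙ (evaluation _ _).obj A).op ⋙ (linearYoneda k C).obj (B⟦n⟧)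

/-- The connecting map `Hom(T₁, B[n₀]) → Hom(T₃, B[n₁])` for a morphism `T₃ → T₁[1]`. -/
def connecting {T₁ T₃ : C} (d : T₃ ⟶ T₁⟦(1 : ℤ)⟧) (n₀ n₁ : ℤ) (h : n₀ + 1 = n₁) :
    (T₁ ⟶ B⟦n₀⟧) →ₗ[k] (T₃ ⟶ B⟦n₁⟧) where
  toFun x := d ≫ x⟦(1 : ℤ)⟧' ≫ (shiftFunctorAdd' C n₀ 1 n₁ h).inv.app B
  map_add' x y := by simp [Functor.map_add]
  map_smul' c x := by simp [Functor.map_smul]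

lemma mk₂_exact {X Y Z : ModuleCat.{v} k} (f : X ⟶ Y) (g : Y ⟶ Z)
    (h₁ : ∀ x, g (f x) = 0) (h₂ : ∀ y, g y = 0 → ∃ x, f x = y) : (mk₂ f g).Exact := by
  let S : ShortComplex (ModuleCat.{v} k) := ShortComplex.mk f g (by ext x; exact h₁ x)
  exact ((ShortComplex.moduleCat_exact_iff S).2 h₂).exact_toComposableArrows

lemma connecting_apply {T₁ T₃ : C} (d : T₃ ⟶ T₁⟦(1 : ℤ)⟧) (n₀ n₁ : ℤ) (h : n₀ + 1 = n₁)
    (x : T₁ ⟶ B⟦n₀⟧) :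
    connecting k B d n₀ n₁ h x = d ≫ x⟦(1 : ℤ)⟧' ≫ (shiftFunctorAdd' C n₀ 1 n₁ h).inv.app B := rfl

lemma exact₁_aux (T : Triangle C) (hT : T ∈ distTriang C) (n₀ n₁ : ℤ) (h : n₀ + 1 = n₁) :
    (mk₂ (ModuleCat.ofHom (connecting k B T.mor₃ n₀ n₁ h))
      (((linearYoneda k C).obj (B⟦n₁⟧)).map T.mor₂.op)).Exact := by
  refine mk₂_exact k _ _ (fun (x : T.obj₁ ⟶ B⟦n₀⟧) ↦ ?_) (fun (y : T.obj₃ ⟶ B⟦n₁⟧) hy ↦ ?_)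
  · change T.mor₂ ≫ connecting k B T.mor₃ n₀ n₁ h x = 0
    rw [connecting_apply, comp_distTriang_mor_zero₂₃_assoc _ hT, zero_comp]
  · obtain ⟨z, hz⟩ := Triangle.yoneda_exact₃ T hT y hy
    obtain ⟨x, hx⟩ := (shiftFunctor C (1 : ℤ)).map_surjective
      (z ≫ (shiftFunctorAdd' C n₀ 1 n₁ h).hom.app B)
    refine ⟨x, ?_⟩
    change connecting k B T.mor₃ n₀ n₁ h x = y
    rw [connecting_apply, hx, hz, Category.assoc, Iso.hom_inv_id_app]
    exact congrArg (T.mor₃ ≫ ·) (Category.comp_id z)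

lemma exact₂_aux (T : Triangle C) (hT : T ∈ distTriang C) (n : ℤ) :
    (mk₂ (((linearYoneda k C).obj (B⟦n⟧)).map T.mor₂.op)
      (((linearYoneda k C).obj (B⟦n⟧)).map T.mor₁.op)).Exact := by
  refine mk₂_exact k _ _ (fun (x : T.obj₃ ⟶ B⟦n⟧) ↦ ?_) (fun (y : T.obj₂ ⟶ B⟦n⟧) hy ↦ ?_)
  · change T.mor₁ ≫ T.mor₂ ≫ x = 0
    rw [comp_distTriang_mor_zero₁₂_assoc _ hT, zero_comp]
  · obtain ⟨z, hz⟩ := Triangle.yoneda_exact₂ T hT y hy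
    exact ⟨z, hz.symm⟩

lemma exact₃_aux (T : Triangle C) (hT : T ∈ distTriang C) (n₀ n₁ : ℤ) (h : n₀ + 1 = n₁) :
    (mk₂ (((linearYoneda k C).obj (B⟦n₀⟧)).map T.mor₁.op)
      (ModuleCat.ofHom (connecting k B T.mor₃ n₀ n₁ h))).Exact := by
  refine mk₂_exact k _ _ (fun (x : T.obj₂ ⟶ B⟦n₀⟧) ↦ ?_) (fun (y : T.obj₁ ⟶ B⟦n₀⟧) hy ↦ ?_)
  · change connecting k B T.mor₃ n₀ n₁ h (T.mor₁ ≫ x) = 0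
    rw [connecting_apply, Functor.map_comp, Category.assoc,
      comp_distTriang_mor_zero₃₁_assoc _ hT, zero_comp]
  · change T.mor₃ ≫ y⟦(1 : ℤ)⟧' ≫ (shiftFunctorAdd' C n₀ 1 n₁ h).inv.app B = 0 at hy
    rw [← Category.assoc] at hy
    have hy' := (cancel_mono ((shiftFunctorAdd' C n₀ 1 n₁ h).inv.app B)).1
      (hy.trans zero_comp.symm)
    obtain ⟨z, hz⟩ := Triangle.yoneda_exact₃ T.rotate (rot_of_distTriang _ hT) (y⟦(1 : ℤ)⟧') hy'
    obtain ⟨x, rfl⟩ : ∃ x : T.obj₂ ⟶ B⟦n₀⟧, x⟦(1 : ℤ)⟧' = z :=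
      (shiftFunctor C (1 : ℤ)).map_surjective z
    refine ⟨-x, (shiftFunctor C (1 : ℤ)).map_injective ?_⟩
    refine Eq.trans ?_ hz.symm
    change (T.mor₁ ≫ (-x))⟦(1 : ℤ)⟧' = (-T.mor₁⟦(1 : ℤ)⟧') ≫ x⟦(1 : ℤ)⟧'
    rw [Preadditive.comp_neg, Functor.map_neg, Functor.map_comp, Preadditive.neg_comp]

lemma connecting_naturality {a b c a' b' c' : EInt} (hab : a ≤ b) (hbc : b ≤ c)
    (hab' : a' ≤ b') (hbc' : b' ≤ c') (ha : a ≤ a') (hb : b ≤ b') (hc : c ≤ c')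
    (n₀ n₁ : ℤ) (h : n₀ + 1 = n₁)
    (x : (t.ω₁.obj (mk₁ (homOfLE hab'))).obj A ⟶ B⟦n₀⟧) :
    connecting k B ((t.ω₁δ a b c hab hbc).app A) n₀ n₁ h
      ((t.ω₁.map (homMk₁ (homOfLE ha) (homOfLE hb) :
        mk₁ (homOfLE hab) ⟶ mk₁ (homOfLE hab'))).app A ≫ x) =
    (t.ω₁.map (homMk₁ (homOfLE hb) (homOfLE hc) :
        mk₁ (homOfLE hbc) ⟶ mk₁ (homOfLE hbc'))).app A ≫
      connecting k B ((t.ω₁δ a' b' c' hab' hbc').app A) n₀ n₁ h x := by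
  have key := NatTrans.congr_app (t.ω₁δ_naturality a b c hab hbc a' b' c' hab' hbc'
    (homMk₂ (homOfLE ha) (homOfLE hb) (homOfLE hc))) A
  rw [connecting_apply, connecting_apply, Functor.map_comp, Category.assoc]
  have := congrArg (· ≫ x⟦(1 : ℤ)⟧' ≫ (shiftFunctorAdd' C n₀ 1 n₁ h).inv.app B) key
  exact (Category.assoc _ _ _).symm.trans (this.symm.trans (Category.assoc _ _ _))

/-- The spectral object with `Hⁿ(a ≤ b) = Hom(τ A, B[n])`, where `τ A` is the truncation of `A` to
degrees `-q` with `a ≤ q < b`, and with the connecting maps given by the truncation triangles. -/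
def homSpectralObject : Abelian.SpectralObject (ModuleCat.{v} k) EInt where
  H n := homTrunc k t A B n
  δ' n₀ n₁ h :=
    { app D := ModuleCat.ofHom (connecting k B ((t.ω₁δ (EInt.rev (D.obj 2)) (EInt.rev (D.obj 1))
        (EInt.rev (D.obj 0)) (EInt.rev_le_rev (leOfHom (D.map' 1 2)))
        (EInt.rev_le_rev (leOfHom (D.map' 0 1)))).app A) n₀ n₁ h)
      naturality D D' φ := by
        refine ModuleCat.hom_ext (LinearMap.ext fun x ↦ ?_)
        exact connecting_naturality k t A B (EInt.rev_le_rev (leOfHom (D'.map' 1 2)))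
          (EInt.rev_le_rev (leOfHom (D'.map' 0 1))) (EInt.rev_le_rev (leOfHom (D.map' 1 2)))
          (EInt.rev_le_rev (leOfHom (D.map' 0 1))) (EInt.rev_le_rev (leOfHom (φ.app 2)))
          (EInt.rev_le_rev (leOfHom (φ.app 1))) (EInt.rev_le_rev (leOfHom (φ.app 0))) n₀ n₁ h x }
  exact₁' n₀ n₁ h D := exact₁_aux k B _ (t.triangleω₁δ_distinguished (EInt.rev (D.obj 2))
    (EInt.rev (D.obj 1)) (EInt.rev (D.obj 0)) (EInt.rev_le_rev (leOfHom (D.map' 1 2)))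
    (EInt.rev_le_rev (leOfHom (D.map' 0 1))) A) n₀ n₁ h
  exact₂' n D := exact₂_aux k B _ (t.triangleω₁δ_distinguished (EInt.rev (D.obj 2))
    (EInt.rev (D.obj 1)) (EInt.rev (D.obj 0)) (EInt.rev_le_rev (leOfHom (D.map' 1 2)))
    (EInt.rev_le_rev (leOfHom (D.map' 0 1))) A) n
  exact₃' n₀ n₁ h D := exact₃_aux k B _ (t.triangleω₁δ_distinguished (EInt.rev (D.obj 2))
    (EInt.rev (D.obj 1)) (EInt.rev (D.obj 0)) (EInt.rev_le_rev (leOfHom (D.map' 1 2)))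
    (EInt.rev_le_rev (leOfHom (D.map' 0 1))) A) n₀ n₁ h

end CategoryTheory.Triangulated.TStructure
end

namespace CategoryTheory.Abelian.SpectralObject

noncomputable section

variable {k : Type*} [Ring k] (S : SpectralObject (ModuleCat k) EInt)

/-- The abutment of the spectral sequence of a spectral object, in degree `n`. -/
def abutment (n : ℤ) : ModuleCat k :=
  (S.H n).obj (ComposableArrows.mk₁ (homOfLE (bot_le : (⊥ : EInt) ≤ ⊤)))

/-- The `q`-th step of the increasing filtration of the abutment: the image of the part of
index `≤ q` of the spectral object. -/
def filtration (n q : ℤ) : Submodule k (S.abutment n) :=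
  LinearMap.range ((S.H n).map (ComposableArrows.homMk₁ (𝟙 _) (homOfLE le_top) :
    ComposableArrows.mk₁ (homOfLE (bot_le : ⊥ ≤ ((q + 1 : ℤ) : EInt))) ⟶
      ComposableArrows.mk₁ (homOfLE (bot_le : (⊥ : EInt) ≤ ⊤)))).hom

/-- The graded piece `F_q / F_{q-1}` of the filtration of the abutment. -/
abbrev graded (n q : ℤ) : Type _ :=
  S.filtration n q ⧸ (S.filtration n (q - 1)).submoduleOf (S.filtration n q)

end

end CategoryTheory.Abelian.SpectralObject

namespace AlgebraicGeometry.Scheme.Modules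

noncomputable section

variable {X : Scheme.{u}}

/-- The `𝒪_Y`-module `i_* 𝒪_X`. -/
abbrev pushforwardStructureSheaf {Y : Scheme.{u}} (i : X ⟶ Y) : Y.Modules :=
  (Scheme.Modules.pushforward i).obj (structureSheaf X)

variable (k : Type u) [Field k] [X.Over (Spec (.of k))]

/-- The spectral object that computes `Hom(A, B[n])` from the filtration of the object `A` of
`D(X)` by its truncations. -/
def homSpectralObject (A B : DerivedCategory X.Modules) :
    Abelian.SpectralObject (ModuleCat.{u + 1} k) EInt :=
  Triangulated.TStructure.homSpectralObject k DerivedCategory.TStructure.t A B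

/-- The spectral sequence `E₂^{p,q} = Hom(H^{-q}(A)[q], B[p + q]) ⇒ Hom(A, B[p + q])` obtained from
the filtration of `A` by its truncations. -/
abbrev homSpectralSequence (A B : DerivedCategory X.Modules) :
    E₂CohomologicalSpectralSequence (ModuleCat.{u + 1} k) :=
  (homSpectralObject k A B).E₂SpectralSequence

end

end AlgebraicGeometry.Scheme.Modules

open AlgebraicGeometry AlgebraicGeometry.Scheme.Modules

universe z

set_option linter.unusedVariables false

/-! Let A be the derived pull-back of i_*O_X and let E_q = Alt^q(N, O_X) be the dual of the q-th
exterior power of N. Everything rests on one splitting statement: the piece H^{-q}(A)[q] is E_q[q],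
and the map from τ^{≤-q}A to this piece extends to a morphism ψ_q from A to E_q[q]. Then every class
on a piece extends to A by composition with ψ_q. By descending induction on q, Hom(A, O_X[n]) maps
onto Hom(τ^{≤-q}A, O_X[n]) for all q, so all connecting maps vanish, and all differentials with them
(`isDegenerate_of_mem_range`, `IsDegenerate.del_eq_zero`).

By adjunction ψ_q is a class in Ext^q on Y from i_*O_X to i_*E_q, and condition (*) serves to
construct it. Let V on X' extend N, and let I be the ideal of X in X', which is the conormal sheaf
since X' is cut out by the square of the ideal of X. The sequences 0 → Alt^n(V, I) → Alt^n(V, O_X')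
→ Alt^n(V, O_X) → 0 are exact, and the pairing of N with the conormal sheaf gives maps Alt^n(V, I) →
Alt^{n+1}(V, O_X). Composing extension classes and these maps alternately yields a class on X'
(`contractClass`), which is pushed forward to Y.

That the class is the right one can be checked on charts where X is cut out by a regular sequence of
length c. There the Koszul complex Alt^n(O^c, O) resolves O_X and maps to the sequences above.
Contracting a form of degree n + 1 and antisymmetrising again multiplies it by n + 1
(`sum_removeNth`), so the class is n! times the class of the Koszul resolution (`comp_cls`). For n ≤
c the number n! is invertible in k, and for n > c there are no forms. Hence φ ↦ class ∘ φ is a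
bijection from Hom(E_n, J) to Ext^n_Y(i_*O_X, i_*J) for every flasque J supported on a small open
set (`contractClass_comp_bijective`). The second group is Hom(A, J[n]), which for injective J is
Hom(H^{-n}(A), J); so the map from H^{-n}(A) to E_n induced by the class is an isomorphism
(`exists_pieceAt_iso`).

Two general facts complete the argument. The object A exists, because extensions by zero of
structure sheaves of open sets are acyclic for the pull-back (`exists_derivedPullback`). And
Ext^p(E_q, O_X) is H^p(X, ∧^q N), because E_q is locally free with dual ∧^q N
(`LocallyFramed.nonempty_ext_equiv`, `LocallyFramed.nonempty_exteriorPower_iso`). -/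

noncomputable section

/-! ### Presheaves of modules, and acyclicity of flasque abelian sheaves. -/

namespace PresheafOfModules

variable {C : Type u} [SmallCategory C] (R : Cᵒᵖ ⥤ RingCat.{u})

instance hasExactColimitsOfShape (K : Type u) [SmallCategory K] [IsFiltered K] :
    HasExactColimitsOfShape K (PresheafOfModules.{u} R) :=
  HasExactColimitsOfShape.domain_of_functor K (toPresheaf R)

lemma mono_free_map {F G : Cᵒᵖ ⥤ Type u} (f : F ⟶ G) (hf : ∀ U, Function.Injective (f.app U)) :
    Mono ((free R).map f) :=
  mono_of_injective fun U ↦ Finsupp.mapDomain_injective (hf U)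

end PresheafOfModules

namespace CategoryTheory.Abelian.Ext

variable {C : Type u} [Category.{v} C] [Abelian C] [HasExt.{w} C]

/-- If every object of a class embeds into an injective object with quotient in the class,
such that morphisms from `Z` lift to the injective object, then the objects of the class are
acyclic for `Hom(Z, -)`. -/
lemma eq_zero_of_embedding (Z : C) (P : C → Prop)
    (emb : ∀ F, P F → ∃ (I Q : C) (f : F ⟶ I) (g : I ⟶ Q) (w : f ≫ g = 0),
      (ShortComplex.mk f g w).ShortExact ∧ Injective I ∧ P Q ∧
        ∀ h : Z ⟶ Q, ∃ h' : Z ⟶ I, h' ≫ g = h)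
    (n : ℕ) (F : C) (hF : P F) (x : Ext Z F (n + 1)) : x = 0 := by
  induction n generalizing F with
  | zero =>
    obtain ⟨I, Q, f, g, w, hS, hI, hQ, hl⟩ := emb F hF
    -- In degree one the class is the connecting image of a morphism to `Q`; that morphism lifts to
    -- `I`, so its connecting image is zero.
    obtain ⟨y, rfl⟩ := covariant_sequence_exact₁ Z hS x (eq_zero_of_injective _) (zero_add 1)
    obtain ⟨y, rfl⟩ := (mk₀_bijective _ _).2 y
    obtain ⟨z, rfl⟩ := hl y
    rw [← mk₀_comp_mk₀, comp_assoc_of_second_deg_zero, hS.comp_extClass, comp_zero]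
  | succ n ih =>
    obtain ⟨I, Q, f, g, w, hS, hI, hQ, -⟩ := emb F hF
    obtain ⟨y, rfl⟩ := covariant_sequence_exact₁ Z hS x (eq_zero_of_injective _) rfl
    rw [ih Q hQ y, zero_comp]

end CategoryTheory.Abelian.Ext

lemma FreeAbelianGroup.map_injective_of_injective {α β : Type*} {f : α → β}
    (hf : Function.Injective f) : Function.Injective (FreeAbelianGroup.map f) := by
  rcases isEmpty_or_nonempty α with h | h
  · exact Function.injective_of_subsingleton _
  · refine Function.LeftInverse.injective (g := FreeAbelianGroup.map (Function.invFun f)) fun x ↦ ?_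
    rw [← FreeAbelianGroup.map_comp_apply, (Function.leftInverse_invFun hf).comp_eq_id,
      FreeAbelianGroup.map_id_apply]

namespace TopCat.Sheaf

variable {X : TopCat.{u}}

/-- Sections over an open set are morphisms from the sheafified free presheaf on it. The inclusion
of open sets induces a monomorphism of these sheaves, along which injectivity extends sections. -/
lemma isFlasque_of_injective (I : CategoryTheory.Sheaf (Opens.grothendieckTopology X)
    AddCommGrpCat.{u}) [Injective I] : IsFlasque (X := X) I where
  epi {U V} i := by
    rw [AddCommGrpCat.epi_iff_surjective]
    intro s
    let adj := sheafificationAdjunction (Opens.grothendieckTopology X) AddCommGrpCat.{u}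
    let e (W : Opens X) : (yoneda.obj W ⋙ AddCommGrpCat.free ⟶ I.obj) ≃ I.obj.obj (op W) :=
      ((AddCommGrpCat.adj.whiskerRight _).homEquiv (yoneda.obj W) I.obj).trans yonedaEquiv
    let a : yoneda.obj V.unop ⋙ AddCommGrpCat.free ⟶ yoneda.obj U.unop ⋙ AddCommGrpCat.free :=
      Functor.whiskerRight (yoneda.map i.unop) _
    have : Mono a := by
      have : ∀ W, Mono (a.app W) := fun W ↦ by
        rw [AddCommGrpCat.mono_iff_injective]
        refine FreeAbelianGroup.map_injective_of_injective fun x y _ ↦ ?_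
        exact (inferInstance : Subsingleton (W.unop ⟶ V.unop)).elim x y
      exact NatTrans.mono_of_mono_app a
    let b := (presheafToSheaf (Opens.grothendieckTopology X) AddCommGrpCat.{u}).map a
    let t : (presheafToSheaf (Opens.grothendieckTopology X) AddCommGrpCat.{u}).obj _ ⟶ I :=
      (adj.homEquiv _ I).symm ((e V.unop).symm s)
    let t' := Injective.factorThru t b
    refine ⟨(e U.unop) (adj.homEquiv _ I t'), ?_⟩
    have h1 : a ≫ adj.homEquiv _ I t' = (e V.unop).symm s := by
      rw [← Adjunction.homEquiv_naturality_left, Injective.comp_factorThru]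
      exact Equiv.apply_symm_apply _ _
    have h2 : ∀ z, e V.unop (a ≫ z) = I.obj.map i (e U.unop z) := by
      intro z
      change yonedaEquiv ((AddCommGrpCat.adj.whiskerRight _).homEquiv _ _
        (((Functor.whiskeringRight _ _ _).obj AddCommGrpCat.free).map (yoneda.map i.unop) ≫ z)) = _
      rw [Adjunction.homEquiv_naturality_left]
      exact (yonedaEquiv_naturality _ i.unop).symm
    rw [← h2, h1, Equiv.apply_symm_apply]

/-- Embed in an injective sheaf: the quotient of a flasque sheaf by a flasque subsheaf is flasque,
and global sections lift to the injective sheaf because the kernel is flasque. -/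
lemma H_eq_zero_of_isFlasque (F : CategoryTheory.Sheaf (Opens.grothendieckTopology X)
    AddCommGrpCat.{u}) (hF : IsFlasque (X := X) F) (n : ℕ)
    (x : CategoryTheory.Sheaf.H F (n + 1)) : x = 0 := by
  refine Abelian.Ext.eq_zero_of_embedding _ (fun F : CategoryTheory.Sheaf
    (Opens.grothendieckTopology X) AddCommGrpCat.{u} ↦ IsFlasque (X := X) F)
    (fun F hF ↦ ?_) n F hF x
  have hS : (ShortComplex.mk (Injective.ι F) (cokernel.π _) (cokernel.condition _)).ShortExact :=
    .mk' (ShortComplex.exact_cokernel (Injective.ι F)) inferInstance inferInstance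
  have hI := isFlasque_of_injective (Injective.under F)
  refine ⟨_, _, Injective.ι F, cokernel.π _, cokernel.condition _, hS, inferInstance,
    IsFlasque.of_shortExact_of_isFlasque₁₂ (X := X) hS, fun h ↦ ?_⟩
  have := IsFlasque.epi_of_shortExact (X := X) hS (U := ⊤)
  rw [AddCommGrpCat.epi_iff_surjective] at this
  let e := fun G : CategoryTheory.Sheaf (Opens.grothendieckTopology X) AddCommGrpCat.{u} ↦
    CategoryTheory.Sheaf.H.equiv₀ G isTerminalTop
  obtain ⟨s, hs⟩ := this (e _ (Abelian.Ext.mk₀ h))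
  refine ⟨Abelian.Ext.addEquiv₀ ((e _).symm s), ?_⟩
  rw [← CategoryTheory.Sheaf.H.addEquiv₀_map, CategoryTheory.Sheaf.H.equiv₀_symm_naturality]
  refine (congrArg (fun y ↦ Abelian.Ext.addEquiv₀ ((e _).symm y)) hs).trans ?_
  rw [AddEquiv.symm_apply_apply]
  exact Abelian.Ext.homEquiv₀.apply_symm_apply h

end TopCat.Sheaf

/-! ### Modules on a scheme: enough injectives and flasque modules. -/

namespace AlgebraicGeometry.Scheme.Modules

variable {X : Scheme.{u}}

variable (X) in
/-- The adjunction between sheafification and the inclusion of sheaves of modules in presheaves. -/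
abbrev sheafifyAdj := PresheafOfModules.sheafificationAdjunction (𝟙 X.ringCatSheaf.obj)

instance : HasColimitsOfSize.{u, u} X.Modules :=
  inferInstanceAs (HasColimitsOfSize.{u, u} (SheafOfModules.{u} X.ringCatSheaf))

/-- Exactness of filtered colimits passes from presheaves to sheaves of modules along
sheafification. Together with the separator below it yields enough injectives. -/
instance : AB5OfSize.{u, u} X.Modules where
  ofShape K _ _ := (sheafifyAdj X).hasExactColimitsOfShape K

/-- The extension by zero of the structure sheaf of an open subset `U`. -/
def freeOpen (U : X.Opens) : X.Modules :=
  sheafify ((PresheafOfModules.free X.ringCatSheaf.obj).obj (yoneda.obj U))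

/-- Morphisms from `freeOpen U` are sections over `U`. -/
def freeOpenEquiv {U : X.Opens} {M : X.Modules} : (freeOpen U ⟶ M) ≃ Γ(M, U) :=
  ((sheafifyAdj X).homEquiv _ M).trans PresheafOfModules.freeYonedaEquiv

lemma freeOpenEquiv_comp {U : X.Opens} {M N : X.Modules} (f : freeOpen U ⟶ M) (g : M ⟶ N) :
    freeOpenEquiv (f ≫ g) = g.app U (freeOpenEquiv f) :=
  congrArg PresheafOfModules.freeYonedaEquiv ((sheafifyAdj X).homEquiv_naturality_right f g)

lemma freeOpen_isSeparating : ObjectProperty.IsSeparating (.ofObj (freeOpen (X := X))) := by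
  intro M N f g h
  ext U m
  obtain ⟨a, rfl⟩ := freeOpenEquiv.surjective m
  rw [← freeOpenEquiv_comp, ← freeOpenEquiv_comp, h _ ⟨U⟩]

instance : HasSeparator X.Modules :=
  ⟨_, (isSeparator_sigma freeOpen).2 freeOpen_isSeparating⟩

instance : IsGrothendieckAbelian.{u} X.Modules where
  hasFilteredColimitsOfSize := inferInstance

instance : EnoughInjectives X.Modules := inferInstance

/-- The inclusion of `freeOpen V` in `freeOpen U` for `V ≤ U`. -/
def freeOpenMap {U V : X.Opens} (h : V ≤ U) : freeOpen V ⟶ freeOpen U :=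
  (PresheafOfModules.sheafification (𝟙 X.ringCatSheaf.obj)).map
    ((PresheafOfModules.free X.ringCatSheaf.obj).map (yoneda.map (homOfLE h)))

instance {U V : X.Opens} (h : V ≤ U) : Mono (freeOpenMap h) := by
  have := PresheafOfModules.mono_free_map X.ringCatSheaf.obj (yoneda.map (homOfLE h))
    (fun W x y _ ↦ (inferInstance : Subsingleton (W.unop ⟶ V)).elim x y)
  exact inferInstanceAs (Mono ((PresheafOfModules.sheafification (𝟙 X.ringCatSheaf.obj)).map
    ((PresheafOfModules.free X.ringCatSheaf.obj).map (yoneda.map (homOfLE h)))))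

lemma freeOpenEquiv_map {U V : X.Opens} (h : V ≤ U) {M : X.Modules} (f : freeOpen U ⟶ M) :
    freeOpenEquiv (freeOpenMap h ≫ f) = M.res h (freeOpenEquiv f) := by
  refine (congrArg PresheafOfModules.freeYonedaEquiv
    ((sheafifyAdj X).homEquiv_naturality_left _ f)).trans ?_
  let f' := (sheafifyAdj X).homEquiv _ M f
  have key : PresheafOfModules.freeHomEquiv
      ((PresheafOfModules.free X.ringCatSheaf.obj).map (yoneda.map (homOfLE h)) ≫ f') =
      yoneda.map (homOfLE h) ≫ PresheafOfModules.freeHomEquiv f' := ?_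
  · exact (congrArg yonedaEquiv key).trans
      (yonedaEquiv_naturality (PresheafOfModules.freeHomEquiv f') (homOfLE h)).symm
  exact (congrFun (congrArg DFunLike.coe (PresheafOfModules.freeAdjunction_homEquiv _ _).symm) _).trans
    (((PresheafOfModules.freeAdjunction X.ringCatSheaf.obj).homEquiv_naturality_left _ _).trans
      (congrArg (yoneda.map (homOfLE h) ≫ ·) (congrFun (congrArg DFunLike.coe
        (PresheafOfModules.freeAdjunction_homEquiv _ _)) _)))

/-- An `𝒪_X`-module is flasque if its restriction maps are surjective. -/
def IsFlasque (M : X.Modules) : Prop :=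
  ∀ ⦃U V : X.Opens⦄ (h : V ≤ U), Function.Surjective (M.res h)

lemma isFlasque_iff {M : X.Modules} :
    M.IsFlasque ↔ TopCat.Sheaf.IsFlasque (X := X.carrier) ((toAbSheaf X).obj M) := by
  constructor
  · exact fun h ↦ ⟨fun i ↦ (AddCommGrpCat.epi_iff_surjective _).2 (h (leOfHom i.unop))⟩
  · exact fun h U V hUV ↦ (AddCommGrpCat.epi_iff_surjective _).1 (h.epi (homOfLE hUV).op)

/-- A section over `V` is a morphism from `freeOpen V`, which extends along the monomorphism to
`freeOpen U`. -/
lemma isFlasque_of_injective (I : X.Modules) [Injective I] : I.IsFlasque := by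
  intro U V h s
  obtain ⟨a, rfl⟩ := freeOpenEquiv.surjective s
  refine ⟨freeOpenEquiv (Injective.factorThru a (freeOpenMap h)), ?_⟩
  rw [← freeOpenEquiv_map, Injective.comp_factorThru]

instance : PreservesFiniteLimits (toAbSheaf X) :=
  inferInstanceAs (PreservesFiniteLimits (SheafOfModules.toSheaf _))

/-- Epimorphisms of modules and of abelian sheaves are both the locally surjective maps, so a left
exact functor between them that forgets scalars is exact. -/
instance : PreservesFiniteColimits (toAbSheaf X) := by
  have : (toAbSheaf X).PreservesEpimorphisms := ⟨fun {M N} φ _ ↦ by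
    refine (TopCat.Sheaf.isLocallySurjective_iff_epi (X := X.carrier) _).1 ?_
    rw [TopCat.Presheaf.isLocallySurjective_iff]
    intro U s x hx
    obtain ⟨V, hV, hxV, t, ht⟩ := locallySurjective_of_epi φ U s x hx
    exact ⟨V, hV, ⟨t, ht⟩, hxV⟩⟩
  have hL : PreservesFiniteLimits (toAbSheaf X) := inferInstance
  rw [Functor.preservesFiniteLimits_iff_forall_exact_map_and_mono] at hL
  refine ((toAbSheaf X).preservesFiniteColimits_tfae.out 0 3).mp ?_
  intro S hS
  have := hS.epi_g
  exact ⟨(hL S hS).1, inferInstance⟩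

lemma shortExact_toAbSheaf {S : ShortComplex X.Modules} (hS : S.ShortExact) :
    (S.map (toAbSheaf X)).ShortExact := hS.map_of_exact _

lemma surjective_app_of_shortExact {S : ShortComplex X.Modules} (hS : S.ShortExact)
    (h : S.X₁.IsFlasque) (U : X.Opens) : Function.Surjective (S.g.app U) := by
  rw [isFlasque_iff] at h
  exact (AddCommGrpCat.epi_iff_surjective _).1
    (@TopCat.Sheaf.IsFlasque.epi_of_shortExact X.carrier U _ (shortExact_toAbSheaf hS) h)

lemma isFlasque_of_shortExact {S : ShortComplex X.Modules} (hS : S.ShortExact)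
    (h₁ : S.X₁.IsFlasque) (h₂ : S.X₂.IsFlasque) : S.X₃.IsFlasque := by
  rw [isFlasque_iff] at h₁ h₂ ⊢
  exact @TopCat.Sheaf.IsFlasque.of_shortExact_of_isFlasque₁₂ X.carrier _ (shortExact_toAbSheaf hS)
    h₁ h₂

/-- The embedding of a module in an injective module, with its cokernel. -/
abbrev injectiveEmbedding {C : Type*} [Category* C] [Abelian C] [EnoughInjectives C] (M : C) :
    ShortComplex C :=
  ShortComplex.mk (Injective.ι M) (cokernel.π _) (cokernel.condition _)

lemma injectiveEmbedding_shortExact {C : Type*} [Category* C] [Abelian C] [EnoughInjectives C]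
    (M : C) : (injectiveEmbedding M).ShortExact :=
  .mk' (ShortComplex.exact_cokernel _) inferInstance inferInstance

lemma H_eq_zero_of_isFlasque (T : X.Modules) (hT : T.IsFlasque) (n : ℕ)
    (x : Sheaf.H ((toAbSheaf X).obj T) (n + 1)) : x = 0 :=
  TopCat.Sheaf.H_eq_zero_of_isFlasque (X := X.carrier) _ (isFlasque_iff.1 hT) n x

lemma IsFlasque.pushforward {Y : Scheme.{u}} {T : X.Modules} (hT : T.IsFlasque) (f : X ⟶ Y) :
    ((Scheme.Modules.pushforward f).obj T).IsFlasque :=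
  fun _ _ h ↦ hT (show f ⁻¹ᵁ _ ≤ f ⁻¹ᵁ _ from fun _ hx ↦ h hx)

end AlgebraicGeometry.Scheme.Modules

/-! ### Comparison of Ext groups under an exact functor. -/

namespace CategoryTheory.Abelian.Ext

universe w' u' v'
variable {C : Type u} [Category.{v} C] [Abelian C] [HasExt.{w} C]
  {D : Type u'} [Category.{v'} D] [Abelian D] [HasExt.{w'} D]
  (F : C ⥤ D) [F.Additive] [PreservesFiniteLimits F] [PreservesFiniteColimits F]

/-- The comparison map `Ext(E, M) → Ext(Z, F M)` given by an exact functor `F` and a morphism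
`Z ⟶ F E`. -/
def comparison {E : C} {Z : D} (e : Z ⟶ F.obj E) (M : C) (n : ℕ) :
    Ext E M n →+ Ext Z (F.obj M) n :=
  ((mk₀ e).precomp (F.obj M) (zero_add n)).comp (F.mapExtAddHom E M n)

lemma comparison_apply {E : C} {Z : D} (e : Z ⟶ F.obj E) (M : C) (n : ℕ) (x : Ext E M n) :
    comparison F e M n x = (mk₀ e).comp (x.mapExactFunctor F) (zero_add n) := rfl

lemma comparison_comp {E : C} {Z : D} (e : Z ⟶ F.obj E) {M N : C} {n m k : ℕ} (x : Ext E M n)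
    (y : Ext M N m) (h : n + m = k) :
    comparison F e N k (x.comp y h) =
      (comparison F e M n x).comp (y.mapExactFunctor F) h := by
  rw [comparison_apply, comparison_apply, mapExactFunctor_comp,
    comp_assoc _ _ _ (zero_add n) h (by omega)]

/-- Dimension shifting for the comparison map. -/
lemma comparison_bijective {E : C} {Z : D} (e : Z ⟶ F.obj E) (P : C → Prop)
    (hom : ∀ M, P M → Function.Bijective fun f : E ⟶ M ↦ e ≫ F.map f)
    (emb : ∀ M, P M → ∃ (I Q : C) (f : M ⟶ I) (g : I ⟶ Q) (w : f ≫ g = 0),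
      (ShortComplex.mk f g w).ShortExact ∧ P I ∧ P Q ∧ (∀ n (x : Ext E I (n + 1)), x = 0) ∧
        ∀ n (x : Ext Z (F.obj I) (n + 1)), x = 0)
    (M : C) (hM : P M) (n : ℕ) : Function.Bijective (comparison F e M n) := by
  induction n generalizing M with
  | zero =>
    have : ∀ f, comparison F e M 0 (mk₀ f) = mk₀ (e ≫ F.map f) := fun f ↦ by
      rw [comparison_apply, mapExactFunctor_mk₀, mk₀_comp_mk₀]
    constructor
    · intro x y hxy
      obtain ⟨x, rfl⟩ := (mk₀_bijective _ _).2 x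
      obtain ⟨y, rfl⟩ := (mk₀_bijective _ _).2 y
      rw [this, this] at hxy
      rw [(hom M hM).1 ((mk₀_bijective _ _).1 hxy)]
    · intro y
      obtain ⟨y, rfl⟩ := (mk₀_bijective _ _).2 y
      obtain ⟨x, rfl⟩ := (hom M hM).2 y
      exact ⟨mk₀ x, this x⟩
  | succ n hn =>
    obtain ⟨I, Q, f, g, w, hS, hI, hQ, h₁, h₂⟩ := emb M hM
    -- Both groups in degree `n + 1` are cokernels of the maps from degree `n` of `I` to degree `n`
    -- of `Q`, because `I` and its image are acyclic.
    refine AddMonoidHom.bijective_of_surjective_of_bijective_of_right_exact _ _ _ _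
      (comparison F e I n) (comparison F e Q n) (comparison F e M (n + 1))
      ?_ ?_ ((ShortComplex.ab_exact_iff_function_exact _).mp
        (covariant_sequence_exact₃' E hS n (n + 1) rfl))
      ((ShortComplex.ab_exact_iff_function_exact _).mp
        (covariant_sequence_exact₃' Z (hS.map_of_exact F) n (n + 1) rfl))
      (hn _ hI).surjective (hn _ hQ)
      (fun x₁ ↦ covariant_sequence_exact₁ _ hS x₁ (h₁ _ _) rfl)
      (fun y₁ ↦ covariant_sequence_exact₁ _ (hS.map_of_exact F) y₁ (h₂ _ _) rfl)
    · ext x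
      change (comparison F e I n x).comp (mk₀ (F.map g)) (add_zero n) =
        comparison F e Q n (x.comp (mk₀ g) (add_zero n))
      rw [comparison_comp, mapExactFunctor_mk₀]
    · ext x
      change (comparison F e Q n x).comp (hS.map_of_exact F).extClass rfl =
        comparison F e M (n + 1) (x.comp hS.extClass rfl)
      rw [comparison_comp, mapExactFunctor_extClass]
      rfl

end CategoryTheory.Abelian.Ext

/-! ### Ext groups and restriction to an open subscheme. -/

namespace AlgebraicGeometry.Scheme.Modules

variable {U Y : Scheme.{u}} (g : U ⟶ Y) [IsOpenImmersion g]

instance : (restrictFunctor g).Additive where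
  map_add := rfl

instance : PreservesFiniteLimits (restrictFunctor g) := by
  have : ReflectsLimits (toPresheaf U) := reflectsLimits_of_reflectsIsomorphisms
  have : PreservesLimits (restrictFunctor g ⋙ toPresheaf U) :=
    have : PreservesLimits ((Functor.whiskeringLeft _ _ Ab.{u}).obj g.opensFunctor.op) :=
      ⟨inferInstance⟩
    inferInstanceAs (PreservesLimits (toPresheaf Y ⋙
      (Functor.whiskeringLeft _ _ Ab.{u}).obj g.opensFunctor.op))
  have : PreservesLimits (restrictFunctor g) :=
    preservesLimits_of_reflects_of_preserves _ (toPresheaf U)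
  infer_instance

instance : (pushforward g).Full := (restrictAdjunction g).fullyFaithfulROfIsIsoCounit.full
instance : (pushforward g).Faithful := (restrictAdjunction g).fullyFaithfulROfIsIsoCounit.faithful

instance : (pushforward g).PreservesInjectiveObjects :=
  Functor.preservesInjectiveObjects_of_adjunction_of_preservesMonomorphisms (restrictAdjunction g)

lemma epi_of_surjective_app {X : Scheme.{u}} {M N : X.Modules} (f : M ⟶ N)
    (h : ∀ U, Function.Surjective (f.app U)) : Epi f :=
  LocallySurjective.epi fun U s x hx ↦ by
    obtain ⟨t, ht⟩ := h U s
    refine ⟨U, le_rfl, hx, t, ht.trans ?_⟩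
    exact (ConcreteCategory.congr_hom (N.presheaf.map_id (op U)) s).symm

/-- A direct image is only left exact in general; a flasque kernel makes the last map surjective on
sections over every preimage. -/
lemma shortExact_pushforward {X Y : Scheme.{u}} (f : X ⟶ Y) {S : ShortComplex X.Modules}
    (hS : S.ShortExact) (h : S.X₁.IsFlasque) : (S.map (pushforward f)).ShortExact := by
  have := hS.mono_f
  have hL : PreservesFiniteLimits (pushforward f) := inferInstance
  rw [Functor.preservesFiniteLimits_iff_forall_exact_map_and_mono] at hL
  have : Epi ((pushforward f).map S.g) :=
    epi_of_surjective_app _ fun V ↦ surjective_app_of_shortExact hS h (f ⁻¹ᵁ V)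
  exact .mk' (hL S hS).1 (inferInstanceAs (Mono ((pushforward f).map S.f))) this

/-- Dimension shifting over the class of direct images of flasque modules. In degree zero this is
the adjunction, whose counit is an isomorphism for an open immersion. -/
lemma ext_restrict_bijective (M : Y.Modules) (T : U.Modules) (hT : T.IsFlasque) (n : ℕ) :
    Function.Bijective
      ((restrictFunctor g).mapExtAddHom M ((pushforward g).obj T) n) := by
  have key := Abelian.Ext.comparison_bijective (restrictFunctor g) (E := M) (𝟙 _)
    (fun K ↦ ∃ T : U.Modules, T.IsFlasque ∧ K = (pushforward g).obj T) ?_ ?_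
    ((pushforward g).obj T) ⟨T, hT, rfl⟩ n
  · convert key using 1
    ext x
    rw [Abelian.Ext.comparison_apply, Abelian.Ext.mk₀_id_comp]
    rfl
  · rintro _ ⟨T, hT, rfl⟩
    simp only [Category.id_comp]
    have h (f : M ⟶ (pushforward g).obj T) : ((restrictAdjunction g).homEquiv M T).symm f =
        (restrictFunctor g).map f ≫ (restrictAdjunction g).counit.app T :=
      (restrictAdjunction g).homEquiv_counit _ _ _
    refine ⟨fun f f' hf ↦ ?_, fun x ↦ ?_⟩
    · apply ((restrictAdjunction g).homEquiv M T).symm.injective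
      rw [h, h]
      exact congrArg (· ≫ _) hf
    · refine ⟨(restrictAdjunction g).homEquiv M T (x ≫ (restrictAdjunction g).counit.app T), ?_⟩
      refine (cancel_mono ((restrictAdjunction g).counit.app T)).1 ?_
      exact (h _).symm.trans (Equiv.symm_apply_apply _ _)
  · rintro _ ⟨T, hT, rfl⟩
    have hS := injectiveEmbedding_shortExact T
    have hI := isFlasque_of_injective (Injective.under T)
    have : Injective ((pushforward g).obj (Injective.under T)) :=
      Functor.PreservesInjectiveObjects.injective_obj inferInstance
    -- Restricting the direct image gives back the injective module, so both sides of the comparison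
    -- are acyclic.
    have : Injective ((restrictFunctor g).obj ((pushforward g).obj (Injective.under T))) :=
      Injective.of_iso (asIso ((restrictAdjunction g).counit.app _)).symm inferInstance
    refine ⟨_, _, _, _, _, shortExact_pushforward g hS hT, ⟨_, hI, rfl⟩,
      ⟨_, isFlasque_of_shortExact hS hT hI, rfl⟩, fun n x ↦ ?_, fun n x ↦ ?_⟩
    · exact Abelian.Ext.eq_zero_of_injective (I := (pushforward g).obj (Injective.under T)) x
    · exact Abelian.Ext.eq_zero_of_injective
        (I := (restrictFunctor g).obj ((pushforward g).obj (Injective.under T))) x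

end AlgebraicGeometry.Scheme.Modules

/-! ### Left resolutions of complexes that are bounded above. -/

namespace ChainComplex

variable {C : Type*} [Category* C] [Abelian C] (K : ChainComplex C ℕ)
  (cover : C → C) (π : ∀ M, cover M ⟶ M) [∀ M, Epi (π M)]

/-- The data from which the next step of the resolution of a chain complex is constructed. -/
structure ResolutionStep (n : ℕ) where
  /-- the object to be covered -/
  B : C
  /-- the map from the next term of the complex -/
  β : K.X (n + 1) ⟶ B
  /-- the map to the complex -/
  g : B ⟶ K.X n
  fac : β ≫ g = K.d (n + 1) n
  zero : K.d (n + 2) (n + 1) ≫ β = 0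
  ker : ∀ {A : C} (z : A ⟶ K.X (n + 1)), z ≫ K.d (n + 1) n = 0 → z ≫ β = 0

variable {K} in
/-- The construction of the next step of the resolution. -/
def ResolutionStep.next {n : ℕ} (s : ResolutionStep K n) : ResolutionStep K (n + 1) where
  B := pullback (π s.B) s.β
  -- The component in the cover is zero: the boundaries of `K` are lifted to the fibre product as
  -- pairs `(0, d y)`.
  β := pullback.lift 0 (K.d (n + 2) (n + 1)) (by rw [zero_comp, s.zero])
  g := pullback.snd _ _
  fac := pullback.lift_snd _ _ _
  zero := by
    apply pullback.hom_ext
    · rw [Category.assoc, pullback.lift_fst, comp_zero, zero_comp]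
    · rw [Category.assoc, pullback.lift_snd, K.d_comp_d, zero_comp]
  ker z hz := by
    apply pullback.hom_ext
    · rw [Category.assoc, pullback.lift_fst, comp_zero, zero_comp]
    · rw [Category.assoc, pullback.lift_snd, hz, zero_comp]

/-- The sequence of steps of the resolution. -/
def resolutionSteps : ∀ n, ResolutionStep K n
  | 0 => ⟨K.X 0, K.d 1 0, 𝟙 _, by simp, by simp, fun _ h ↦ h⟩
  | n + 1 => (resolutionSteps n).next cover π

/-- The data of a resolution `P → K` of a chain complex: the differential of `P` factors as
`P (n + 1) → B (n + 1) → P n`, where `B (n + 1)` is the fibre product of `P n` and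
`K (n + 1)` over `B n`. -/
structure ResolutionData where
  /-- the terms of the resolution -/
  P : ℕ → C
  /-- the fibre products -/
  B : ℕ → C
  /-- the covering maps -/
  p : ∀ n, P n ⟶ B n
  epi_p : ∀ n, Epi (p n)
  /-- the maps from the next term of the complex -/
  β : ∀ n, K.X (n + 1) ⟶ B n
  /-- the maps to the complex -/
  g : ∀ n, B n ⟶ K.X n
  /-- the projections of the fibre products -/
  f : ∀ n, B (n + 1) ⟶ P n
  isPullback : ∀ n, IsPullback (f n) (g (n + 1)) (p n) (β n)
  mono_g : Mono (g 0)
  epi_g : Epi (g 0)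
  fac : ∀ n, β n ≫ g n = K.d (n + 1) n
  β_f : ∀ n, β (n + 1) ≫ f n = 0
  ker : ∀ n {A : C} (z : A ⟶ K.X (n + 1)), z ≫ K.d (n + 1) n = 0 → z ≫ β n = 0

/-- The data of a resolution, constructed step by step. -/
def resolutionData : ResolutionData K where
  P n := cover (resolutionSteps K cover π n).B
  B n := (resolutionSteps K cover π n).B
  p _ := π _
  epi_p _ := inferInstance
  β n := (resolutionSteps K cover π n).β
  g n := (resolutionSteps K cover π n).g
  f _ := pullback.fst _ _
  isPullback _ := IsPullback.of_hasPullback _ _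
  mono_g := inferInstanceAs (Mono (𝟙 _))
  epi_g := inferInstanceAs (Epi (𝟙 _))
  fac n := (resolutionSteps K cover π n).fac
  β_f _ := pullback.lift_fst _ _ _
  ker n _ z hz := (resolutionSteps K cover π n).ker z hz

namespace ResolutionData

attribute [instance] epi_p mono_g epi_g

variable {K} (D : ResolutionData K)

/-- The chain complex of a resolution. -/
abbrev complex : ChainComplex C ℕ :=
  ChainComplex.of D.P (fun n ↦ D.p (n + 1) ≫ D.f n) (fun n ↦ by
    rw [Category.assoc, (D.isPullback (n + 1)).w_assoc, D.β_f, comp_zero, comp_zero])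

lemma complex_d (n : ℕ) : D.complex.d (n + 1) n = D.p (n + 1) ≫ D.f n :=
  ChainComplex.of_d D.P (fun n ↦ D.p (n + 1) ≫ D.f n) n

/-- The augmentation of a resolution. -/
def aug : D.complex ⟶ K where
  f n := D.p n ≫ D.g n
  comm' := by
    rintro _ n rfl
    rw [complex_d, Category.assoc, Category.assoc, (D.isPullback n).w_assoc, D.fac]

lemma aug_f (n : ℕ) : D.aug.f n = D.p n ≫ D.g n := rfl

lemma exists_lift {n : ℕ} {A : C} (p : A ⟶ D.P n) (k : A ⟶ K.X (n + 1))
    (h : p ≫ D.p n = k ≫ D.β n) :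
    ∃ (A' : C) (a : A' ⟶ A) (_ : Epi a) (x : A' ⟶ D.P (n + 1)),
      x ≫ D.p (n + 1) ≫ D.f n = a ≫ p ∧ x ≫ D.p (n + 1) ≫ D.g (n + 1) = a ≫ k := by
  obtain ⟨A', a, ha, x, hx⟩ := surjective_up_to_refinements_of_epi (D.p (n + 1))
    ((D.isPullback n).lift p k h)
  refine ⟨A', a, ha, x, ?_, ?_⟩
  · rw [← reassoc_of% hx, (D.isPullback n).lift_fst]
  · rw [← reassoc_of% hx, (D.isPullback n).lift_snd]

/-- A cycle of the resolution whose image in `K` is a boundary agrees with that boundary already in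
the fibre product; with `exists_lift` it becomes a boundary after a refinement. This is injectivity
on homology. -/
lemma comp_p_eq_of_cycle {n : ℕ} {A : C} (x : A ⟶ D.P n) (y : A ⟶ K.X (n + 1))
    (hx : ∀ m, m + 1 = n → x ≫ D.complex.d n m = 0)
    (hy : x ≫ D.p n ≫ D.g n = y ≫ K.d (n + 1) n) : x ≫ D.p n = y ≫ D.β n := by
  cases n with
  | zero => rw [← cancel_mono (D.g 0), Category.assoc, Category.assoc, hy, D.fac]
  | succ n =>
    have hx := hx n rfl
    rw [complex_d] at hx
    apply (D.isPullback n).hom_ext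
    · rw [Category.assoc, hx, Category.assoc, D.β_f, comp_zero]
    · rw [Category.assoc, hy, Category.assoc, D.fac]

/-- Surjectivity on homology: a cycle `y` of `K` is killed by `β`, so the pair `(0, y)` lies in the
fibre product, and a lift of it to `P (n + 1)` is a cycle above `y`. -/
instance : QuasiIso D.aug where
  quasiIsoAt n := by
    rw [quasiIsoAt_iff_isIso_homologyMap]
    have hm : Mono (HomologicalComplex.homologyMap D.aug n) := by
      rw [HomologicalComplex.mono_homologyMap_iff_up_to_refinements _ (n + 1) n _ (by simp) rfl]
      intro A x hx y hy
      obtain ⟨A', a, ha, z, hz, -⟩ := D.exists_lift x y (D.comp_p_eq_of_cycle x y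
        (fun m hm ↦ by subst hm; rwa [ChainComplex.next_nat_succ] at hx) hy)
      exact ⟨A', a, ha, z, by rw [complex_d, hz]⟩
    have he : Epi (HomologicalComplex.homologyMap D.aug n) := by
      rw [HomologicalComplex.epi_homologyMap_iff_up_to_refinements _ (n + 1) n _ (by simp) rfl]
      intro A y hy
      cases n with
      | zero =>
        obtain ⟨A', a, ha, x, hx⟩ := surjective_up_to_refinements_of_epi (D.p 0 ≫ D.g 0) y
        refine ⟨A', a, ha, x, ?_, 0, ?_⟩
        · rw [D.complex.shape, comp_zero]
          simp
        · rw [zero_comp, add_zero, aug_f, hx]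
      | succ n =>
        rw [ChainComplex.next_nat_succ] at hy ⊢
        obtain ⟨A', a, ha, x, hx, hx'⟩ := D.exists_lift (n := n) 0 y
          (by rw [zero_comp, D.ker n y hy])
        exact ⟨A', a, ha, x, by rw [complex_d, hx, comp_zero], 0,
          by rw [aug_f, hx', zero_comp, add_zero]⟩
    exact isIso_of_mono_of_epi _

end ResolutionData

end ChainComplex

namespace CochainComplex

variable {C : Type*} [Category* C] [Abelian C]

lemma exists_iso_extend (K : CochainComplex C ℤ) [K.IsStrictlyLE 0] :
    Nonempty ((K.restriction (ComplexShape.embeddingUpIntLE 0)).extend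
      (ComplexShape.embeddingUpIntLE 0) ≅ K) := by
  let e := ComplexShape.embeddingUpIntLE 0
  have hφ : e.HasLift (𝟙 (K.restriction e)) := by
    intro j hj
    obtain ⟨h1, h2⟩ := hj
    exact (h2 (j + 1) (by simp [e, ComplexShape.embeddingUpIntLE])).elim
  have (n : ℤ) : IsIso ((e.liftExtend _ hφ).f n) := by
    by_cases h : ∃ j, e.f j = n
    · obtain ⟨j, hj⟩ := h
      rw [e.isIso_liftExtend_f_iff _ _ hj]
      infer_instance
    · rw [not_exists] at h
      exact ⟨0, (HomologicalComplex.isZero_X_of_isStrictlySupported _ e _ h).eq_of_src _ _,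
        (HomologicalComplex.isZero_extend_X _ e _ h).eq_of_src _ _⟩
  have := HomologicalComplex.Hom.isIso_of_components (e.liftExtend _ hφ)
  exact ⟨(asIso (e.liftExtend _ hφ)).symm⟩

/-- Such a complex is an extension by zero of a chain complex indexed by `ℕ`, to which the stepwise
construction applies; the added zero terms explain the hypothesis `h0`. -/
lemma exists_resolution (P : ObjectProperty C) [P.IsClosedUnderIsomorphisms]
    (h0 : ∀ M, IsZero M → P M)
    (hP : ∀ M, ∃ (F : C) (p : F ⟶ M), P F ∧ Epi p) (K : CochainComplex C ℤ) [K.IsStrictlyLE 0] :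
    ∃ (L : CochainComplex C ℤ) (φ : L ⟶ K), L.IsStrictlyLE 0 ∧ (∀ n, P (L.X n)) ∧ QuasiIso φ := by
  choose cover π hcover hπ using hP
  let e := ComplexShape.embeddingUpIntLE 0
  obtain ⟨i⟩ := exists_iso_extend K
  let φ := (ChainComplex.resolutionData (K.restriction e) cover π).aug
  refine ⟨_, HomologicalComplex.extendMap φ e ≫ i.hom, inferInstance, fun n ↦ ?_, ?_⟩
  · by_cases h : ∃ j, e.f j = n
    · obtain ⟨j, hj⟩ := h
      exact P.prop_of_iso (HomologicalComplex.extendXIso _ e hj).symm (hcover _)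
    · exact h0 _ (HomologicalComplex.isZero_extend_X _ e n (by simpa using h))
  · have : QuasiIso (HomologicalComplex.extendMap φ e) := by
      rw [HomologicalComplex.quasiIso_extendMap_iff]
      infer_instance
    infer_instance

end CochainComplex

/-! ### Cones, cycles of acyclic complexes and fractions. -/

namespace CochainComplex

variable {C : Type*} [Category* C] [Abelian C]

lemma quasiIso_iff_acyclic_mappingCone {K L : CochainComplex C ℤ} (φ : K ⟶ L) :
    QuasiIso φ ↔ (mappingCone φ).Acyclic := by
  rw [← HomologicalComplex.mem_quasiIso_iff, ← HomotopyCategory.quotient_map_mem_quasiIso_iff,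
    HomotopyCategory.quasiIso_eq_trW_subcategoryAcyclic,
    ← HomotopyCategory.quotient_obj_mem_subcategoryAcyclic_iff_acyclic]
  exact (HomotopyCategory.subcategoryAcyclic C).trW_iff_of_distinguished _
    (HomotopyCategory.mappingCone_triangleh_distinguished φ)

instance isStrictlyLE_mappingCone {K L : CochainComplex C ℤ} (φ : K ⟶ L) (n : ℤ) [K.IsStrictlyLE n]
    [L.IsStrictlyLE n] : (mappingCone φ).IsStrictlyLE n := by
  rw [isStrictlyLE_iff]
  intro i hi
  refine IsZero.of_iso ?_ (HomologicalComplex.homotopyCofiber.XIsoBiprod φ i (i + 1) rfl)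
  rw [biprod_isZero_iff]
  exact ⟨K.isZero_of_isStrictlyLE n _, L.isZero_of_isStrictlyLE n _⟩

lemma shortExact_cycles {K : CochainComplex C ℤ} (hK : K.Acyclic) (i : ℤ) :
    (ShortComplex.mk (K.iCycles i) (K.toCycles i (i + 1)) (by
      rw [← cancel_mono (K.iCycles (i + 1))]; simp)).ShortExact := by
  have : Epi (K.toCycles i (i + 1)) := by
    have h := hK (i + 1)
    rw [HomologicalComplex.exactAt_iff' K i (i + 1) (i + 1 + 1) (by simp) (by simp),
      ShortComplex.exact_iff_epi_toCycles] at h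
    have h' : K.toCycles i (i + 1) = (K.sc' i (i + 1) (i + 1 + 1)).toCycles ≫
        (K.cyclesIsoSc' i (i + 1) (i + 1 + 1) (by simp) (by simp)).inv := by
      rw [← K.toCycles_cyclesIsoSc'_hom i (i + 1) (i + 1 + 1) (by simp) (by simp)]
      exact (Iso.eq_comp_inv _).2 rfl
    rw [h']
    exact @epi_comp _ _ _ _ _ _ h _ _
  refine { exact := ShortComplex.exact_of_f_is_kernel _ ?_ }
  refine KernelFork.IsLimit.ofι' _ _ fun {A} k hk ↦ ⟨K.liftCycles k (i + 1) (by simp) ?_,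
    K.liftCycles_i _ _ _ _⟩
  rw [← K.toCycles_i i (i + 1), ← Category.assoc]
  exact (congrArg (· ≫ _) hk).trans zero_comp

end CochainComplex

namespace DerivedCategory

/-- The derived category is the localisation of the homotopy category at quasi-isomorphisms, with a
calculus of fractions: two maps become equal exactly when some quasi-isomorphism into the source
equalises them up to homotopy. -/
lemma exists_homotopy_of_Q_map_eq_zero {C : Type*} [Category* C] [Abelian C]
    [HasDerivedCategory.{w} C] {K L : CochainComplex C ℤ} (f : K ⟶ L) (hf : Q.map f = 0) :
    ∃ (X : CochainComplex C ℤ) (t : X ⟶ K) (_ : QuasiIso t), Nonempty (Homotopy (t ≫ f) 0) := by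
  have h : Qh.map ((HomotopyCategory.quotient _ _).map f) = Qh.map 0 := by
    rw [← cancel_mono ((quotientCompQhIso C).hom.app L), quotientCompQhIso_hom_naturality, hf]
    simp
  rw [MorphismProperty.map_eq_iff_precomp Qh (HomotopyCategory.quasiIso C (ComplexShape.up ℤ))] at h
  obtain ⟨X, t, ht, h⟩ := h
  obtain ⟨X, rfl⟩ := HomotopyCategory.quotient_obj_surjective X
  obtain ⟨t, rfl⟩ := (HomotopyCategory.quotient C _).map_surjective t
  rw [HomotopyCategory.quotient_map_mem_quasiIso_iff] at ht
  refine ⟨X, t, ht, ⟨HomotopyCategory.homotopyOfEq _ _ ?_⟩⟩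
  rw [Functor.map_comp, h, comp_zero, Functor.map_zero]

end DerivedCategory

/-! ### Deriving a left adjoint on complexes of acyclic objects. -/

namespace CategoryTheory.Adjunction

open Abelian _root_.DerivedCategory

universe v₁ v₂ u₁ u₂ w₁ w₂
variable {C : Type u₁} [Category.{v₁} C] [Abelian C] {D : Type u₂} [Category.{v₂} D] [Abelian D]
  {L : C ⥤ D} {R : D ⥤ C} (adj : L ⊣ R) [L.Additive] [R.Additive] [HasExt.{w} C]

include adj in
/-- The objects that are acyclic for the left derived functors of `L`. -/
def adapted (_ : L ⊣ R) : ObjectProperty C :=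
  fun F ↦ ∀ (J : D) [Injective J] (q : ℕ) (x : Ext F (R.obj J) (q + 1)), x = 0

instance : adj.adapted.IsClosedUnderIsomorphisms where
  of_iso e h J _ q x := by
    have := h J q ((Ext.mk₀ e.hom).comp x (zero_add _))
    have h2 := congrArg (fun y ↦ (Ext.mk₀ e.inv).comp y (zero_add _)) this
    simpa using h2

lemma adapted_of_isZero {M : C} (h : IsZero M) : adj.adapted M := fun J _ q x ↦ by
  have : Ext.mk₀ (𝟙 M) = 0 := by rw [(h.eq_of_src _ _ : 𝟙 M = 0), Ext.mk₀_zero]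
  rw [← Ext.mk₀_id_comp x, this, Ext.zero_comp]

lemma adapted_biprod {M N : C} (hM : adj.adapted M) (hN : adj.adapted N) :
    adj.adapted (M ⊞ N) := fun J _ q x ↦ by
  have h : Ext.mk₀ (𝟙 (M ⊞ N)) = (Ext.mk₀ biprod.fst).comp (Ext.mk₀ biprod.inl) (zero_add 0) +
      (Ext.mk₀ biprod.snd).comp (Ext.mk₀ biprod.inr) (zero_add 0) := by
    rw [Ext.mk₀_comp_mk₀, Ext.mk₀_comp_mk₀, ← Ext.mk₀_add, biprod.total]
  have h₁ : (Ext.mk₀ biprod.inl).comp x (zero_add _) = 0 := hM J q _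
  have h₂ : (Ext.mk₀ biprod.inr).comp x (zero_add _) = 0 := hN J q _
  rw [← Ext.mk₀_id_comp x, h, Ext.add_comp, Ext.comp_assoc _ _ _ (zero_add 0) (zero_add _) (by omega),
    Ext.comp_assoc _ _ _ (zero_add 0) (zero_add _) (by omega), h₁, h₂, Ext.comp_zero,
    Ext.comp_zero, add_zero]

/-- Each higher Ext group of `S.X₁` lies between one of `S.X₂` in the same degree and one of `S.X₃`
a degree higher. -/
lemma adapted_of_shortExact {S : ShortComplex C} (hS : S.ShortExact) (h₂ : adj.adapted S.X₂)
    (h₃ : adj.adapted S.X₃) : adj.adapted S.X₁ := fun J _ q x ↦ by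
  obtain ⟨y, rfl⟩ := Ext.contravariant_sequence_exact₁ hS _ x (n₁ := q + 2) (by omega)
    (h₃ J (q + 1) _)
  rw [h₂ J q y, Ext.comp_zero]

/-- Embed `L S.X₁` in an injective `J`. The transpose of the embedding extends from `S.X₁` to
`S.X₂`, since the obstruction lies in a vanishing Ext¹; transposing back factors the embedding
through `L S.f`. -/
lemma mono_map_of_adapted [EnoughInjectives D] {S : ShortComplex C} (hS : S.ShortExact)
    (h₃ : adj.adapted S.X₃) : Mono (L.map S.f) := by
  let j := Injective.ι (L.obj S.X₁)
  obtain ⟨y, hy⟩ := Ext.contravariant_sequence_exact₁ hS _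
    (Ext.mk₀ (adj.homEquiv _ _ j)) (n₁ := 1) rfl (h₃ _ 0 _)
  obtain ⟨y, rfl⟩ := (Ext.mk₀_bijective _ _).2 y
  rw [Ext.mk₀_comp_mk₀] at hy
  have hy := (Ext.mk₀_bijective _ _).1 hy
  have : L.map S.f ≫ (adj.homEquiv _ _).symm y = j := by
    rw [← adj.homEquiv_naturality_left_symm, hy, Equiv.symm_apply_apply]
  exact mono_of_mono_fac this

variable [EnoughInjectives D]

/-- Descending induction from the top degree, where the cycles vanish; boundedness above is needed
to start it. -/
lemma adapted_cycles (K : CochainComplex C ℤ) (hK : K.Acyclic) (n : ℤ) [K.IsStrictlyLE n]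
    (hP : ∀ i, adj.adapted (K.X i)) (i : ℤ) : adj.adapted (K.cycles i) := by
  by_cases hi : n < i
  · have := (K.isZero_of_isStrictlyLE n i).of_mono (K.iCycles i)
    exact adj.adapted_of_isZero this
  · obtain ⟨m, hm⟩ := Int.eq_ofNat_of_zero_le (show 0 ≤ n - i by omega)
    induction m generalizing i with
    | zero =>
      exact adj.adapted_of_shortExact (CochainComplex.shortExact_cycles hK i) (hP i)
        (adj.adapted_of_isZero ((K.isZero_of_isStrictlyLE n (i + 1)).of_mono (K.iCycles (i + 1))))
    | succ m ih =>
      exact adj.adapted_of_shortExact (CochainComplex.shortExact_cycles hK i) (hP i)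
        (ih (i + 1) (by omega) (by omega))

/-- The complex splits into short exact sequences of cycles. As all cycles are acyclic for `L`,
these remain exact under `L` and can be spliced again. -/
lemma acyclic_map (K : CochainComplex C ℤ) (hK : K.Acyclic) (n : ℤ) [K.IsStrictlyLE n]
    (hP : ∀ i, adj.adapted (K.X i)) :
    ((L.mapHomologicalComplex _).obj K).Acyclic := by
  have := adj.leftAdjoint_preservesColimits
  intro i
  obtain ⟨i, rfl⟩ : ∃ j, i = j + 1 := ⟨i - 1, by omega⟩
  rw [HomologicalComplex.exactAt_iff' _ i (i + 1) (i + 1 + 1) (by simp) (by simp)]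
  have hS := CochainComplex.shortExact_cycles hK (i + 1)
  have hE := hS.exact.map_of_epi_of_preservesCokernel L hS.epi_g inferInstance
  -- An intermediate complex: `φ` exchanges its first term for `L` of the cycles along an
  -- epimorphism, and `ψ` embeds its last term in that of `L K`. Neither changes exactness in the
  -- middle.
  let S : ShortComplex D := ShortComplex.mk (L.map (K.d i (i + 1)))
    (L.map (K.toCycles (i + 1) (i + 1 + 1))) (by rw [← L.map_comp]; simp)
  let φ : S ⟶ (ShortComplex.mk (K.iCycles (i + 1)) (K.toCycles (i + 1) (i + 1 + 1)) (by
      rw [← cancel_mono (K.iCycles (i + 1 + 1))]; simp)).map L :=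
    { τ₁ := L.map (K.toCycles i (i + 1))
      τ₂ := 𝟙 _
      τ₃ := 𝟙 _
      comm₁₂ := by
        refine Eq.trans ?_ (Category.comp_id _).symm
        exact (L.map_comp _ _).symm.trans (congrArg L.map (K.toCycles_i i (i + 1)))
      comm₂₃ := (Category.id_comp _).trans (Category.comp_id _).symm }
  let ψ : S ⟶ ((L.mapHomologicalComplex (ComplexShape.up ℤ)).obj K).sc' i (i + 1) (i + 1 + 1) :=
    { τ₁ := 𝟙 _
      τ₂ := 𝟙 _
      τ₃ := L.map (K.iCycles (i + 1 + 1))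
      comm₁₂ := (Category.id_comp _).trans (Category.comp_id _).symm
      comm₂₃ := (Category.id_comp _).trans
        ((congrArg L.map (K.toCycles_i (i + 1) (i + 1 + 1))).symm.trans (L.map_comp _ _)) }
  have : Epi φ.τ₁ := by
    have := (CochainComplex.shortExact_cycles hK i).epi_g
    exact inferInstanceAs (Epi (L.map (K.toCycles i (i + 1))))
  have : IsIso φ.τ₂ := inferInstanceAs (IsIso (𝟙 _))
  have : Mono φ.τ₃ := inferInstanceAs (Mono (𝟙 _))
  have : Epi ψ.τ₁ := inferInstanceAs (Epi (𝟙 _))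
  have : IsIso ψ.τ₂ := inferInstanceAs (IsIso (𝟙 _))
  have : Mono ψ.τ₃ := adj.mono_map_of_adapted (CochainComplex.shortExact_cycles hK (i + 1 + 1))
    (adj.adapted_cycles K hK n hP _)
  exact (ShortComplex.exact_iff_of_epi_of_isIso_of_mono ψ).1
    ((ShortComplex.exact_iff_of_epi_of_isIso_of_mono φ).2 hE)

lemma quasiIso_map {K K' : CochainComplex C ℤ} (φ : K ⟶ K') [QuasiIso φ] (n : ℤ)
    [K.IsStrictlyLE n] [K'.IsStrictlyLE n] (hK : ∀ i, adj.adapted (K.X i))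
    (hK' : ∀ i, adj.adapted (K'.X i)) : QuasiIso ((L.mapHomologicalComplex _).map φ) := by
  rw [CochainComplex.quasiIso_iff_acyclic_mappingCone]
  have h := (CochainComplex.quasiIso_iff_acyclic_mappingCone φ).1 inferInstance
  have := adj.acyclic_map _ h n fun i ↦ adj.adapted.prop_of_iso
    (HomologicalComplex.homotopyCofiber.XIsoBiprod φ i (i + 1) rfl).symm
      (adj.adapted_biprod (hK _) (hK' _))
  exact fun i ↦ (this i).of_iso (CochainComplex.mappingCone.mapHomologicalComplexIso φ L)

/-- The unit of an adjunction, applied to a complex. -/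
def unitComplex (adj : L ⊣ R) (P : CochainComplex C ℤ) :
    P ⟶ (R.mapHomologicalComplex _).obj ((L.mapHomologicalComplex _).obj P) where
  f n := adj.unit.app (P.X n)
  comm' i j _ := (adj.unit.naturality (P.d i j)).symm

/-- The transpose of a morphism of complexes. -/
def transposeComplex (adj : L ⊣ R) {P : CochainComplex C ℤ} {G : CochainComplex D ℤ}
    (h : P ⟶ (R.mapHomologicalComplex _).obj G) : (L.mapHomologicalComplex _).obj P ⟶ G where
  f n := (adj.homEquiv (P.X n) (G.X n)).symm (h.f n)
  comm' i j _ := (adj.homEquiv_naturality_right_symm (h.f i) (G.d i j)).symm.trans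
    ((congrArg (adj.homEquiv (P.X i) (G.X j)).symm (h.comm i j)).trans
      (adj.homEquiv_naturality_left_symm (P.d i j) (h.f j)))

lemma unitComplex_transposeComplex (adj : L ⊣ R) {P : CochainComplex C ℤ}
    {G : CochainComplex D ℤ} (h : P ⟶ (R.mapHomologicalComplex _).obj G) :
    adj.unitComplex P ≫ (R.mapHomologicalComplex _).map (adj.transposeComplex h) = h := by
  ext n
  exact (adj.homEquiv_unit _ _ _).symm.trans ((adj.homEquiv (P.X n) (G.X n)).apply_symm_apply _)

lemma unitComplex_naturality (adj : L ⊣ R) {P P' : CochainComplex C ℤ} (φ : P ⟶ P') :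
    φ ≫ adj.unitComplex P' = adj.unitComplex P ≫
      (R.mapHomologicalComplex _).map ((L.mapHomologicalComplex _).map φ) := by
  ext n
  exact (adj.unit.naturality (φ.f n))

lemma transposeComplex_comp (adj : L ⊣ R) {P P' : CochainComplex C ℤ} {G : CochainComplex D ℤ}
    (φ : P ⟶ P') (a : (L.mapHomologicalComplex _).obj P' ⟶ G) :
    adj.transposeComplex (φ ≫ adj.unitComplex P' ≫ (R.mapHomologicalComplex _).map a) =
      (L.mapHomologicalComplex _).map φ ≫ a := by
  ext n
  refine (adj.homEquiv_naturality_left_symm (φ.f n) (adj.unit.app (P'.X n) ≫ R.map (a.f n))).trans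
    (congrArg (L.map (φ.f n) ≫ ·) ?_)
  exact (congrArg (adj.homEquiv (P'.X n) (G.X n)).symm (adj.homEquiv_unit _ _ (a.f n)).symm).trans
    (Equiv.symm_apply_apply _ _)

lemma homEquiv_symm_zero (adj : L ⊣ R) (M : C) (N : D) :
    (adj.homEquiv M N).symm (0 : M ⟶ R.obj N) = 0 := by
  rw [adj.homEquiv_counit, L.map_zero, zero_comp]

lemma homEquiv_symm_comp_add_comp (adj : L ⊣ R) {M M' : C} {N N' : D} (d : M ⟶ M')
    (h : M' ⟶ R.obj N) (h' : M ⟶ R.obj N') (d' : N' ⟶ N) :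
    (adj.homEquiv M N).symm (d ≫ h + h' ≫ R.map d') =
      L.map d ≫ (adj.homEquiv M' N).symm h + (adj.homEquiv M N').symm h' ≫ d' := by
  simp [adj.homEquiv_counit]

/-- The transpose of a morphism that is homotopic to zero is homotopic to zero. -/
def homotopyTransposeComplex (adj : L ⊣ R) {P : CochainComplex C ℤ} {G : CochainComplex D ℤ}
    {h : P ⟶ (R.mapHomologicalComplex _).obj G} (H : Homotopy h 0) :
    Homotopy (adj.transposeComplex h) 0 where
  hom i j := (adj.homEquiv (P.X i) (G.X j)).symm (H.hom i j)
  zero i j hij := (congrArg (adj.homEquiv (P.X i) (G.X j)).symm (H.zero i j hij)).trans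
    (adj.homEquiv_symm_zero _ _)
  comm i := by
    have h₁ := H.comm i
    rw [HomologicalComplex.zero_f, add_zero, dNext_eq _ (rfl : (ComplexShape.up ℤ).Rel i (i + 1)),
      prevD_eq _ (show (ComplexShape.up ℤ).Rel (i - 1) i by simp)] at h₁
    refine (congrArg (adj.homEquiv (P.X i) (G.X i)).symm h₁).trans
      ((adj.homEquiv_symm_comp_add_comp (P.d i (i + 1)) (H.hom (i + 1) i) (H.hom i (i - 1))
        (G.d (i - 1) i)).trans ?_)
    refine Eq.trans (congrArg₂ (· + ·) ?_ ?_) (add_zero _).symm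
    · exact (dNext_eq (C := (L.mapHomologicalComplex _).obj P) (D := G)
        (fun i j ↦ (adj.homEquiv (P.X i) (G.X j)).symm (H.hom i j))
        (rfl : (ComplexShape.up ℤ).Rel i (i + 1))).symm
    · exact (prevD_eq (C := (L.mapHomologicalComplex _).obj P) (D := G)
        (fun i j ↦ (adj.homEquiv (P.X i) (G.X j)).symm (H.hom i j))
        (show (ComplexShape.up ℤ).Rel (i - 1) i by simp)).symm

variable [HasDerivedCategory.{w₁} C] [HasDerivedCategory.{w₂} D]
  [PreservesFiniteLimits R] [PreservesFiniteColimits R]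

/-- The universal morphism of the derived adjunction at a complex. -/
def derivedUnit (adj : L ⊣ R) (P : CochainComplex C ℤ) :
    Q.obj P ⟶ R.mapDerivedCategory.obj (Q.obj ((L.mapHomologicalComplex _).obj P)) :=
  Q.map (adj.unitComplex P) ≫ R.mapDerivedCategoryFactors.inv.app _

lemma derivedUnit_map (adj : L ⊣ R) (P : CochainComplex C ℤ) {G : CochainComplex D ℤ}
    (a : (L.mapHomologicalComplex _).obj P ⟶ G) :
    adj.derivedUnit P ≫ R.mapDerivedCategory.map (Q.map a) =
      Q.map (adj.unitComplex P ≫ (R.mapHomologicalComplex _).map a) ≫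
        R.mapDerivedCategoryFactors.inv.app G := by
  have := R.mapDerivedCategoryFactors.inv.naturality a
  dsimp at this
  rw [derivedUnit, Category.assoc, ← this, Functor.map_comp, Category.assoc]

lemma derivedUnit_naturality (adj : L ⊣ R) {P P' : CochainComplex C ℤ} (φ : P ⟶ P') :
    Q.map φ ≫ adj.derivedUnit P' = adj.derivedUnit P ≫
      R.mapDerivedCategory.map (Q.map ((L.mapHomologicalComplex _).map φ)) := by
  rw [derivedUnit_map, ← unitComplex_naturality, Functor.map_comp, derivedUnit, Category.assoc]

/-- Only the source has to be bounded above with acyclic terms; `G` is arbitrary. Morphisms from `P`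
are fractions whose denominators can again be chosen bounded above with acyclic terms, and `L` maps
such denominators to quasi-isomorphisms, so the adjunction of complexes passes to fractions. -/
lemma derivedUnit_bijective (adj : L ⊣ R)
    (hcover : ∀ M, ∃ (F : C) (p : F ⟶ M), adj.adapted F ∧ Epi p)
    (P : CochainComplex C ℤ) [P.IsStrictlyLE 0] (hP : ∀ i, adj.adapted (P.X i))
    (G : DerivedCategory D) :
    Function.Bijective (fun f : Q.obj ((L.mapHomologicalComplex _).obj P) ⟶ G ↦
      adj.derivedUnit P ≫ R.mapDerivedCategory.map f) := by
  obtain ⟨G', ⟨e⟩⟩ := Functor.EssSurj.mem_essImage (F := Q) G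
  have hresolve := fun K : CochainComplex C ℤ ↦ fun _ : K.IsStrictlyLE 0 ↦
    CochainComplex.exists_resolution adj.adapted (fun _ ↦ adj.adapted_of_isZero) hcover K
  constructor
  · intro f₁ f₂ hf
    rw [← sub_eq_zero, ← cancel_mono e.inv, zero_comp]
    -- A fraction with denominator on the target side leaves the source `L P` unchanged, so its
    -- numerator transposes to a morphism of complexes from `P`.
    obtain ⟨G'', a, s, hs, hfac⟩ := left_fac ((f₁ - f₂) ≫ e.inv)
    have h1 : adj.derivedUnit P ≫ R.mapDerivedCategory.map ((f₁ - f₂) ≫ e.inv) = 0 := by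
      rw [Functor.map_comp, Functor.map_sub, ← Category.assoc, Preadditive.comp_sub,
        show adj.derivedUnit P ≫ _ = _ from hf, sub_self, zero_comp]
    have h2 : Q.map (adj.unitComplex P ≫ (R.mapHomologicalComplex _).map a) = 0 := by
      rw [← cancel_mono (R.mapDerivedCategoryFactors.inv.app G''), ← derivedUnit_map,
        (by rw [hfac]; simp : Q.map a = ((f₁ - f₂) ≫ e.inv) ≫ Q.map s), Functor.map_comp,
        ← Category.assoc, h1, zero_comp, zero_comp]
    have h3 : ∃ (X : CochainComplex C ℤ) (t : X ⟶ P) (_ : QuasiIso t),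
        Nonempty (Homotopy (t ≫ adj.unitComplex P ≫ (R.mapHomologicalComplex _).map a) 0) :=
      exists_homotopy_of_Q_map_eq_zero _ h2
    obtain ⟨X, t, ht, ⟨H⟩⟩ := h3
    -- The complex `X` need not be bounded; since `P` lives in degrees at most zero, truncating `X`
    -- there keeps a quasi-isomorphism to `P`.
    have : QuasiIso (CochainComplex.truncLEMap t 0 ≫ P.ιTruncLE 0) := by
      have : QuasiIso (CochainComplex.truncLEMap t 0) := by
        rw [CochainComplex.quasiIso_truncLEMap_iff]
        intro i _
        infer_instance
      infer_instance
    obtain ⟨P', p, hP', hP'', hp⟩ := hresolve (X.truncLE 0) inferInstance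
    let t' := p ≫ X.ιTruncLE 0 ≫ t
    have ht' : QuasiIso t' := by
      have : QuasiIso (X.ιTruncLE 0 ≫ t) := by rwa [← CochainComplex.ιTruncLE_naturality]
      infer_instance
    have hq := adj.quasiIso_map t' 0 hP'' hP
    have H' : Homotopy (t' ≫ adj.unitComplex P ≫ (R.mapHomologicalComplex _).map a) 0 :=
      (Homotopy.ofEq (by simp [t'])).trans ((H.compLeft (p ≫ X.ιTruncLE 0)).trans
        (Homotopy.ofEq comp_zero))
    -- The transposed map is `L t'` followed by `a`, and `L t'` is a quasi-isomorphism, hence `a`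
    -- vanishes in the derived category.
    have h4 := Q_map_eq_of_homotopy _ (adj.homotopyTransposeComplex H')
    rw [transposeComplex_comp, Functor.map_comp, Functor.map_zero] at h4
    have h5 : Q.map a = 0 := by
      rw [← cancel_epi (Q.map ((L.mapHomologicalComplex _).map t')), h4, comp_zero]
    rw [hfac, h5, zero_comp]
  · intro g
    -- The denominator is chosen with source in degrees at most zero, so that the source has a
    -- resolution by acyclic objects.
    obtain ⟨X, _, s, hs, h, hfac⟩ := right_fac_of_isStrictlyLE
      (g ≫ R.mapDerivedCategory.map e.inv ≫ R.mapDerivedCategoryFactors.hom.app G') 0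
    obtain ⟨P', p, hP', hP'', hp⟩ := hresolve X inferInstance
    have : QuasiIso s := by rwa [← isIso_Q_map_iff_quasiIso]
    have hq := adj.quasiIso_map (p ≫ s) 0 hP'' hP
    refine ⟨inv (Q.map ((L.mapHomologicalComplex _).map (p ≫ s))) ≫
      Q.map (adj.transposeComplex (p ≫ h)) ≫ e.hom, ?_⟩
    have h1 := adj.derivedUnit_map P' (adj.transposeComplex (p ≫ h))
    rw [unitComplex_transposeComplex] at h1
    have h2 := adj.derivedUnit_naturality (p ≫ s)
    have h3 : g = inv (Q.map s) ≫ Q.map h ≫ R.mapDerivedCategoryFactors.inv.app G' ≫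
        R.mapDerivedCategory.map e.hom := by
      rw [← reassoc_of% hfac]
      simp [← Functor.map_comp]
    rw [h3]
    dsimp only
    rw [← cancel_epi (Q.map (p ≫ s)), reassoc_of% h2, ← Functor.map_comp, IsIso.hom_inv_id_assoc,
      Functor.map_comp, reassoc_of% h1]
    simp

lemma exists_corepresentableBy [HasDerivedCategory.{w₁} D] (adj : L ⊣ R)
    (hcover : ∀ M, ∃ (F : C) (p : F ⟶ M), adj.adapted F ∧ Epi p) (M : C) :
    ∃ A : DerivedCategory D, Nonempty ((R.mapDerivedCategory ⋙
      coyoneda.obj (Opposite.op ((singleFunctor C 0).obj M))).CorepresentableBy A) := by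
  obtain ⟨P, p, hP, hP', hp⟩ := CochainComplex.exists_resolution adj.adapted
    (fun _ ↦ adj.adapted_of_isZero) hcover ((CochainComplex.singleFunctor C 0).obj M)
  let e : (singleFunctor C 0).obj M ≅ Q.obj P :=
    (singleFunctorIsoCompQ C 0).app M ≪≫ (asIso (Q.map p)).symm
  refine ⟨Q.obj ((L.mapHomologicalComplex _).obj P), ⟨
    { homEquiv {G} := (Equiv.ofBijective _ (adj.derivedUnit_bijective hcover P hP' G)).trans
        (e.symm.homCongr (Iso.refl _))
      homEquiv_comp {G G'} g f := ?_ }⟩⟩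
  simp

end CategoryTheory.Adjunction

/-! ### Existence of the derived pull-back. -/

namespace AlgebraicGeometry.Scheme.Modules

variable {X Y : Scheme.{u}}

/-- The canonical epimorphism from a coproduct of free modules on open subsets. -/
abbrev freeCover (M : Y.Modules) : Y.Modules :=
  ∐ fun x : Σ U : Y.Opens, Γ(M, U) ↦ freeOpen x.1

/-- The canonical epimorphism from a coproduct of free modules on open subsets. -/
def freeCoverπ (M : Y.Modules) : freeCover M ⟶ M := Sigma.desc fun x ↦ freeOpenEquiv.symm x.2

instance (M : Y.Modules) : Epi (freeCoverπ M) := by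
  refine epi_of_surjective_app _ fun U s ↦ ?_
  refine ⟨freeOpenEquiv (Sigma.ι (fun x : Σ U : Y.Opens, Γ(M, U) ↦ freeOpen x.1) ⟨U, s⟩), ?_⟩
  rw [← freeOpenEquiv_comp]
  simp [freeCoverπ]

/-- The quotient map of an embedding of a flasque module in an injective one is surjective on the
sections over every open set, so lifting along such maps is all that is required of `Z`. -/
lemma ext_eq_zero_of_isFlasque (Z : Y.Modules)
    (hZ : ∀ (M N : Y.Modules) (g : M ⟶ N), (∀ U, Function.Surjective (g.app U)) →
      ∀ h : Z ⟶ N, ∃ h' : Z ⟶ M, h' ≫ g = h)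
    (T : Y.Modules) (hT : T.IsFlasque) (n : ℕ) (x : Abelian.Ext Z T (n + 1)) : x = 0 := by
  refine Abelian.Ext.eq_zero_of_embedding _ IsFlasque (fun F hF ↦ ?_) n T hT x
  have hS := injectiveEmbedding_shortExact F
  exact ⟨_, _, _, _, _, hS, inferInstance,
    isFlasque_of_shortExact hS hF (isFlasque_of_injective _),
    hZ _ _ _ (surjective_app_of_shortExact hS hF)⟩

lemma ext_freeCover_eq_zero (M T : Y.Modules) (hT : T.IsFlasque) (n : ℕ)
    (x : Abelian.Ext (freeCover M) T (n + 1)) : x = 0 := by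
  refine ext_eq_zero_of_isFlasque _ (fun N N' g hg h ↦ ?_) T hT n x
  choose s hs using fun y : Σ U : Y.Opens, Γ(M, U) ↦ hg y.1 (freeOpenEquiv
    (Sigma.ι (fun x : Σ U : Y.Opens, Γ(M, U) ↦ freeOpen x.1) y ≫ h))
  refine ⟨Sigma.desc fun y ↦ freeOpenEquiv.symm (s y), Sigma.hom_ext _ _ fun y ↦ ?_⟩
  rw [Sigma.ι_desc_assoc]
  refine freeOpenEquiv.injective ?_
  rw [freeOpenEquiv_comp, Equiv.apply_symm_apply]
  exact hs y

/-- Coproducts of modules `freeOpen U` cover every module and are acyclic for pull-back, since the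
direct image of an injective module is flasque. -/
lemma exists_derivedPullback (f : X ⟶ Y) [IsClosedImmersion f] (M : Y.Modules) :
    ∃ A : DerivedCategory X.Modules, Nonempty (DerivedPullback f (single₀ M) A) :=
  (pullbackPushforwardAdjunction f).exists_corepresentableBy
    (fun N ↦ ⟨_, freeCoverπ N, fun J _ q x ↦
      ext_freeCover_eq_zero N _ ((isFlasque_of_injective J).pushforward f) q x, inferInstance⟩) M

end AlgebraicGeometry.Scheme.Modules

/-! ### Alternating maps: base change and dual bases. -/

namespace AlternatingMap

open Module

section BaseChange

variable {R S : Type*} [CommRing R] [CommRing S] {ρ : R →+* S}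
  {M N T T' : Type*} [AddCommGroup M] [Module R M] [AddCommGroup N] [Module S N]
  [AddCommGroup T] [Module R T] [AddCommGroup T'] [Module S T']

lemma ext_of_basis {ι : Type*} (b : Basis ι R M) {q : ℕ} (m : M →ₛₗ[ρ] N)
    (b' : Basis ι S N) (hb : ∀ i, m (b i) = b' i) {f g : N [⋀^Fin q]→ₗ[S] T'}
    (h : ∀ x : Fin q → M, f (m ∘ x) = g (m ∘ x)) : f = g := by
  refine b'.ext_alternating fun v _ ↦ ?_
  have : (fun i ↦ b' (v i)) = m ∘ fun i ↦ b (v i) := funext fun i ↦ (hb _).symm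
  rw [this, h]

/-- Base change of alternating maps along a ring map, for free modules. -/
lemma exists_baseChange {ι : Type*} (b : Basis ι R M) (q : ℕ) (m : M →ₛₗ[ρ] N)
    (b' : Basis ι S N) (hb : ∀ i, m (b i) = b' i) (τ : T →ₛₗ[ρ] T') (f : M [⋀^Fin q]→ₗ[R] T) :
    ∃ g : N [⋀^Fin q]→ₗ[S] T', ∀ x : Fin q → M, g (m ∘ x) = τ (f x) := by
  classical
  let _ : LinearOrder ι := linearOrderOfSTO WellOrderingRel
  let _ : Module R T' := Module.compHom T' ρ
  let _ : Module R (⋀[S]^q N) := Module.compHom _ ρ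
  let F : ⋀[R]^q M →ₗ[R] T := exteriorPower.alternatingMapLinearEquiv f
  let G : ⋀[S]^q N →ₗ[S] T' :=
    (b'.exteriorPower q).constr S fun s ↦ τ (F (exteriorPower.ιMulti_family R q b s))
  let μ : ⋀[R]^q M →ₗ[R] ⋀[S]^q N :=
    { toFun := exteriorPower.mapₛₗ q m
      map_add' := map_add _
      map_smul' := fun c x ↦ (exteriorPower.mapₛₗ q m).map_smulₛₗ c x }
  let G' : ⋀[S]^q N →ₗ[R] T' :=
    { toFun := G, map_add' := map_add _, map_smul' := fun c x ↦ G.map_smul (ρ c) x }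
  let τ' : T →ₗ[R] T' :=
    { toFun := τ, map_add' := map_add _, map_smul' := fun c x ↦ τ.map_smulₛₗ c x }
  have key : G' ∘ₗ μ = τ' ∘ₗ F := by
    refine (b.exteriorPower q).ext fun s ↦ ?_
    rw [exteriorPower.basis_apply]
    have h1 : μ (exteriorPower.ιMulti_family R q b s) = b'.exteriorPower q s := by
      rw [exteriorPower.basis_apply]
      refine (exteriorPower.mapₛₗ_ιMulti q m _).trans (congrArg _ (funext fun i ↦ hb _))
    change G (μ _) = τ (F _)
    rw [h1, Basis.constr_basis]
  refine ⟨exteriorPower.alternatingMapLinearEquiv.symm G, fun x ↦ ?_⟩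
  have h2 := LinearMap.congr_fun key (exteriorPower.ιMulti R q x)
  have h3 : F (exteriorPower.ιMulti R q x) = f x :=
    exteriorPower.alternatingMapLinearEquiv_apply_ιMulti _ _
  rw [← h3]
  refine Eq.trans ?_ h2
  exact congrArg G (exteriorPower.mapₛₗ_ιMulti q m x).symm

/-- The alternating maps to the base ring on a free module of finite rank form a free module. -/
def basis {ι : Type*} [Finite ι] [LinearOrder ι] (b : Basis ι R M) (q : ℕ) :
    Basis (Set.powersetCard ι q) R (M [⋀^Fin q]→ₗ[R] R) :=
  (b.exteriorPower q).dualBasis.map exteriorPower.alternatingMapLinearEquiv.symm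

lemma basis_apply {ι : Type*} [Finite ι] [LinearOrder ι] (b : Basis ι R M) (q : ℕ)
    (s t : Set.powersetCard ι q) :
    basis b q s (fun i ↦ b (Set.powersetCard.ofFinEmbEquiv.symm t i)) = if t = s then 1 else 0 := by
  have : basis b q s (fun i ↦ b (Set.powersetCard.ofFinEmbEquiv.symm t i)) =
      (b.exteriorPower q).dualBasis s (b.exteriorPower q t) := by
    rw [exteriorPower.basis_apply]
    rfl
  rw [this, Basis.dualBasis_apply_self]

lemma ext_powersetCard {ι : Type*} [LinearOrder ι] (b : Basis ι R M) {q : ℕ}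
    {f g : M [⋀^Fin q]→ₗ[R] T}
    (h : ∀ s : Set.powersetCard ι q, f (fun i ↦ b (Set.powersetCard.ofFinEmbEquiv.symm s i)) =
      g (fun i ↦ b (Set.powersetCard.ofFinEmbEquiv.symm s i))) : f = g := by
  refine exteriorPower.alternatingMapLinearEquiv.injective ((b.exteriorPower q).ext fun s ↦ ?_)
  rw [exteriorPower.basis_apply, exteriorPower.ιMulti_family]
  exact (exteriorPower.alternatingMapLinearEquiv_apply_ιMulti _ _).trans
    ((h s).trans (exteriorPower.alternatingMapLinearEquiv_apply_ιMulti _ _).symm)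

end BaseChange

/-! ### Exactness of the Koszul complex of a regular sequence. -/

section Koszul

variable {R : Type*} [CommRing R] {M : Type*} [AddCommGroup M] [Module R M]

/-- The product of a linear form and an alternating form. -/
def wedge {n : ℕ} (ε : M →ₗ[R] R) (f : M [⋀^Fin n]→ₗ[R] R) : M [⋀^Fin (n + 1)]→ₗ[R] R :=
  alternatizeUncurryFin (ε.smulRight f)

lemma curryLeft_wedge_zero (ε : M →ₗ[R] R) (f : M [⋀^Fin 0]→ₗ[R] R) (x : M) :
    (wedge ε f).curryLeft x = ε x • f := by
  ext v
  simp [wedge, alternatizeUncurryFin_apply, Subsingleton.elim _ v]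

/-- Contraction is an antiderivation: in the expansion of the wedge product the term with index zero
gives `ε x • f`, and the others, shifted by one, change sign. -/
lemma curryLeft_wedge {n : ℕ} (ε : M →ₗ[R] R) (f : M [⋀^Fin (n + 1)]→ₗ[R] R) (x : M) :
    (wedge ε f).curryLeft x = ε x • f - wedge ε (f.curryLeft x) := by
  ext v
  rw [curryLeft_apply_apply, wedge, alternatizeUncurryFin_apply, Fin.sum_univ_succ, sub_apply,
    smul_apply, wedge, alternatizeUncurryFin_apply, sub_eq_add_neg, ← Finset.sum_neg_distrib]
  refine congrArg₂ (· + ·) (by simp) (Finset.sum_congr rfl fun i _ ↦ ?_)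
  rw [Fin.val_succ, pow_succ, mul_neg_one, neg_smul]
  refine congrArg (fun y : R ↦ -((-1 : ℤ) ^ (i : ℕ) • y)) ?_
  rw [LinearMap.smulRight_apply, LinearMap.smulRight_apply, AlternatingMap.smul_apply,
    AlternatingMap.smul_apply, curryLeft_apply_apply]
  refine congrArg₂ (fun (a : R) (y : Fin (n + 1) → M) ↦ a • f y) rfl ?_
  funext j
  cases j using Fin.cases <;> simp [Fin.removeNth]

lemma curryLeft_swap {n : ℕ} (f : M [⋀^Fin (n + 2)]→ₗ[R] R) (x y : M) :
    (f.curryLeft x).curryLeft y = -(f.curryLeft y).curryLeft x := by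
  have h := curryLeft_same f (x + y)
  rw [map_add f.curryLeft, curryLeft_add, LinearMap.add_apply, map_add, map_add, curryLeft_same,
    curryLeft_same, zero_add, add_zero] at h
  exact eq_neg_of_add_eq_zero_left h

@[simp]
lemma wedge_zero {n : ℕ} (ε : M →ₗ[R] R) : wedge ε (0 : M [⋀^Fin n]→ₗ[R] R) = 0 := by
  ext v; simp [wedge, alternatizeUncurryFin_apply]

variable {c : ℕ} (b : Basis (Fin c) R M) (f : Fin c → R)

/-- The vector with coordinates `f i` for `i < k` and `0` otherwise. -/
def partialVector (k : ℕ) : M := ∑ i with i.val < k, f i • b i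

lemma partialVector_succ (k : Fin c) :
    partialVector b f (k + 1) = partialVector b f k + f k • b k := by
  have : Finset.univ.filter (fun i : Fin c ↦ i.val < k.val + 1) =
      insert k (Finset.univ.filter fun i : Fin c ↦ i.val < k.val) := by
    ext i
    simp only [Finset.mem_filter, Finset.mem_univ, true_and, Finset.mem_insert, Fin.ext_iff]
    omega
  rw [partialVector, this, Finset.sum_insert (by simp), add_comm, partialVector]

lemma partialVector_last : partialVector b f c = ∑ i, f i • b i := by
  simp [partialVector]

/-- The ideal generated by the `f i` for `i < k`. -/
def partialIdeal (k : ℕ) : Ideal R := Ideal.span (f '' {i | i.val < k})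

lemma partialIdeal_succ (k : Fin c) :
    partialIdeal f (k + 1) = partialIdeal f k ⊔ Ideal.span {f k} := by
  rw [partialIdeal, partialIdeal, ← Ideal.span_union]
  congr 1
  ext r
  constructor
  · rintro ⟨i, hi, rfl⟩
    by_cases h : i = k
    · exact Or.inr (by simp [h])
    · refine Or.inl ⟨i, ?_, rfl⟩
      simp only [Set.mem_ofPred_eq] at hi ⊢
      have : i.val ≠ k.val := fun h' ↦ h (Fin.ext h')
      omega
  · rintro (⟨i, hi, rfl⟩ | h)
    · exact ⟨i, Nat.lt_succ_of_lt hi, rfl⟩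
    · rw [Set.mem_singleton_iff] at h
      exact ⟨k, by simp, h.symm⟩

/-- The form does not involve the coordinates with index at least `k`. -/
def Supported {n : ℕ} (k : ℕ) (g : M [⋀^Fin (n + 1)]→ₗ[R] R) : Prop :=
  ∀ i : Fin c, k ≤ i.val → g.curryLeft (b i) = 0

variable {b}

lemma Supported.curryLeft {n k : ℕ} {g : M [⋀^Fin (n + 2)]→ₗ[R] R} (hg : Supported b k g) (x : M) :
    Supported b k (g.curryLeft x) := fun i hi ↦ by
  rw [curryLeft_swap, hg i hi, curryLeft_zero, LinearMap.zero_apply, neg_zero]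

lemma Supported.wedge {n : ℕ} {k : Fin c} {g : M [⋀^Fin (n + 1)]→ₗ[R] R}
    (hg : Supported b k g) : Supported b (k + 1) (wedge (b.coord k) g) := fun i hi ↦ by
  have : i ≠ k := by rintro rfl; omega
  rw [curryLeft_wedge, hg i (by omega)]
  simp [this]

lemma supported_wedge_zero {k : Fin c} (g : M [⋀^Fin 0]→ₗ[R] R) :
    Supported b (k + 1) (AlternatingMap.wedge (b.coord k) g) := fun i hi ↦ by
  have : i ≠ k := by rintro rfl; omega
  rw [curryLeft_wedge_zero]
  simp [this]

lemma Supported.mono {n k l : ℕ} {g : M [⋀^Fin (n + 1)]→ₗ[R] R} (hg : Supported b k g)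
    (h : k ≤ l) : Supported b l g := fun i hi ↦ hg i (h.trans hi)

lemma Supported.curryLeft_succ {n : ℕ} {k : Fin c} {g : M [⋀^Fin (n + 1)]→ₗ[R] R}
    (hg : Supported b k g) :
    g.curryLeft (partialVector b f (k + 1)) = g.curryLeft (partialVector b f k) := by
  rw [partialVector_succ, map_add, _root_.map_smul, hg k le_rfl, smul_zero, add_zero]

/-- Exactness at the end of the complex: an element `s + r * f k` of the ideal is reached by a
linear form handling `s` plus `r` times the coordinate `k`. -/
lemma exists_curryLeft_zero (k : ℕ) (hk : k ≤ c) (g : M [⋀^Fin 0]→ₗ[R] R)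
    (hg : g ![] ∈ partialIdeal f k) :
    ∃ h : M [⋀^Fin 1]→ₗ[R] R, Supported b k h ∧ h.curryLeft (partialVector b f k) = g := by
  induction k generalizing g with
  | zero =>
    refine ⟨0, fun _ _ ↦ by simp, ?_⟩
    ext v
    rw [Subsingleton.elim v ![]]
    simpa [partialIdeal, eq_comm] using hg
  | succ k ih =>
    lift k to Fin c using hk with k
    rw [partialIdeal_succ, Submodule.mem_sup] at hg
    obtain ⟨s, hs, t, ht, hst⟩ := hg
    obtain ⟨r, rfl⟩ := Ideal.mem_span_singleton'.1 ht
    obtain ⟨h, hh, hh'⟩ := ih (by omega) (AlternatingMap.constOfIsEmpty R M (Fin 0) s) hs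
    refine ⟨h + wedge (b.coord k) (AlternatingMap.constOfIsEmpty R M (Fin 0) r),
      fun i hi ↦ ?_, ?_⟩
    · rw [curryLeft_add, LinearMap.add_apply, hh.mono (Nat.le_succ _) i hi,
        supported_wedge_zero _ i hi, add_zero]
    · rw [curryLeft_add, LinearMap.add_apply, hh.curryLeft_succ, hh', curryLeft_wedge_zero]
      ext v
      rw [Subsingleton.elim v ![], ← hst]
      have : b.coord k (partialVector b f k) = 0 := by
        simp [partialVector, Finsupp.single_apply]
      rw [partialVector_succ, map_add, this, _root_.map_smul]
      simp [mul_comm]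

lemma apply_mem_partialIdeal (k : ℕ) (g : M [⋀^Fin 1]→ₗ[R] R) :
    g.curryLeft (partialVector b f k) ![] ∈ partialIdeal f k := by
  have h : g.curryLeft (partialVector b f k) ![] =
      ∑ i with i.val < k, f i * g.curryLeft (b i) ![] := by
    simp only [partialVector, map_sum, _root_.map_smul]
    induction (Finset.univ.filter fun i : Fin c ↦ i.val < k) using Finset.induction_on with
    | empty => simp
    | insert i s hi ih => rw [Finset.sum_insert hi, Finset.sum_insert hi, ← ih]; rfl
  rw [h]
  refine Ideal.sum_mem _ fun i hi ↦ ?_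
  exact Ideal.mul_mem_right _ _ (Ideal.subset_span ⟨i, by simpa using hi, rfl⟩)

/-- Induction on the number `k` of coordinates, as when the Koszul complex is built as an iterated
cone. Write `g = a + ε ∧ e`, where `ε` is the new coordinate. That `g` is closed means that `e` is
closed for the shorter vector `x` and that `a` contracts with `x` to `-f k • e`. Primitives `e'` of
`e` and `a'` of `a + f k • e'` then give one of `g`. -/
lemma exists_curryLeft_succ
    (hf : ∀ (k : Fin c) (r : R), f k * r ∈ partialIdeal f k → r ∈ partialIdeal f k)
    (k : ℕ) (hk : k ≤ c) (n : ℕ) (g : M [⋀^Fin (n + 1)]→ₗ[R] R) (hg : Supported b k g)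
    (hg' : g.curryLeft (partialVector b f k) = 0) :
    ∃ h : M [⋀^Fin (n + 2)]→ₗ[R] R, Supported b k h ∧ h.curryLeft (partialVector b f k) = g := by
  induction k generalizing n g with
  | zero =>
    refine ⟨0, fun _ _ ↦ by simp, ?_⟩
    have : g.curryLeft = 0 := b.ext fun i ↦ hg i (Nat.zero_le _)
    ext v
    rw [← Matrix.cons_head_tail v, ← curryLeft_apply_apply g, this]
    simp
  | succ k ih =>
    lift k to Fin c using hk with k
    have ih := ih (by omega)
    set x := partialVector b f k with hx
    have hεx : b.coord k x = 0 := by simp [hx, partialVector, Finsupp.single_apply]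
    have hε : b.coord k (partialVector b f (k + 1)) = f k := by
      rw [partialVector_succ, map_add, ← hx, hεx]; simp
    -- write `g = a + ε ∧ e` where `a` and `e` do not involve the coordinate `k`
    set e := g.curryLeft (b k) with he
    set a := g - wedge (b.coord k) e with ha
    have hga : g = a + wedge (b.coord k) e := by rw [ha, sub_add_cancel]
    -- it is enough to find a primitive of `e`
    suffices H : ∃ e' : M [⋀^Fin (n + 1)]→ₗ[R] R, Supported b k e' ∧ e'.curryLeft x = e ∧
        Supported b k a ∧ a.curryLeft x = -(f k • e) by
      obtain ⟨e', he', hee', hsa, hax⟩ := H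
      obtain ⟨a', ha', haa'⟩ := ih n (a + f k • e')
        (fun i hi ↦ by
          rw [curryLeft_add, LinearMap.add_apply, hsa i hi, curryLeft_smul, LinearMap.smul_apply,
            he' i hi, smul_zero, add_zero])
        (by rw [curryLeft_add, LinearMap.add_apply, hax, curryLeft_smul, LinearMap.smul_apply,
            hee', neg_add_cancel])
      -- Contracting with `x + f k • b k`, the first term gives `a + f k • e'` and the second takes
      -- away `f k • e' - ε ∧ e`; the result is `g`.
      refine ⟨a' - wedge (b.coord k) e', fun i hi ↦ ?_, ?_⟩
      · have := he'.wedge i hi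
        have h2 := (ha'.mono (Nat.le_succ _)) i hi
        change a'.curryLeft (b i) - (wedge (b.coord k) e').curryLeft (b i) = 0
        rw [this, h2, sub_zero]
      · change a'.curryLeft _ - (wedge (b.coord k) e').curryLeft _ = g
        rw [ha'.curryLeft_succ, ← hx, haa', curryLeft_wedge, hε, he'.curryLeft_succ, ← hx, hee',
          hga]
        abel
    cases n with
    | zero =>
      have hsa : Supported b k a := fun i hi ↦ by
        change g.curryLeft (b i) - (wedge (b.coord k) e).curryLeft (b i) = 0
        rw [curryLeft_wedge_zero]
        by_cases h : i = k
        · subst h; simp [he]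
        · have : (k : ℕ) + 1 ≤ i := by
            have : i.val ≠ k.val := fun h' ↦ h (Fin.ext h')
            omega
          rw [hg i this]; simp [h]
      have hax : a.curryLeft x = -(f k • e) := by
        have : a.curryLeft x + f k • e = 0 := by
          rw [← hg', hga, curryLeft_add, LinearMap.add_apply, hsa.curryLeft_succ,
            curryLeft_wedge_zero, hε]
        exact eq_neg_of_add_eq_zero_left this
      -- Here regularity enters. The form `e` is a scalar, and `f k • e` is, up to sign, the
      -- contraction of a linear form with `x`, hence in the ideal of the earlier `f i`; so `e`
      -- itself lies there.
      obtain ⟨e', h1, h2⟩ := exists_curryLeft_zero (b := b) f k k.2.le e (hf k _ (by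
        have := apply_mem_partialIdeal (b := b) f k a
        rw [← hx, hax] at this
        exact neg_mem_iff.1 this))
      exact ⟨e', h1, h2, hsa, hax⟩
    | succ n =>
      have hee : e.curryLeft (b k) = 0 := by rw [he, curryLeft_same]
      have hse : Supported b k e := fun i hi ↦ by
        by_cases h : i = k
        · subst h; exact hee
        · have : (k : ℕ) + 1 ≤ i := by
            have : i.val ≠ k.val := fun h' ↦ h (Fin.ext h')
            omega
          exact hg.curryLeft _ i this
      have hsa : Supported b k a := fun i hi ↦ by
        change g.curryLeft (b i) - (wedge (b.coord k) e).curryLeft (b i) = 0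
        rw [curryLeft_wedge, hse i hi, wedge_zero, sub_zero]
        by_cases h : i = k
        · subst h; simp [he]
        · have : (k : ℕ) + 1 ≤ i := by
            have : i.val ≠ k.val := fun h' ↦ h (Fin.ext h')
            omega
          rw [hg i this]; simp [h]
      have h0 : a.curryLeft x + (f k • e - wedge (b.coord k) (e.curryLeft x)) = 0 := by
        rw [← hg']
        conv_rhs => rw [hga]
        rw [curryLeft_add, LinearMap.add_apply, hsa.curryLeft_succ,
            curryLeft_wedge, hε, hse.curryLeft_succ]
      -- Contract `h0` with `b k`: neither `a` nor `e` involves that coordinate, so only the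
      -- contraction of `e` with `x` survives.
      have hex : e.curryLeft x = 0 := by
        have h1 := congrArg (fun y ↦ y.curryLeft (b k)) h0
        simp only [curryLeft_add, LinearMap.add_apply, curryLeft_zero, LinearMap.zero_apply] at h1
        rw [curryLeft_swap, hsa k le_rfl] at h1
        change -curryLeft 0 x + (f k • e.curryLeft (b k) -
          (wedge (b.coord k) (e.curryLeft x)).curryLeft (b k)) = 0 at h1
        cases n with
        | zero =>
          rw [hee, curryLeft_wedge_zero] at h1
          simpa using h1
        | succ n =>
          rw [hee, curryLeft_wedge, hse.curryLeft x k le_rfl] at h1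
          simpa using h1
      have hax : a.curryLeft x = -(f k • e) := by
        rw [hex, wedge_zero, sub_zero] at h0
        exact eq_neg_of_add_eq_zero_left h0
      obtain ⟨e', h1, h2⟩ := ih n e hse hex
      exact ⟨e', h1, h2, hsa, hax⟩

end Koszul

end AlternatingMap

/-! ### Sections of modules: restriction, gluing, local criteria. -/

namespace AlgebraicGeometry.Scheme.Modules

variable {X : Scheme.{u}}

/-- Restriction of functions. -/
abbrev resₒ {U V : X.Opens} (h : V ≤ U) : Γ(X, U) →+* Γ(X, V) := (X.presheaf.map (homOfLE h).op).hom

lemma resₒ_resₒ {U V W : X.Opens} (h : V ≤ U) (h' : W ≤ V) (r : Γ(X, U)) :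
    resₒ h' (resₒ h r) = resₒ (h'.trans h) r := map_map_eq h h' r

lemma resₒ_self {U : X.Opens} (h : U ≤ U) (r : Γ(X, U)) : resₒ h r = r :=
  DFunLike.congr_fun (congrArg CommRingCat.Hom.hom (X.presheaf.map_id (op U))) r

lemma res_res (M : X.Modules) {U V W : X.Opens} (h : V ≤ U) (h' : W ≤ V) (m : Γ(M, U)) :
    M.res h' (M.res h m) = M.res (h'.trans h) m :=
  (DFunLike.congr_fun (congrArg AddCommGrpCat.Hom.hom
    (M.presheaf.map_comp (homOfLE h).op (homOfLE h').op)) m).symm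

lemma res_self (M : X.Modules) {U : X.Opens} (h : U ≤ U) (m : Γ(M, U)) : M.res h m = m :=
  DFunLike.congr_fun (congrArg AddCommGrpCat.Hom.hom (M.presheaf.map_id (op U))) m

lemma res_comp_res (M : X.Modules) {U V W : X.Opens} (h : V ≤ U) (h' : W ≤ V) {ι : Type*}
    (m : ι → Γ(M, U)) : M.res h' ∘ M.res h ∘ m = M.res (h'.trans h) ∘ m :=
  funext fun _ ↦ M.res_res h h' _

lemma eq_of_res_eq (M : X.Modules) {U : X.Opens} {s t : Γ(M, U)}
    (h : ∀ x ∈ U, ∃ (V : X.Opens) (hV : V ≤ U), x ∈ V ∧ M.res hV s = M.res hV t) : s = t := by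
  refine TopCat.Presheaf.section_ext ⟨M.presheaf, M.isSheaf⟩ U _ _ fun x hx ↦ ?_
  obtain ⟨V, hV, hxV, h⟩ := h x hx
  exact TopCat.Presheaf.germ_ext M.presheaf V hxV (homOfLE hV) (homOfLE hV) h

lemma exists_glue (M : X.Modules) {ι : Type u} {U : X.Opens} (V : ι → X.Opens)
    (hV : ∀ i, V i ≤ U) (hU : U ≤ iSup V) (s : ∀ i, Γ(M, V i))
    (hs : ∀ i j, M.res (inf_le_left : V i ⊓ V j ≤ V i) (s i) =
      M.res (inf_le_right : V i ⊓ V j ≤ V j) (s j)) :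
    ∃ t : Γ(M, U), ∀ i, M.res (hV i) t = s i :=
  (TopCat.Sheaf.existsUnique_gluing' ⟨M.presheaf, M.isSheaf⟩ V U (fun i ↦ homOfLE (hV i)) hU s
    fun i j ↦ hs i j).exists

lemma eq_of_cover (M : X.Modules) {ι : Type*} {U : X.Opens} (V : ι → X.Opens)
    (hV : ∀ i, V i ≤ U) (hU : U ≤ iSup V) {s t : Γ(M, U)}
    (h : ∀ i, M.res (hV i) s = M.res (hV i) t) : s = t := M.eq_of_res_eq fun x hx ↦ by
  obtain ⟨i, hi⟩ := Opens.mem_iSup.1 (hU hx)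
  exact ⟨V i, hV i, hi, h i⟩

/-- The action of a morphism on sections, as a linear map. -/
def Hom.appₗ {M N : X.Modules} (f : M ⟶ N) (U : X.Opens) : Γ(M, U) →ₗ[Γ(X, U)] Γ(N, U) where
  toFun := f.app U
  map_add' := map_add _
  map_smul' := f.app_smul

lemma Hom.appₗ_res {M N : X.Modules} (f : M ⟶ N) {U V : X.Opens} (h : V ≤ U) (m : Γ(M, U)) :
    f.appₗ V (M.res h m) = N.res h (f.appₗ U m) :=
  ConcreteCategory.congr_hom (f.mapPresheaf.naturality (homOfLE h).op) m

lemma Hom.comp_appₗ {M N K : X.Modules} (f : M ⟶ N) (g : N ⟶ K) (U : X.Opens) (m : Γ(M, U)) :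
    (f ≫ g).appₗ U m = g.appₗ U (f.appₗ U m) := rfl

lemma Hom.id_appₗ {M : X.Modules} (U : X.Opens) (m : Γ(M, U)) : Hom.appₗ (𝟙 M) U m = m := rfl

lemma Hom.add_appₗ {M N : X.Modules} (f g : M ⟶ N) (U : X.Opens) (m : Γ(M, U)) :
    (f + g).appₗ U m = f.appₗ U m + g.appₗ U m := rfl

lemma Hom.zero_appₗ {M N : X.Modules} (U : X.Opens) (m : Γ(M, U)) :
    Hom.appₗ (0 : M ⟶ N) U m = 0 := rfl

lemma Hom.sum_appₗ {M N : X.Modules} {ι : Type*} (s : Finset ι) (f : ι → (M ⟶ N)) (U : X.Opens)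
    (m : Γ(M, U)) : (∑ i ∈ s, f i).appₗ U m = ∑ i ∈ s, (f i).appₗ U m := by
  classical
  induction s using Finset.induction_on with
  | empty => rfl
  | insert i s hi ih => rw [Finset.sum_insert hi, Finset.sum_insert hi, Hom.add_appₗ, ih]

lemma hom_extₗ {M N : X.Modules} {f g : M ⟶ N} (h : ∀ U (m : Γ(M, U)), f.appₗ U m = g.appₗ U m) :
    f = g := by
  ext U m
  exact h U m

/-- A morphism of modules from its action on sections. -/
def homOfAppₗ {M N : X.Modules} (f : ∀ U, Γ(M, U) →ₗ[Γ(X, U)] Γ(N, U))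
    (hf : ∀ {U V : X.Opens} (h : V ≤ U) (m : Γ(M, U)), f V (M.res h m) = N.res h (f U m)) :
    M ⟶ N where
  val := PresheafOfModules.homMk
    { app U := AddCommGrpCat.ofHom (f (unop U)).toAddMonoidHom
      naturality U V i := by
        ext m
        exact hf (leOfHom i.unop) m }
    (fun U r m ↦ (f (unop U)).map_smul r m)

lemma isIso_of_bijective {M N : X.Modules} (f : M ⟶ N)
    (h : ∀ U, Function.Bijective (f.appₗ U)) : IsIso f := by
  rw [Hom.isIso_iff_isIso_app]
  exact fun U ↦ (ConcreteCategory.isIso_iff_bijective (f.app U)).2 (h U)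

lemma bijective_of_isIso {M N : X.Modules} (f : M ⟶ N) [IsIso f] (U : X.Opens) :
    Function.Bijective (f.appₗ U) :=
  (ConcreteCategory.isIso_iff_bijective (f.app U)).1 inferInstance

lemma injective_of_locally {M N : X.Modules} (f : M ⟶ N)
    (h : ∀ (U : X.Opens), ∀ x ∈ U, ∃ V ≤ U, x ∈ V ∧ Function.Injective (f.appₗ V)) (U : X.Opens) :
    Function.Injective (f.appₗ U) := by
  intro s t hst
  refine M.eq_of_res_eq fun x hx ↦ ?_
  obtain ⟨V, hV, hxV, h⟩ := h U x hx
  exact ⟨V, hV, hxV, h ((f.appₗ_res hV s).trans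
    ((congrArg (N.res hV) hst).trans (f.appₗ_res hV t).symm))⟩

/-- Injectivity makes local preimages unique, so they agree on overlaps and glue. -/
lemma surjective_of_locally {M N : X.Modules} (f : M ⟶ N)
    (hf : ∀ (U : X.Opens), Function.Injective (f.appₗ U)) (h : LocallySurjective f)
    (U : X.Opens) : Function.Surjective (f.appₗ U) := by
  intro s
  choose V hV hxV t ht using fun x : U ↦ h U s x.1 x.2
  obtain ⟨m, hm⟩ := M.exists_glue V hV (fun x hx ↦ Opens.mem_iSup.2 ⟨⟨x, hx⟩, hxV _⟩) t
    fun i j ↦ hf _ (by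
      refine (f.appₗ_res _ _).trans (Eq.trans ?_ (f.appₗ_res _ _).symm)
      refine (congrArg (N.res _) (ht i)).trans (Eq.trans ?_ (congrArg (N.res _) (ht j)).symm)
      exact (N.res_res (hV i) _ s).trans (N.res_res (hV j) _ s).symm)
  refine ⟨m, N.eq_of_res_eq fun x hx ↦ ⟨V ⟨x, hx⟩, hV _, hxV _, ?_⟩⟩
  exact (f.appₗ_res _ _).symm.trans ((congrArg _ (hm _)).trans (ht _))

lemma locallySurjective_of_locally {M N : X.Modules} (f : M ⟶ N)
    (h : ∀ (U : X.Opens), ∀ x ∈ U, ∃ V ≤ U, x ∈ V ∧ Function.Surjective (f.appₗ V)) :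
    LocallySurjective f := by
  intro U s x hx
  obtain ⟨V, hV, hxV, h⟩ := h U x hx
  obtain ⟨t, ht⟩ := h (N.res hV s)
  exact ⟨V, hV, hxV, t, ht⟩

lemma isIso_of_locally {M N : X.Modules} (f : M ⟶ N)
    (h : ∀ (U : X.Opens), ∀ x ∈ U, ∃ V ≤ U, x ∈ V ∧ Function.Bijective (f.appₗ V)) : IsIso f := by
  have h1 : ∀ U, Function.Injective (f.appₗ U) := injective_of_locally f fun U x hx ↦ by
    obtain ⟨V, hV, hxV, h⟩ := h U x hx
    exact ⟨V, hV, hxV, h.1⟩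
  exact isIso_of_bijective f fun U ↦ ⟨h1 U, surjective_of_locally f h1
    (locallySurjective_of_locally f fun U x hx ↦ by
      obtain ⟨V, hV, hxV, h⟩ := h U x hx
      exact ⟨V, hV, hxV, h.2⟩) U⟩

lemma mono_of_injective {M N : X.Modules} (f : M ⟶ N)
    (h : ∀ U, Function.Injective (f.appₗ U)) : Mono f where
  right_cancellation _ _ hab := hom_extₗ fun U m ↦ h U
    (congrArg (fun c : _ ⟶ N ↦ c.appₗ U m) hab)

/-- Sections over `U` are morphisms from `freeOpen U`, where a monomorphism can be cancelled. -/
lemma injective_of_mono {M N : X.Modules} (f : M ⟶ N) [Mono f] (U : X.Opens) :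
    Function.Injective (f.appₗ U) := by
  intro s t hst
  refine freeOpenEquiv.symm.injective ((cancel_mono f).1 (freeOpenEquiv.injective ?_))
  rw [freeOpenEquiv_comp, freeOpenEquiv_comp, Equiv.apply_symm_apply, Equiv.apply_symm_apply]
  exact hst

/-- The kernel of a morphism on sections. -/
lemma exists_of_exact {M N K : X.Modules} (f : M ⟶ N) (g : N ⟶ K) (w : f ≫ g = 0)
    (h : (ShortComplex.mk f g w).Exact) [Mono f] (U : X.Opens) (n : Γ(N, U))
    (hn : g.appₗ U n = 0) : ∃ m, f.appₗ U m = n := by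
  have hl : freeOpenEquiv.symm n ≫ g = 0 := freeOpenEquiv.injective (by
    rw [freeOpenEquiv_comp, Equiv.apply_symm_apply]
    refine Eq.trans hn ?_
    rw [← comp_zero (f := freeOpenEquiv.symm n), freeOpenEquiv_comp]
    rfl)
  refine ⟨freeOpenEquiv (h.lift (freeOpenEquiv.symm n) hl), ?_⟩
  refine (freeOpenEquiv_comp _ f).symm.trans ?_
  exact (congrArg freeOpenEquiv (h.lift_f _ hl)).trans (Equiv.apply_symm_apply _ _)

lemma exact_of_locally {M N K : X.Modules} (f : M ⟶ N) (g : N ⟶ K) (w : f ≫ g = 0)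
    (h : ∀ (U : X.Opens) (n : Γ(N, U)), g.appₗ U n = 0 → ∀ x ∈ U, ∃ (V : X.Opens) (hV : V ≤ U),
      x ∈ V ∧ ∃ m, f.appₗ V m = N.res hV n) : (ShortComplex.mk f g w).Exact := by
  rw [ShortComplex.exact_iff_epi_kernel_lift]
  refine LocallySurjective.epi fun U s x hx ↦ ?_
  obtain ⟨V, hV, hxV, m, hm⟩ := h U (Hom.appₗ (kernel.ι g) U s) (by
    rw [← Hom.comp_appₗ, kernel.condition, Hom.zero_appₗ]) x hx
  refine ⟨V, hV, hxV, m, injective_of_mono (kernel.ι g) V ?_⟩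
  refine Eq.trans ?_ ((hm).trans ((kernel.ι g).appₗ_res hV s).symm)
  exact congrArg (fun c : M ⟶ N ↦ c.appₗ V m) (kernel.lift_ι g f w)

/-! ### The sheaf of alternating forms. -/

section Alternating

variable (M T : X.Modules) (q : ℕ)

/-- The sections over `U` of the sheaf of alternating forms: families of alternating forms
`M(V)^q → T(V)` for `V ⊆ U`, compatible with restriction. -/
def altSections (U : X.Opens) :
    AddSubgroup (∀ V : Set.Iic U, Γ(M, V.1) [⋀^Fin q]→ₗ[Γ(X, V.1)] Γ(T, V.1)) where
  carrier := {φ | ∀ (V W : Set.Iic U) (h : W ≤ V) (m : Fin q → Γ(M, V.1)),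
    φ W (M.res h ∘ m) = T.res h (φ V m)}
  zero_mem' V W h m := (map_zero (T.res h)).symm
  add_mem' {a b} ha hb V W h m :=
    (congrArg₂ (· + ·) (ha V W h m) (hb V W h m)).trans (map_add (T.res h) _ _).symm
  neg_mem' {a} ha V W h m := (congrArg Neg.neg (ha V W h m)).trans (map_neg (T.res h) _).symm

variable {M T q}

lemma altSections_ext {U : X.Opens} {φ ψ : altSections M T q U}
    (h : ∀ (V : Set.Iic U) (m : Fin q → Γ(M, V.1)), φ.1 V m = ψ.1 V m) : φ = ψ :=
  Subtype.ext (funext fun V ↦ AlternatingMap.ext (h V))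

instance (U : X.Opens) : SMul Γ(X, U) (altSections M T q U) where
  smul r φ := ⟨fun V ↦ resₒ V.2 r • φ.1 V, fun V W h m ↦ by
    refine (congrArg (resₒ W.2 r • ·) (φ.2 V W h m)).trans
      (Eq.trans ?_ ((T.res h).map_smulₛₗ (resₒ V.2 r) (φ.1 V m)).symm)
    exact congrArg (· • T.res h (φ.1 V m)) (resₒ_resₒ V.2 h r).symm⟩

lemma altSections_smul_apply {U : X.Opens} (r : Γ(X, U)) (φ : altSections M T q U)
    (V : Set.Iic U) (m : Fin q → Γ(M, V.1)) : (r • φ).1 V m = resₒ V.2 r • φ.1 V m := rfl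

instance (U : X.Opens) : Module Γ(X, U) (altSections M T q U) where
  one_smul φ := altSections_ext fun V m ↦ by
    rw [altSections_smul_apply, map_one, one_smul]
  mul_smul r s φ := altSections_ext fun V m ↦ by
    rw [altSections_smul_apply, map_mul, mul_smul, altSections_smul_apply, altSections_smul_apply]
  smul_zero r := altSections_ext fun V m ↦ smul_zero _
  smul_add r φ ψ := altSections_ext fun V m ↦ smul_add _ _ _
  add_smul r s φ := altSections_ext fun V m ↦ by
    rw [altSections_smul_apply, map_add, add_smul]
    rfl
  zero_smul φ := altSections_ext fun V m ↦ by
    rw [altSections_smul_apply, map_zero, zero_smul]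
    rfl

/-- Restriction of families of alternating forms. -/
def altRes {U V : X.Opens} (h : V ≤ U) : altSections M T q U →+ altSections M T q V where
  toFun φ := ⟨fun W ↦ φ.1 ⟨W.1, W.2.trans h⟩,
    fun W W' h' m ↦ φ.2 ⟨W.1, W.2.trans h⟩ ⟨W'.1, W'.2.trans h⟩ h' m⟩
  map_zero' := rfl
  map_add' _ _ := rfl

variable (M T q) in
/-- The presheaf of alternating forms. -/
def altPresheaf : X.PresheafOfModules :=
  letI (U : X.Opensᵒᵖ) : Module (X.ringCatSheaf.obj.obj U)
      (AddCommGrpCat.of (altSections M T q (unop U))) :=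
    inferInstanceAs (Module Γ(X, unop U) (altSections M T q (unop U)))
  PresheafOfModules.ofPresheaf
    { obj U := AddCommGrpCat.of (altSections M T q (unop U))
      map {U V} i := AddCommGrpCat.ofHom (altRes (leOfHom i.unop))
      map_id U := rfl
      map_comp _ _ := rfl }
    (fun U V i r φ ↦ altSections_ext fun W m ↦
      congrArg (· • φ.1 ⟨W.1, W.2.trans (leOfHom i.unop)⟩ m)
        (map_map_eq (leOfHom i.unop) W.2 r).symm)

/-- An open subset of `U`, as an element of the interval below `U`. -/
abbrev iic {U V : X.Opens} (h : V ≤ U) : Set.Iic U := ⟨V, h⟩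

lemma altSections_comp_res {U V W : X.Opens} (φ : altSections M T q U) (hV : V ≤ U) (h : W ≤ V)
    (m : Fin q → Γ(M, V)) :
    φ.1 (iic (h.trans hV)) (M.res h ∘ m) = T.res h (φ.1 (iic hV) m) :=
  φ.2 (iic hV) (iic (h.trans hV)) h m

/-- The value of the glued form on sections over `V` is glued from the values over `V ⊓ U i`.
Multilinearity and compatibility with restriction follow from uniqueness of gluing. -/
lemma exists_glue_altSections {ι : Type u} (U : ι → X.Opens)
    (s : ∀ i, altSections M T q (U i))
    (hs : ∀ i j, altRes (inf_le_left : U i ⊓ U j ≤ U i) (s i) =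
      altRes (inf_le_right : U i ⊓ U j ≤ U j) (s j)) :
    ∃ t : altSections M T q (iSup U), ∀ i, altRes (le_iSup U i) t = s i := by
  have hc (V : X.Opens) (hV : V ≤ iSup U) : V ≤ ⨆ i, V ⊓ U i := by
    rw [← inf_iSup_eq]; exact le_inf le_rfl hV
  have key (V : Set.Iic (iSup U)) (m : Fin q → Γ(M, V.1)) : ∃ t : Γ(T, V.1), ∀ i,
      T.res (inf_le_left : V.1 ⊓ U i ≤ V.1) t =
        (s i).1 (iic (inf_le_right : V.1 ⊓ U i ≤ U i)) (M.res inf_le_left ∘ m) := by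
    refine T.exists_glue _ (fun i ↦ inf_le_left) (hc V.1 V.2)
      (fun i ↦ (s i).1 (iic (inf_le_right : V.1 ⊓ U i ≤ U i)) (M.res inf_le_left ∘ m)) fun i j ↦ ?_
    have h1 := altSections_comp_res (s i) (inf_le_right : V.1 ⊓ U i ≤ U i)
      (inf_le_left : (V.1 ⊓ U i) ⊓ (V.1 ⊓ U j) ≤ _) (M.res inf_le_left ∘ m)
    have h2 := altSections_comp_res (s j) (inf_le_right : V.1 ⊓ U j ≤ U j)
      (inf_le_right : (V.1 ⊓ U i) ⊓ (V.1 ⊓ U j) ≤ _) (M.res inf_le_left ∘ m)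
    refine h1.symm.trans (Eq.trans ?_ h2)
    rw [res_comp_res, res_comp_res]
    have h3 := congrArg (fun φ : altSections M T q (U i ⊓ U j) ↦
      φ.1 (iic (le_inf (inf_le_left.trans inf_le_right)
        (inf_le_right.trans inf_le_right) : (V.1 ⊓ U i) ⊓ (V.1 ⊓ U j) ≤ U i ⊓ U j)) (M.res (inf_le_left.trans inf_le_left) ∘ m)) (hs i j)
    exact h3
  choose t ht using key
  have huniq (V : Set.Iic (iSup U)) {a b : Γ(T, V.1)}
      (h : ∀ i, T.res (inf_le_left : V.1 ⊓ U i ≤ V.1) a = T.res inf_le_left b) : a = b :=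
    T.eq_of_cover _ (fun i ↦ inf_le_left) (hc V.1 V.2) h
  let φ : ∀ V : Set.Iic (iSup U), Γ(M, V.1) [⋀^Fin q]→ₗ[Γ(X, V.1)] Γ(T, V.1) := fun V ↦
    { toFun := t V
      map_update_add' := fun m k x y ↦ huniq V fun i ↦ by
        rw [map_add, ht, ht, ht, Function.comp_update, Function.comp_update,
          Function.comp_update, map_add]
        convert! AlternatingMap.map_update_add _ _ _ _ _
      map_update_smul' := fun m k c x ↦ huniq V fun i ↦ by
        rw [(T.res _).map_smulₛₗ, ht, ht, Function.comp_update, Function.comp_update,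
          (M.res _).map_smulₛₗ]
        convert! AlternatingMap.map_update_smul _ _ _ _ _
      map_eq_zero_of_eq' := fun m k l h hkl ↦ huniq V fun i ↦ by
        rw [map_zero, ht]
        exact AlternatingMap.map_eq_zero_of_eq _ _ (congrArg (M.res _) h) hkl }
  refine ⟨⟨φ, fun V W h m ↦ huniq W fun i ↦ ?_⟩, fun i ↦ altSections_ext fun V m ↦ ?_⟩
  · refine (ht W _ i).trans ?_
    rw [res_comp_res]
    refine Eq.trans ?_ (T.res_res h inf_le_left _).symm
    have h1 := altSections_comp_res (s i) (inf_le_right : V.1 ⊓ U i ≤ U i)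
      (inf_le_inf_right (U i) h : W.1 ⊓ U i ≤ V.1 ⊓ U i) (M.res inf_le_left ∘ m)
    rw [res_comp_res] at h1
    refine h1.trans ((congrArg (T.res (inf_le_inf_right _ h)) (ht V m i).symm).trans ?_)
    exact T.res_res _ _ _
  · have hle : V.1 ≤ V.1 ⊓ U i := le_inf le_rfl V.2
    have h1 := ht ⟨V.1, V.2.trans (le_iSup U i)⟩ m i
    have h2 := altSections_comp_res (s i) inf_le_right hle (M.res inf_le_left ∘ m)
    rw [← h1] at h2
    refine Eq.trans ?_ (h2.symm.trans (congrArg ((s i).1 V) (funext fun k ↦ ?_)))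
    · exact ((T.res_res _ _ _).trans (T.res_self _ _)).symm
    · exact (M.res_res _ _ _).trans (M.res_self _ _)

variable (M T q) in
/-- The sheaf of alternating `q`-forms on `M` with values in `T`. -/
def altSheaf : X.Modules where
  val := altPresheaf M T q
  isSheaf := by
    change TopCat.Presheaf.IsSheaf (X := X.carrier) _
    rw [TopCat.Presheaf.isSheaf_iff_isSheafUniqueGluing]
    intro ι U s hs
    obtain ⟨t, ht⟩ := exists_glue_altSections (M := M) (T := T) (q := q) U s fun i j ↦ hs i j
    refine ⟨t, ht, fun t' ht' ↦ ?_⟩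
    refine altSections_ext fun V m ↦ ?_
    refine T.eq_of_cover (fun i ↦ V.1 ⊓ U i) (fun i ↦ inf_le_left)
      (by rw [← inf_iSup_eq]; exact le_inf le_rfl V.2) fun i ↦ ?_
    have key (a : altSections M T q (iSup U)) (ha : altRes (le_iSup U i) a = s i) :
        T.res inf_le_left (a.1 V m) = (s i).1 (iic (inf_le_right : V.1 ⊓ U i ≤ U i)) (M.res inf_le_left ∘ m) := by
      rw [← ha]
      exact (altSections_comp_res a V.2 inf_le_left m).symm
    exact (key t' (ht' i)).trans (key t (ht i)).symm

/-- The value on an open subset of a section of the sheaf of alternating forms. -/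
def altEval {U V : X.Opens} (h : V ≤ U) (φ : Γ(altSheaf M T q, U)) :
    Γ(M, V) [⋀^Fin q]→ₗ[Γ(X, V)] Γ(T, V) :=
  (show altSections M T q U from φ).1 ⟨V, h⟩

/-- Construct a section of the sheaf of alternating forms. -/
def altMk {U : X.Opens} (φ : ∀ V, V ≤ U → Γ(M, V) [⋀^Fin q]→ₗ[Γ(X, V)] Γ(T, V))
    (hφ : ∀ (V W : X.Opens) (hV : V ≤ U) (h : W ≤ V) (m : Fin q → Γ(M, V)),
      φ W (h.trans hV) (M.res h ∘ m) = T.res h (φ V hV m)) : Γ(altSheaf M T q, U) :=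
  show altSections M T q U from ⟨fun V ↦ φ V.1 V.2, fun V W h m ↦ hφ V.1 W.1 V.2 h m⟩

@[simp]
lemma altEval_altMk {U V : X.Opens} (h : V ≤ U)
    (φ : ∀ V, V ≤ U → Γ(M, V) [⋀^Fin q]→ₗ[Γ(X, V)] Γ(T, V)) (hφ) :
    altEval h (altMk φ hφ) = φ V h := rfl

lemma altEval_comp_res {U V W : X.Opens} (h : V ≤ U) (h' : W ≤ V) (φ : Γ(altSheaf M T q, U))
    (m : Fin q → Γ(M, V)) :
    altEval (h'.trans h) φ (M.res h' ∘ m) = T.res h' (altEval h φ m) :=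
  (show altSections M T q U from φ).2 ⟨V, h⟩ ⟨W, h'.trans h⟩ h' m

lemma altEval_res {U V W : X.Opens} (h : V ≤ U) (h' : W ≤ V) (φ : Γ(altSheaf M T q, U)) :
    altEval h' ((altSheaf M T q).res h φ) = altEval (h'.trans h) φ := rfl

lemma altEval_add {U V : X.Opens} (h : V ≤ U) (φ ψ : Γ(altSheaf M T q, U)) :
    altEval h (φ + ψ) = altEval h φ + altEval h ψ := rfl

lemma altEval_smul {U V : X.Opens} (h : V ≤ U) (r : Γ(X, U)) (φ : Γ(altSheaf M T q, U)) :
    altEval h (r • φ) = resₒ h r • altEval h φ := rfl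

lemma altSheaf_ext {U : X.Opens} {φ ψ : Γ(altSheaf M T q, U)}
    (h : ∀ (V : X.Opens) (hV : V ≤ U) (m : Fin q → Γ(M, V)),
      altEval hV φ m = altEval hV ψ m) : φ = ψ :=
  altSections_ext (φ := φ) (ψ := ψ) fun V m ↦ h V.1 V.2 m

/-- Evaluation at the open set itself, as a linear map. -/
def altEvalₗ (U : X.Opens) :
    Γ(altSheaf M T q, U) →ₗ[Γ(X, U)] (Γ(M, U) [⋀^Fin q]→ₗ[Γ(X, U)] Γ(T, U)) where
  toFun φ := altEval le_rfl φ
  map_add' _ _ := rfl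
  map_smul' r φ := AlternatingMap.ext fun m ↦ by
    rw [altEval_smul, resₒ_self]
    rfl

/-- Functoriality of the sheaf of alternating forms in the values. -/
def altMap (M : X.Modules) (q : ℕ) {T T' : X.Modules} (f : T ⟶ T') :
    altSheaf M T q ⟶ altSheaf M T' q :=
  homOfAppₗ (fun U ↦
    { toFun φ := altMk (fun V hV ↦ (f.appₗ V).compAlternatingMap (altEval hV φ))
        fun V W hV h m ↦ by
          refine (congrArg (f.appₗ W) (altEval_comp_res hV h φ m)).trans (f.appₗ_res h _)
      map_add' φ ψ := altSheaf_ext fun V hV m ↦ map_add (f.appₗ V) _ _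
      map_smul' r φ := altSheaf_ext fun V hV m ↦ _root_.map_smul (f.appₗ V) _ _ })
    fun _ _ ↦ rfl

lemma altEval_altMap {T T' : X.Modules} (f : T ⟶ T') {U V : X.Opens} (h : V ≤ U)
    (φ : Γ(altSheaf M T q, U)) (m : Fin q → Γ(M, V)) :
    altEval h ((altMap M q f).appₗ U φ) m = f.appₗ V (altEval h φ m) := rfl

end Alternating

end AlgebraicGeometry.Scheme.Modules

/-! ### Frames and their universal property. -/

namespace AlgebraicGeometry.Scheme.Modules

variable {X : Scheme.{u}}

/-- The sections `b` of `M` over `U` form a basis of `M` over every open subset of `U`. -/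
def IsFrame (M : X.Modules) (U : X.Opens) {ι : Type*} (b : ι → Γ(M, U)) : Prop :=
  ∀ (W : X.Opens) (h : W ≤ U), LinearIndependent Γ(X, W) (M.res h ∘ b) ∧
    ⊤ ≤ Submodule.span Γ(X, W) (Set.range (M.res h ∘ b))

/-- Functions are sections of the structure sheaf. -/
def sec (U : X.Opens) : Γ(X, U) ≃ₗ[Γ(X, U)] Γ(structureSheaf X, U) where
  toFun r := r
  invFun r := r
  map_add' _ _ := rfl
  map_smul' _ _ := rfl

lemma res_sec {U V : X.Opens} (h : V ≤ U) (r : Γ(X, U)) :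
    (structureSheaf X).res h (sec U r) = sec V (resₒ h r) := rfl

lemma res_sec_one {U V : X.Opens} (h : V ≤ U) :
    (structureSheaf X).res h (sec U 1) = sec V 1 :=
  (res_sec h 1).trans (congrArg (sec V) (map_one (resₒ h)))

lemma sec_eq_smul {U : X.Opens} (r : Γ(X, U)) : sec U r = r • sec U 1 := by
  rw [← LinearEquiv.map_smul, smul_eq_mul, mul_one]

/-- Alternating maps with values in isomorphic modules. -/
def altCongr {R M T T' : Type*} [CommRing R] [AddCommGroup M] [Module R M] [AddCommGroup T]
    [Module R T] [AddCommGroup T'] [Module R T'] (e : T ≃ₗ[R] T') {q : ℕ} :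
    (M [⋀^Fin q]→ₗ[R] T) ≃ₗ[R] (M [⋀^Fin q]→ₗ[R] T') where
  toFun f := e.toLinearMap.compAlternatingMap f
  invFun f := e.symm.toLinearMap.compAlternatingMap f
  map_add' f g := AlternatingMap.ext fun m ↦ map_add e _ _
  map_smul' r f := AlternatingMap.ext fun m ↦ _root_.map_smul e _ _
  left_inv f := AlternatingMap.ext fun m ↦ e.symm_apply_apply _
  right_inv f := AlternatingMap.ext fun m ↦ e.apply_symm_apply _

namespace IsFrame

variable {M T : X.Modules} {U : X.Opens} {ι : Type*} {b : ι → Γ(M, U)}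

/-- The basis of sections over an open subset given by a frame. -/
def basis (hb : IsFrame M U b) {W : X.Opens} (h : W ≤ U) : Module.Basis ι Γ(X, W) Γ(M, W) :=
  .mk (hb W h).1 (hb W h).2

@[simp]
lemma basis_apply (hb : IsFrame M U b) {W : X.Opens} (h : W ≤ U) (i : ι) :
    hb.basis h i = M.res h (b i) := Module.Basis.mk_apply _ _ _

lemma of_basis (B : ∀ (W : X.Opens), W ≤ U → Module.Basis ι Γ(X, W) Γ(M, W))
    (hB : ∀ W h i, B W h i = M.res h (b i)) : IsFrame M U b := fun W h ↦ by
  have : M.res h ∘ b = B W h := funext fun i ↦ (hB W h i).symm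
  rw [this]
  exact ⟨(B W h).linearIndependent, (B W h).span_eq.ge⟩

lemma res (hb : IsFrame M U b) {V : X.Opens} (h : V ≤ U) : IsFrame M V (M.res h ∘ b) :=
  fun W h' ↦ by
    rw [res_comp_res]
    exact hb W (h'.trans h)

lemma map {N : X.Modules} (hb : IsFrame M U b) (f : M ⟶ N)
    (hf : ∀ W ≤ U, Function.Bijective (f.appₗ W)) : IsFrame N U fun i ↦ f.appₗ U (b i) :=
  of_basis (fun W h ↦ (hb.basis h).map (.ofBijective _ (hf W h))) fun W h i ↦ by
    rw [Module.Basis.map_apply, basis_apply, ← Hom.appₗ_res]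
    rfl

lemma altEval_injective (hb : IsFrame M U b) {q : ℕ} :
    Function.Injective (altEvalₗ (M := M) (T := T) (q := q) U) := by
  intro φ ψ h
  refine altSheaf_ext fun V hV m ↦ ?_
  refine DFunLike.congr_fun (AlternatingMap.ext_of_basis (hb.basis le_rfl) (M.res hV)
    (hb.basis hV) (fun i ↦ ?_) fun x ↦ ?_) m
  · rw [basis_apply, basis_apply, res_res]
  · refine (altEval_comp_res le_rfl hV φ x).trans
      (Eq.trans ?_ (altEval_comp_res le_rfl hV ψ x).symm)
    exact congrArg (T.res hV) (DFunLike.congr_fun h x)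

/-- A form over `U` extends to each smaller open set by base change of free modules, a frame
restricting to a frame. -/
lemma altEval_surjective (hb : IsFrame M U b) {q : ℕ} :
    Function.Surjective (altEvalₗ (M := M) (T := T) (q := q) U) := by
  intro f
  choose g hg using fun (W : X.Opens) (h : W ≤ U) ↦
    AlternatingMap.exists_baseChange (hb.basis le_rfl) q (M.res h) (hb.basis h)
      (fun i ↦ by rw [basis_apply, basis_apply, res_res]) (T.res h) f
  refine ⟨altMk g fun V W hV h m ↦ ?_, AlternatingMap.ext fun m ↦ ?_⟩
  -- Restriction commutes with the extended forms: both sides are alternating over the functions on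
  -- `V`, so comparison on sections restricted from `U` is enough.
  · let _ : Module Γ(X, V) Γ(T, W) := Module.compHom _ (resₒ h)
    let f₁ : Γ(M, V) [⋀^Fin q]→ₗ[Γ(X, V)] Γ(T, W) :=
      { toFun m := g W (h.trans hV) (M.res h ∘ m)
        map_update_add' m i x y := by
          simp only [Function.comp_update, map_add]
          exact (g W (h.trans hV)).map_update_add (M.res h ∘ m) i _ _
        map_update_smul' m i c x := by
          simp only [Function.comp_update, map_smulₛₗ]
          exact (g W (h.trans hV)).map_update_smul (M.res h ∘ m) i _ _
        map_eq_zero_of_eq' m i j h' hij :=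
          (g W (h.trans hV)).map_eq_zero_of_eq (M.res h ∘ m) (congrArg (M.res h) h') hij }
    let f₂ : Γ(M, V) [⋀^Fin q]→ₗ[Γ(X, V)] Γ(T, W) :=
      { toFun m := T.res h (g V hV m)
        map_update_add' m i x y := by
          rw [(g V hV).map_update_add, map_add]
        map_update_smul' m i c x := by
          rw [(g V hV).map_update_smul]
          exact (T.res h).map_smulₛₗ c _
        map_eq_zero_of_eq' m i j h' hij := by
          rw [(g V hV).map_eq_zero_of_eq m h' hij, map_zero] }
    refine DFunLike.congr_fun (AlternatingMap.ext_of_basis (f := f₁) (g := f₂) (hb.basis le_rfl)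
      (M.res hV) (hb.basis hV) (fun i ↦ ?_) fun x ↦ ?_) m
    · rw [basis_apply, basis_apply, res_res]
    · change g W _ (M.res h ∘ M.res hV ∘ x) = T.res h (g V hV (M.res hV ∘ x))
      rw [hg, res_comp_res, hg, res_res]
  · have h1 := hg U le_rfl m
    refine Eq.trans ?_ (h1.trans (T.res_self _ _))
    exact congrArg (g U le_rfl) (funext fun i ↦ (M.res_self _ _).symm)

variable {q : ℕ}

/-- Alternating forms on a framed module over `U` are alternating forms on the module of sections
over `U`. -/
def altEquiv (hb : IsFrame M U b) : Γ(altSheaf M T q, U) ≃ₗ[Γ(X, U)]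
    (Γ(M, U) [⋀^Fin q]→ₗ[Γ(X, U)] Γ(T, U)) :=
  .ofBijective (altEvalₗ U) ⟨hb.altEval_injective, hb.altEval_surjective⟩

@[simp]
lemma altEquiv_apply (hb : IsFrame M U b) (φ : Γ(altSheaf M T q, U)) :
    hb.altEquiv φ = altEval le_rfl φ := rfl

lemma altEval_altEquiv_symm (hb : IsFrame M U b) (f : Γ(M, U) [⋀^Fin q]→ₗ[Γ(X, U)] Γ(T, U)) :
    altEval le_rfl (hb.altEquiv.symm f) = f := hb.altEquiv.apply_symm_apply f

variable [Finite ι] [LinearOrder ι]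

/-- The frame of alternating forms that is dual to a frame. -/
def altFrame (hb : IsFrame M U b) (q : ℕ) (s : Set.powersetCard ι q) :
    Γ(altSheaf M (structureSheaf X) q, U) :=
  hb.altEquiv.symm
    ((sec U).toLinearMap.compAlternatingMap (AlternatingMap.basis (hb.basis le_rfl) q s))

lemma altEval_altFrame (hb : IsFrame M U b) {V : X.Opens} (hV : V ≤ U)
    (s : Set.powersetCard ι q) :
    altEval hV (hb.altFrame q s) =
      (sec V).toLinearMap.compAlternatingMap (AlternatingMap.basis (hb.basis hV) q s) := by
  refine AlternatingMap.ext_powersetCard (hb.basis hV) fun t ↦ ?_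
  have h1 : (fun i ↦ hb.basis hV (Set.powersetCard.ofFinEmbEquiv.symm t i)) =
      M.res hV ∘ fun i ↦ hb.basis le_rfl (Set.powersetCard.ofFinEmbEquiv.symm t i) := by
    funext i
    rw [Function.comp_apply, basis_apply, basis_apply, res_res]
  rw [LinearMap.compAlternatingMap_apply, AlternatingMap.basis_apply, h1]
  refine (altEval_comp_res le_rfl hV _ _).trans ?_
  rw [altFrame, altEval_altEquiv_symm, LinearMap.compAlternatingMap_apply,
    AlternatingMap.basis_apply]
  refine (res_sec hV _).trans (congrArg (sec V) ?_)
  split_ifs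
  · exact map_one (resₒ hV)
  · exact map_zero (resₒ hV)

lemma alt (hb : IsFrame M U b) (q : ℕ) :
    IsFrame (altSheaf M (structureSheaf X) q) U (hb.altFrame q) :=
  of_basis (fun W h ↦ (AlternatingMap.basis (hb.basis h) q).map
    (altCongr (sec W) ≪≫ₗ ((hb.res h).altEquiv (T := structureSheaf X)).symm)) fun W h s ↦ by
    rw [Module.Basis.map_apply, LinearEquiv.trans_apply, LinearEquiv.symm_apply_eq, altEquiv_apply,
      altEval_res, altEval_altFrame]
    rfl

end IsFrame

/-- Sections of `T` over `W` are the same as sections over `W ∩ U`. -/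
def SupportedOn (T : X.Modules) (U : X.Opens) : Prop :=
  ∀ W : X.Opens, Function.Bijective (T.res (inf_le_left : W ⊓ U ≤ W))

lemma SupportedOn.pushforward {Y : Scheme.{u}} (f : X ⟶ Y) {T : X.Modules} {U : Y.Opens}
    (hT : T.SupportedOn (f ⁻¹ᵁ U)) : ((Scheme.Modules.pushforward f).obj T).SupportedOn U :=
  fun W ↦ hT (f ⁻¹ᵁ W)

lemma supportedOn_pushforward (U : X.Opens) (M : U.toScheme.Modules) :
    ((Scheme.Modules.pushforward U.ι).obj M).SupportedOn U := fun W ↦ by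
  have h : U.ι ⁻¹ᵁ W ≤ U.ι ⁻¹ᵁ (W ⊓ U) := fun x hx ↦ ⟨hx, x.2⟩
  have h' : U.ι ⁻¹ᵁ (W ⊓ U) ≤ U.ι ⁻¹ᵁ W := fun x hx ↦ hx.1
  refine Function.bijective_iff_has_inverse.2 ⟨M.res h, fun x ↦ ?_, fun x ↦ ?_⟩
  · exact (M.res_res h' h x).trans (M.res_self _ x)
  · exact (M.res_res h h' x).trans (M.res_self _ x)

section Hom

variable {M T : X.Modules} {U : X.Opens} {ι : Type*} {b : ι → Γ(M, U)}

lemma IsFrame.hom_injective (hb : IsFrame M U b) (hT : T.SupportedOn U) {φ ψ : M ⟶ T}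
    (h : ∀ i, φ.appₗ U (b i) = ψ.appₗ U (b i)) : φ = ψ := by
  refine hom_extₗ fun W m ↦ (hT W).1 ?_
  rw [← Hom.appₗ_res, ← Hom.appₗ_res]
  have : φ.appₗ (W ⊓ U) = ψ.appₗ (W ⊓ U) := (hb.basis inf_le_right).ext fun i ↦ by
    rw [basis_apply, Hom.appₗ_res, Hom.appₗ_res, h]
  rw [this]

/-- Over `W ⊓ U` the map is prescribed on a basis. Since sections of `T` over `W` and over `W ⊓ U`
are the same, this defines it over all of `W`. -/
lemma IsFrame.hom_surjective (hb : IsFrame M U b) (hT : T.SupportedOn U) (t : ι → Γ(T, U)) :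
    ∃ φ : M ⟶ T, ∀ i, φ.appₗ U (b i) = t i := by
  let f (W : X.Opens) : Γ(M, W ⊓ U) →ₗ[Γ(X, W ⊓ U)] Γ(T, W ⊓ U) :=
    (hb.basis inf_le_right).constr ℕ fun i ↦ T.res inf_le_right (t i)
  have hf {W V : X.Opens} (h : V ≤ W) (m : Γ(M, W ⊓ U)) :
      f V (M.res (inf_le_inf_right U h) m) = T.res (inf_le_inf_right U h) (f W m) := by
    let _ : Module Γ(X, W ⊓ U) Γ(T, V ⊓ U) := Module.compHom _ (resₒ (inf_le_inf_right U h))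
    let f₁ : Γ(M, W ⊓ U) →ₗ[Γ(X, W ⊓ U)] Γ(T, V ⊓ U) :=
      { toFun m := f V (M.res (inf_le_inf_right U h) m)
        map_add' x y := by rw [map_add, map_add]
        map_smul' r x := by rw [map_smulₛₗ, _root_.map_smul]; rfl }
    let f₂ : Γ(M, W ⊓ U) →ₗ[Γ(X, W ⊓ U)] Γ(T, V ⊓ U) :=
      { toFun m := T.res (inf_le_inf_right U h) (f W m)
        map_add' x y := by rw [map_add, map_add]
        map_smul' r x := by rw [_root_.map_smul, map_smulₛₗ]; rfl }
    have : f₁ = f₂ := (hb.basis inf_le_right).ext fun i ↦ by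
      change f V (M.res _ (hb.basis inf_le_right i)) = T.res _ (f W (hb.basis inf_le_right i))
      rw [basis_apply, res_res, ← basis_apply hb, Module.Basis.constr_basis]
      change _ = T.res _ (f W (M.res _ _))
      rw [← basis_apply hb, Module.Basis.constr_basis, res_res]
    exact LinearMap.congr_fun this m
  choose g hg using fun (W : X.Opens) (x : Γ(M, W)) ↦ (hT W).2 (f W (M.res inf_le_left x))
  refine ⟨homOfAppₗ (fun W ↦
    { toFun := g W
      map_add' x y := (hT W).1 (by rw [map_add, hg, hg, hg, map_add, map_add])
      map_smul' r x := (hT W).1 (by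
        rw [RingHom.id_apply, map_smulₛₗ, hg, hg, map_smulₛₗ, _root_.map_smul]) }) ?_, ?_⟩
  · intro W V h m
    refine (hT V).1 ((hg V _).trans ?_)
    rw [res_res, res_res]
    refine Eq.trans ?_ ((hf h (M.res inf_le_left m)).trans ?_)
    · rw [res_res]
    · rw [← hg]
      exact T.res_res _ _ _
  · intro i
    refine (hT U).1 ((hg U _).trans ?_)
    have := hb.basis_apply (inf_le_left : U ⊓ U ≤ U) i
    rw [← this]
    exact (hb.basis inf_le_right).constr_basis ℕ _ i

/-- The module `W ↦ M(W ∩ U)`. -/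
def extend (M : X.Modules) (U : X.Opens) : X.Modules :=
  (Scheme.Modules.pushforward U.ι).obj (M.restrict U.ι)

lemma extend_supportedOn (M : X.Modules) (U : X.Opens) : (M.extend U).SupportedOn U :=
  supportedOn_pushforward U _

/-- The canonical map `M(W) → M(W ∩ U)`. -/
def toExtend (M : X.Modules) (U : X.Opens) : M ⟶ M.extend U := (restrictAdjunction U.ι).unit.app M

lemma toExtend_bijective (M : X.Modules) {U W : X.Opens} (h : W ≤ U) :
    Function.Bijective ((M.toExtend U).appₗ W) := by
  have h₁ : U.ι ''ᵁ (U.ι ⁻¹ᵁ W) ≤ W := U.ι.image_preimage_le W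
  have h₂ : W ≤ U.ι ''ᵁ (U.ι ⁻¹ᵁ W) := fun x hx ↦ ⟨⟨x, h hx⟩, hx, rfl⟩
  refine Function.bijective_iff_has_inverse.2 ⟨M.res h₂, fun x ↦ ?_, fun x ↦ ?_⟩
  · exact (M.res_res h₁ h₂ x).trans (M.res_self _ x)
  · exact (M.res_res h₂ h₁ (show Γ(M, U.ι ''ᵁ (U.ι ⁻¹ᵁ W)) from x)).trans (M.res_self _ _)

lemma isFrame_structureSheaf (U : X.Opens) :
    IsFrame (structureSheaf X) U fun _ : Unit ↦ sec U 1 :=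
  IsFrame.of_basis (fun W h ↦ (Module.Basis.singleton Unit Γ(X, W)).map (sec W)) fun W h i ↦ by
    rw [Module.Basis.map_apply, Module.Basis.singleton_apply, res_sec_one]

/-- Converse of the universal property of a frame. Testing on the structure sheaf, extended from
`U`, produces coordinate functions, and testing on `M`, extended from `U`, shows that the
coordinates recover every section. Frames can thus be transported along adjunctions. -/
lemma isFrame_of_hom [Finite ι] (b : ι → Γ(M, U))
    (hsurj : ∀ (T : X.Modules), T.SupportedOn U → ∀ t : ι → Γ(T, U),
      ∃ φ : M ⟶ T, ∀ i, φ.appₗ U (b i) = t i)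
    (hinj : ∀ (T : X.Modules), T.SupportedOn U → ∀ φ ψ : M ⟶ T,
      (∀ i, φ.appₗ U (b i) = ψ.appₗ U (b i)) → φ = ψ) : IsFrame M U b := by
  classical
  have := Fintype.ofFinite ι
  let e := (structureSheaf X).toExtend U
  have he {W : X.Opens} (h : W ≤ U) := toExtend_bijective (structureSheaf X) h
  have hO := (isFrame_structureSheaf U).map e fun W h ↦ he h
  let e' := M.toExtend U
  choose φ hφ using fun i ↦ hsurj _ (extend_supportedOn (structureSheaf X) U)
    (fun j ↦ (if i = j then (1 : Γ(X, U)) else 0) • e.appₗ U (sec U 1))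
  choose β hβ using fun i ↦ hO.hom_surjective (extend_supportedOn M U) fun _ ↦ e'.appₗ U (b i)
  -- The decomposition of the identity: `φ i` takes the coordinate `i`, and `β i` multiplies the
  -- section `b i` by it.
  have hψ : e' = ∑ i, φ i ≫ β i := hinj _ (extend_supportedOn M U) _ _ fun j ↦ by
    rw [Hom.sum_appₗ]
    simp only [Hom.comp_appₗ, hφ, _root_.map_smul, hβ _ ()]
    simp
  have hc (W : X.Opens) (h : W ≤ U) (i : ι) (m : Γ(M, W)) :
      ∃ c : Γ(X, W), (φ i).appₗ W m = c • e.appₗ W (sec W 1) := by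
    obtain ⟨x, hx⟩ := (he h).2 ((φ i).appₗ W m)
    obtain ⟨c, rfl⟩ := (sec W).surjective x
    exact ⟨c, by rw [← hx, sec_eq_smul, _root_.map_smul]⟩
  have hβ' (W : X.Opens) (h : W ≤ U) (i : ι) :
      (β i).appₗ W (e.appₗ W (sec W 1)) = e'.appₗ W (M.res h (b i)) := by
    have h1 : sec W 1 = (structureSheaf X).res h (sec U 1) := by rw [res_sec_one]
    rw [h1, Hom.appₗ_res, Hom.appₗ_res, hβ _ (), Hom.appₗ_res]
  intro W h
  refine ⟨?_, fun m _ ↦ ?_⟩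
  · rw [Fintype.linearIndependent_iff]
    intro a ha i
    have h1 := congrArg ((φ i).appₗ W) ha
    have h2 (j : ι) : (φ i).appₗ W (M.res h (b j)) =
        (if i = j then (1 : Γ(X, W)) else 0) • e.appₗ W (sec W 1) := by
      rw [Hom.appₗ_res, hφ, map_smulₛₗ, ← Hom.appₗ_res, res_sec_one]
      split_ifs <;> simp
    have h3 : a i • e.appₗ W (sec W 1) = 0 := by
      rw [map_zero, map_sum] at h1
      rw [← h1, Finset.sum_eq_single i]
      · rw [_root_.map_smul, Function.comp_apply, h2, if_pos rfl, one_smul]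
      · intro j _ hj
        rw [_root_.map_smul, Function.comp_apply, h2, if_neg hj.symm, zero_smul, smul_zero]
      · simp
    rw [← _root_.map_smul, ← map_zero (e.appₗ W), (he h).1.eq_iff, ← sec_eq_smul,
      LinearEquiv.map_eq_zero_iff] at h3
    exact h3
  · choose c hc using fun i ↦ hc W h i m
    have : m = ∑ i, c i • M.res h (b i) := by
      refine (toExtend_bijective M h).1 ?_
      change e'.appₗ W m = _
      conv_lhs => rw [hψ]
      rw [Hom.sum_appₗ, map_sum]
      refine Finset.sum_congr rfl fun i _ ↦ ?_
      rw [Hom.comp_appₗ, hc, _root_.map_smul, hβ' W h, _root_.map_smul]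
    rw [this]
    exact Submodule.sum_mem _ fun i _ ↦ Submodule.smul_mem _ _ (Submodule.subset_span ⟨i, rfl⟩)

/-- Maps from the pull-back to `T` are maps from `M` to the direct image of `T`, which is supported
on `U` when `T` is supported on its preimage. So the universal property is inherited, with no
formula for the pull-back. -/
lemma isFrame_pullback {Y : Scheme.{u}} (f : X ⟶ Y) [Finite ι] {M : Y.Modules} {U : Y.Opens}
    {b : ι → Γ(M, U)} (hb : IsFrame M U b) :
    IsFrame ((Scheme.Modules.pullback f).obj M) (f ⁻¹ᵁ U)
      fun i ↦ ((pullbackPushforwardAdjunction f).unit.app M).appₗ U (b i) := by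
  let adj := pullbackPushforwardAdjunction f
  refine isFrame_of_hom _ (fun T hT t ↦ ?_) fun T hT φ ψ h ↦ ?_
  · obtain ⟨φ, hφ⟩ := hb.hom_surjective (hT.pushforward f) t
    refine ⟨(adj.homEquiv M T).symm φ, fun i ↦ ?_⟩
    refine Eq.trans ?_ (hφ i)
    have : adj.unit.app M ≫ (Scheme.Modules.pushforward f).map ((adj.homEquiv M T).symm φ) = φ := by
      exact (adj.homEquiv_unit _ _ _).symm.trans (Equiv.apply_symm_apply _ _)
    exact congrArg (fun c : M ⟶ _ ↦ c.appₗ U (b i)) this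
  · refine (adj.homEquiv M T).injective (hb.hom_injective (hT.pushforward f) fun i ↦ ?_)
    refine (congrArg (fun c : M ⟶ _ ↦ c.appₗ U (b i)) (adj.homEquiv_unit _ _ φ)).trans
      (Eq.trans ?_ (congrArg (fun c : M ⟶ _ ↦ c.appₗ U (b i)) (adj.homEquiv_unit _ _ ψ)).symm)
    exact h i

end Hom

end AlgebraicGeometry.Scheme.Modules

/-! ### Locally framed modules and exactness of alternating forms. -/

namespace AlgebraicGeometry.Scheme.Modules

variable {X Y : Scheme.{u}}

lemma isFrame_iff_bijective {ι : Type*} [Fintype ι] {M : X.Modules} {U : X.Opens}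
    {b : ι → Γ(M, U)} : IsFrame M U b ↔ ∀ (W : X.Opens) (h : W ≤ U),
      Function.Bijective fun a : ι → Γ(X, W) ↦ ∑ i, a i • M.res h (b i) := by
  refine forall₂_congr fun W h ↦ ?_
  refine and_congr ?_ ?_
  · exact linearIndependent_iff_injective_fintypeLinearCombination
  · rw [top_le_iff, ← Fintype.range_linearCombination, LinearMap.range_eq_top]
    rfl

lemma isFrame_of_coproduct {ι : Type*} [Finite ι] {F : X.Modules}
    (j : ι → (structureSheaf X ⟶ F))
    (hj : ∀ (T : X.Modules) (φ : ι → (structureSheaf X ⟶ T)), ∃ d : F ⟶ T, ∀ i, j i ≫ d = φ i)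
    (hj' : ∀ (T : X.Modules) (φ ψ : F ⟶ T), (∀ i, j i ≫ φ = j i ≫ ψ) → φ = ψ) :
    IsFrame F ⊤ fun i ↦ (j i).appₗ ⊤ (sec ⊤ 1) := by
  have hO := isFrame_structureSheaf (X := X) ⊤
  refine isFrame_of_hom _ (fun T hT t ↦ ?_) fun T hT φ ψ h ↦ ?_
  · choose φ hφ using fun i ↦ hO.hom_surjective hT fun _ ↦ t i
    obtain ⟨d, hd⟩ := hj T φ
    exact ⟨d, fun i ↦ by rw [← Hom.comp_appₗ, hd, hφ i ()]⟩
  · exact hj' T φ ψ fun i ↦ hO.hom_injective hT fun _ ↦ h i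

variable (X) in
/-- The free module `𝒪^n`. -/
def freeModule (n : ℕ) : X.Modules :=
  SheafOfModules.free (R := X.ringCatSheaf) (ULift.{u} (Fin n))

lemma exists_isFrame_freeModule (n : ℕ) :
    ∃ b : Fin n → Γ(freeModule X n, ⊤), IsFrame (freeModule X n) ⊤ b := by
  let j (i : Fin n) : structureSheaf X ⟶ freeModule X n :=
    SheafOfModules.ιFree (R := X.ringCatSheaf) (ULift.up i)
  refine ⟨_, isFrame_of_coproduct j (fun T φ ↦ ?_) fun T φ ψ h ↦ ?_⟩
  · exact ⟨Sigma.desc (C := SheafOfModules X.ringCatSheaf) fun i : ULift.{u} (Fin n) ↦ φ i.down,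
      fun i ↦ Sigma.ι_desc (C := SheafOfModules X.ringCatSheaf)
        (fun i : ULift.{u} (Fin n) ↦ φ i.down) (ULift.up i)⟩
  · exact Sigma.hom_ext (C := SheafOfModules X.ringCatSheaf) _ _ fun i ↦ h i.down

lemma isFrame_of_restrict (g : X ⟶ Y) [IsOpenImmersion g] {M : Y.Modules} {ι : Type*} [Finite ι]
    (b : ι → Γ(M, g ''ᵁ ⊤)) (hb : IsFrame (M.restrict g) ⊤ (show ι → Γ(M.restrict g, ⊤) from b)) :
    IsFrame M (g ''ᵁ ⊤) b := by
  have := Fintype.ofFinite ι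
  rw [isFrame_iff_bijective] at hb ⊢
  intro W h
  have hW : g ''ᵁ (g ⁻¹ᵁ W) ≤ W := g.image_preimage_le W
  have hW' : W ≤ g ''ᵁ (g ⁻¹ᵁ W) := fun x hx ↦ by
    obtain ⟨y, -, rfl⟩ := h hx
    exact ⟨y, hx, rfl⟩
  let e : Γ(X, g ⁻¹ᵁ W) → Γ(Y, W) := fun r ↦ resₒ hW' ((g.appIso (g ⁻¹ᵁ W)).inv r)
  have he : Function.Bijective e := by
    refine Function.Bijective.comp (g := resₒ hW') ?_
      (ConcreteCategory.bijective_of_isIso (g.appIso (g ⁻¹ᵁ W)).inv)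
    refine Function.bijective_iff_has_inverse.2 ⟨resₒ hW, fun x ↦ ?_, fun x ↦ ?_⟩
    · rw [resₒ_resₒ, resₒ_self]
    · rw [resₒ_resₒ, resₒ_self]
  have hE : Function.Bijective (M.res hW') :=
    Function.bijective_iff_has_inverse.2 ⟨M.res hW, fun x ↦ by rw [res_res, res_self],
      fun x ↦ by rw [res_res, res_self]⟩
  have key : (fun a : ι → Γ(Y, W) ↦ ∑ i, a i • M.res h (b i)) ∘ (fun a ↦ e ∘ a) =
      M.res hW' ∘ fun a : ι → Γ(X, g ⁻¹ᵁ W) ↦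
        ∑ i, a i • (M.restrict g).res (le_top : g ⁻¹ᵁ W ≤ ⊤) (show Γ(M.restrict g, ⊤) from b i) := by
    funext a
    refine Eq.trans ?_ (map_sum (M.res hW') _ _).symm
    refine Finset.sum_congr rfl fun i _ ↦ ?_
    have h1 : M.res h (b i) = M.res hW' (M.res (g.image_mono le_top) (b i)) :=
      (M.res_res _ _ _).symm
    rw [h1]
    exact ((M.res hW').map_smulₛₗ _ _).symm
  have h2 : Function.Bijective (M.res hW' ∘ fun a : ι → Γ(X, g ⁻¹ᵁ W) ↦
      ∑ i, a i • (M.restrict g).res (le_top : g ⁻¹ᵁ W ≤ ⊤) (show Γ(M.restrict g, ⊤) from b i)) :=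
    hE.comp (hb (g ⁻¹ᵁ W) le_top)
  exact (Function.Bijective.of_comp_iff _ he.comp_left).1 (key ▸ h2 :)

/-- `M` has a finite frame in a neighbourhood of every point. -/
def LocallyFramed (M : X.Modules) : Prop :=
  ∀ x : X, ∃ U : X.Opens, x ∈ U ∧ ∃ (n : ℕ) (b : Fin n → Γ(M, U)), IsFrame M U b

lemma IsVectorBundle.locallyFramed {M : X.Modules} (hM : M.IsVectorBundle) : M.LocallyFramed := by
  intro x
  obtain ⟨U, hx, n, ⟨e⟩⟩ := hM x
  obtain ⟨b, hb⟩ := exists_isFrame_freeModule (X := U.toScheme) n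
  let e : M.restrict U.ι ≅ freeModule U.toScheme n := e
  have hb' := hb.map (N := M.restrict U.ι) e.inv fun W _ ↦ bijective_of_isIso e.inv W
  exact ⟨U.ι ''ᵁ ⊤, ⟨⟨x, hx⟩, trivial, rfl⟩, n, _, isFrame_of_restrict U.ι _ hb'⟩

lemma LocallyFramed.exists_frame {M : X.Modules} (hM : M.LocallyFramed) {U : X.Opens} {x : X}
    (hx : x ∈ U) : ∃ V ≤ U, x ∈ V ∧ ∃ (n : ℕ) (b : Fin n → Γ(M, V)), IsFrame M V b := by
  obtain ⟨V, hV, n, b, hb⟩ := hM x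
  exact ⟨V ⊓ U, inf_le_right, ⟨hV, hx⟩, n, _, hb.res inf_le_left⟩

lemma LocallyFramed.of_iso {M N : X.Modules} (hM : M.LocallyFramed) (e : M ≅ N) :
    N.LocallyFramed := fun x ↦ by
  obtain ⟨V, hV, n, b, hb⟩ := hM x
  exact ⟨V, hV, n, _, hb.map e.hom fun W _ ↦ bijective_of_isIso _ _⟩

lemma locallyFramed_of_frame {M : X.Modules} (h : ∀ x : X, ∃ U : X.Opens, x ∈ U ∧
    ∃ (ι : Type) (_ : Finite ι) (b : ι → Γ(M, U)), IsFrame M U b) : M.LocallyFramed := fun x ↦ by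
  obtain ⟨U, hx, ι, _, b, hb⟩ := h x
  obtain ⟨n, ⟨e⟩⟩ := Finite.exists_equiv_fin ι
  refine ⟨U, hx, n, b ∘ e.symm, .of_basis (fun W h ↦ (hb.basis h).reindex e) fun W h i ↦ ?_⟩
  rw [Module.Basis.reindex_apply, IsFrame.basis_apply]
  rfl

lemma LocallyFramed.alt {M : X.Modules} (hM : M.LocallyFramed) (q : ℕ) :
    (altSheaf M (structureSheaf X) q).LocallyFramed := locallyFramed_of_frame fun x ↦ by
  obtain ⟨U, hx, n, b, hb⟩ := hM x
  exact ⟨U, hx, _, inferInstance, _, hb.alt q⟩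

lemma LocallyFramed.pullback {M : Y.Modules} (hM : M.LocallyFramed) (f : X ⟶ Y) :
    ((Scheme.Modules.pullback f).obj M).LocallyFramed := fun x ↦ by
  obtain ⟨U, hx, n, b, hb⟩ := hM (f x)
  exact ⟨f ⁻¹ᵁ U, hx, n, _, isFrame_pullback f hb⟩

/-- The functor of alternating forms on `M`. -/
def altFunctor (M : X.Modules) (q : ℕ) : X.Modules ⥤ X.Modules where
  obj T := altSheaf M T q
  map f := altMap M q f
  map_id _ := rfl
  map_comp _ _ := rfl

instance (M : X.Modules) (q : ℕ) : (altFunctor M q).Additive where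
  map_add := rfl

lemma LocallySurjective.exists_lift {T T' : X.Modules} {f : T ⟶ T'} (hf : LocallySurjective f)
    {ι : Type*} [Finite ι] {U : X.Opens} (s : ι → Γ(T', U)) {x : X} (hx : x ∈ U) :
    ∃ (V : X.Opens) (h : V ≤ U), x ∈ V ∧ ∀ i, ∃ t, f.appₗ V t = T'.res h (s i) := by
  choose V hV hxV t ht using fun i ↦ hf U (s i) x hx
  have hle (i : ι) : U ⊓ ⨅ i, V i ≤ V i := inf_le_right.trans (iInf_le V i)
  refine ⟨U ⊓ ⨅ i, V i, inf_le_left, ⟨hx, ?_⟩, fun i ↦ ⟨T.res (hle i) (t i), ?_⟩⟩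
  · have h1 : x ∈ (↑(⨅ i, V i) : Set X) := by
      rw [Opens.coe_iInf]
      exact Set.mem_iInter.2 hxV
    exact h1
  · rw [Hom.appₗ_res]
    refine (congrArg (T'.res (hle i)) (ht i)).trans ?_
    exact T'.res_res (hV i) (hle i) (s i)

lemma IsFrame.exists_altEval_eq {M T : X.Modules} {U : X.Opens} {ι : Type*} [Finite ι]
    [LinearOrder ι] {b : ι → Γ(M, U)} (hb : IsFrame M U b) {q : ℕ}
    (t : Set.powersetCard ι q → Γ(T, U)) : ∃ φ : Γ(altSheaf M T q, U), ∀ s,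
      altEval le_rfl φ (fun i ↦ hb.basis le_rfl (Set.powersetCard.ofFinEmbEquiv.symm s i)) = t s := by
  classical
  have := Fintype.ofFinite ι
  have := Fintype.ofFinite (Set.powersetCard ι q)
  let f : Γ(M, U) [⋀^Fin q]→ₗ[Γ(X, U)] Γ(T, U) :=
    ∑ s, (LinearMap.toSpanSingleton Γ(X, U) Γ(T, U) (t s)).compAlternatingMap
      (AlternatingMap.basis (hb.basis le_rfl) q s)
  refine ⟨hb.altEquiv.symm f, fun s ↦ ?_⟩
  have hf (m) : f m = ∑ s, (LinearMap.toSpanSingleton Γ(X, U) Γ(T, U) (t s)).compAlternatingMap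
      (AlternatingMap.basis (hb.basis le_rfl) q s) m :=
    map_sum (⟨⟨fun f ↦ f m, rfl⟩, fun _ _ ↦ rfl⟩ :
      (Γ(M, U) [⋀^Fin q]→ₗ[Γ(X, U)] Γ(T, U)) →+ Γ(T, U)) _ _
  rw [hb.altEval_altEquiv_symm, hf, Finset.sum_eq_single s]
  · rw [LinearMap.compAlternatingMap_apply, AlternatingMap.basis_apply, if_pos rfl,
      LinearMap.toSpanSingleton_apply, one_smul]
  · intro s' _ hs
    rw [LinearMap.compAlternatingMap_apply, AlternatingMap.basis_apply]
    split_ifs with h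
    · exact (hs (by first | exact h | exact h.symm)).elim
    · rw [map_zero]
  · simp

/-- On a framed open set a form is a finite family of sections of `T'`, and finitely many sections
lift simultaneously on a neighbourhood. -/
lemma LocallyFramed.locallySurjective_altMap {M T T' : X.Modules} (hM : M.LocallyFramed) (q : ℕ)
    {f : T ⟶ T'} (hf : LocallySurjective f) : LocallySurjective (altMap M q f) := by
  intro U φ x hx
  obtain ⟨V, hV, hxV, n, b, hb⟩ := hM.exists_frame hx
  obtain ⟨W, hW, hxW, h⟩ := hf.exists_lift (fun s : Set.powersetCard (Fin n) q ↦
    altEval hV φ (fun i ↦ hb.basis le_rfl (Set.powersetCard.ofFinEmbEquiv.symm s i))) hxV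
  choose t ht using h
  obtain ⟨ψ, hψ⟩ := (hb.res hW).exists_altEval_eq t
  refine ⟨W, hW.trans hV, hxW, ψ, (hb.res hW).altEval_injective ?_⟩
  refine AlternatingMap.ext_powersetCard ((hb.res hW).basis le_rfl) fun s ↦ ?_
  refine (congrArg (f.appₗ W) (hψ s)).trans ((ht s).trans ?_)
  refine (altEval_comp_res hV hW φ _).symm.trans ?_
  refine congrArg (altEval (hW.trans hV) φ) (funext fun i ↦ ?_)
  rw [Function.comp_apply, IsFrame.basis_apply, IsFrame.basis_apply, Function.comp_apply, res_self,
    res_self]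

lemma LocallyFramed.shortExact_alt {M : X.Modules} (hM : M.LocallyFramed) (q : ℕ)
    {S : ShortComplex X.Modules} (hS : S.ShortExact) : (S.map (altFunctor M q)).ShortExact := by
  have := hS.mono_f
  have := hS.epi_g
  refine .mk' ?_ (mono_of_injective _ fun U φ ψ h ↦ altSheaf_ext fun V hV m ↦ ?_)
    (hM.locallySurjective_altMap q (locallySurjective_of_epi S.g)).epi
  -- Exactness in the middle needs no frame: each value of `φ` has a unique preimage in `S.X₁`, and
  -- uniqueness makes the preimages alternating and compatible.
  · refine exact_of_locally _ _ _ fun U φ hφ x hx ↦ ⟨U, le_rfl, hx, ?_⟩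
    have h1 (V : X.Opens) (hV : V ≤ U) (m : Fin q → Γ(M, V)) :
        ∃ t, S.f.appₗ V t = altEval hV φ m :=
      exists_of_exact S.f S.g S.zero hS.exact V _
        (congrArg (fun ψ : Γ(altSheaf M S.X₃ q, U) ↦ altEval hV ψ m) hφ)
    choose t ht using h1
    have hi (V) := injective_of_mono S.f V
    refine ⟨altMk (fun V hV ↦
      { toFun := t V hV
        map_update_add' m i x y := hi V (by
          rw [map_add, ht, ht, ht, AlternatingMap.map_update_add])
        map_update_smul' m i c x := hi V (by
          rw [_root_.map_smul, ht, ht, AlternatingMap.map_update_smul])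
        map_eq_zero_of_eq' m i j h hij := hi V (by
          rw [ht, map_zero, AlternatingMap.map_eq_zero_of_eq _ _ h hij]) }) ?_, ?_⟩
    · intro V W hV h m
      refine hi W ((ht W _ _).trans ?_)
      refine (altEval_comp_res hV h φ m).trans ?_
      exact (congrArg _ (ht V hV m).symm).trans (S.f.appₗ_res h _).symm
    · refine altSheaf_ext fun V hV m ↦ ?_
      exact (ht V hV m).trans (DFunLike.congr_fun (altEval_res le_rfl hV φ) m).symm
  · exact injective_of_mono S.f V (congrArg (fun ψ : Γ(altSheaf M S.X₂ q, U) ↦ altEval hV ψ m) h)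

lemma LocallyFramed.preservesFiniteLimits {M : X.Modules} (hM : M.LocallyFramed) (q : ℕ) :
    PreservesFiniteLimits (altFunctor M q) :=
  (((altFunctor M q).exact_tfae.out 0 3 rfl rfl).1 fun _ h ↦ hM.shortExact_alt q h).1

lemma LocallyFramed.preservesFiniteColimits {M : X.Modules} (hM : M.LocallyFramed) (q : ℕ) :
    PreservesFiniteColimits (altFunctor M q) :=
  (((altFunctor M q).exact_tfae.out 0 3 rfl rfl).1 fun _ h ↦ hM.shortExact_alt q h).2

end AlgebraicGeometry.Scheme.Modules

/-! ### Closed immersions, contraction of forms and the iterated extension class. -/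

namespace AlgebraicGeometry.Scheme.Modules

variable {X Y : Scheme.{u}}

lemma structureMap_appₗ (f : X ⟶ Y) (U : Y.Opens) (r : Γ(Y, U)) :
    (structureMap f).appₗ U (sec U r) = sec (f ⁻¹ᵁ U) (f.app U r) := rfl

lemma pushforward_smul (f : X ⟶ Y) (M : X.Modules) (U : Y.Opens) (r : Γ(Y, U))
    (m : Γ(M, f ⁻¹ᵁ U)) :
    r • (show Γ((Scheme.Modules.pushforward f).obj M, U) from m) = f.app U r • m := rfl

lemma app_resₒ (f : X ⟶ Y) {U V : Y.Opens} (h : V ≤ U) (r : Γ(Y, U)) :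
    f.app V (resₒ h r) = resₒ (f.preimage_mono h) (f.app U r) :=
  ConcreteCategory.congr_hom (f.naturality (homOfLE h).op) r

lemma exists_affine_le {U : Y.Opens} {y : Y} (hy : y ∈ U) :
    ∃ V : Y.affineOpens, y ∈ V.1 ∧ V.1 ≤ U := by
  obtain ⟨V, hV, hyV, h⟩ := (Opens.isBasis_iff_nbhd.1 Y.isBasis_affineOpens) hy
  exact ⟨⟨V, hV⟩, hyV, h⟩

lemma locallySurjective_structureMap (f : X ⟶ Y) [IsClosedImmersion f] :
    LocallySurjective (structureMap f) := by
  intro U s y hy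
  obtain ⟨V, hyV, hV⟩ := exists_affine_le hy
  obtain ⟨r, hr⟩ := f.app_surjective V.1 V.2
    ((sec (f ⁻¹ᵁ V.1)).symm (((Scheme.Modules.pushforward f).obj (structureSheaf X)).res hV s))
  refine ⟨V.1, hV, hyV, sec V.1 r, (structureMap_appₗ f V.1 r).trans ?_⟩
  rw [hr]
  exact LinearEquiv.apply_symm_apply _ _

instance (f : X ⟶ Y) [IsClosedImmersion f] : Epi (structureMap f) :=
  (locallySurjective_structureMap f).epi

section Full

variable (f : X ⟶ Y) [IsClosedImmersion f]

lemma exists_preimage_eq (U : X.Opens) : ∃ W : Y.Opens, f ⁻¹ᵁ W = U := by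
  obtain ⟨W, hW, h⟩ := f.isClosedEmbedding.isInducing.isOpen_iff.1 U.2
  exact ⟨⟨W, hW⟩, Opens.ext h⟩

/-- Every open set of `X` is a preimage, which defines the map on sections. Linearity over functions
on `X` can be checked on affine opens of `Y`, where these functions lift to `Y`. -/
lemma exists_preimage_hom {M N : X.Modules}
    (φ : (Scheme.Modules.pushforward f).obj M ⟶ (Scheme.Modules.pushforward f).obj N) :
    ∃ ψ : M ⟶ N, (Scheme.Modules.pushforward f).map ψ = φ := by
  choose W hW using exists_preimage_eq f
  -- Compatibility is needed although `V'` need not lie in `V`; only the preimages are nested, and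
  -- `V ⊓ V'` has the same preimage as `V'`.
  have nat {V V' : Y.Opens} (h : f ⁻¹ᵁ V' ≤ f ⁻¹ᵁ V) (m : Γ(M, f ⁻¹ᵁ V)) :
      N.res h (φ.appₗ V m) = φ.appₗ V' (M.res h m) := by
    have h1 : f ⁻¹ᵁ V' ≤ f ⁻¹ᵁ (V ⊓ V') := fun x hx ↦ ⟨h hx, hx⟩
    have h2 : f ⁻¹ᵁ (V ⊓ V') ≤ f ⁻¹ᵁ V' := fun x hx ↦ hx.2
    have h3 : f ⁻¹ᵁ (V ⊓ V') ≤ f ⁻¹ᵁ V := fun x hx ↦ hx.1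
    have e1 : φ.appₗ (V ⊓ V') (M.res h3 m) = N.res h3 (φ.appₗ V m) :=
      φ.appₗ_res (inf_le_left : V ⊓ V' ≤ V) m
    have e2 : φ.appₗ (V ⊓ V') (M.res h2 (M.res h m)) = N.res h2 (φ.appₗ V' (M.res h m)) :=
      φ.appₗ_res (inf_le_right : V ⊓ V' ≤ V') (M.res h m)
    have e3 : M.res h2 (M.res h m) = M.res h3 m := M.res_res _ _ _
    have e4 := congrArg (N.res h1) (e1.symm.trans ((congrArg (φ.appₗ (V ⊓ V')) e3.symm).trans e2))
    exact (N.res_res h3 h1 _).symm.trans (e4.trans ((N.res_res h2 h1 _).trans (N.res_self _ _)))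
  have hle (U : X.Opens) : f ⁻¹ᵁ W U ≤ U := (hW U).le
  have hge (U : X.Opens) : U ≤ f ⁻¹ᵁ W U := (hW U).ge
  let ψ (U : X.Opens) (m : Γ(M, U)) : Γ(N, U) := N.res (hge U) (φ.appₗ (W U) (M.res (hle U) m))
  have hψ {U : X.Opens} {V : Y.Opens} (h : f ⁻¹ᵁ V ≤ U) (m : Γ(M, U)) :
      N.res h (ψ U m) = φ.appₗ V (M.res h m) :=
    (N.res_res (hge U) h _).trans ((nat (h.trans (hge U)) _).trans
      (congrArg (φ.appₗ V) (M.res_res (hle U) _ m)))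
  have hadd (U : X.Opens) (m m' : Γ(M, U)) : ψ U (m + m') = ψ U m + ψ U m' := by
    have h1 : φ.appₗ (W U) (M.res (hle U) m + M.res (hle U) m') =
        φ.appₗ (W U) (M.res (hle U) m) + φ.appₗ (W U) (M.res (hle U) m') :=
      map_add (φ.appₗ (W U)) _ _
    refine (congrArg (fun z ↦ N.res (hge U) (φ.appₗ (W U) z)) (map_add (M.res (hle U)) m m')).trans ?_
    exact (congrArg (N.res (hge U)) h1).trans (map_add (N.res (hge U)) _ _)
  have hsmul (U : X.Opens) (r : Γ(X, U)) (m : Γ(M, U)) : ψ U (r • m) = r • ψ U m := by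
    refine N.eq_of_res_eq fun x hx ↦ ?_
    have hx' : f x ∈ W U := hge U hx
    obtain ⟨V, hxV, hV⟩ := exists_affine_le hx'
    have hV' : f ⁻¹ᵁ V.1 ≤ U := (f.preimage_mono hV).trans (hle U)
    obtain ⟨r', hr'⟩ := f.app_surjective V.1 V.2 (resₒ hV' r)
    refine ⟨f ⁻¹ᵁ V.1, hV', hxV, ?_⟩
    refine (hψ hV' _).trans (Eq.trans ?_ ((N.res hV').map_smulₛₗ r _).symm)
    refine (congrArg (φ.appₗ V.1) ((M.res hV').map_smulₛₗ r m)).trans ?_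
    have h1 : φ.appₗ V.1 (f.app V.1 r' • M.res hV' m) =
        f.app V.1 r' • (show Γ(N, f ⁻¹ᵁ V.1) from φ.appₗ V.1 (M.res hV' m)) :=
      (φ.appₗ V.1).map_smul r' (M.res hV' m)
    rw [hr'] at h1
    exact h1.trans (congrArg (resₒ hV' r • ·) (hψ hV' m).symm)
  refine ⟨homOfAppₗ (fun U ↦ ⟨⟨ψ U, hadd U⟩, hsmul U⟩) fun {U V} h m ↦ ?_, hom_extₗ fun V m ↦ ?_⟩
  · change ψ V (M.res h m) = N.res h (ψ U m)
    have e1 := (hψ (hle V) (M.res h m)).trans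
      ((congrArg (φ.appₗ (W V)) (M.res_res h (hle V) m)).trans
      ((hψ ((hle V).trans h) m).symm.trans (N.res_res h (hle V) _).symm))
    have e2 := congrArg (N.res (hge V)) e1
    exact (N.res_self _ _).symm.trans ((N.res_res _ _ _).symm.trans
      (e2.trans ((N.res_res _ _ _).trans (N.res_self _ _))))
  · change ψ (f ⁻¹ᵁ V) m = φ.appₗ V m
    refine (N.res_self le_rfl _).symm.trans ((hψ le_rfl m).trans ?_)
    exact congrArg (φ.appₗ V) (M.res_self _ m)

end Full

section Functoriality

/-- Precomposition of alternating forms with a morphism. -/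
def altPrecomp {M M' : X.Modules} (g : M ⟶ M') (T : X.Modules) (q : ℕ) :
    altSheaf M' T q ⟶ altSheaf M T q :=
  homOfAppₗ (fun U ↦
    { toFun φ := altMk (fun V hV ↦ (altEval hV φ).compLinearMap (g.appₗ V)) fun V W hV h m ↦ by
        refine Eq.trans ?_ (altEval_comp_res hV h φ _)
        exact congrArg (altEval (h.trans hV) φ) (funext fun i ↦ g.appₗ_res h (m i))
      map_add' φ ψ := rfl
      map_smul' r φ := rfl }) fun _ _ ↦ rfl

/-- An alternating form on `X` is an alternating form on direct images. -/
def altPushforward (f : X ⟶ Y) (M T : X.Modules) (q : ℕ) :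
    (Scheme.Modules.pushforward f).obj (altSheaf M T q) ⟶
      altSheaf ((Scheme.Modules.pushforward f).obj M) ((Scheme.Modules.pushforward f).obj T) q :=
  homOfAppₗ (fun U ↦
    { toFun φ := altMk (fun V hV ↦
        { toFun m := altEval (f.preimage_mono hV) (show Γ(altSheaf M T q, f ⁻¹ᵁ U) from φ) m
          map_update_add' m i x y :=
            (altEval (f.preimage_mono hV) (show Γ(altSheaf M T q, f ⁻¹ᵁ U) from φ)).map_update_add
              m i x y
          map_update_smul' m i c x :=
            (altEval (f.preimage_mono hV) (show Γ(altSheaf M T q, f ⁻¹ᵁ U) from φ)).map_update_smul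
              m i (f.app V c) x
          map_eq_zero_of_eq' m i j h hij :=
            (altEval (f.preimage_mono hV)
              (show Γ(altSheaf M T q, f ⁻¹ᵁ U) from φ)).map_eq_zero_of_eq m h hij })
        fun V W hV h m ↦ altEval_comp_res (f.preimage_mono hV) (f.preimage_mono h)
          (show Γ(altSheaf M T q, f ⁻¹ᵁ U) from φ) m
      map_add' φ ψ := rfl
      map_smul' r φ := altSheaf_ext fun V hV m ↦
        congrArg (· • altEval (f.preimage_mono hV) (show Γ(altSheaf M T q, f ⁻¹ᵁ U) from φ) m)
          (app_resₒ f hV r).symm }) fun _ _ ↦ rfl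

end Functoriality

section Contract

variable {V I T : X.Modules} (β : V ⟶ altSheaf I T 1) (q : ℕ)

/-- The bilinear map `V × I → T` given by `β`, composed with an alternating form with values in
`I`. -/
def pairWith {U W : X.Opens} (h : W ≤ U) (φ : Γ(altSheaf V I q, U)) :
    Γ(V, W) →ₗ[Γ(X, W)] (Γ(V, W) [⋀^Fin q]→ₗ[Γ(X, W)] Γ(T, W)) where
  toFun v := ((AlternatingMap.ofSubsingleton Γ(X, W) Γ(I, W) Γ(T, W) (0 : Fin 1)).symm
    (altEval le_rfl (β.appₗ W v))).compAlternatingMap (altEval h φ)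
  map_add' v v' := AlternatingMap.ext fun m ↦ by
    rw [map_add]
    rfl
  map_smul' r v := AlternatingMap.ext fun m ↦ by
    rw [_root_.map_smul]
    refine (DFunLike.congr_fun (altEval_smul le_rfl r _) _).trans ?_
    rw [resₒ_self]
    rfl

lemma pairWith_apply {U W : X.Opens} (h : W ≤ U) (φ : Γ(altSheaf V I q, U)) (v : Γ(V, W))
    (m : Fin q → Γ(V, W)) :
    pairWith β q h φ v m = altEval le_rfl (β.appₗ W v) fun _ ↦ altEval h φ m := rfl

/-- The map `Alt^q(V, I) → Alt^{q+1}(V, T)` given by a pairing of `V` and `I` with values in `T`. -/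
def contract : altSheaf V I q ⟶ altSheaf V T (q + 1) :=
  homOfAppₗ (fun U ↦
    { toFun φ := altMk (fun W hW ↦ AlternatingMap.alternatizeUncurryFin (pairWith β q hW φ))
        fun W W' hW h m ↦ by
          rw [AlternatingMap.alternatizeUncurryFin_apply,
            AlternatingMap.alternatizeUncurryFin_apply, map_sum]
          refine Finset.sum_congr rfl fun k _ ↦ ?_
          refine Eq.trans ?_ (map_zsmul (T.res h) _ _).symm
          refine congrArg (_ • ·) ?_
          rw [pairWith_apply, pairWith_apply]
          have h1 : β.appₗ W' (V.res h (m k)) = (altSheaf I T 1).res h (β.appₗ W (m k)) :=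
            β.appₗ_res h _
          have h2 : altEval (h.trans hW) φ (V.res h ∘ k.removeNth m) =
            I.res h (altEval hW φ (k.removeNth m)) := altEval_comp_res hW h φ _
          refine (congrArg₂ (fun a b ↦ altEval le_rfl a fun _ : Fin 1 ↦ b) h1 h2).trans ?_
          exact altEval_comp_res le_rfl h (β.appₗ W (m k)) _
      map_add' φ ψ := altSheaf_ext fun W hW m ↦ by
        rw [altEval_add, altEval_altMk, altEval_altMk, altEval_altMk, AlternatingMap.add_apply,
          ← AlternatingMap.add_apply, ← AlternatingMap.alternatizeUncurryFin_add]
        refine congrArg (fun f ↦ AlternatingMap.alternatizeUncurryFin f m) ?_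
        refine LinearMap.ext fun v ↦ AlternatingMap.ext fun x ↦ ?_
        exact map_add ((AlternatingMap.ofSubsingleton Γ(X, W) Γ(I, W) Γ(T, W) (0 : Fin 1)).symm
          (altEval le_rfl (β.appₗ W v))) _ _
      map_smul' r φ := altSheaf_ext fun W hW m ↦ by
        rw [RingHom.id_apply, altEval_smul, altEval_altMk, altEval_altMk,
          ← AlternatingMap.alternatizeUncurryFin_smul]
        refine congrArg (fun f ↦ AlternatingMap.alternatizeUncurryFin f m) ?_
        refine LinearMap.ext fun v ↦ AlternatingMap.ext fun x ↦ ?_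
        exact _root_.map_smul ((AlternatingMap.ofSubsingleton Γ(X, W) Γ(I, W) Γ(T, W)
          (0 : Fin 1)).symm (altEval le_rfl (β.appₗ W v))) _ _ })
    fun _ _ ↦ rfl

lemma altEval_contract {U W : X.Opens} (h : W ≤ U) (φ : Γ(altSheaf V I q, U))
    (m : Fin (q + 1) → Γ(V, W)) : altEval h ((contract β q).appₗ U φ) m =
      ∑ k : Fin (q + 1), (-1 : ℤ) ^ (k : ℕ) •
        altEval le_rfl (β.appₗ W (m k)) fun _ ↦ altEval h φ (k.removeNth m) :=
  AlternatingMap.alternatizeUncurryFin_apply _ m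

end Contract

section Class

variable {V : X.Modules} (hV : V.LocallyFramed) {S : ShortComplex X.Modules} (hS : S.ShortExact)
  (β : V ⟶ altSheaf S.X₁ S.X₃ 1)

/-- The iterated extension class of an extension of `T` by `I` and a pairing of `V` and `I` with
values in `T`. -/
def contractClass : ∀ n : ℕ, Abelian.Ext (altSheaf V S.X₃ 0) (altSheaf V S.X₃ n) n
  | 0 => Abelian.Ext.mk₀ (𝟙 _)
  | n + 1 => (contractClass n).comp
      ((hV.shortExact_alt n hS).extClass.comp (Abelian.Ext.mk₀ (contract β n)) (add_zero 1)) rfl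

end Class

section Normal

/-- The sheaf of homomorphisms is the sheaf of alternating `1`-forms. -/
lemma nonempty_dual_iso (C : X.Modules) : Nonempty (C.dual ≅ altSheaf C (structureSheaf X) 1) := by
  let h : homPresheaf C (structureSheaf X) ⟶ (altSheaf C (structureSheaf X) 1).val :=
    PresheafOfModules.homMk
      { app U := AddCommGrpCat.ofHom
          { toFun φ := altMk (fun V hV ↦ AlternatingMap.ofSubsingleton Γ(X, V) Γ(C, V)
                Γ(structureSheaf X, V) (0 : Fin 1)
                ((show homSections C (structureSheaf X) (unop U) from φ).1 ⟨V, hV⟩))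
              fun V W hV h m ↦ (show homSections C (structureSheaf X) (unop U) from φ).2
                ⟨V, hV⟩ ⟨W, h.trans hV⟩ h (m 0)
            map_zero' := rfl
            map_add' _ _ := rfl }
        naturality U V i := rfl }
      fun U r φ ↦ rfl
  have hb (U : X.Opens) : Function.Bijective fun φ : homSections C (structureSheaf X) U ↦
      (altMk (fun V hV ↦ AlternatingMap.ofSubsingleton Γ(X, V) Γ(C, V)
        Γ(structureSheaf X, V) (0 : Fin 1) (φ.1 ⟨V, hV⟩)) fun V W hV h m ↦ φ.2 ⟨V, hV⟩
          ⟨W, h.trans hV⟩ h (m 0) : Γ(altSheaf C (structureSheaf X) 1, U)) := by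
    refine ⟨fun φ ψ h ↦ Subtype.ext (funext fun V ↦ LinearMap.ext fun m ↦ ?_), fun φ ↦ ?_⟩
    · exact congrArg (fun φ : Γ(altSheaf C (structureSheaf X) 1, U) ↦
        altEval V.2 φ fun _ ↦ m) h
    · refine ⟨⟨fun V ↦ (AlternatingMap.ofSubsingleton Γ(X, V.1) Γ(C, V.1)
        Γ(structureSheaf X, V.1) (0 : Fin 1)).symm (altEval V.2 φ), fun V W h m ↦
          altEval_comp_res V.2 h φ fun _ ↦ m⟩, altSheaf_ext fun V hV m ↦ ?_⟩
      exact DFunLike.congr_fun (Equiv.apply_symm_apply (AlternatingMap.ofSubsingleton Γ(X, V)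
        Γ(C, V) Γ(structureSheaf X, V) (0 : Fin 1)) (altEval hV φ)) m
  have h1 : IsIso ((PresheafOfModules.toPresheaf _).map h) := by
    rw [NatTrans.isIso_iff_isIso_app]
    exact fun U ↦ (ConcreteCategory.isIso_iff_bijective _).2 (hb (unop U))
  have h2 : IsIso h := isIso_of_reflects_iso h (PresheafOfModules.toPresheaf _)
  exact ⟨(PresheafOfModules.sheafification (𝟙 X.ringCatSheaf.obj)).mapIso (asIso h) ≪≫
    (asIso (PresheafOfModules.sheafificationAdjunction (𝟙 X.ringCatSheaf.obj)).counit).app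
      (show SheafOfModules X.ringCatSheaf from altSheaf C (structureSheaf X) 1)⟩

end Normal

end AlgebraicGeometry.Scheme.Modules

/-! ### Ideal sheaves, the conormal sheaf and forms on an extension of the normal sheaf. -/

namespace AlgebraicGeometry.Scheme.Modules

variable {X X' Y : Scheme.{u}}

/-- The inclusion of the ideal sheaf. -/
def idealι (f : X ⟶ Y) : idealModule f ⟶ structureSheaf Y := kernel.ι (structureMap f)

instance (f : X ⟶ Y) : Mono (idealι f) := inferInstanceAs (Mono (kernel.ι (structureMap f)))

lemma idealι_comp (f : X ⟶ Y) : idealι f ≫ structureMap f = 0 := kernel.condition _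

/-- The sequence `I ⟶ 𝒪_Y ⟶ f_* 𝒪_X`. -/
abbrev idealSequence (f : X ⟶ Y) : ShortComplex Y.Modules :=
  ShortComplex.mk (idealι f) (structureMap f) (idealι_comp f)

lemma exact_idealSequence (f : X ⟶ Y) : (idealSequence f).Exact :=
  ShortComplex.exact_kernel (structureMap f)

lemma shortExact_idealSequence (f : X ⟶ Y) [IsClosedImmersion f] : (idealSequence f).ShortExact :=
  .mk' (exact_idealSequence f) (inferInstanceAs (Mono (idealι f)))
    (inferInstanceAs (Epi (structureMap f)))

lemma exists_idealModule (f : X ⟶ Y) (U : Y.Opens) (r : Γ(Y, U)) (h : f.app U r = 0) :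
    ∃ s : Γ(idealModule f, U), (idealι f).appₗ U s = sec U r :=
  exists_of_exact (idealι f) (structureMap f) (idealι_comp f) (exact_idealSequence f) U (sec U r) ((structureMap_appₗ f U r).trans
      ((congrArg (sec (f ⁻¹ᵁ U)) h).trans (map_zero _)))

lemma app_idealModule (f : X ⟶ Y) (U : Y.Opens) (s : Γ(idealModule f, U)) (r : Γ(Y, U))
    (h : (idealι f).appₗ U s = sec U r) : f.app U r = 0 := by
  have h1 : (structureMap f).appₗ U ((idealι f).appₗ U s) = 0 := by
    rw [← Hom.comp_appₗ, idealι_comp, Hom.zero_appₗ]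
  rw [h] at h1
  exact (sec (f ⁻¹ᵁ U)).map_eq_zero_iff.1 ((structureMap_appₗ f U r).symm.trans h1)

lemma idealModule_injective (f : X ⟶ Y) (U : Y.Opens) :
    Function.Injective ((idealι f).appₗ U) := injective_of_mono _ U

lemma exists_sec_eq (U : X.Opens) (s : Γ(structureSheaf X, U)) : ∃ r : Γ(X, U), s = sec U r :=
  ⟨(sec U).symm s, ((sec U).apply_symm_apply s).symm⟩

/-- The unit of the adjunction between inverse and direct images. -/
abbrev pullbackUnit (f : X ⟶ Y) (M : Y.Modules) :
    M ⟶ (Scheme.Modules.pushforward f).obj ((Scheme.Modules.pullback f).obj M) :=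
  (pullbackPushforwardAdjunction f).unit.app M

/-- The map from the ideal sheaf to the conormal sheaf. -/
abbrev toConormal (f : X ⟶ Y) :
    idealModule f ⟶ (Scheme.Modules.pushforward f).obj (conormalSheaf f) :=
  pullbackUnit f (idealModule f)

variable (i : X ⟶ X') (j : X' ⟶ Y)

/-- A product `a * b` of elements of the ideal is `a` times the section `b`, and `a` acts as zero on
a direct image from `X`. -/
lemma toConormal_eq_zero (f : X ⟶ Y) {V : Y.affineOpens} [QuasiCompact f] {r : Γ(Y, V.1)}
    (hr : r ∈ f.ker.ideal V ^ 2) (s : Γ(idealModule f, V.1))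
    (h : (idealι f).appₗ V.1 s = sec V.1 r) :
    (toConormal f).appₗ V.1 s = 0 := by
  suffices h' : ∃ s : Γ(idealModule f, V.1),
      (idealι f).appₗ V.1 s = sec V.1 r ∧ (toConormal f).appₗ V.1 s = 0 by
    obtain ⟨s', h1, h2⟩ := h'
    rw [idealModule_injective f V.1 (h.trans h1.symm), h2]
  have hmem (a : Γ(Y, V.1)) : a ∈ f.ker.ideal V ↔ f.app V.1 a = 0 := by
    rw [f.ker_apply]
    rfl
  rw [pow_two] at hr
  refine Submodule.mul_induction_on hr (fun a ha b hb ↦ ?_) fun a b ha hb ↦ ?_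
  · obtain ⟨t, ht⟩ := exists_idealModule f V.1 b ((hmem b).1 hb)
    refine ⟨a • t, ?_, ?_⟩
    · rw [_root_.map_smul, ht, ← _root_.map_smul]
      rfl
    · rw [_root_.map_smul]
      refine (pushforward_smul f _ V.1 a _).trans ?_
      rw [(hmem a).1 ha]
      exact zero_smul Γ(X, f ⁻¹ᵁ V.1) (show Γ(conormalSheaf f, f ⁻¹ᵁ V.1) from _)
  · obtain ⟨s, h1, h2⟩ := ha
    obtain ⟨t, h3, h4⟩ := hb
    exact ⟨s + t, by rw [map_add, map_add, h1, h3], by rw [map_add, h2, h4, add_zero]⟩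

section

variable [IsClosedImmersion j] [IsClosedImmersion i]

/-- The ideal of `X` in `Y` maps onto the ideal of `X` in `X'`, and by `hker` the kernel is its
square, which dies in the conormal sheaf. So the map to the conormal sheaf descends, and fullness of
the direct image along `j` gives a morphism of modules on `X'`. -/
lemma exists_conormalMap (hker : j.ker = (i ≫ j).ker ^ 2) :
    ∃ c : idealModule i ⟶ (Scheme.Modules.pushforward i).obj (conormalSheaf (i ≫ j)),
      ∀ (U : Y.Opens) (s : Γ(idealModule (i ≫ j), U)) (t : Γ(idealModule i, j ⁻¹ᵁ U)),
        (idealι i).appₗ (j ⁻¹ᵁ U) t =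
          (structureMap j).appₗ U ((idealι (i ≫ j)).appₗ U s) →
        c.appₗ (j ⁻¹ᵁ U) t = (toConormal (i ≫ j)).appₗ U s := by
  have hK' : (ShortComplex.mk ((Scheme.Modules.pushforward j).map (idealι i))
      ((Scheme.Modules.pushforward j).map (structureMap i)) (by
        rw [← Functor.map_comp, idealι_comp, Functor.map_zero])).Exact :=
    (exact_idealSequence i).map (Scheme.Modules.pushforward j)
  have hz : (idealι (i ≫ j) ≫ structureMap j) ≫
      (Scheme.Modules.pushforward j).map (structureMap i) = 0 := hom_extₗ fun U s ↦ by
    obtain ⟨r, hr⟩ := exists_sec_eq U ((idealι (i ≫ j)).appₗ U s)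
    have h1 := app_idealModule (i ≫ j) U s r hr
    have h2 : i.app (j ⁻¹ᵁ U) (j.app U r) = 0 := by
      rw [Scheme.Hom.comp_app] at h1
      exact h1
    rw [Hom.comp_appₗ, Hom.comp_appₗ, hr]
    refine (structureMap_appₗ i (j ⁻¹ᵁ U) (j.app U r)).trans ?_
    rw [h2]
    exact map_zero (sec (i ⁻¹ᵁ (j ⁻¹ᵁ U)))
  let φ : idealModule (i ≫ j) ⟶ (Scheme.Modules.pushforward j).obj (idealModule i) :=
    hK'.lift (idealι (i ≫ j) ≫ structureMap j) hz
  have hφ : φ ≫ (Scheme.Modules.pushforward j).map (idealι i) =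
      idealι (i ≫ j) ≫ structureMap j := hK'.lift_f _ hz
  have hφ' (U : Y.Opens) (s : Γ(idealModule (i ≫ j), U)) :
      (idealι i).appₗ (j ⁻¹ᵁ U) (φ.appₗ U s) =
        (structureMap j).appₗ U ((idealι (i ≫ j)).appₗ U s) :=
    congrArg (fun a : _ ⟶ _ ↦ Hom.appₗ a U s) hφ
  let η : idealModule (i ≫ j) ⟶ (Scheme.Modules.pushforward j).obj
      ((Scheme.Modules.pushforward i).obj (conormalSheaf (i ≫ j))) :=
    toConormal (i ≫ j) ≫ (pushforwardComp i j).inv.app _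
  have hη (U : Y.Opens) (s : Γ(idealModule (i ≫ j), U)) :
      η.appₗ U s = (toConormal (i ≫ j)).appₗ U s := rfl
  -- A section of the ideal in `X'` is locally induced by a function on `Y`, and that function
  -- vanishes on `X`.
  have hepi : Epi φ := by
    refine LocallySurjective.epi fun U t y hy ↦ ?_
    obtain ⟨V, hV, hyV, r, hr⟩ := locallySurjective_structureMap j U
      ((idealι i).appₗ (j ⁻¹ᵁ U) t) y hy
    obtain ⟨r, rfl⟩ := exists_sec_eq V r
    let t' := (idealModule i).res (j.preimage_mono hV) t
    have ht' : (idealι i).appₗ (j ⁻¹ᵁ V) t' = sec _ (j.app V r) :=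
      (Hom.appₗ_res (idealι i) (j.preimage_mono hV) t).trans
        (hr.symm.trans (structureMap_appₗ j V r))
    have h1 : (i ≫ j).app V r = 0 := by
      rw [Scheme.Hom.comp_app]
      exact app_idealModule i (j ⁻¹ᵁ V) t' _ ht'
    obtain ⟨s, hs⟩ := exists_idealModule (i ≫ j) V r h1
    refine ⟨V, hV, hyV, s, idealModule_injective i (j ⁻¹ᵁ V) ?_⟩
    refine (hφ' V s).trans ?_
    rw [hs]
    exact (structureMap_appₗ j V r).trans ht'.symm
  have hker' : kernel.ι φ ≫ η = 0 := hom_extₗ fun U m ↦ by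
    set s := Hom.appₗ (kernel.ι φ) U m with hs
    have hs0 : φ.appₗ U s = 0 := by rw [hs, ← Hom.comp_appₗ, kernel.condition, Hom.zero_appₗ]
    rw [Hom.comp_appₗ, ← hs, Hom.zero_appₗ]
    refine ((Scheme.Modules.pushforward j).obj ((Scheme.Modules.pushforward i).obj
      (conormalSheaf (i ≫ j)))).eq_of_res_eq fun y hy ↦ ?_
    obtain ⟨V, hyV, hV⟩ := exists_affine_le hy
    refine ⟨V.1, hV, hyV, ?_⟩
    rw [← Hom.appₗ_res, map_zero, hη]
    obtain ⟨r, hr⟩ := exists_sec_eq V.1 ((idealι (i ≫ j)).appₗ V.1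
      ((idealModule (i ≫ j)).res hV s))
    refine toConormal_eq_zero (i ≫ j) (r := r) ?_ _ hr
    have h1 : r ∈ j.ker.ideal V := by
      rw [j.ker_apply]
      have h2 := hφ' V.1 ((idealModule (i ≫ j)).res hV s)
      rw [Hom.appₗ_res φ, hs0, map_zero, hr] at h2
      exact (sec (j ⁻¹ᵁ V.1)).map_eq_zero_iff.1 ((structureMap_appₗ j V.1 r).symm.trans
        (h2.symm.trans (map_zero ((idealι i).appₗ (j ⁻¹ᵁ V.1)))))
    rw [hker] at h1
    exact h1
  obtain ⟨c, hc⟩ := exists_preimage_hom j (Abelian.epiDesc φ η hker')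
  refine ⟨c, fun U s t h ↦ ?_⟩
  have h1 : t = φ.appₗ U s := idealModule_injective i _ (h.trans (hφ' U s).symm)
  have h2 : φ ≫ (Scheme.Modules.pushforward j).map c = η := by
    rw [hc, Abelian.comp_epiDesc]
  rw [h1]
  exact congrArg (fun a : _ ⟶ _ ↦ Hom.appₗ a U s) h2

end

section Extension

variable {V : X'.Modules} {N : X.Modules} (ν : V ⟶ (Scheme.Modules.pushforward i).obj N)

/-- The comparison of alternating forms on `N` and on an extension `V` of `N`. -/
def altComparison (n : ℕ) : (Scheme.Modules.pushforward i).obj (altSheaf N (structureSheaf X) n) ⟶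
    altSheaf V ((Scheme.Modules.pushforward i).obj (structureSheaf X)) n :=
  altPushforward i N (structureSheaf X) n ≫ altPrecomp ν _ n

/-- `ν` sends frames to frames. -/
def PreservesFrames : Prop := ∀ (U : X'.Opens) (n : ℕ) (b : Fin n → Γ(V, U)), IsFrame V U b →
  IsFrame N (i ⁻¹ᵁ U) fun k ↦ ν.appₗ U (b k)

variable {i ν}

lemma preservesFrames_of_iso (e : (Scheme.Modules.pullback i).obj V ≅ N) :
    PreservesFrames i (pullbackUnit i V ≫ (Scheme.Modules.pushforward i).map e.hom) :=
  fun U n b hb ↦ (isFrame_pullback i hb).map e.hom fun W _ ↦ bijective_of_isIso _ _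

/-- With values in functions on `X`, a form on `V` and a form on `N` are both given by arbitrary
values on corresponding frames. -/
lemma isIso_altComparison (hν : PreservesFrames i ν) (hV : V.LocallyFramed) (n : ℕ) :
    IsIso (altComparison i ν n) := by
  refine isIso_of_locally _ fun U x hx ↦ ?_
  obtain ⟨W, hW, hxW, r, b, hb⟩ := hV.exists_frame hx
  have hb' := hν W r b hb
  have hbas (s : Set.powersetCard (Fin r) n) :
      (fun k ↦ ν.appₗ W (hb.basis le_rfl (Set.powersetCard.ofFinEmbEquiv.symm s k))) =
        fun k ↦ hb'.basis le_rfl (Set.powersetCard.ofFinEmbEquiv.symm s k) := by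
    funext k
    exact (congrArg (ν.appₗ W) ((hb.basis_apply le_rfl _).trans (V.res_self _ _))).trans
      ((hb'.basis_apply le_rfl _).trans (N.res_self _ _)).symm
  refine ⟨W, hW, hxW, fun φ ψ h ↦ ?_, fun φ ↦ ?_⟩
  · refine hb'.altEval_injective (AlternatingMap.ext_powersetCard (hb'.basis le_rfl) fun s ↦ ?_)
    have h1 := congrArg (fun z ↦ altEval le_rfl z
      (fun k ↦ hb.basis le_rfl (Set.powersetCard.ofFinEmbEquiv.symm s k))) h
    refine Eq.trans ?_ (h1.trans ?_)
    · exact congrArg (altEval le_rfl φ) (hbas s).symm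
    · exact congrArg (altEval le_rfl ψ) (hbas s)
  · obtain ⟨ψ, hψ⟩ := hb'.exists_altEval_eq (T := structureSheaf X) (q := n) fun s ↦
      altEval le_rfl φ (fun k ↦ hb.basis le_rfl (Set.powersetCard.ofFinEmbEquiv.symm s k))
    refine ⟨ψ, hb.altEval_injective (AlternatingMap.ext_powersetCard (hb.basis le_rfl) fun s ↦ ?_)⟩
    refine Eq.trans ?_ (hψ s)
    exact congrArg (altEval le_rfl ψ) (hbas s)

end Extension

/-- Alternating `0`-forms are sections. -/
def altZero (V T : X.Modules) : T ⟶ altSheaf V T 0 :=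
  homOfAppₗ (fun U ↦
    { toFun t := altMk (fun W hW ↦ AlternatingMap.constOfIsEmpty Γ(X, W) Γ(V, W) (Fin 0)
          (T.res hW t)) fun W W' hW h m ↦ (T.res_res hW h t).symm
      map_add' s t := altSheaf_ext fun W hW m ↦ map_add (T.res hW) s t
      map_smul' r t := altSheaf_ext fun W hW m ↦ (T.res hW).map_smulₛₗ r t })
    fun h t ↦ altSheaf_ext fun W hW m ↦ T.res_res h hW t

lemma altEval_altZero (V T : X.Modules) {U W : X.Opens} (h : W ≤ U) (t : Γ(T, U))
    (m : Fin 0 → Γ(V, W)) : altEval h ((altZero V T).appₗ U t) m = T.res h t := rfl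

instance (V T : X.Modules) : IsIso (altZero V T) := isIso_of_bijective _ fun U ↦ by
  refine ⟨fun s t h ↦ ?_, fun φ ↦ ⟨altEval le_rfl φ Fin.elim0, altSheaf_ext fun W hW m ↦ ?_⟩⟩
  · have h1 := congrArg (fun z ↦ altEval le_rfl z Fin.elim0) h
    exact (T.res_self le_rfl s).symm.trans (h1.trans (T.res_self le_rfl t))
  · refine (altEval_altZero V T hW _ m).trans ((altEval_comp_res le_rfl hW φ _).symm.trans ?_)
    exact congrArg (altEval hW φ) (Subsingleton.elim _ _)

end AlgebraicGeometry.Scheme.Modules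

/-! ### Spliced resolutions and their iterated extension classes. -/

namespace CategoryTheory.Abelian

variable {C : Type u} [Category.{v} C] [Abelian C]

/-- A resolution `⋯ ⟶ K 1 ⟶ K 0 ⟶ Z 0 ⟶ 0`, split into short exact sequences. -/
structure SplicedResolution (K : ℕ → C) where
  /-- the syzygies -/
  Z : ℕ → C
  /-- the projections onto the syzygies -/
  z (n : ℕ) : K n ⟶ Z n
  /-- the inclusions of the syzygies -/
  w (n : ℕ) : Z (n + 1) ⟶ K n
  w_z (n : ℕ) : w n ≫ z n = 0
  shortExact (n : ℕ) : (ShortComplex.mk (w n) (z n) (w_z n)).ShortExact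

namespace SplicedResolution

section Construction

variable (K : ℕ → C) (d : ∀ n, K (n + 1) ⟶ K n) {Q : C} (ε : K 0 ⟶ Q)

/-- The syzygies of an exact sequence. -/
def syzygy : ℕ → C
  | 0 => Q
  | 1 => kernel ε
  | n + 2 => kernel (d n)

variable (h₀ : d 0 ≫ ε = 0) (h : ∀ n, d (n + 1) ≫ d n = 0)

/-- The spliced resolution given by an exact sequence. -/
def ofExact [Epi ε] (hε : (ShortComplex.mk (d 0) ε h₀).Exact)
    (hd : ∀ n, (ShortComplex.mk (d (n + 1)) (d n) (h n)).Exact) : SplicedResolution K where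
  Z := syzygy K d ε
  z
    | 0 => ε
    | 1 => kernel.lift ε (d 0) h₀
    | n + 2 => kernel.lift (d n) (d (n + 1)) (h n)
  w
    | 0 => kernel.ι ε
    | n + 1 => kernel.ι (d n)
  w_z
    | 0 => kernel.condition ε
    | 1 => (cancel_mono (kernel.ι ε)).1 (show (kernel.ι (d 0) ≫ kernel.lift ε (d 0) h₀) ≫
        kernel.ι ε = 0 ≫ kernel.ι ε by simp)
    | n + 2 => (cancel_mono (kernel.ι (d n))).1 (show (kernel.ι (d (n + 1)) ≫
        kernel.lift (d n) (d (n + 1)) (h n)) ≫ kernel.ι (d n) = 0 ≫ kernel.ι (d n) by simp)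
  shortExact
    | 0 => .mk' (ShortComplex.exact_kernel ε) (show Mono (kernel.ι ε) from inferInstance) ‹_›
    | 1 => by
      have h1 : Epi (kernel.lift ε (d 0) h₀) := (ShortComplex.exact_iff_epi_kernel_lift _).1 hε
      refine .mk' ?_ (show Mono (kernel.ι (d 0)) from inferInstance) h1
      refine ShortComplex.exact_of_f_is_kernel _ (isKernelOfComp (kernel.ι ε) _
        (kernelIsKernel (d 0)) _ (kernel.lift_ι _ _ _))
    | n + 2 => by
      have h1 : Epi (kernel.lift (d n) (d (n + 1)) (h n)) :=
        (ShortComplex.exact_iff_epi_kernel_lift _).1 (hd n)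
      refine .mk' ?_ (show Mono (kernel.ι (d (n + 1))) from inferInstance) h1
      refine ShortComplex.exact_of_f_is_kernel _ (isKernelOfComp (kernel.ι (d n)) _
        (kernelIsKernel (d (n + 1))) _ (kernel.lift_ι _ _ _))

lemma ofExact_z_w [Epi ε] (hε : (ShortComplex.mk (d 0) ε h₀).Exact)
    (hd : ∀ n, (ShortComplex.mk (d (n + 1)) (d n) (h n)).Exact) (n : ℕ) :
    (ofExact K d ε h₀ h hε hd).z (n + 1) ≫ (ofExact K d ε h₀ h hε hd).w n = d n := by
  cases n with
  | zero => exact kernel.lift_ι _ _ _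
  | succ n => exact kernel.lift_ι _ _ _

end Construction

variable {K : ℕ → C} (R : SplicedResolution K)

instance (n : ℕ) : Epi (R.z n) := (R.shortExact n).epi_g

/-- The differential. -/
def d (n : ℕ) : K (n + 1) ⟶ K n := R.z (n + 1) ≫ R.w n

variable [HasExt.{w} C]

/-- The iterated extension class of a resolution. -/
def cls : ∀ n : ℕ, Ext (R.Z 0) (R.Z n) n
  | 0 => Ext.mk₀ (𝟙 _)
  | n + 1 => (cls n).comp (R.shortExact n).extClass rfl

section Acyclic

variable {T : C} (hT : ∀ n k (x : Ext (K n) T (k + 1)), x = 0)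
  (hd : ∀ n (f : K n ⟶ T), R.d n ≫ f = 0)

include hd in
lemma w_comp (n : ℕ) (f : K n ⟶ T) : R.w n ≫ f = 0 := by
  rw [← cancel_epi (R.z (n + 1)), comp_zero]
  exact (Category.assoc _ _ _).symm.trans (hd n f)

include hT hd in
-- The connecting map is surjective since the middle term is acyclic. Its kernel comes from `Ext (K
-- n) T k`, which vanishes for `k > 0`, while for `k = 0` every morphism from `K n` to `T` dies on
-- the syzygy by `w_comp`.
lemma extClass_comp_bijective (n k : ℕ) :
    Function.Bijective fun x : Ext (R.Z (n + 1)) T k ↦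
      (R.shortExact n).extClass.comp x (add_comm 1 k) := by
  refine ⟨fun x y h ↦ ?_, fun y ↦ ?_⟩
  · rw [← sub_eq_zero]
    have h1 : (R.shortExact n).extClass.comp (x - y) (add_comm 1 k) = 0 := by
      rw [sub_eq_add_neg, Ext.comp_add, Ext.comp_neg, ← sub_eq_add_neg, sub_eq_zero]
      exact h
    obtain ⟨z, hz⟩ := Ext.contravariant_sequence_exact₁ (R.shortExact n) T (x - y) (add_comm 1 k) h1
    rw [← hz]
    cases k with
    | zero =>
      obtain ⟨f, rfl⟩ := (Ext.mk₀_bijective _ _).2 z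
      rw [Ext.mk₀_comp_mk₀]
      exact (congrArg Ext.mk₀ (R.w_comp hd n f)).trans (Ext.mk₀_zero _ _)
    | succ k => rw [hT n k z, Ext.comp_zero]
  · exact Ext.contravariant_sequence_exact₃ (R.shortExact n) T y (hT n k _) (add_comm 1 k)

include hT hd in
lemma cls_comp_bijective (n k m : ℕ) (h : n + k = m) :
    Function.Bijective fun x : Ext (R.Z n) T k ↦ (R.cls n).comp x h := by
  induction n generalizing k m with
  | zero =>
    obtain rfl : k = m := by omega
    convert! Function.bijective_id
    exact Ext.mk₀_id_comp _
  | succ n ih =>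
    have h1 := (ih (k + 1) m (by omega)).comp (R.extClass_comp_bijective hT hd n k)
    convert! h1 using 1
    funext x
    exact Ext.comp_assoc (R.cls n) (R.shortExact n).extClass x rfl (add_comm 1 k) (by omega)

include hd in
lemma z_comp_bijective (n : ℕ) :
    Function.Bijective fun f : R.Z n ⟶ T ↦ R.z n ≫ f :=
  ⟨fun f g h ↦ (cancel_epi _).1 h, fun f ↦
    ⟨(R.shortExact n).exact.desc f (R.w_comp hd n f), (R.shortExact n).exact.g_desc _ _⟩⟩

end Acyclic

section Comparison

variable {S : ℕ → ShortComplex C} (hS : ∀ n, (S n).ShortExact) (p : ∀ n, (S n).X₁ ⟶ (S (n + 1)).X₃)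
  (x : ∀ n, Ext (S 0).X₃ (S n).X₃ n) (hx₀ : x 0 = Ext.mk₀ (𝟙 _))
  (hx : ∀ n, x (n + 1) = (x n).comp ((hS n).extClass.comp (Ext.mk₀ (p n)) (add_zero 1)) rfl)
  (t : ∀ n, K n ⟶ (S n).X₂) (m : ∀ n, K (n + 1) ⟶ (S n).X₁)
  (hm : ∀ n, m n ≫ (S n).f = R.d n ≫ t n)
  (hp : ∀ n, m n ≫ p n = (n + 1) • (t (n + 1) ≫ (S (n + 1)).g))
  (θ : ∀ n, R.Z n ⟶ (S n).X₃) (hθ : ∀ n, R.z n ≫ θ n = t n ≫ (S n).g)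

include hx₀ hx hm hp hθ in
-- Each step is a morphism from a syzygy sequence to `S n`, so extension classes correspond by
-- naturality. Passing on through `p n` costs a factor `n + 1` by `hp`, and these factors multiply
-- to the factorial.
lemma comp_cls (n : ℕ) :
    (Ext.mk₀ (θ 0)).comp (x n) (zero_add n) =
      n.factorial • (R.cls n).comp (Ext.mk₀ (θ n)) (add_zero n) := by
  induction n with
  | zero => rw [hx₀, Nat.factorial_zero, one_smul, Ext.comp_mk₀_id, cls, Ext.mk₀_id_comp]
  | succ n ih =>
    have := (hS n).mono_f
    have hμ : (R.w n ≫ t n) ≫ (S n).g = 0 := by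
      rw [Category.assoc, ← hθ, ← Category.assoc, R.w_z, zero_comp]
    -- The map induced on the kernels: `t n` restricted to the syzygy vanishes in the quotient.
    -- Preceded by the projection of `K (n + 1)`, it is `m n`.
    let μ : R.Z (n + 1) ⟶ (S n).X₁ := (hS n).exact.lift (R.w n ≫ t n) hμ
    have hμ' : μ ≫ (S n).f = R.w n ≫ t n := (hS n).exact.lift_f _ _
    have hzμ : R.z (n + 1) ≫ μ = m n := by
      rw [← cancel_mono (S n).f, hm, Category.assoc, hμ', ← Category.assoc]
      rfl
    have hμp : μ ≫ p n = (n + 1) • θ (n + 1) := by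
      rw [← cancel_epi (R.z (n + 1)), ← Category.assoc, hzμ, hp, Preadditive.comp_nsmul, hθ]
    let φ : ShortComplex.mk (R.w n) (R.z n) (R.w_z n) ⟶ S n :=
      { τ₁ := μ, τ₂ := t n, τ₃ := θ n, comm₁₂ := hμ', comm₂₃ := (hθ n).symm }
    have hnat := ShortComplex.ShortExact.extClass_naturality (R.shortExact n) (hS n) φ
    have e1 : (Ext.mk₀ (θ 0)).comp (x (n + 1)) (zero_add (n + 1)) =
        ((Ext.mk₀ (θ 0)).comp (x n) (zero_add n)).comp
          ((hS n).extClass.comp (Ext.mk₀ (p n)) (add_zero 1)) rfl := by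
      rw [hx, Ext.comp_assoc _ _ _ (zero_add n) rfl (by omega)]
    have e2 : ((R.cls n).comp (Ext.mk₀ (θ n)) (add_zero n)).comp
        ((hS n).extClass.comp (Ext.mk₀ (p n)) (add_zero 1)) rfl =
        (n + 1) • (R.cls (n + 1)).comp (Ext.mk₀ (θ (n + 1))) (add_zero (n + 1)) := by
      have e3 : (Ext.mk₀ (θ n)).comp ((hS n).extClass.comp (Ext.mk₀ (p n)) (add_zero 1))
          (zero_add 1) = (R.shortExact n).extClass.comp ((n + 1) • Ext.mk₀ (θ (n + 1)))
            (add_zero 1) := by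
        rw [← Ext.comp_assoc _ _ _ (zero_add 1) (add_zero 1) (by omega)]
        have h3 : (Ext.mk₀ (θ n)).comp (hS n).extClass (zero_add 1) =
          (R.shortExact n).extClass.comp (Ext.mk₀ μ) (add_zero 1) := hnat.symm
        rw [h3, Ext.comp_assoc _ _ _ (add_zero 1) (add_zero 0) (by omega), Ext.mk₀_comp_mk₀, hμp]
        congr 1
        exact map_nsmul Ext.addEquiv₀.symm _ _
      rw [Ext.comp_assoc _ _ _ (add_zero n) (zero_add 1) (by omega), e3,
        ← Ext.comp_assoc _ _ _ rfl (add_zero 1) (by omega)]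
      exact map_nsmul ((R.cls (n + 1)).precomp _ (add_zero (n + 1))) _ _
    rw [e1, ih]
    refine Eq.trans (b := n.factorial • (((R.cls n).comp (Ext.mk₀ (θ n)) (add_zero n)).comp
        ((hS n).extClass.comp (Ext.mk₀ (p n)) (add_zero 1)) rfl)) ?_ ?_
    · exact map_nsmul (((hS n).extClass.comp (Ext.mk₀ (p n)) (add_zero 1)).postcomp _ rfl) _ _
    · rw [e2, ← mul_smul, Nat.factorial_succ, mul_comm]

end Comparison

end SplicedResolution

end CategoryTheory.Abelian

/-! ### Regular sequences in terms of partial ideals. -/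

namespace AlternatingMap

variable {R : Type*} [CommRing R] {c : ℕ} {f : Fin c → R}

lemma partialIdeal_eq_ofList (k : ℕ) :
    partialIdeal f k = Ideal.ofList ((List.ofFn f).take k) := by
  refine congrArg Ideal.span (Set.ext fun r ↦ ?_)
  simp only [Set.mem_image, Set.mem_ofPred_eq]
  constructor
  · rintro ⟨i, hi, rfl⟩
    refine List.mem_take_iff_getElem.2 ⟨i, by simpa using hi, by simp⟩
  · intro hr
    obtain ⟨i, hi, rfl⟩ := List.mem_take_iff_getElem.1 hr
    simp only [List.length_ofFn, lt_min_iff] at hi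
    exact ⟨⟨i, hi.2⟩, hi.1, by simp⟩

lemma mem_partialIdeal_of_isWeaklyRegular
    (hf : RingTheory.Sequence.IsWeaklyRegular R (List.ofFn f)) (k : Fin c) (r : R)
    (hr : f k * r ∈ partialIdeal f k) : r ∈ partialIdeal f k := by
  rw [RingTheory.Sequence.isWeaklyRegular_iff] at hf
  have h1 := hf k.1 (by simp)
  have h2 : Ideal.ofList (List.take k.1 (List.ofFn f)) • (⊤ : Submodule R R) =
      partialIdeal f k := by
    rw [partialIdeal_eq_ofList, smul_eq_mul]
    exact Ideal.mul_top _
  rw [h2, List.getElem_ofFn] at h1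
  have h3 := @h1 (Submodule.Quotient.mk r) 0 (by
    change f k • Submodule.Quotient.mk r = f k • 0
    rw [smul_zero, ← Submodule.Quotient.mk_smul, Submodule.Quotient.mk_eq_zero]
    exact hr)
  rwa [Submodule.Quotient.mk_eq_zero] at h3

end AlternatingMap

/-! ### The Koszul complex as sheaves of alternating forms. -/

namespace AlgebraicGeometry.Scheme.Modules

variable {Z : Scheme.{u}}

lemma supportedOn_top (T : Z.Modules) : T.SupportedOn ⊤ := fun W ↦ by
  have h : W ≤ W ⊓ ⊤ := le_inf le_rfl le_top
  exact Function.bijective_iff_has_inverse.2 ⟨T.res h, fun x ↦ by rw [res_res, res_self],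
    fun x ↦ by rw [res_res, res_self]⟩

/-- Maps from a module with a global frame are families of global sections, so they lift along maps
surjective on sections. Applied to the terms of the Koszul complex, this is the acyclicity that a
resolution needs. -/
lemma IsFrame.ext_eq_zero {M T : Z.Modules} {ι : Type*} {b : ι → Γ(M, ⊤)} (hb : IsFrame M ⊤ b)
    (hT : T.IsFlasque) (n : ℕ) (x : Abelian.Ext M T (n + 1)) : x = 0 := by
  refine ext_eq_zero_of_isFlasque M (fun P Q g hg h ↦ ?_) T hT n x
  choose t ht using fun i ↦ hg ⊤ (h.appₗ ⊤ (b i))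
  obtain ⟨h', hh'⟩ := hb.hom_surjective (supportedOn_top P) t
  refine ⟨h', hb.hom_injective (supportedOn_top Q) fun i ↦ ?_⟩
  rw [Hom.comp_appₗ, hh']
  exact ht i

section Contraction

variable {M T : Z.Modules} (v : Γ(M, ⊤)) (n : ℕ)

lemma res_comp_vecCons {U W : Z.Opens} (h : W ≤ U) (x : Γ(M, U)) (m : Fin n → Γ(M, U)) :
    M.res h ∘ Matrix.vecCons x m = Matrix.vecCons (M.res h x) (M.res h ∘ m) := by
  funext k
  cases k using Fin.cases <;> rfl

/-- Contraction of alternating forms with a global section. -/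
def altContract : altSheaf M T (n + 1) ⟶ altSheaf M T n :=
  homOfAppₗ (fun U ↦
    { toFun φ := altMk (fun W hW ↦ (altEval hW φ).curryLeft (M.res le_top v))
        fun W W' hW h m ↦ by
          rw [AlternatingMap.curryLeft_apply_apply, AlternatingMap.curryLeft_apply_apply,
            ← altEval_comp_res hW h, res_comp_vecCons, res_res]
      map_add' φ ψ := rfl
      map_smul' r φ := rfl }) fun _ _ ↦ rfl

lemma altEval_altContract {U W : Z.Opens} (h : W ≤ U) (φ : Γ(altSheaf M T (n + 1), U)) :
    altEval h ((altContract v n).appₗ U φ) = (altEval h φ).curryLeft (M.res le_top v) := rfl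

lemma altContract_comp :
    altContract v (n + 1) ≫ altContract v n = (0 : altSheaf M T (n + 2) ⟶ altSheaf M T n) :=
  hom_extₗ fun U φ ↦ altSheaf_ext fun W h m ↦ by
    rw [Hom.comp_appₗ, altEval_altContract, altEval_altContract, AlternatingMap.curryLeft_same]
    rfl

end Contraction

section Koszul

variable {c : ℕ}

variable (Z c) in
/-- The standard frame of the free module. -/
def stdFrame : Fin c → Γ(freeModule Z c, ⊤) := (exists_isFrame_freeModule c).choose

lemma isFrame_stdFrame : IsFrame (freeModule Z c) ⊤ (stdFrame Z c) :=
  (exists_isFrame_freeModule c).choose_spec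

variable (Z c) in
/-- The terms of the Koszul complex, as sheaves of alternating forms. -/
abbrev koszul (n : ℕ) : Z.Modules := altSheaf (freeModule Z c) (structureSheaf Z) n

variable (a : Fin c → Γ(Z, ⊤))

/-- The section of the free module with coordinates `a`. -/
def koszulVector : Γ(freeModule Z c, ⊤) := ∑ k, a k • stdFrame Z c k

/-- The differential of the Koszul complex: contraction with the vector `a`. -/
abbrev koszulD (n : ℕ) : koszul Z c (n + 1) ⟶ koszul Z c n := altContract (koszulVector a) n

lemma res_koszulVector (W : Z.Opens) :
    (freeModule Z c).res (le_top : W ≤ ⊤) (koszulVector a) =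
      ∑ k, resₒ (le_top : W ≤ ⊤) (a k) • (isFrame_stdFrame (Z := Z) (c := c)).basis (le_top : W ≤ ⊤) k := by
  rw [koszulVector, map_sum]
  refine Finset.sum_congr rfl fun k _ ↦ ?_
  rw [map_smulₛₗ, IsFrame.basis_apply]

lemma partialVector_eq (W : Z.Opens) :
    AlternatingMap.partialVector ((isFrame_stdFrame (Z := Z) (c := c)).basis (le_top : W ≤ ⊤))
      (fun k ↦ resₒ le_top (a k)) c = (freeModule Z c).res le_top (koszulVector a) := by
  rw [AlternatingMap.partialVector_last, res_koszulVector]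

lemma partialIdeal_last {R : Type*} [CommRing R] (f : Fin c → R) :
    AlternatingMap.partialIdeal f c = Ideal.span (Set.range f) := by
  rw [AlternatingMap.partialIdeal, ← Set.image_univ]
  congr 2
  ext k
  simp

/-- An alternating form with values in `𝒪` on a framed open set. -/
def koszulMk {n : ℕ} (W : Z.Opens)
    (φ : Γ(freeModule Z c, W) [⋀^Fin n]→ₗ[Γ(Z, W)] Γ(Z, W)) : Γ(koszul Z c n, W) :=
  (isFrame_stdFrame.res (le_top : W ≤ ⊤)).altEquiv.symm ((sec W).toLinearMap.compAlternatingMap φ)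

lemma altEval_koszulMk {n : ℕ} (W : Z.Opens)
    (φ : Γ(freeModule Z c, W) [⋀^Fin n]→ₗ[Γ(Z, W)] Γ(Z, W)) :
    altEval le_rfl (koszulMk W φ) = (sec W).toLinearMap.compAlternatingMap φ :=
  IsFrame.altEval_altEquiv_symm _ _

lemma exists_koszulMk {n : ℕ} {W : Z.Opens} (φ : Γ(koszul Z c n, W)) :
    ∃ f, φ = koszulMk W f := by
  refine ⟨(sec W).symm.toLinearMap.compAlternatingMap (altEval le_rfl φ), ?_⟩
  refine (isFrame_stdFrame.res (le_top : W ≤ ⊤)).altEval_injective ?_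
  refine Eq.trans ?_ (altEval_koszulMk W _).symm
  exact AlternatingMap.ext fun m ↦ ((sec W).apply_symm_apply _).symm

lemma koszulD_koszulMk {n : ℕ} {W : Z.Opens}
    (f : Γ(freeModule Z c, W) [⋀^Fin (n + 1)]→ₗ[Γ(Z, W)] Γ(Z, W)) :
    (koszulD a n).appₗ W (koszulMk W f) =
      koszulMk W (f.curryLeft ((freeModule Z c).res le_top (koszulVector a))) := by
  refine (isFrame_stdFrame.res (le_top : W ≤ ⊤)).altEval_injective ?_
  refine (altEval_altContract _ n le_rfl (koszulMk W f)).trans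
    (Eq.trans ?_ (altEval_koszulMk W _).symm)
  rw [altEval_koszulMk]
  rfl

lemma koszulMk_injective {n : ℕ} (W : Z.Opens) :
    Function.Injective (koszulMk (c := c) (n := n) W) := fun f g h ↦ by
  have h1 := congrArg (altEval le_rfl) h
  rw [altEval_koszulMk, altEval_koszulMk] at h1
  exact AlternatingMap.ext fun m ↦ (sec W).injective (DFunLike.congr_fun h1 m)

lemma koszulMk_zero {n : ℕ} (W : Z.Opens) : koszulMk (c := c) (n := n) W 0 = 0 := by
  refine (isFrame_stdFrame.res (le_top : W ≤ ⊤)).altEval_injective ?_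
  exact (altEval_koszulMk W _).trans (AlternatingMap.ext fun m ↦ map_zero (sec W))

variable (hreg : ∀ W : Z.affineOpens, RingTheory.Sequence.IsWeaklyRegular Γ(Z, W.1)
  (List.ofFn fun k ↦ resₒ (le_top : W.1 ≤ ⊤) (a k)))

include hreg in
lemma exists_koszulD (n : ℕ) (W : Z.affineOpens) (φ : Γ(koszul Z c (n + 1), W.1))
    (hφ : (koszulD a n).appₗ W.1 φ = 0) : ∃ ψ, (koszulD a (n + 1)).appₗ W.1 ψ = φ := by
  obtain ⟨f, rfl⟩ := exists_koszulMk φ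
  rw [koszulD_koszulMk, ← koszulMk_zero] at hφ
  have h1 := koszulMk_injective _ hφ
  rw [← partialVector_eq] at h1
  obtain ⟨g, -, hg⟩ := AlternatingMap.exists_curryLeft_succ _
    (AlternatingMap.mem_partialIdeal_of_isWeaklyRegular (hreg W)) c le_rfl n f
    -- With all `c` coordinates admitted, the support condition is empty.
    (fun k hk ↦ absurd k.2 (by omega)) h1
  refine ⟨koszulMk W.1 g, ?_⟩
  rw [koszulD_koszulMk, ← partialVector_eq, hg]

include hreg in
lemma koszul_exact (n : ℕ) :
    (ShortComplex.mk (koszulD a (n + 1)) (koszulD a n) (altContract_comp _ n)).Exact := by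
  refine exact_of_locally _ _ _ fun U φ hφ x hx ↦ ?_
  obtain ⟨W, hxW, hW⟩ := exists_affine_le hx
  refine ⟨W.1, hW, hxW, exists_koszulD a hreg n W _ ?_⟩
  rw [Hom.appₗ_res, hφ, map_zero]

lemma exists_koszulD_zero (W : Z.Opens) (f : Γ(freeModule Z c, W) [⋀^Fin 0]→ₗ[Γ(Z, W)] Γ(Z, W))
    (hf : f ![] ∈ Ideal.span (Set.range fun k ↦ resₒ (le_top : W ≤ ⊤) (a k))) :
    ∃ ψ, (koszulD a 0).appₗ W ψ = koszulMk W f := by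
  rw [← partialIdeal_last] at hf
  obtain ⟨g, -, hg⟩ := AlternatingMap.exists_curryLeft_zero
    (b := (isFrame_stdFrame (Z := Z) (c := c)).basis (le_top : W ≤ ⊤)) _ c le_rfl f hf
  refine ⟨koszulMk W g, ?_⟩
  rw [koszulD_koszulMk, ← partialVector_eq, hg]

include hreg in
/-- The coefficients of a relation between the elements of a regular sequence lie in the ideal
generated by the sequence. -/
lemma mem_span_of_relation (W : Z.affineOpens) (r : Fin c → Γ(Z, W.1))
    (hr : ∑ k, r k * resₒ (le_top : W.1 ≤ ⊤) (a k) = 0) (k : Fin c) :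
    r k ∈ Ideal.span (Set.range fun k ↦ resₒ (le_top : W.1 ≤ ⊤) (a k)) := by
  let b := (isFrame_stdFrame (Z := Z) (c := c)).basis (le_top : W.1 ≤ ⊤)
  let l : Γ(freeModule Z c, W.1) →ₗ[Γ(Z, W.1)] Γ(Z, W.1) := b.constr ℕ r
  -- The coefficients of the relation form a linear form, and the relation says that it is closed.
  -- By exactness it is the contraction of a 2-form with the vector of the sequence, so its values
  -- lie in the ideal.
  let f := AlternatingMap.ofSubsingleton Γ(Z, W.1) Γ(freeModule Z c, W.1) Γ(Z, W.1) (0 : Fin 1) l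
  have hf (x) (m) : f.curryLeft x m = l x := rfl
  have h1 : f.curryLeft (AlternatingMap.partialVector b (fun k ↦ resₒ le_top (a k)) c) = 0 := by
    refine AlternatingMap.ext fun m ↦ (hf _ m).trans ?_
    rw [AlternatingMap.partialVector_last, map_sum]
    refine Eq.trans (Finset.sum_congr rfl fun k _ ↦ ?_) hr
    rw [_root_.map_smul, Module.Basis.constr_basis, smul_eq_mul, mul_comm]
  obtain ⟨g, -, hg⟩ := AlternatingMap.exists_curryLeft_succ _
    (AlternatingMap.mem_partialIdeal_of_isWeaklyRegular (hreg W)) c le_rfl 0 f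
    (fun k hk ↦ absurd k.2 (by omega)) h1
  have h2 : r k = g.curryLeft (AlternatingMap.partialVector b (fun k ↦ resₒ le_top (a k)) c)
      (fun _ ↦ b k) := by
    rw [hg]
    exact (b.constr_basis ℕ r k).symm
  rw [h2, AlternatingMap.partialVector_last, map_sum]
  simp only [_root_.map_smul]
  have h3 (s : Finset (Fin c)) (m : Fin 1 → Γ(freeModule Z c, W.1)) :
      (∑ x ∈ s, resₒ (le_top : W.1 ≤ ⊤) (a x) • g.curryLeft (b x)) m ∈
        Ideal.span (Set.range fun k ↦ resₒ (le_top : W.1 ≤ ⊤) (a k)) := by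
    induction s using Finset.induction_on with
    | empty => exact Ideal.zero_mem _
    | insert x s hx ih =>
      rw [Finset.sum_insert hx, AlternatingMap.add_apply, AlternatingMap.smul_apply]
      exact Ideal.add_mem _ (Ideal.mul_mem_right _ _ (Ideal.subset_span ⟨x, rfl⟩)) ih
  exact h3 _ _

end Koszul

end AlgebraicGeometry.Scheme.Modules

/-! ### Charts on which the ideal is generated by a regular sequence. -/

namespace AlgebraicGeometry.Scheme.Modules

variable {X Y Z : Scheme.{u}}

section Restrict

variable (g : Z ⟶ Y) [IsOpenImmersion g]

/-- Functions on an open subscheme, as functions on its image. -/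
abbrev imgₒ (W : Z.Opens) : Γ(Z, W) →+* Γ(Y, g ''ᵁ W) := (g.appIso W).inv.hom

lemma resₒ_imgₒ {U W : Z.Opens} (h : W ≤ U) (r : Γ(Z, U)) :
    resₒ (g.image_mono h) (imgₒ g U r) = imgₒ g W (resₒ h r) :=
  (ConcreteCategory.congr_hom (g.appIso_inv_naturality (homOfLE h).op) r).symm

lemma imgₒ_bijective (W : Z.Opens) : Function.Bijective (imgₒ g W) :=
  ConcreteCategory.bijective_of_isIso (g.appIso W).inv

lemma IsFlasque.restrict {M : Y.Modules} (hM : M.IsFlasque) : (M.restrict g).IsFlasque := by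
  intro U V i
  exact hM (g.image_mono i)

lemma isIso_unit_of_supportedOn {P : Y.Modules} (hP : P.SupportedOn (g ''ᵁ ⊤)) :
    IsIso ((restrictAdjunction g).unit.app P) := isIso_of_bijective _ fun W ↦ by
  have h1 : g ''ᵁ (g ⁻¹ᵁ W) ≤ W := g.image_preimage_le W
  have h2 : W ⊓ g ''ᵁ ⊤ ≤ g ''ᵁ (g ⁻¹ᵁ W) := by
    rintro x ⟨hx, z, -, rfl⟩
    exact ⟨z, hx, rfl⟩
  have h3 : g ''ᵁ (g ⁻¹ᵁ W) ≤ W ⊓ g ''ᵁ ⊤ := le_inf h1 (g.image_mono le_top)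
  have h4 : Function.Bijective (P.res h3) := Function.bijective_iff_has_inverse.2
    ⟨P.res h2, fun x ↦ by rw [res_res, res_self], fun x ↦ by rw [res_res, res_self]⟩
  have h5 : ⇑(P.res h3) ∘ P.res inf_le_left = P.res h1 := funext fun x ↦ P.res_res _ _ x
  have h6 : Function.Bijective (P.res h1) := h5 ▸ h4.comp (hP W)
  exact h6

lemma exists_restrict_map_eq {M P : Y.Modules} (hP : P.SupportedOn (g ''ᵁ ⊤))
    (ψ : M.restrict g ⟶ P.restrict g) : ∃ φ : M ⟶ P, (restrictFunctor g).map φ = ψ := by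
  have := isIso_unit_of_supportedOn g hP
  let adj := restrictAdjunction g
  refine ⟨adj.homEquiv _ _ ψ ≫ inv (adj.unit.app P), (adj.homEquiv _ _).injective ?_⟩
  rw [adj.homEquiv_unit _ _ ((restrictFunctor g).map _)]
  refine (adj.unit.naturality _).symm.trans ?_
  exact (Category.assoc _ _ _).trans ((congrArg _ (IsIso.inv_hom_id _)).trans (Category.comp_id _))

/-- A module supported on the chart is the direct image of its restriction, so the statement for
direct images of flasque modules applies. -/
lemma ext_restrict_bijective_of_supportedOn (M P : Y.Modules) (hP : P.SupportedOn (g ''ᵁ ⊤))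
    (hP' : P.IsFlasque) (n : ℕ) :
    Function.Bijective ((restrictFunctor g).mapExtAddHom M P n) := by
  have := isIso_unit_of_supportedOn g hP
  let u := (restrictAdjunction g).unit.app P
  have hpost {C : Type _} [Category.{u} C] [Abelian C] [HasExt.{u + 1} C] (A : C) {B B' : C}
      (e : B ⟶ B') [IsIso e] : Function.Bijective fun x : Abelian.Ext A B n ↦
        x.comp (Abelian.Ext.mk₀ e) (add_zero n) := by
    refine Function.bijective_iff_has_inverse.2
      ⟨fun x ↦ x.comp (Abelian.Ext.mk₀ (inv e)) (add_zero n), fun x ↦ ?_, fun x ↦ ?_⟩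
    · dsimp only
      rw [Abelian.Ext.comp_assoc _ _ _ _ (add_zero 0) (by omega), Abelian.Ext.mk₀_comp_mk₀,
        IsIso.hom_inv_id, Abelian.Ext.comp_mk₀_id]
    · dsimp only
      rw [Abelian.Ext.comp_assoc _ _ _ _ (add_zero 0) (by omega), Abelian.Ext.mk₀_comp_mk₀,
        IsIso.inv_hom_id, Abelian.Ext.comp_mk₀_id]
  have h1 := (ext_restrict_bijective g M _ (hP'.restrict g) n).comp (hpost M u)
  refine (Function.Bijective.of_comp_iff' (hpost (M.restrict g) ((restrictFunctor g).map u))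
    ((restrictFunctor g).mapExtAddHom M P n)).1 ?_
  convert! h1 using 1
  funext x
  refine Eq.trans ?_ (Abelian.Ext.mapExactFunctor_comp _ _ _ _).symm
  rw [Abelian.Ext.mapExactFunctor_mk₀]
  rfl

end Restrict

section Chart

variable (f : X ⟶ Y) [IsClosedImmersion f] (g : Z ⟶ Y) [IsOpenImmersion g] {c : ℕ}
  (a : Fin c → Γ(Z, ⊤))

/-- On the affine open subscheme `Z` of `Y`, the ideal of `X` is generated by the regular
sequence `a`. -/
structure IsKoszulChart : Prop where
  affine : IsAffineOpen (⊤ : Z.Opens)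
  regular (W : Z.affineOpens) : RingTheory.Sequence.IsWeaklyRegular Γ(Z, W.1)
    (List.ofFn fun k ↦ resₒ (le_top : W.1 ≤ ⊤) (a k))
  mem_iff (W : Z.affineOpens) (r : Γ(Z, W.1)) : f.app (g ''ᵁ W.1) (imgₒ g W.1 r) = 0 ↔
    r ∈ Ideal.span (Set.range fun k ↦ resₒ (le_top : W.1 ≤ ⊤) (a k))

lemma exists_isKoszulChart {x : X} (h : HasCodimAt f x c) {O : Y.Opens} (hO : f x ∈ O) :
    ∃ (Z : Scheme.{u}) (g : Z ⟶ Y) (_ : IsOpenImmersion g) (a : Fin c → Γ(Z, ⊤)),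
      IsKoszulChart f g a ∧ f x ∈ g ''ᵁ ⊤ ∧ g ''ᵁ ⊤ ≤ O := by
  obtain ⟨U, hxU, rs, hrs, rfl, hI⟩ := h
  obtain ⟨D, hxD, hD⟩ := exists_affine_le (show f x ∈ U.1 ⊓ O from ⟨hxU, hO⟩)
  let g := D.1.ι
  have hle (W : D.1.toScheme.Opens) : W ≤ g ⁻¹ᵁ U.1 := fun z _ ↦ (hD z.2).1
  have hW (W : D.1.toScheme.Opens) (r : Γ(Y, U.1)) :
      resₒ (le_top : W ≤ ⊤) (g.appLE U.1 ⊤ (hle ⊤) r) = g.appLE U.1 W (hle W) r :=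
    ConcreteCategory.congr_hom (g.appLE_map (hle ⊤) (homOfLE (le_top : W ≤ ⊤)).op) r
  have : IsAffine D.1.toScheme := D.2
  refine ⟨D.1.toScheme, g, inferInstance, fun k ↦ g.appLE U.1 ⊤ (hle ⊤) (rs.get k),
    ⟨isAffineOpen_top _, fun W ↦ ?_, fun W r ↦ ?_⟩, ⟨⟨f x, hxD⟩, trivial, rfl⟩, ?_⟩
  -- Restriction to a smaller affine open is flat, which preserves weak regularity. Regularity
  -- proper may be lost, because the quotient is zero where `W` misses `X`.
  · have hflat := g.flat_appLE U.2 W.2 (hle W.1)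
    algebraize [(g.appLE U.1 W.1 (hle W.1)).hom]
    have h1 := RingTheory.Sequence.IsWeaklyRegular.of_flat (S := Γ(D.1.toScheme, W.1))
      hrs.toIsWeaklyRegular
    convert! h1 using 1
    refine List.ext_getElem (by simp) fun k h1 h2 ↦ ?_
    rw [List.getElem_ofFn, List.getElem_map]
    exact hW W.1 _
  · let W' : Y.affineOpens := ⟨g ''ᵁ W.1, W.2.image_of_isOpenImmersion g⟩
    have hle' : W' ≤ U := by
      rintro y ⟨z, -, rfl⟩
      exact (hD z.2).1
    have h1 : f.app W'.1 (imgₒ g W.1 r) = 0 ↔ imgₒ g W.1 r ∈ f.ker.ideal W' := by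
      rw [f.ker_apply]
      rfl
    refine h1.trans ?_
    rw [← f.ker.map_ideal hle', hI, Ideal.map_ofList, Ideal.ofList]
    have h2 : Ideal.span {r | r ∈ List.map (Y.presheaf.map (homOfLE hle').op).hom rs} =
        Ideal.map (imgₒ g W.1) (Ideal.span (Set.range fun k ↦ resₒ (le_top : W.1 ≤ ⊤)
          (g.appLE U.1 ⊤ (hle ⊤) (rs.get k)))) := by
      rw [Ideal.map_span, ← Set.range_comp]
      congr 1
      ext r'
      simp only [List.mem_map, Set.mem_ofPred_eq, Set.mem_range, Function.comp_apply]
      have h3 (k) : imgₒ g W.1 (resₒ le_top (g.appLE U.1 ⊤ (hle ⊤) (rs.get k))) =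
          (Y.presheaf.map (homOfLE hle').op).hom (rs.get k) := by
        rw [hW]
        exact ConcreteCategory.congr_hom (g.appLE_appIso_inv (hle W.1)) _
      constructor
      · rintro ⟨b, hb, rfl⟩
        obtain ⟨k, rfl⟩ := List.get_of_mem hb
        exact ⟨k, h3 k⟩
      · rintro ⟨k, rfl⟩
        exact ⟨rs.get k, List.get_mem _ _, (h3 k).symm⟩
    rw [h2]
    have h4 := Ideal.comap_map_of_bijective (imgₒ g W.1) (imgₒ_bijective g W.1)
      (I := Ideal.span (Set.range fun k ↦ resₒ (le_top : W.1 ≤ ⊤)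
          (g.appLE U.1 ⊤ (hle ⊤) (rs.get k))))
    rw [← Ideal.mem_comap, h4]
  · rintro y ⟨z, -, rfl⟩
    exact (hD z.2).2

namespace IsKoszulChart

variable {f g a} (h : IsKoszulChart f g a)

include h

lemma app_imgₒ (k : Fin c) : f.app (g ''ᵁ ⊤) (imgₒ g ⊤ (a k)) = 0 :=
  (h.mem_iff ⟨⊤, h.affine⟩ (a k)).2 (Ideal.subset_span ⟨k, resₒ_self _ _⟩)

/-- The generators of the ideal sheaf. -/
def idealSec (k : Fin c) : Γ(idealModule f, g ''ᵁ ⊤) :=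
  (exists_idealModule f _ _ (h.app_imgₒ k)).choose

lemma idealι_idealSec (k : Fin c) :
    (idealι f).appₗ (g ''ᵁ ⊤) (h.idealSec k) = sec _ (imgₒ g ⊤ (a k)) :=
  (exists_idealModule f _ _ (h.app_imgₒ k)).choose_spec

lemma idealι_res_idealSec (W : Z.Opens) (k : Fin c) : (idealι f).appₗ (g ''ᵁ W)
    ((idealModule f).res (g.image_mono le_top) (h.idealSec k)) =
      sec _ (imgₒ g W (resₒ le_top (a k))) := by
  rw [Hom.appₗ_res, idealι_idealSec, res_sec, resₒ_imgₒ]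

lemma idealι_sum (W : Z.Opens) (r : Fin c → Γ(Z, W)) : (idealι f).appₗ (g ''ᵁ W)
    (∑ k, imgₒ g W (r k) • (idealModule f).res (g.image_mono le_top) (h.idealSec k)) =
      sec _ (imgₒ g W (∑ k, r k * resₒ le_top (a k))) := by
  rw [map_sum, map_sum, map_sum]
  refine Finset.sum_congr rfl fun k _ ↦ ?_
  rw [_root_.map_smul, h.idealι_res_idealSec, map_mul, ← smul_eq_mul, _root_.map_smul]

lemma exists_coeff (W : Z.affineOpens) (m : Γ(idealModule f, g ''ᵁ W.1)) :
    ∃ r : Fin c → Γ(Z, W.1), m = ∑ k, imgₒ g W.1 (r k) •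
      (idealModule f).res (g.image_mono le_top) (h.idealSec k) := by
  obtain ⟨s, hs⟩ := exists_sec_eq _ ((idealι f).appₗ _ m)
  obtain ⟨s, rfl⟩ := (imgₒ_bijective g W.1).2 s
  have h1 := (h.mem_iff W s).1 (app_idealModule f _ m _ hs)
  obtain ⟨r, hr⟩ := (Submodule.mem_span_range_iff_exists_fun _).1 h1
  refine ⟨r, idealModule_injective f _ (hs.trans ?_)⟩
  rw [h.idealι_sum, ← hr]
  rfl

lemma hom_ext {P : Y.Modules} (hP : P.SupportedOn (g ''ᵁ ⊤)) {φ ψ : idealModule f ⟶ P}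
    (hφ : ∀ k, φ.appₗ _ (h.idealSec k) = ψ.appₗ _ (h.idealSec k)) : φ = ψ := by
  refine hom_extₗ fun W m ↦ (hP W).1 ?_
  rw [← Hom.appₗ_res, ← Hom.appₗ_res]
  refine P.eq_of_res_eq ?_
  rintro _ ⟨hy, z, -, rfl⟩
  obtain ⟨W', hzW, hW'⟩ := exists_affine_le (show z ∈ g ⁻¹ᵁ W from hy)
  have hle : g ''ᵁ W'.1 ≤ W ⊓ g ''ᵁ ⊤ :=
    le_inf ((g.image_mono hW').trans (g.image_preimage_le W)) (g.image_mono le_top)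
  refine ⟨g ''ᵁ W'.1, hle, ⟨z, hzW, rfl⟩, ?_⟩
  rw [← Hom.appₗ_res, ← Hom.appₗ_res]
  obtain ⟨r, hr⟩ := h.exists_coeff W' ((idealModule f).res hle ((idealModule f).res inf_le_left m))
  rw [hr, map_sum, map_sum]
  refine Finset.sum_congr rfl fun k _ ↦ ?_
  rw [_root_.map_smul, _root_.map_smul, Hom.appₗ_res, Hom.appₗ_res, hφ]

/-- The ideal is a quotient of a free module on the chart, and a relation between the generators has
coefficients in the ideal (`mem_span_of_relation`). Such coefficients act as zero on a direct image
from `X`, so every choice of values descends. This makes the conormal sheaf free. -/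
lemma exists_hom (T : X.Modules) (hT : T.SupportedOn (f ⁻¹ᵁ (g ''ᵁ ⊤)))
    (t : Fin c → Γ(T, f ⁻¹ᵁ (g ''ᵁ ⊤))) :
    ∃ φ : idealModule f ⟶ (Scheme.Modules.pushforward f).obj T,
      ∀ k, φ.appₗ _ (h.idealSec k) = t k := by
  let P := (Scheme.Modules.pushforward f).obj T
  have hP : P.SupportedOn (g ''ᵁ ⊤) := hT.pushforward f
  have hF := isFrame_stdFrame (Z := Z) (c := c)
  obtain ⟨q, hq⟩ := hF.hom_surjective (supportedOn_top ((idealModule f).restrict g)) h.idealSec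
  obtain ⟨p, hp⟩ := hF.hom_surjective (supportedOn_top (P.restrict g)) t
  have hq' (W : Z.Opens) (r : Fin c → Γ(Z, W)) :
      q.appₗ W (∑ k, r k • (freeModule Z c).res le_top (stdFrame Z c k)) = ∑ k, imgₒ g W (r k) •
        (idealModule f).res (g.image_mono le_top) (h.idealSec k) := by
    rw [map_sum]
    refine Finset.sum_congr rfl fun k _ ↦ ?_
    rw [_root_.map_smul, Hom.appₗ_res, hq]
    rfl
  have hepi : Epi q := by
    refine LocallySurjective.epi fun U s z hz ↦ ?_
    obtain ⟨W, hzW, hW⟩ := exists_affine_le hz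
    obtain ⟨r, hr⟩ := h.exists_coeff W ((idealModule f).res (g.image_mono hW) s)
    exact ⟨W.1, hW, hzW, _, (hq' W.1 r).trans hr.symm⟩
  have hk : kernel.ι q ≫ p = 0 := hom_extₗ fun U m ↦ by
    set s := Hom.appₗ (kernel.ι q) U m with hs
    have hs0 : q.appₗ U s = 0 := by rw [hs, ← Hom.comp_appₗ, kernel.condition, Hom.zero_appₗ]
    rw [Hom.comp_appₗ, ← hs, Hom.zero_appₗ]
    refine (P.restrict g).eq_of_res_eq fun z hz ↦ ?_
    obtain ⟨W, hzW, hW⟩ := exists_affine_le hz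
    refine ⟨W.1, hW, hzW, ?_⟩
    rw [← Hom.appₗ_res, map_zero]
    set r := (hF.basis (le_top : W.1 ≤ ⊤)).repr ((freeModule Z c).res hW s) with hr
    have h1 : (freeModule Z c).res hW s =
        ∑ k, r k • (freeModule Z c).res le_top (stdFrame Z c k) := by
      rw [← (hF.basis (le_top : W.1 ≤ ⊤)).sum_repr ((freeModule Z c).res hW s)]
      simp only [IsFrame.basis_apply]
      rfl
    have h2 : q.appₗ W.1 ((freeModule Z c).res hW s) = 0 := by rw [Hom.appₗ_res, hs0, map_zero]
    rw [h1, hq'] at h2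
    have h3 := congrArg ((idealι f).appₗ (g ''ᵁ W.1)) h2
    rw [h.idealι_sum] at h3
    have h3' := (sec (g ''ᵁ W.1)).map_eq_zero_iff.1
      (h3.trans (map_zero ((idealι f).appₗ (g ''ᵁ W.1))))
    have h4 := mem_span_of_relation a h.regular W r
      ((imgₒ_bijective g W.1).1 (h3'.trans (map_zero _).symm))
    rw [h1, map_sum]
    refine Finset.sum_eq_zero fun k _ ↦ ?_
    rw [_root_.map_smul]
    have h5 : f.app (g ''ᵁ W.1) (imgₒ g W.1 (r k)) = 0 := (h.mem_iff W (r k)).2 (h4 k)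
    have h6 (y : Γ(T, f ⁻¹ᵁ (g ''ᵁ W.1))) : f.app (g ''ᵁ W.1) (imgₒ g W.1 (r k)) • y = 0 := by
      rw [h5, zero_smul]
    exact h6 _
  -- The map is built on the chart only; it extends to `Y` because its target is supported on the
  -- chart.
  obtain ⟨φ, hφ⟩ := exists_restrict_map_eq g hP (Abelian.epiDesc q p hk)
  refine ⟨φ, fun k ↦ ?_⟩
  have h1 : q ≫ (restrictFunctor g).map φ = p := by rw [hφ, Abelian.comp_epiDesc]
  have h2 := congrArg (fun z : _ ⟶ _ ↦ Hom.appₗ z ⊤ (stdFrame Z c k)) h1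
  refine Eq.trans ?_ (h2.trans (hp k))
  exact (congrArg (φ.appₗ (g ''ᵁ ⊤)) (hq k)).symm

/-- The conormal sheaf is free on the classes of a regular sequence of generators. -/
lemma isFrame_conormalSheaf : IsFrame (conormalSheaf f) (f ⁻¹ᵁ (g ''ᵁ ⊤))
    fun k ↦ (toConormal f).appₗ (g ''ᵁ ⊤) (h.idealSec k) := by
  let adj := pullbackPushforwardAdjunction f
  refine isFrame_of_hom _ (fun T hT t ↦ ?_) fun T hT φ ψ h' ↦ ?_
  · obtain ⟨φ, hφ⟩ := h.exists_hom T hT t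
    refine ⟨(adj.homEquiv _ T).symm φ, fun i ↦ ?_⟩
    refine Eq.trans ?_ (hφ i)
    have : adj.unit.app (idealModule f) ≫ (Scheme.Modules.pushforward f).map
        ((adj.homEquiv _ T).symm φ) = φ :=
      (adj.homEquiv_unit _ _ _).symm.trans (Equiv.apply_symm_apply _ _)
    exact congrArg (fun c : _ ⟶ _ ↦ Hom.appₗ c _ (h.idealSec i)) this
  · refine (adj.homEquiv _ T).injective (h.hom_ext (hT.pushforward f) fun i ↦ ?_)
    refine (congrArg (fun c : _ ⟶ _ ↦ Hom.appₗ c _ (h.idealSec i)) (adj.homEquiv_unit _ _ φ)).trans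
      (Eq.trans ?_ (congrArg (fun c : _ ⟶ _ ↦ Hom.appₗ c _ (h.idealSec i))
        (adj.homEquiv_unit _ _ ψ)).symm)
    exact h' i

end IsKoszulChart

end Chart

end AlgebraicGeometry.Scheme.Modules

/-! ### Coordinates of alternating forms under base change. -/

namespace AlternatingMap

variable {R S M N : Type*} [CommRing R] [CommRing S] [AddCommGroup M] [Module R M]
  [AddCommGroup N] [Module S N] {ρ : R →+* S}

lemma basis_baseChange {ι : Type*} [Finite ι] [LinearOrder ι] (b : Module.Basis ι R M) (q : ℕ)
    (m : M →ₛₗ[ρ] N) (b' : Module.Basis ι S N) (hb : ∀ i, m (b i) = b' i)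
    (s : Set.powersetCard ι q) (x : Fin q → M) :
    basis b' q s (m ∘ x) = ρ (basis b q s x) := by
  let τ : R →ₛₗ[ρ] S :=
    { toFun := ρ
      map_add' := map_add ρ
      map_smul' := fun r x ↦ map_mul ρ r x }
  obtain ⟨g, hg⟩ := exists_baseChange b q m b' hb τ (basis b q s)
  have : g = basis b' q s := ext_powersetCard b' fun t ↦ by
    have h1 : (fun k ↦ b' (Set.powersetCard.ofFinEmbEquiv.symm t k)) =
        m ∘ fun k ↦ b (Set.powersetCard.ofFinEmbEquiv.symm t k) := funext fun k ↦ (hb _).symm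
    rw [basis_apply, h1, hg, basis_apply]
    change ρ _ = _
    split_ifs <;> simp
  rw [← this]
  exact hg x

lemma sum_smul_apply {ι T : Type*} [AddCommGroup T] [Module R T] {q : ℕ} (s : Finset ι) (c : ι → R)
    (f : ι → M [⋀^Fin q]→ₗ[R] T) (x : Fin q → M) :
    (∑ i ∈ s, c i • f i) x = ∑ i ∈ s, c i • f i x :=
  map_sum (⟨⟨fun f ↦ f x, rfl⟩, fun _ _ ↦ rfl⟩ : (M [⋀^Fin q]→ₗ[R] T) →+ T) (fun i ↦ c i • f i) s

lemma eq_sum_basis {ι : Type*} [Finite ι] [LinearOrder ι] (b : Module.Basis ι R M) (q : ℕ)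
    [Fintype (Set.powersetCard ι q)] (f : M [⋀^Fin q]→ₗ[R] R) :
    f = ∑ s, f (fun k ↦ b (Set.powersetCard.ofFinEmbEquiv.symm s k)) • basis b q s := by
  classical
  refine ext_powersetCard b fun t ↦ ?_
  rw [sum_smul_apply]
  simp [basis_apply]

lemma curryLeft_sum_smul {c q : ℕ} {T : Type*} [AddCommGroup T] [Module R T] (y : Fin c → R)
    (e : Fin c → M) (f : M [⋀^Fin (q + 1)]→ₗ[R] T) (x : Fin q → M) :
    f (Matrix.vecCons (∑ k, y k • e k) x) = ∑ k, y k • f (Matrix.vecCons (e k) x) := by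
  rw [← curryLeft_apply_apply, map_sum]
  simp only [_root_.map_smul]
  rw [sum_smul_apply]
  rfl

end AlternatingMap

/-! ### Charts adapted to the normal sheaf and its extension. -/

namespace AlgebraicGeometry.Scheme.Modules

variable {X X' Y Z : Scheme.{u}}

lemma koszulMk_add {c n : ℕ} (W : Z.Opens)
    (f f' : Γ(freeModule Z c, W) [⋀^Fin n]→ₗ[Γ(Z, W)] Γ(Z, W)) :
    koszulMk W (f + f') = koszulMk W f + koszulMk W f' := by
  refine (isFrame_stdFrame.res (le_top : W ≤ ⊤)).altEval_injective ?_
  refine (altEval_koszulMk W _).trans (Eq.trans ?_ (map_add (altEvalₗ W) _ _).symm)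
  refine AlternatingMap.ext fun m ↦ ?_
  refine Eq.trans ?_ (congrArg₂ (· + ·) (DFunLike.congr_fun (altEval_koszulMk W f) m)
    (DFunLike.congr_fun (altEval_koszulMk W f') m)).symm
  exact map_add (sec W) (f m) (f' m)

lemma koszulMk_smul {c n : ℕ} (W : Z.Opens) (r : Γ(Z, W))
    (f : Γ(freeModule Z c, W) [⋀^Fin n]→ₗ[Γ(Z, W)] Γ(Z, W)) :
    koszulMk W (r • f) = r • koszulMk W f := by
  refine (isFrame_stdFrame.res (le_top : W ≤ ⊤)).altEval_injective ?_
  refine (altEval_koszulMk W _).trans (Eq.trans ?_ (_root_.map_smul (altEvalₗ W) _ _).symm)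
  refine AlternatingMap.ext fun m ↦ ?_
  refine Eq.trans ?_ (congrArg (r • ·) (DFunLike.congr_fun (altEval_koszulMk W f) m)).symm
  exact _root_.map_smul (sec W) r (f m)

lemma koszulMk_sum {c n : ℕ} (W : Z.Opens) {ι : Type*} (s : Finset ι) (r : ι → Γ(Z, W))
    (f : ι → Γ(freeModule Z c, W) [⋀^Fin n]→ₗ[Γ(Z, W)] Γ(Z, W)) :
    koszulMk W (∑ i ∈ s, r i • f i) = ∑ i ∈ s, r i • koszulMk W (f i) := by
  classical
  induction s using Finset.induction_on with
  | empty => exact koszulMk_zero W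
  | insert i s hi ih =>
    rw [Finset.sum_insert hi, Finset.sum_insert hi, koszulMk_add, koszulMk_smul, ih]

lemma altFrame_eq_koszulMk {c n : ℕ} (s : Set.powersetCard (Fin c) n) :
    (isFrame_stdFrame (Z := Z)).altFrame n s =
      koszulMk ⊤ (AlternatingMap.basis (isFrame_stdFrame.basis le_rfl) n s) := by
  refine isFrame_stdFrame.altEval_injective ?_
  refine (isFrame_stdFrame.altEval_altFrame le_rfl s).trans (altEval_koszulMk ⊤ _).symm

lemma koszul_induction {c n : ℕ} {T : Z.Modules} {φ ψ : koszul Z c n ⟶ T}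
    (h : ∀ s, φ.appₗ ⊤ (koszulMk ⊤ (AlternatingMap.basis (isFrame_stdFrame.basis le_rfl) n s)) =
      ψ.appₗ ⊤ (koszulMk ⊤ (AlternatingMap.basis (isFrame_stdFrame.basis le_rfl) n s))) : φ = ψ :=
  (isFrame_stdFrame.alt n).hom_injective (supportedOn_top T) fun s ↦ by
    rw [altFrame_eq_koszulMk]
    exact h s

lemma exists_koszul_hom {c n : ℕ} {T : Z.Modules} (t : Set.powersetCard (Fin c) n → Γ(T, ⊤)) :
    ∃ φ : koszul Z c n ⟶ T, ∀ s,
      φ.appₗ ⊤ (koszulMk ⊤ (AlternatingMap.basis (isFrame_stdFrame.basis le_rfl) n s)) = t s := by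
  obtain ⟨φ, hφ⟩ := (isFrame_stdFrame.alt n).hom_surjective (supportedOn_top T) t
  exact ⟨φ, fun s ↦ by rw [← altFrame_eq_koszulMk]; exact hφ s⟩

variable (i : X ⟶ X') (j : X' ⟶ Y) [IsClosedImmersion i] [IsClosedImmersion j]
  {V : X'.Modules} {N : X.Modules} (ν : V ⟶ (Scheme.Modules.pushforward i).obj N)
  (β : V ⟶ altSheaf (idealModule i) ((Scheme.Modules.pushforward i).obj (structureSheaf X)) 1)
  (g : Z ⟶ Y) [IsOpenImmersion g] {c : ℕ} (a : Fin c → Γ(Z, ⊤))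

/-- A chart in which the normal sheaf `N` and its extension `V` are free, and in which the pairing
of `V` and the ideal is given by the coordinates with respect to the frame of `N`. -/
structure NormalChart where
  chart : IsKoszulChart (i ≫ j) g a
  /-- the rank of `V` -/
  r : ℕ
  /-- the frame of `V` -/
  b : Fin r → Γ(V, j ⁻¹ᵁ (g ''ᵁ ⊤))
  isFrame : IsFrame V _ b
  /-- the frame of `N` -/
  bN : Fin c → Γ(N, i ⁻¹ᵁ (j ⁻¹ᵁ (g ''ᵁ ⊤)))
  isFrameN : IsFrame N _ bN
  /-- the generators of the ideal -/
  s : Fin c → Γ(idealModule i, j ⁻¹ᵁ (g ''ᵁ ⊤))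
  idealι_s (k : Fin c) : (idealι i).appₗ _ (s k) = sec _ (j.app _ (imgₒ g ⊤ (a k)))
  pairing (v : Γ(V, j ⁻¹ᵁ (g ''ᵁ ⊤))) (k : Fin c) : altEval le_rfl (β.appₗ _ v) (fun _ ↦ s k) =
    sec (i ⁻¹ᵁ (j ⁻¹ᵁ (g ''ᵁ ⊤))) ((isFrameN.basis le_rfl).repr (ν.appₗ _ v) k)

namespace NormalChart

variable {i j ν β g a} (h : NormalChart i j ν β g a)

/-- The open subset of the neighbourhood of the chart. -/
abbrev dom (_ : NormalChart i j ν β g a) : X'.Opens := j ⁻¹ᵁ (g ''ᵁ (⊤ : Z.Opens))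

/-- The map from functions on `Z` to functions on the neighbourhood. -/
def scalar : Γ(Z, ⊤) →+* Γ(X', h.dom) := (j.app (g ''ᵁ ⊤)).hom.comp (imgₒ g ⊤)

lemma affine_dom : IsAffineOpen h.dom :=
  (h.chart.affine.image_of_isOpenImmersion g).preimage j

lemma app_scalar (k : Fin c) : i.app h.dom (h.scalar (a k)) = 0 := by
  have h1 := h.chart.app_imgₒ k
  rw [Scheme.Hom.comp_app] at h1
  exact h1

/-- The map from the free module on `Z` to the free module over functions on the neighbourhood. -/
def liftFree : Γ(freeModule Z c, ⊤) →ₛₗ[h.scalar] (Fin c → Γ(X', h.dom)) where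
  toFun x k := h.scalar ((isFrame_stdFrame.basis le_rfl).repr x k)
  map_add' x y := by
    funext k
    simp
  map_smul' r x := by
    funext k
    simp

lemma liftFree_basis (k : Fin c) : h.liftFree (isFrame_stdFrame.basis le_rfl k) =
    Pi.basisFun Γ(X', h.dom) (Fin c) k := by
  funext l
  change h.scalar _ = _
  rw [Module.Basis.repr_self, Pi.basisFun_apply, Finsupp.single_apply, Pi.single_apply]
  split_ifs with h1 h2 h2
  · simp
  · exact (h2 h1.symm).elim
  · exact (h1 h2.symm).elim
  · simp

/-- The map from the free module over functions on the neighbourhood to the normal sheaf. -/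
def toNormal : (Fin c → Γ(X', h.dom)) →ₛₗ[(i.app h.dom).hom] Γ(N, i ⁻¹ᵁ h.dom) where
  toFun y := ∑ k, i.app h.dom (y k) • h.bN k
  map_add' x y := by
    rw [← Finset.sum_add_distrib]
    refine Finset.sum_congr rfl fun k _ ↦ ?_
    rw [Pi.add_apply, map_add, add_smul]
  map_smul' r x := by
    rw [Finset.smul_sum]
    refine Finset.sum_congr rfl fun k _ ↦ ?_
    rw [Pi.smul_apply, smul_eq_mul, map_mul, mul_smul]

lemma toNormal_apply (y : Fin c → Γ(X', h.dom)) :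
    h.toNormal y = ∑ k, i.app h.dom (y k) • h.bN k := rfl

lemma toNormal_basis (k : Fin c) :
    h.toNormal (Pi.basisFun Γ(X', h.dom) (Fin c) k) = h.isFrameN.basis le_rfl k := by
  rw [toNormal_apply, Finset.sum_eq_single k]
  · rw [Pi.basisFun_apply, Pi.single_eq_same, map_one, one_smul, IsFrame.basis_apply, res_self]
  · intro l _ hl
    rw [Pi.basisFun_apply, Pi.single_eq_of_ne hl, map_zero, zero_smul]
  · simp

lemma toNormal_koszulVector : h.toNormal (h.liftFree (koszulVector a)) = 0 := by
  rw [toNormal_apply]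
  refine Finset.sum_eq_zero fun k _ ↦ ?_
  have h1 : (isFrame_stdFrame.basis le_rfl).repr (koszulVector a) k = a k := by
    have h2 := res_koszulVector a ⊤
    rw [res_self] at h2
    rw [h2]
    simp [resₒ_self, Finsupp.single_apply, -IsFrame.basis_apply]
  have h2 : h.liftFree (koszulVector a) k = h.scalar (a k) := congrArg h.scalar h1
  rw [h2, h.app_scalar, zero_smul]

/-- The domain is affine, so functions on `X` lift to `X'`; as `V` is free, lifting the coordinates
of the images of its frame is enough. The lift is a choice, but its reduction to `X` is `ν`. -/
lemma exists_lift : ∃ w : Γ(V, h.dom) →ₗ[Γ(X', h.dom)] (Fin c → Γ(X', h.dom)),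
    ∀ v, h.toNormal (w v) = ν.appₗ h.dom v := by
  have h1 (l : Fin h.r) : ∃ y : Fin c → Γ(X', h.dom), h.toNormal y = ν.appₗ h.dom (h.b l) := by
    choose y hy using fun k ↦ i.app_surjective h.dom h.affine_dom
      ((h.isFrameN.basis le_rfl).repr (ν.appₗ h.dom (h.b l)) k)
    refine ⟨y, ?_⟩
    have h2 := (h.isFrameN.basis le_rfl).sum_repr (ν.appₗ h.dom (h.b l))
    rw [toNormal_apply]
    refine Eq.trans (Finset.sum_congr rfl fun k _ ↦ ?_) h2
    rw [hy, IsFrame.basis_apply, res_self]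
  choose y hy using h1
  let w := (h.isFrame.basis le_rfl).constr ℕ y
  let f : Γ(V, h.dom) →ₗ[Γ(X', h.dom)] Γ((Scheme.Modules.pushforward i).obj N, h.dom) :=
    { toFun v := h.toNormal (w v)
      map_add' x y := (congrArg h.toNormal (map_add w x y)).trans (map_add h.toNormal _ _)
      map_smul' r x := (congrArg h.toNormal (_root_.map_smul w r x)).trans
        (h.toNormal.map_smulₛₗ r (w x)) }
  have hf : f = ν.appₗ h.dom := (h.isFrame.basis le_rfl).ext fun l ↦ by
    have h3 : w (h.isFrame.basis le_rfl l) = y l := Module.Basis.constr_basis _ _ _ _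
    refine (congrArg h.toNormal h3).trans ((hy l).trans ?_)
    rw [IsFrame.basis_apply, res_self]
  exact ⟨w, fun v ↦ LinearMap.congr_fun hf v⟩

/-- A lift of `ν` to the free module over functions on the neighbourhood. -/
def lift : Γ(V, h.dom) →ₗ[Γ(X', h.dom)] (Fin c → Γ(X', h.dom)) := h.exists_lift.choose

lemma toNormal_lift (v : Γ(V, h.dom)) : h.toNormal (h.lift v) = ν.appₗ h.dom v :=
  h.exists_lift.choose_spec v

/-- The functor from modules on the neighbourhood to modules on `Z`. -/
abbrev Φ (_ : NormalChart i j ν β g a) : X'.Modules ⥤ Z.Modules :=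
  Scheme.Modules.pushforward j ⋙ restrictFunctor g

lemma exists_formHom (n : ℕ) : ∃ t : koszul Z c n ⟶ h.Φ.obj (altSheaf V (structureSheaf X') n),
    ∀ s, t.appₗ ⊤ (koszulMk ⊤ (AlternatingMap.basis (isFrame_stdFrame.basis le_rfl) n s)) =
      h.isFrame.altEquiv.symm ((sec h.dom).toLinearMap.compAlternatingMap
        ((AlternatingMap.basis (Pi.basisFun Γ(X', h.dom) (Fin c)) n s).compLinearMap h.lift)) :=
  exists_koszul_hom (T := h.Φ.obj (altSheaf V (structureSheaf X') n)) fun s ↦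
    h.isFrame.altEquiv.symm ((sec h.dom).toLinearMap.compAlternatingMap
      ((AlternatingMap.basis (Pi.basisFun Γ(X', h.dom) (Fin c)) n s).compLinearMap h.lift))

/-- The map from the Koszul complex to alternating forms on `V`. -/
def formHom (n : ℕ) : koszul Z c n ⟶ h.Φ.obj (altSheaf V (structureSheaf X') n) :=
  (h.exists_formHom n).choose

/-- The value of `formHom`, as a form on `V`. -/
def formVal {n : ℕ} (x : Γ(koszul Z c n, ⊤)) : Γ(altSheaf V (structureSheaf X') n, h.dom) :=
  (h.formHom n).appₗ ⊤ x

lemma formVal_basis (n : ℕ) (s : Set.powersetCard (Fin c) n) (v : Fin n → Γ(V, h.dom)) :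
    altEval le_rfl (h.formVal
      (koszulMk ⊤ (AlternatingMap.basis (isFrame_stdFrame.basis le_rfl) n s))) v =
      sec h.dom (AlternatingMap.basis (Pi.basisFun Γ(X', h.dom) (Fin c)) n s (h.lift ∘ v)) := by
  have h1 := congrArg (fun z : Γ(altSheaf V (structureSheaf X') n, h.dom) ↦ altEval le_rfl z v)
    ((h.exists_formHom n).choose_spec s)
  exact h1.trans (DFunLike.congr_fun (h.isFrame.altEval_altEquiv_symm _) v)

/-- Any form `f'` compatible with `f` along `liftFree` computes the image of `f`: it is enough to
expand in basis forms, for which the formula is the definition of `formHom`. -/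
lemma altEval_formVal {n : ℕ}
    (f : Γ(freeModule Z c, ⊤) [⋀^Fin n]→ₗ[Γ(Z, ⊤)] Γ(Z, ⊤))
    (f' : (Fin c → Γ(X', h.dom)) [⋀^Fin n]→ₗ[Γ(X', h.dom)] Γ(X', h.dom))
    (hf : ∀ x, f' (h.liftFree ∘ x) = h.scalar (f x)) (v : Fin n → Γ(V, h.dom)) :
    altEval le_rfl (h.formVal (koszulMk ⊤ f)) v = sec h.dom (f' (h.lift ∘ v)) := by
  classical
  have := Fintype.ofFinite (Set.powersetCard (Fin c) n)
  have hf' := AlternatingMap.eq_sum_basis (Pi.basisFun Γ(X', h.dom) (Fin c)) n f'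
  have h1 : koszulMk ⊤ f = ∑ s, f (fun k ↦ isFrame_stdFrame.basis le_rfl
      (Set.powersetCard.ofFinEmbEquiv.symm s k)) •
        koszulMk ⊤ (AlternatingMap.basis (isFrame_stdFrame.basis le_rfl) n s) := by
    conv_lhs => rw [AlternatingMap.eq_sum_basis (isFrame_stdFrame.basis le_rfl) n f]
    rw [koszulMk_sum]
  have h2 : h.formVal (koszulMk ⊤ f) = ∑ s, h.scalar (f (fun k ↦ isFrame_stdFrame.basis le_rfl
      (Set.powersetCard.ofFinEmbEquiv.symm s k))) •
        h.formVal (koszulMk ⊤ (AlternatingMap.basis (isFrame_stdFrame.basis le_rfl) n s)) := by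
    rw [h1]
    refine (map_sum ((h.formHom n).appₗ ⊤) _ _).trans (Finset.sum_congr rfl fun s _ ↦ ?_)
    exact _root_.map_smul ((h.formHom n).appₗ ⊤) _ _
  have h3 : altEval le_rfl (h.formVal (koszulMk ⊤ f)) =
      ∑ s, h.scalar (f (fun k ↦ isFrame_stdFrame.basis le_rfl
        (Set.powersetCard.ofFinEmbEquiv.symm s k))) • altEval le_rfl
          (h.formVal (koszulMk ⊤ (AlternatingMap.basis (isFrame_stdFrame.basis le_rfl) n s))) := by
    have h4 := congrArg (altEvalₗ (M := V) (T := structureSheaf X') (q := n) h.dom) h2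
    rw [map_sum] at h4
    refine h4.trans (Finset.sum_congr rfl fun s _ ↦ ?_)
    exact _root_.map_smul (altEvalₗ (M := V) (T := structureSheaf X') (q := n) h.dom) _ _
  rw [h3, AlternatingMap.sum_smul_apply]
  conv_rhs => rw [hf', AlternatingMap.sum_smul_apply, map_sum]
  refine Finset.sum_congr rfl fun s _ ↦ ?_
  rw [h.formVal_basis, _root_.map_smul]
  refine congrArg (· • sec h.dom _) ?_
  rw [← hf]
  exact congrArg f' (funext fun k ↦ h.liftFree_basis _)

end NormalChart

end AlgebraicGeometry.Scheme.Modules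

/-! ### The map from the Koszul complex to forms on the extension. -/

namespace AlgebraicGeometry.Scheme.Modules

variable {X X' Y Z : Scheme.{u}} {i : X ⟶ X'} {j : X' ⟶ Y} [IsClosedImmersion i]
  [IsClosedImmersion j] {V : X'.Modules} {N : X.Modules}
  {ν : V ⟶ (Scheme.Modules.pushforward i).obj N}
  {β : V ⟶ altSheaf (idealModule i) ((Scheme.Modules.pushforward i).obj (structureSheaf X)) 1}
  {g : Z ⟶ Y} [IsOpenImmersion g] {c : ℕ} {a : Fin c → Γ(Z, ⊤)}

lemma Hom.nsmul_appₗ {M T : X.Modules} (n : ℕ) (f : M ⟶ T) (U : X.Opens) (m : Γ(M, U)) :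
    (n • f).appₗ U m = n • f.appₗ U m := by
  induction n with
  | zero => rw [zero_smul, zero_smul, Hom.zero_appₗ]
  | succ n ih => rw [succ_nsmul, succ_nsmul, Hom.add_appₗ, ih]

namespace NormalChart

variable (h : NormalChart i j ν β g a)

/-- The forms on `V` with values in `i_* 𝒪_X`. -/
abbrev forms (n : ℕ) (_ : NormalChart i j ν β g a) : X'.Modules :=
  altSheaf V ((Scheme.Modules.pushforward i).obj (structureSheaf X)) n

/-- The map from the Koszul complex to alternating forms on `V` with values in `i_* 𝒪_X`. -/
def normalHom (n : ℕ) : koszul Z c n ⟶ h.Φ.obj (h.forms n) :=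
  h.formHom n ≫ h.Φ.map (altMap V n (structureMap i))

/-- The value of `normalHom`, as a form on `V`. -/
def normalVal {n : ℕ} (x : Γ(koszul Z c n, ⊤)) : Γ(h.forms n, h.dom) :=
  (altMap V n (structureMap i)).appₗ h.dom (h.formVal x)

lemma normalHom_appₗ {n : ℕ} (x : Γ(koszul Z c n, ⊤)) :
    (h.normalHom n).appₗ ⊤ x = h.normalVal x := rfl

lemma altEval_normalVal {n : ℕ}
    (f : Γ(freeModule Z c, ⊤) [⋀^Fin n]→ₗ[Γ(Z, ⊤)] Γ(Z, ⊤))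
    (f' : (Fin c → Γ(X', h.dom)) [⋀^Fin n]→ₗ[Γ(X', h.dom)] Γ(X', h.dom))
    (hf : ∀ x, f' (h.liftFree ∘ x) = h.scalar (f x)) (v : Fin n → Γ(V, h.dom)) :
    altEval le_rfl (h.normalVal (koszulMk ⊤ f)) v =
      sec (i ⁻¹ᵁ h.dom) (i.app h.dom (f' (h.lift ∘ v))) :=
  (congrArg ((structureMap i).appₗ h.dom) (h.altEval_formVal f f' hf v)).trans
    (structureMap_appₗ i _ _)

lemma app_basis {n : ℕ} (s : Set.powersetCard (Fin c) n) (x : Fin n → Fin c → Γ(X', h.dom)) :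
    i.app h.dom (AlternatingMap.basis (Pi.basisFun Γ(X', h.dom) (Fin c)) n s x) =
      AlternatingMap.basis (h.isFrameN.basis le_rfl) n s (h.toNormal ∘ x) :=
  (AlternatingMap.basis_baseChange (Pi.basisFun Γ(X', h.dom) (Fin c)) n h.toNormal
    (h.isFrameN.basis le_rfl) h.toNormal_basis s x).symm

lemma altEval_normalVal_basis {n : ℕ} (s : Set.powersetCard (Fin c) n) (v : Fin n → Γ(V, h.dom)) :
    altEval le_rfl (h.normalVal
      (koszulMk ⊤ (AlternatingMap.basis (isFrame_stdFrame.basis le_rfl) n s))) v =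
      sec (i ⁻¹ᵁ h.dom) (AlternatingMap.basis (h.isFrameN.basis le_rfl) n s
        fun k ↦ ν.appₗ h.dom (v k)) := by
  refine (h.altEval_normalVal _ _ (fun x ↦ AlternatingMap.basis_baseChange _ n h.liftFree
    (Pi.basisFun Γ(X', h.dom) (Fin c)) h.liftFree_basis s x) v).trans (congrArg (sec _) ?_)
  refine (h.app_basis s _).trans (congrArg (AlternatingMap.basis _ n s) (funext fun k ↦ ?_))
  exact h.toNormal_lift (v k)

lemma comp_vecCons {A B : Type*} (f : A → B) {n : ℕ} (x : A) (m : Fin n → A) :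
    f ∘ Matrix.vecCons x m = Matrix.vecCons (f x) (f ∘ m) := by
  funext k
  cases k using Fin.cases <;> rfl

lemma koszulD_basis {n : ℕ} (s : Set.powersetCard (Fin c) (n + 1)) :
    (koszulD a n).appₗ ⊤
        (koszulMk ⊤ (AlternatingMap.basis (isFrame_stdFrame.basis le_rfl) (n + 1) s)) =
      koszulMk ⊤ ((AlternatingMap.basis (isFrame_stdFrame.basis le_rfl) (n + 1) s).curryLeft
        (koszulVector a)) := by
  rw [koszulD_koszulMk, res_self]

lemma liftFree_curryLeft {n : ℕ} (s : Set.powersetCard (Fin c) (n + 1))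
    (x : Fin n → Γ(freeModule Z c, ⊤)) :
    (AlternatingMap.basis (Pi.basisFun Γ(X', h.dom) (Fin c)) (n + 1) s).curryLeft
        (h.liftFree (koszulVector a)) (h.liftFree ∘ x) =
      h.scalar ((AlternatingMap.basis (isFrame_stdFrame.basis le_rfl) (n + 1) s).curryLeft
        (koszulVector a) x) := by
  rw [AlternatingMap.curryLeft_apply_apply, AlternatingMap.curryLeft_apply_apply, ← comp_vecCons]
  exact AlternatingMap.basis_baseChange _ (n + 1) h.liftFree _ h.liftFree_basis s _

/-- The Koszul differential contracts with the vector of generators, whose entries vanish on `X`. -/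
lemma koszulD_normalHom (n : ℕ) : koszulD a n ≫ h.normalHom n = 0 := by
  refine koszul_induction fun s ↦ ?_
  rw [Hom.comp_appₗ, koszulD_basis, normalHom_appₗ, Hom.zero_appₗ]
  refine h.isFrame.altEval_injective (AlternatingMap.ext fun v ↦ ?_)
  refine (h.altEval_normalVal _ _ (h.liftFree_curryLeft s) v).trans ?_
  refine Eq.trans (congrArg (sec _) ?_) (map_zero (sec (i ⁻¹ᵁ h.dom)))
  rw [AlternatingMap.curryLeft_apply_apply, app_basis, comp_vecCons, toNormal_koszulVector,
    ← AlternatingMap.curryLeft_apply_apply, map_zero]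
  rfl

/-- The sequences of sheaves of alternating forms on `V`, on the chart. -/
abbrev formSequence (_ : NormalChart i j ν β g a) (n : ℕ) : ShortComplex Z.Modules :=
  (((idealSequence i).map (altFunctor V n)).map (Scheme.Modules.pushforward j)).map
    (restrictFunctor g)

lemma shortExact_formSequence (hV : V.LocallyFramed) (n : ℕ) : (h.formSequence n).ShortExact :=
  ((hV.shortExact_alt n (shortExact_idealSequence i)).map_of_exact
    (Scheme.Modules.pushforward j)).map_of_exact (restrictFunctor g)

/-- Since the boundary of a form vanishes on `X`, its image among forms with values in functions on
`X'` takes values in the ideal. -/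
lemma exists_idealHom (hV : V.LocallyFramed) (n : ℕ) :
    ∃ m : koszul Z c (n + 1) ⟶ h.Φ.obj (altSheaf V (idealModule i) n),
      m ≫ h.Φ.map (altMap V n (idealι i)) = koszulD a n ≫ h.formHom n := by
  have h1 := h.shortExact_formSequence hV n
  have := h1.mono_f
  exact ⟨h1.exact.lift (koszulD a n ≫ h.formHom n)
    ((Category.assoc _ _ _).trans (h.koszulD_normalHom n)), h1.exact.lift_f _ _⟩

/-- The vector of generators is the sum of `a k` times the `k`-th basis vector, and `h.s k` is the
section of the ideal given by `a k`. The formula may be checked after embedding the ideal in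
functions. -/
lemma altEval_idealHom {n : ℕ} {m : koszul Z c (n + 1) ⟶ h.Φ.obj (altSheaf V (idealModule i) n)}
    (hm : m ≫ h.Φ.map (altMap V n (idealι i)) = koszulD a n ≫ h.formHom n)
    (s : Set.powersetCard (Fin c) (n + 1)) (φ : Γ(altSheaf V (idealModule i) n, h.dom))
    (hφ : φ = m.appₗ ⊤
      (koszulMk ⊤ (AlternatingMap.basis (isFrame_stdFrame.basis le_rfl) (n + 1) s)))
    (v : Fin n → Γ(V, h.dom)) :
    altEval le_rfl φ v = ∑ k, AlternatingMap.basis (Pi.basisFun Γ(X', h.dom) (Fin c)) (n + 1) s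
      (Matrix.vecCons (Pi.basisFun Γ(X', h.dom) (Fin c) k) (h.lift ∘ v)) • h.s k := by
  refine idealModule_injective i _ ?_
  have h1 : (altMap V n (idealι i)).appₗ h.dom φ = h.formVal ((koszulD a n).appₗ ⊤
      (koszulMk ⊤ (AlternatingMap.basis (isFrame_stdFrame.basis le_rfl) (n + 1) s))) := by
    have h0 (x : Γ(koszul Z c (n + 1), ⊤)) (φ : Γ(altSheaf V (idealModule i) n, h.dom))
        (hφ : φ = m.appₗ ⊤ x) : (altMap V n (idealι i)).appₗ h.dom φ =
          h.formVal ((koszulD a n).appₗ ⊤ x) := by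
      subst hφ
      exact congrArg (fun f : koszul Z c (n + 1) ⟶ h.Φ.obj (altSheaf V (structureSheaf X') n) ↦
        Hom.appₗ f ⊤ x) hm
    exact h0 _ _ hφ
  rw [koszulD_basis] at h1
  have h2 : (idealι i).appₗ h.dom (altEval le_rfl φ v) = altEval le_rfl (h.formVal (koszulMk ⊤
      ((AlternatingMap.basis (isFrame_stdFrame.basis le_rfl) (n + 1) s).curryLeft
        (koszulVector a)))) v :=
    congrArg (fun z : Γ(altSheaf V (structureSheaf X') n, h.dom) ↦ altEval le_rfl z v) h1
  refine h2.trans ((h.altEval_formVal _ _ (h.liftFree_curryLeft s) v).trans ?_)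
  have h3 : h.liftFree (koszulVector a) =
      ∑ k, h.scalar (a k) • Pi.basisFun Γ(X', h.dom) (Fin c) k := by
    rw [koszulVector, map_sum]
    refine Finset.sum_congr rfl fun k _ ↦ ?_
    rw [map_smulₛₗ, ← h.liftFree_basis, IsFrame.basis_apply, res_self]
  rw [AlternatingMap.curryLeft_apply_apply, h3, AlternatingMap.curryLeft_sum_smul, map_sum, map_sum]
  refine Finset.sum_congr rfl fun k _ ↦ ?_
  refine Eq.trans ?_ (_root_.map_smul ((idealι i).appₗ h.dom) _ _).symm
  refine Eq.trans ?_ (congrArg (_ • ·) (h.idealι_s k)).symm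
  refine Eq.trans ?_ (_root_.map_smul (sec h.dom) _ _)
  rw [smul_eq_mul, smul_eq_mul, mul_comm]
  rfl

/-- Moving the `k`-th argument to the front costs the sign `(-1) ^ k`, so all `n + 1` terms are
equal. The factorial in the comparison of classes originates here. -/
lemma sum_removeNth {R M T : Type*} [CommRing R] [AddCommGroup M] [Module R M] [AddCommGroup T]
    [Module R T] {n : ℕ} (f : M [⋀^Fin (n + 1)]→ₗ[R] T) (v : Fin (n + 1) → M) :
    ∑ k : Fin (n + 1), (-1 : ℤ) ^ (k : ℕ) • f (Matrix.vecCons (v k) (k.removeNth v)) =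
      (n + 1) • f v := by
  have h1 := DFunLike.congr_fun (AlternatingMap.alternatizeUncurryFin_curryLeft f) v
  rw [AlternatingMap.alternatizeUncurryFin_apply] at h1
  exact h1

/-- The differential inserts the vector of generators into a form; pairing the resulting values in
the ideal with the normal sheaf puts the normal vector into the same slot. Antisymmetrising this
returns the original form `n + 1` times. -/
lemma idealHom_contract {n : ℕ}
    {m : koszul Z c (n + 1) ⟶ h.Φ.obj (altSheaf V (idealModule i) n)}
    (hm : m ≫ h.Φ.map (altMap V n (idealι i)) = koszulD a n ≫ h.formHom n) :
    m ≫ h.Φ.map (contract β n) = (n + 1) • h.normalHom (n + 1) := by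
  refine koszul_induction fun s ↦ ?_
  let x := koszulMk ⊤ (AlternatingMap.basis (isFrame_stdFrame (Z := Z) (c := c).basis le_rfl) (n + 1) s)
  let φ : Γ(altSheaf V (idealModule i) n, h.dom) := m.appₗ ⊤ x
  have hr : Hom.appₗ ((n + 1) • h.normalHom (n + 1)) ⊤ x = (n + 1) • h.normalVal x :=
    Hom.nsmul_appₗ (n + 1) (h.normalHom (n + 1)) ⊤ x
  refine Eq.trans ?_ hr.symm
  change (contract β n).appₗ h.dom φ = _
  refine h.isFrame.altEval_injective (AlternatingMap.ext fun v ↦ ?_)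
  refine (altEval_contract β n le_rfl φ v).trans ?_
  have hr' : altEval le_rfl ((n + 1) • h.normalVal x) v =
      (n + 1) • altEval le_rfl (h.normalVal x) v :=
    map_nsmul (⟨⟨fun z ↦ altEval le_rfl z v, rfl⟩, fun _ _ ↦ rfl⟩ :
      Γ(h.forms (n + 1), h.dom) →+ _) (n + 1) (h.normalVal x)
  refine Eq.trans ?_ hr'.symm
  have hr'' := h.altEval_normalVal_basis s v
  refine Eq.trans ?_ (congrArg ((n + 1) • ·) hr'').symm
  let B := AlternatingMap.basis (h.isFrameN.basis le_rfl) (n + 1) s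
  let v' : Fin (n + 1) → Γ(N, i ⁻¹ᵁ h.dom) := fun k ↦ ν.appₗ h.dom (v k)
  -- Pairing `v l` with `h.s k` gives the `k`-th coordinate of its image in the normal sheaf, so the
  -- sum over `k` reassembles that vector in the first slot.
  have h2 (l : Fin (n + 1)) : (altEval le_rfl (β.appₗ h.dom (v l)) fun _ ↦
      altEval le_rfl φ (l.removeNth v)) =
      sec (i ⁻¹ᵁ h.dom) (B (Matrix.vecCons (v' l) (l.removeNth v'))) := by
    let L := (AlternatingMap.ofSubsingleton Γ(X', h.dom) Γ(idealModule i, h.dom)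
      Γ((Scheme.Modules.pushforward i).obj (structureSheaf X), h.dom) (0 : Fin 1)).symm
        (altEval le_rfl (β.appₗ h.dom (v l)))
    have h3 := congrArg L (h.altEval_idealHom hm s φ rfl (l.removeNth v))
    refine h3.trans ((map_sum L _ _).trans ?_)
    have h4 : v' l = ∑ k, (h.isFrameN.basis le_rfl).repr (v' l) k • h.isFrameN.basis le_rfl k :=
      ((h.isFrameN.basis le_rfl).sum_repr (v' l)).symm
    rw [h4, AlternatingMap.curryLeft_sum_smul]
    refine Eq.trans ?_ (map_sum (sec (i ⁻¹ᵁ h.dom)) _ _).symm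
    refine Finset.sum_congr rfl fun k _ ↦ ?_
    refine (_root_.map_smul L _ _).trans ?_
    have h5 : L (h.s k) = sec (i ⁻¹ᵁ h.dom) ((h.isFrameN.basis le_rfl).repr (v' l) k) :=
      h.pairing (v l) k
    rw [h5]
    refine (pushforward_smul i _ _ _ _).trans ?_
    rw [app_basis, comp_vecCons, toNormal_basis, ← _root_.map_smul, smul_eq_mul, smul_eq_mul,
      mul_comm]
    refine congrArg (fun y ↦ sec (i ⁻¹ᵁ h.dom) (_ * B (Matrix.vecCons _ y))) (funext fun k' ↦ ?_)
    exact h.toNormal_lift _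
  refine (Finset.sum_congr rfl fun (l : Fin (n + 1)) _ ↦ congrArg (fun z ↦ (-1 : ℤ) ^ (l : ℕ) • z) (h2 l)).trans ?_
  refine Eq.trans ?_ ((congrArg (sec _) (sum_removeNth B v')).trans (map_nsmul (sec _) _ _))
  refine Eq.trans ?_ (map_sum (sec (i ⁻¹ᵁ h.dom)) _ _).symm
  exact Finset.sum_congr rfl fun l _ ↦ (map_zsmul (sec (i ⁻¹ᵁ h.dom)) _ _).symm

end NormalChart

end AlgebraicGeometry.Scheme.Modules

lemma Function.Bijective.congr_fun {A B : Type*} {f g : A → B} (hg : Function.Bijective g)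
    (h : ∀ x, f x = g x) : Function.Bijective f := by
  rwa [funext h]

/-! ### Bijectivity of composition with a class that is a factorial multiple of a resolution class.
-/

namespace CategoryTheory.Abelian

variable {C : Type*} [Category C] [Abelian C] [HasExt.{w} C]

lemma Ext.mapExactFunctor_comp_extClass {D : Type*} [Category D] [Abelian D] [HasExt.{w} D]
    (F : C ⥤ D) [F.Additive] [PreservesFiniteLimits F] [PreservesFiniteColimits F]
    {S : ShortComplex C} (hS : S.ShortExact) {A B : C} {n : ℕ} (x : Ext A S.X₃ n) (p : S.X₁ ⟶ B) :
    (x.comp (hS.extClass.comp (Ext.mk₀ p) (add_zero 1)) rfl).mapExactFunctor F =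
      (x.mapExactFunctor F).comp ((hS.map_of_exact F).extClass.comp (Ext.mk₀ (F.map p))
        (add_zero 1)) rfl := by
  rw [mapExactFunctor_comp, mapExactFunctor_comp, mapExactFunctor_mk₀, mapExactFunctor_extClass]
  rfl

namespace SplicedResolution

variable {K : ℕ → C} (R : SplicedResolution K)
  {T : C} (hT : ∀ n k (x : Ext (K n) T (k + 1)), x = 0) (hd : ∀ n (f : K n ⟶ T), R.d n ≫ f = 0)
  {S : ℕ → ShortComplex C} (hS : ∀ n, (S n).ShortExact) (p : ∀ n, (S n).X₁ ⟶ (S (n + 1)).X₃)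
  (x : ∀ n, Ext (S 0).X₃ (S n).X₃ n) (hx₀ : x 0 = Ext.mk₀ (𝟙 _))
  (hx : ∀ n, x (n + 1) = (x n).comp ((hS n).extClass.comp (Ext.mk₀ (p n)) (add_zero 1)) rfl)
  (t : ∀ n, K n ⟶ (S n).X₂) (m : ∀ n, K (n + 1) ⟶ (S n).X₁)
  (hm : ∀ n, m n ≫ (S n).f = R.d n ≫ t n)
  (hp : ∀ n, m n ≫ p n = (n + 1) • (t (n + 1) ≫ (S (n + 1)).g))
  (e : R.Z 0 ≅ (S 0).X₃) (he : R.z 0 ≫ e.hom = t 0 ≫ (S 0).g)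
  {A : Type*} [AddCommGroup A] (n : ℕ) (F : A →+ ((S n).X₃ ⟶ T))
  (hF : Function.Bijective fun φ ↦ t n ≫ (S n).g ≫ F φ)
  (hn : Function.Bijective fun φ : A ↦ n.factorial • φ)

include hT hd hx₀ hx hm hp he hF hn in
-- After the isomorphism `e`, composition with `x n` is multiplication by `n!`, followed by
-- restriction to the syzygy and composition with the class of the resolution; each of these is
-- bijective.
lemma comp_bijective : Function.Bijective fun φ ↦ (x n).comp (Ext.mk₀ (F φ)) (add_zero n) := by
  -- Boundaries land in the subobject `(S n).X₁` by `hm`, so `t n` induces a map `θ n` from the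
  -- syzygy to the quotient.
  have hw (n : ℕ) : R.w n ≫ t n ≫ (S n).g = 0 := by
    rw [← cancel_epi (R.z (n + 1)), comp_zero]
    calc R.z (n + 1) ≫ R.w n ≫ t n ≫ (S n).g = (R.d n ≫ t n) ≫ (S n).g := by simp [d]
      _ = 0 := by rw [← hm, Category.assoc, (S n).zero, comp_zero]
  choose θ hθ using fun n ↦ (⟨(R.shortExact n).exact.desc (t n ≫ (S n).g) (hw n),
    (R.shortExact n).exact.g_desc _ _⟩ : ∃ θ : R.Z n ⟶ (S n).X₃, R.z n ≫ θ = t n ≫ (S n).g)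
  have heθ : e.hom = θ 0 := (cancel_epi (R.z 0)).1 (he.trans (hθ 0).symm)
  have h1 := R.comp_cls hS p x hx₀ hx t m hm hp θ hθ n
  have hpre {q : ℕ} {B : C} : Function.Bijective fun y : Ext (S 0).X₃ B q ↦
      (Ext.mk₀ (θ 0)).comp y (zero_add q) := by
    rw [← heθ]
    refine Function.bijective_iff_has_inverse.2
      ⟨fun y ↦ (Ext.mk₀ e.inv).comp y (zero_add q), fun y ↦ ?_, fun y ↦ ?_⟩
    · simp
    · simp
  have h2 : Function.Bijective fun φ ↦ θ n ≫ F φ := by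
    refine (Function.Bijective.of_comp_iff' (R.z_comp_bijective hd n) _).1 ?_
    convert! hF using 2 with φ
    rw [Function.comp_apply, ← Category.assoc, hθ, Category.assoc]
  refine (Function.Bijective.of_comp_iff' hpre _).1 ?_
  have h4 := (R.cls_comp_bijective hT hd n 0 n (add_zero n)).comp
    ((Ext.mk₀_bijective _ _).comp (h2.comp hn))
  refine h4.congr_fun fun φ ↦ ?_
  change (Ext.mk₀ (θ 0)).comp ((x n).comp (Ext.mk₀ (F φ)) (add_zero n)) (zero_add n) =
    (R.cls n).comp (Ext.mk₀ (θ n ≫ F (n.factorial • φ))) (add_zero n)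
  rw [← Ext.comp_assoc _ _ _ (zero_add n) (add_zero n) (by omega), h1]
  have h5 : Ext.mk₀ (θ n ≫ F (n.factorial • φ)) = n.factorial • Ext.mk₀ (θ n ≫ F φ) := by
    rw [map_nsmul, Preadditive.comp_nsmul]
    exact map_nsmul (Ext.addEquiv₀ (X := R.Z n) (Y := T)).symm _ _
  rw [h5]
  refine (map_nsmul ((Ext.mk₀ (F φ)).postcomp _ (add_zero n)) _ _).trans
    (Eq.trans ?_ (map_nsmul ((R.cls n).precomp _ (add_zero n)) _ _).symm)
  refine congrArg (n.factorial • ·) ?_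
  refine (Ext.comp_assoc _ _ _ (add_zero n) (add_zero 0) (by omega)).trans ?_
  rw [Ext.mk₀_comp_mk₀]
  rfl

end SplicedResolution

end CategoryTheory.Abelian

/-! ### The Koszul resolution of the structure sheaf on a chart, and its class. -/

namespace AlgebraicGeometry.Scheme.Modules

variable {X X' Y Z : Scheme.{u}} {i : X ⟶ X'} {j : X' ⟶ Y} [IsClosedImmersion i]
  [IsClosedImmersion j] {V : X'.Modules} {N : X.Modules}
  {ν : V ⟶ (Scheme.Modules.pushforward i).obj N}
  {β : V ⟶ altSheaf (idealModule i) ((Scheme.Modules.pushforward i).obj (structureSheaf X)) 1}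
  {g : Z ⟶ Y} [IsOpenImmersion g] {c : ℕ} {a : Fin c → Γ(Z, ⊤)}

lemma zeroForm_ext {M T : X.Modules} {U : X.Opens} {φ ψ : Γ(altSheaf M T 0, U)}
    (h : altEval le_rfl φ ![] = altEval le_rfl ψ ![]) : φ = ψ :=
  altSheaf_ext fun W hW m ↦ by
    obtain rfl : M.res hW ∘ ![] = m := Subsingleton.elim _ _
    exact (altEval_comp_res le_rfl hW φ _).trans ((congrArg (T.res hW) h).trans
      (altEval_comp_res le_rfl hW ψ _).symm)

variable (Z c) in
/-- The form `1` of degree zero. -/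
def koszulOne : Γ(koszul Z c 0, ⊤) := koszulMk ⊤ (AlternatingMap.constOfIsEmpty _ _ (Fin 0) 1)

lemma koszulMk_eq_smul_one (W : Z.Opens)
    (f : Γ(freeModule Z c, W) [⋀^Fin 0]→ₗ[Γ(Z, W)] Γ(Z, W)) :
    koszulMk W f = f ![] • (koszul Z c 0).res le_top (koszulOne Z c) := by
  refine zeroForm_ext ?_
  refine (DFunLike.congr_fun (altEval_koszulMk W f) _).trans ?_
  refine Eq.trans ?_ (DFunLike.congr_fun (altEval_smul le_rfl _ _) _).symm
  have h1 : altEval le_rfl ((koszul Z c 0).res (le_top : W ≤ ⊤) (koszulOne Z c)) ![] =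
      sec W 1 := by
    have h2 := altEval_comp_res le_rfl (le_top : W ≤ ⊤) (koszulOne Z c) ![]
    have h3 : altEval le_rfl (koszulOne Z c) ![] = sec ⊤ 1 :=
      DFunLike.congr_fun (altEval_koszulMk ⊤ _) _
    rw [h3, res_sec_one] at h2
    exact (congrArg (altEval le_top (koszulOne Z c)) (Subsingleton.elim _ _)).trans h2
  rw [AlternatingMap.smul_apply, h1, resₒ_self]
  exact sec_eq_smul (f ![])

namespace NormalChart

variable (h : NormalChart i j ν β g a)

lemma altEval_normalVal_one : altEval le_rfl (h.normalVal (koszulOne Z c)) ![] =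
    sec (i ⁻¹ᵁ h.dom) 1 := by
  refine (h.altEval_normalVal (AlternatingMap.constOfIsEmpty _ _ (Fin 0) 1)
    (AlternatingMap.constOfIsEmpty _ _ (Fin 0) 1) (fun x ↦ (map_one h.scalar).symm) ![]).trans (congrArg (sec _) ?_)
  exact map_one (i.app h.dom).hom

/-- The value of a form of degree zero on the chart. -/
def zeroVal (W : Z.Opens) (y : Γ(h.Φ.obj (h.forms 0), W)) :
    Γ(structureSheaf X, i ⁻¹ᵁ (j ⁻¹ᵁ (g ''ᵁ W))) :=
  altEval le_rfl (show Γ(h.forms 0, j ⁻¹ᵁ (g ''ᵁ W)) from y) ![]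

lemma zeroVal_injective (W : Z.Opens) : Function.Injective (h.zeroVal W) :=
  fun _ _ h' ↦ zeroForm_ext h'

/-- In degree zero the map is restriction of functions from the chart to `X`, so it is onto and its
kernel is the ideal. Both ends of the resolution use this. -/
lemma zeroVal_normalHom (W : Z.Opens)
    (f : Γ(freeModule Z c, W) [⋀^Fin 0]→ₗ[Γ(Z, W)] Γ(Z, W)) :
    h.zeroVal W ((h.normalHom 0).appₗ W (koszulMk W f)) =
      sec _ ((i ≫ j).app (g ''ᵁ W) (imgₒ g W (f ![]))) := by
  have hle : j ⁻¹ᵁ (g ''ᵁ W) ≤ h.dom := j.preimage_mono (g.image_mono le_top)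
  have h1 : (h.normalHom 0).appₗ W (koszulMk W f) =
      f ![] • (h.Φ.obj (h.forms 0)).res le_top (h.normalVal (koszulOne Z c)) := by
    rw [koszulMk_eq_smul_one, _root_.map_smul, Hom.appₗ_res]
    rfl
  have h2 : altEval hle (h.normalVal (koszulOne Z c)) ![] = sec (i ⁻¹ᵁ (j ⁻¹ᵁ (g ''ᵁ W))) 1 := by
    have h3 := altEval_comp_res le_rfl hle (h.normalVal (koszulOne Z c)) ![]
    rw [h.altEval_normalVal_one] at h3
    refine (congrArg (altEval hle (h.normalVal (koszulOne Z c))) (Subsingleton.elim _ _)).trans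
      (h3.trans ?_)
    exact res_sec_one (i.preimage_mono hle)
  rw [h1]
  have h3 : h.zeroVal W (f ![] • (h.Φ.obj (h.forms 0)).res le_top (h.normalVal (koszulOne Z c))) =
      resₒ le_rfl (j.app (g ''ᵁ W) (imgₒ g W (f ![]))) •
        altEval hle (h.normalVal (koszulOne Z c)) ![] := rfl
  rw [h3, h2, resₒ_self]
  refine (pushforward_smul i _ _ _ _).trans ?_
  rw [Scheme.Hom.comp_app]
  exact (sec_eq_smul _).symm

instance epi_normalHom_zero : Epi (h.normalHom 0) := by
  refine LocallySurjective.epi fun U s x hx ↦ ?_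
  obtain ⟨W, hxW, hW⟩ := exists_affine_le hx
  refine ⟨W.1, hW, hxW, ?_⟩
  obtain ⟨r, hr⟩ := exists_sec_eq _ (h.zeroVal W.1 ((h.Φ.obj (h.forms 0)).res hW s))
  obtain ⟨r, rfl⟩ := (i ≫ j).app_surjective (g ''ᵁ W.1) (W.2.image_of_isOpenImmersion g) r
  obtain ⟨r, rfl⟩ := (imgₒ_bijective g W.1).2 r
  refine ⟨koszulMk W.1 (AlternatingMap.constOfIsEmpty _ _ (Fin 0) r), h.zeroVal_injective _ ?_⟩
  exact (h.zeroVal_normalHom W.1 _).trans hr.symm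

lemma exact_normalHom_zero :
    (ShortComplex.mk (koszulD a 0) (h.normalHom 0) (h.koszulD_normalHom 0)).Exact := by
  refine exact_of_locally _ _ _ fun U φ hφ x hx ↦ ?_
  obtain ⟨W, hxW, hW⟩ := exists_affine_le hx
  refine ⟨W.1, hW, hxW, ?_⟩
  obtain ⟨f, hf⟩ := exists_koszulMk ((koszul Z c 0).res hW φ)
  rw [hf]
  refine exists_koszulD_zero a W.1 f ((h.chart.mem_iff W _).1 ((sec _).map_eq_zero_iff.1 ?_))
  rw [← h.zeroVal_normalHom, ← hf, Hom.appₗ_res, hφ, map_zero]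
  rfl

/-- The Koszul resolution. -/
def resolution : Abelian.SplicedResolution (koszul Z c) :=
  .ofExact (koszul Z c) (koszulD a) (h.normalHom 0) (h.koszulD_normalHom 0)
    (fun n ↦ altContract_comp _ n) h.exact_normalHom_zero (koszul_exact a h.chart.regular)

lemma resolution_d (n : ℕ) : h.resolution.d n = koszulD a n :=
  Abelian.SplicedResolution.ofExact_z_w _ _ _ _ _ _ _ n

variable (J : X.Modules)

/-- The entries of the differential are multiples of the `a k`, which act as zero on a direct image
from `X`. Hence the Koszul complex computes Ext groups into such modules with zero differential. -/
lemma koszulD_comp (n : ℕ)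
    (f : koszul Z c n ⟶ h.Φ.obj ((Scheme.Modules.pushforward i).obj J)) :
    koszulD a n ≫ f = 0 := by
  refine koszul_induction fun s ↦ ?_
  rw [Hom.comp_appₗ, koszulD_basis, Hom.zero_appₗ]
  have h1 : (AlternatingMap.basis (isFrame_stdFrame.basis le_rfl) (n + 1) s).curryLeft
      (koszulVector a) = ∑ k, a k • (AlternatingMap.basis (isFrame_stdFrame.basis le_rfl)
        (n + 1) s).curryLeft (stdFrame Z c k) := by
    rw [koszulVector, map_sum]
    exact Finset.sum_congr rfl fun k _ ↦ _root_.map_smul _ _ _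
  rw [h1, koszulMk_sum, map_sum]
  refine Finset.sum_eq_zero fun k _ ↦ ?_
  rw [_root_.map_smul]
  have h2 (z : Γ(J, i ⁻¹ᵁ h.dom)) : i.app h.dom (h.scalar (a k)) • z = 0 := by
    rw [h.app_scalar, zero_smul]
  exact h2 _

lemma altComparison_altFrame {n : ℕ} (s : Set.powersetCard (Fin c) n) :
    (altComparison i ν n).appₗ h.dom (h.isFrameN.altFrame n s) =
      h.normalVal (koszulMk ⊤ (AlternatingMap.basis (isFrame_stdFrame.basis le_rfl) n s)) := by
  refine h.isFrame.altEval_injective (AlternatingMap.ext fun v ↦ ?_)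
  refine Eq.trans ?_ (h.altEval_normalVal_basis s v).symm
  exact DFunLike.congr_fun (h.isFrameN.altEval_altFrame le_rfl s) _

/-- Both sides are families of sections of `J` indexed by the subsets of size `n` of the frame: the
basis forms of the Koszul term correspond to the dual frame of forms on `N`. -/
lemma normalHom_comp_bijective {J : X.Modules} (hJ : J.SupportedOn (i ⁻¹ᵁ h.dom)) (n : ℕ)
    [IsIso (altComparison i ν n)] :
    Function.Bijective fun φ : altSheaf N (structureSheaf X) n ⟶ J ↦ h.normalHom n ≫
      h.Φ.map (inv (altComparison i ν n) ≫ (Scheme.Modules.pushforward i).map φ) := by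
  have key (φ : altSheaf N (structureSheaf X) n ⟶ J) (s : Set.powersetCard (Fin c) n) :
      Hom.appₗ (h.normalHom n ≫
        h.Φ.map (inv (altComparison i ν n) ≫ (Scheme.Modules.pushforward i).map φ)) ⊤
        (koszulMk ⊤ (AlternatingMap.basis (isFrame_stdFrame.basis le_rfl) n s)) =
      φ.appₗ (i ⁻¹ᵁ h.dom) (h.isFrameN.altFrame n s) := by
    have h1 (x : Γ(koszul Z c n, ⊤)) : Hom.appₗ (h.normalHom n ≫
        h.Φ.map (inv (altComparison i ν n) ≫ (Scheme.Modules.pushforward i).map φ)) ⊤ x =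
        Hom.appₗ (inv (altComparison i ν n) ≫ (Scheme.Modules.pushforward i).map φ) h.dom
          (h.normalVal x) := rfl
    refine (h1 _).trans ?_
    rw [← altComparison_altFrame]
    exact congrArg (fun f : (Scheme.Modules.pushforward i).obj (altSheaf N (structureSheaf X) n) ⟶
      (Scheme.Modules.pushforward i).obj J ↦ Hom.appₗ f h.dom (h.isFrameN.altFrame n s))
        (IsIso.hom_inv_id_assoc (altComparison i ν n) ((Scheme.Modules.pushforward i).map φ))
  refine ⟨fun φ ψ hφ ↦ ?_, fun f ↦ ?_⟩
  · refine (h.isFrameN.alt n).hom_injective hJ fun s ↦ ?_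
    rw [← key, ← key]
    exact congrArg (fun f : koszul Z c n ⟶ h.Φ.obj ((Scheme.Modules.pushforward i).obj J) ↦
      f.appₗ ⊤ (koszulMk ⊤ (AlternatingMap.basis (isFrame_stdFrame.basis le_rfl) n s))) hφ
  · obtain ⟨φ, hφ⟩ := (h.isFrameN.alt n).hom_surjective hJ fun s ↦
      f.appₗ ⊤ (koszulMk ⊤ (AlternatingMap.basis (isFrame_stdFrame.basis le_rfl) n s))
    exact ⟨φ, koszul_induction fun s ↦ (key φ s).trans (hφ s)⟩

/-- The iterated extension class on the chart. -/
def chartClass (hV : V.LocallyFramed) (n : ℕ) :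
    Abelian.Ext (h.Φ.obj (h.forms 0)) (h.Φ.obj (h.forms n)) n :=
  ((contractClass hV (shortExact_idealSequence i) β n).mapExactFunctor
    (Scheme.Modules.pushforward j)).mapExactFunctor (restrictFunctor g)

lemma chartClass_zero (hV : V.LocallyFramed) : h.chartClass hV 0 = Abelian.Ext.mk₀ (𝟙 _) := by
  rw [chartClass, contractClass, Abelian.Ext.mapExactFunctor_mk₀, Abelian.Ext.mapExactFunctor_mk₀]
  rfl

lemma mapExactFunctor_contractClass_succ {V : X.Modules} (hV : V.LocallyFramed)
    {S : ShortComplex X.Modules} (hS : S.ShortExact) (β : V ⟶ altSheaf S.X₁ S.X₃ 1) (n : ℕ)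
    (f : X ⟶ Y) [IsClosedImmersion f] :
    (contractClass hV hS β (n + 1)).mapExactFunctor (Scheme.Modules.pushforward f) =
      ((contractClass hV hS β n).mapExactFunctor (Scheme.Modules.pushforward f)).comp
        (((hV.shortExact_alt n hS).map_of_exact (Scheme.Modules.pushforward f)).extClass.comp
          (Abelian.Ext.mk₀ ((Scheme.Modules.pushforward f).map (contract β n))) (add_zero 1)) rfl :=
  Abelian.Ext.mapExactFunctor_comp_extClass (Scheme.Modules.pushforward f)
    (hV.shortExact_alt n hS) (contractClass hV hS β n) (contract β n)

lemma chartClass_succ (hV : V.LocallyFramed) (n : ℕ) : h.chartClass hV (n + 1) =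
    (h.chartClass hV n).comp ((h.shortExact_formSequence hV n).extClass.comp
      (Abelian.Ext.mk₀ (h.Φ.map (contract β n))) (add_zero 1)) rfl := by
  rw [chartClass, mapExactFunctor_contractClass_succ]
  exact Abelian.Ext.mapExactFunctor_comp_extClass (restrictFunctor g)
    ((hV.shortExact_alt n (shortExact_idealSequence i)).map_of_exact
      (Scheme.Modules.pushforward j)) ((contractClass hV (shortExact_idealSequence i) β
        n).mapExactFunctor (Scheme.Modules.pushforward j))
    ((Scheme.Modules.pushforward j).map (contract β n))

/-- The morphism of sheaves on the chart given by a morphism on `X`. -/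
def chartHom (J : X.Modules) (n : ℕ) [IsIso (altComparison i ν n)] :
    (altSheaf N (structureSheaf X) n ⟶ J) →+
      (h.Φ.obj (h.forms n) ⟶ h.Φ.obj ((Scheme.Modules.pushforward i).obj J)) :=
  h.Φ.mapAddHom.comp ((Preadditive.leftComp _ (inv (altComparison i ν n))).comp
    (Scheme.Modules.pushforward i).mapAddHom)

lemma chartClass_comp_bijective (hV : V.LocallyFramed) {J : X.Modules} (hJ : J.IsFlasque)
    (hJ' : J.SupportedOn (i ⁻¹ᵁ h.dom)) (n : ℕ) [IsIso (altComparison i ν n)]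
    (hn : Function.Bijective fun φ : altSheaf N (structureSheaf X) n ⟶ J ↦ n.factorial • φ) :
    Function.Bijective fun φ : altSheaf N (structureSheaf X) n ⟶ J ↦
      (h.chartClass hV n).comp (Abelian.Ext.mk₀ (h.chartHom J n φ)) (add_zero n) := by
  have hT : (h.Φ.obj ((Scheme.Modules.pushforward i).obj J)).IsFlasque :=
    ((hJ.pushforward i).pushforward j).restrict g
  choose m hm using h.exists_idealHom hV
  refine h.resolution.comp_bijective (S := h.formSequence)
    (fun n k x ↦ (isFrame_stdFrame.alt n).ext_eq_zero hT k x)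
    (fun n f ↦ by
      rw [h.resolution_d]
      exact h.koszulD_comp J n f)
    (h.shortExact_formSequence hV) (fun n ↦ h.Φ.map (contract β n)) (h.chartClass hV)
    (h.chartClass_zero hV) (h.chartClass_succ hV) h.formHom m
    (fun n ↦ (hm n).trans (congrArg (· ≫ h.formHom n) (h.resolution_d n)).symm)
    (fun n ↦ h.idealHom_contract (hm n)) (Iso.refl _) (Category.comp_id _) n (h.chartHom J n) ?_ hn
  exact (h.normalHom_comp_bijective hJ' n).congr_fun fun φ ↦ (Category.assoc _ _ _).symm

/-- For flasque `J` supported on the chart, Ext groups into its direct image are unchanged by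
restriction to the chart, where the Koszul resolution decides. -/
lemma contractClass_comp_bijective (hV : V.LocallyFramed) {J : X.Modules} (hJ : J.IsFlasque)
    (hJ' : J.SupportedOn (i ⁻¹ᵁ h.dom)) (n : ℕ) [IsIso (altComparison i ν n)]
    (hn : Function.Bijective fun φ : altSheaf N (structureSheaf X) n ⟶ J ↦ n.factorial • φ) :
    Function.Bijective fun φ : altSheaf N (structureSheaf X) n ⟶ J ↦
      ((contractClass hV (shortExact_idealSequence i) β n).mapExactFunctor
        (Scheme.Modules.pushforward j)).comp (Abelian.Ext.mk₀ ((Scheme.Modules.pushforward j).map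
          (inv (altComparison i ν n) ≫ (Scheme.Modules.pushforward i).map φ))) (add_zero n) := by
  have hP : ((Scheme.Modules.pushforward j).obj
      ((Scheme.Modules.pushforward i).obj J)).SupportedOn (g ''ᵁ ⊤) :=
    (hJ'.pushforward i).pushforward j
  refine (Function.Bijective.of_comp_iff' (ext_restrict_bijective_of_supportedOn g
    ((Scheme.Modules.pushforward j).obj (h.forms 0)) _ hP
      ((hJ.pushforward i).pushforward j) n) _).1 ?_
  have h1 (φ : altSheaf N (structureSheaf X) n ⟶ J) :
      (restrictFunctor g).mapExtAddHom _ _ n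
        (((contractClass hV (shortExact_idealSequence i) β n).mapExactFunctor
        (Scheme.Modules.pushforward j)).comp (Abelian.Ext.mk₀ ((Scheme.Modules.pushforward j).map
          (inv (altComparison i ν n) ≫ (Scheme.Modules.pushforward i).map φ))) (add_zero n)) =
      (h.chartClass hV n).comp (Abelian.Ext.mk₀ (h.chartHom J n φ)) (add_zero n) :=
    (Abelian.Ext.mapExactFunctor_comp (restrictFunctor g) _ _ (add_zero n)).trans
      (congrArg (fun y ↦ (h.chartClass hV n).comp y (add_zero n))
        (Abelian.Ext.mapExactFunctor_mk₀ _ _))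
  exact (h.chartClass_comp_bijective hV hJ hJ' n hn).congr_fun h1

end NormalChart

end AlgebraicGeometry.Scheme.Modules

/-! ### Universal classes on the ambient scheme. -/

namespace CategoryTheory.Abelian.Ext

variable {C : Type*} [Category C] [Abelian C] [HasExt.{w} C]

lemma iso_comp_bijective {A A' B : C} (e : A ≅ A') (n : ℕ) :
    Function.Bijective fun x : Ext A' B n ↦ (mk₀ e.hom).comp x (zero_add n) :=
  Function.bijective_iff_has_inverse.2
    ⟨fun y ↦ (mk₀ e.inv).comp y (zero_add n), fun y ↦ by simp, fun y ↦ by simp⟩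

lemma comp_iso_bijective {A B B' : C} (e : B ≅ B') (n : ℕ) :
    Function.Bijective fun x : Ext A B n ↦ x.comp (mk₀ e.hom) (add_zero n) :=
  Function.bijective_iff_has_inverse.2
    ⟨fun y ↦ y.comp (mk₀ e.inv) (add_zero n), fun y ↦ by simp, fun y ↦ by simp⟩

end CategoryTheory.Abelian.Ext

namespace AlgebraicGeometry.Scheme.Modules

variable {X X' Y Z : Scheme.{u}}

section Dual

variable {C : X.Modules} {U : X.Opens} {c : ℕ} {b : Fin c → Γ(C, U)} (hb : IsFrame C U b)

/-- Sections of the dual on a framed open set. -/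
def IsFrame.dualEquiv {W : X.Opens} (h : W ≤ U) :
    Module.Dual Γ(X, W) Γ(C, W) ≃ₗ[Γ(X, W)] Γ(altSheaf C (structureSheaf X) 1, W) :=
  LinearEquiv.trans
    { toFun f := AlternatingMap.ofSubsingleton Γ(X, W) Γ(C, W) Γ(X, W) (0 : Fin 1) f
      invFun f := (AlternatingMap.ofSubsingleton Γ(X, W) Γ(C, W) Γ(X, W) (0 : Fin 1)).symm f
      map_add' _ _ := rfl
      map_smul' _ _ := rfl
      left_inv f := Equiv.symm_apply_apply _ f
      right_inv f := Equiv.apply_symm_apply _ f }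
    (altCongr (sec W) ≪≫ₗ ((hb.res h).altEquiv (T := structureSheaf X)).symm)

lemma IsFrame.altEval_dualEquiv {W : X.Opens} (h : W ≤ U) (f : Module.Dual Γ(X, W) Γ(C, W))
    (m : Fin 1 → Γ(C, W)) : altEval le_rfl (hb.dualEquiv h f) m = sec W (f (m 0)) :=
  DFunLike.congr_fun ((hb.res h).altEval_altEquiv_symm _) m

/-- The dual frame. -/
def IsFrame.dualFrame (k : Fin c) : Γ(altSheaf C (structureSheaf X) 1, U) :=
  hb.dualEquiv le_rfl ((hb.basis le_rfl).dualBasis k)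

lemma IsFrame.altEval_dualFrame (k l : Fin c) :
    altEval le_rfl (hb.dualFrame k) (fun _ ↦ b l) = sec U (if l = k then 1 else 0) := by
  refine (hb.altEval_dualEquiv le_rfl _ _).trans (congrArg (sec U) ?_)
  have h1 : b l = hb.basis le_rfl l := by rw [basis_apply, res_self]
  rw [h1, Module.Basis.dualBasis_apply_self]

lemma IsFrame.dual : IsFrame (altSheaf C (structureSheaf X) 1) U hb.dualFrame :=
  .of_basis (fun W h ↦ (hb.basis h).dualBasis.map (hb.dualEquiv h)) fun W h k ↦ by
    rw [Module.Basis.map_apply]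
    refine (hb.res h).altEval_injective
      ((AlternatingMap.ofSubsingleton Γ(X, W) Γ(C, W) Γ(structureSheaf X, W)
        (0 : Fin 1)).symm.injective ((hb.basis h).ext fun l ↦ ?_))
    refine (hb.altEval_dualEquiv h _ fun _ ↦ hb.basis h l).trans ?_
    rw [Module.Basis.dualBasis_apply_self]
    have h1 := altEval_comp_res le_rfl h (hb.dualFrame k) fun _ ↦ b l
    rw [hb.altEval_dualFrame, res_sec] at h1
    have h2 : (C.res h ∘ fun _ : Fin 1 ↦ b l) = fun _ ↦ hb.basis h l :=
      funext fun _ ↦ (hb.basis_apply h l).symm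
    rw [h2] at h1
    refine Eq.trans (congrArg (sec W) ?_) h1.symm
    split_ifs
    · exact (map_one _).symm
    · exact (map_zero _).symm

/-- In the frame of `N` dual to a frame of `C`, pairing with the `k`-th frame element of `C` is the
`k`-th coordinate. This supplies the field `pairing` of a normal chart. -/
lemma IsFrame.altEval_eq_repr {N : X.Modules} (κ : N ≅ altSheaf C (structureSheaf X) 1)
    (hN : IsFrame N U fun k ↦ κ.inv.appₗ U (hb.dualFrame k)) (m : Γ(N, U)) (k : Fin c) :
    altEval le_rfl (κ.hom.appₗ U m) (fun _ ↦ b k) = sec U ((hN.basis le_rfl).repr m k) := by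
  let L : Γ(N, U) →ₗ[Γ(X, U)] Γ(structureSheaf X, U) :=
    { toFun m := altEval le_rfl (κ.hom.appₗ U m) (fun _ ↦ b k)
      map_add' x y := by
        rw [map_add]
        rfl
      map_smul' r x := by
        rw [_root_.map_smul, altEval_smul, resₒ_self]
        rfl }
  have h1 : L = (sec U).toLinearMap ∘ₗ (hN.basis le_rfl).coord k :=
    (hN.basis le_rfl).ext fun l ↦ by
      have h2 : κ.hom.appₗ U (hN.basis le_rfl l) = hb.dualFrame l := by
        rw [basis_apply, res_self, ← Hom.comp_appₗ, κ.inv_hom_id, Hom.id_appₗ]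
      refine (congrArg (fun z ↦ altEval le_rfl z fun _ ↦ b k) h2).trans ?_
      rw [hb.altEval_dualFrame]
      refine congrArg (sec U) ?_
      rw [Module.Basis.coord_apply, Module.Basis.repr_self, Finsupp.single_apply]
      simp only [eq_comm]
      rfl
  exact LinearMap.congr_fun h1 m

end Dual

section NormalPairing

variable (i : X ⟶ X') (j : X' ⟶ Y) [IsClosedImmersion i] [IsClosedImmersion j]
  {V : X'.Modules} {N : X.Modules} (ν : V ⟶ (Scheme.Modules.pushforward i).obj N)
  {C : X.Modules} (κ : N ≅ altSheaf C (structureSheaf X) 1)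
  (γ : idealModule i ⟶ (Scheme.Modules.pushforward i).obj C)

/-- The pairing of the ideal sheaf and an extension of the normal sheaf. -/
def normalPairing :
    V ⟶ altSheaf (idealModule i) ((Scheme.Modules.pushforward i).obj (structureSheaf X)) 1 :=
  ν ≫ (Scheme.Modules.pushforward i).map κ.hom ≫ altPushforward i C (structureSheaf X) 1 ≫
    altPrecomp γ _ 1

lemma altEval_normalPairing {U : X'.Opens} (v : Γ(V, U)) (s : Γ(idealModule i, U)) :
    altEval le_rfl ((normalPairing i ν κ γ).appₗ U v) (fun _ ↦ s) =
      altEval le_rfl (κ.hom.appₗ (i ⁻¹ᵁ U) (ν.appₗ U v)) fun _ ↦ γ.appₗ U s := rfl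

end NormalPairing

lemma exists_normalChart (i : X ⟶ X') (j : X' ⟶ Y) [IsClosedImmersion i] [IsClosedImmersion j]
    {V : X'.Modules} (hV : V.LocallyFramed) {N : X.Modules}
    (ν : V ⟶ (Scheme.Modules.pushforward i).obj N)
    (κ : N ≅ altSheaf (conormalSheaf (i ≫ j)) (structureSheaf X) 1)
    (γ : idealModule i ⟶ (Scheme.Modules.pushforward i).obj (conormalSheaf (i ≫ j)))
    (hγ : ∀ (U : Y.Opens) (s : Γ(idealModule (i ≫ j), U)) (t : Γ(idealModule i, j ⁻¹ᵁ U)),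
      (idealι i).appₗ (j ⁻¹ᵁ U) t = (structureMap j).appₗ U ((idealι (i ≫ j)).appₗ U s) →
        γ.appₗ (j ⁻¹ᵁ U) t = (toConormal (i ≫ j)).appₗ U s)
    {x : X} {c : ℕ} (h : HasCodimAt (i ≫ j) x c) :
    ∃ (Z : Scheme.{u}) (g : Z ⟶ Y) (_ : IsOpenImmersion g) (a : Fin c → Γ(Z, ⊤)),
      Nonempty (NormalChart i j ν (normalPairing i ν κ γ) g a) ∧ (i ≫ j) x ∈ g ''ᵁ ⊤ := by
  obtain ⟨W, hxW, r, b, hb⟩ := hV (i x)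
  obtain ⟨O, rfl⟩ := exists_preimage_eq j W
  have hO : (i ≫ j) x ∈ O := by
    rw [Scheme.Hom.comp_apply]
    exact hxW
  obtain ⟨Z, g, hg, a, hc, hx, hle⟩ := exists_isKoszulChart (i ≫ j) h hO
  refine ⟨Z, g, hg, a, ?_, hx⟩
  have ha (k : Fin c) : i.app (j ⁻¹ᵁ (g ''ᵁ ⊤)) (j.app (g ''ᵁ ⊤) (imgₒ g ⊤ (a k))) = 0 := by
    have h1 := hc.app_imgₒ k
    rw [Scheme.Hom.comp_app] at h1
    exact h1
  choose s hs using fun k ↦ exists_idealModule i (j ⁻¹ᵁ (g ''ᵁ ⊤)) _ (ha k)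
  have hf := hc.isFrame_conormalSheaf
  have hN := hf.dual.map κ.inv fun W _ ↦ bijective_of_isIso _ _
  exact ⟨{
    chart := hc
    r := r
    b := _
    isFrame := hb.res (j.preimage_mono hle)
    bN := _
    isFrameN := hN
    s := s
    idealι_s := hs
    pairing := fun v k ↦ by
      have h1 : γ.appₗ (j ⁻¹ᵁ (g ''ᵁ ⊤)) (s k) =
          (toConormal (i ≫ j)).appₗ (g ''ᵁ ⊤) (hc.idealSec k) := by
        refine hγ _ _ _ ?_
        rw [hs, hc.idealι_idealSec]
        exact (structureMap_appₗ j _ _).symm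
      refine (altEval_normalPairing i ν κ γ v (s k)).trans ?_
      rw [h1]
      exact hf.altEval_eq_repr κ hN (ν.appₗ _ v) k }⟩

lemma factorial_smul_bijective {k : Type u} [Field k] [X.Over (Spec (.of k))] {M J : X.Modules}
    {n : ℕ} (hn : ringChar k = 0 ∨ n < ringChar k) :
    Function.Bijective fun φ : M ⟶ J ↦ n.factorial • φ := by
  have h1 : (n.factorial : k) ≠ 0 := by
    intro h2
    have h3 := (ringChar.spec k n.factorial).1 h2
    rcases hn with h | h
    · rw [h, zero_dvd_iff] at h3
      exact Nat.factorial_ne_zero n h3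
    · have hp : (ringChar k).Prime :=
        (CharP.char_is_prime_or_zero k (ringChar k)).resolve_right (by omega)
      exact absurd ((Nat.Prime.dvd_factorial hp).1 h3) (by omega)
  have h2 : (fun φ : M ⟶ J ↦ n.factorial • φ) = fun φ ↦ (n.factorial : k) • φ :=
    funext fun φ ↦ (Nat.cast_smul_eq_nsmul k _ _).symm
  rw [h2]
  exact (Units.mk0 _ h1 • LinearEquiv.refl k (M ⟶ J) : _ ≃ₗ[k] _).bijective

/-- A class in `Extⁿ` on `Y` from which every homomorphism to a flasque module on small opens is
obtained. -/
def IsUniversalClass (f : X ⟶ Y) {M : Y.Modules} {E : X.Modules} {n : ℕ}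
    (x : Abelian.Ext M ((Scheme.Modules.pushforward f).obj E) n) : Prop :=
  ∀ p : X, ∃ U : X.Opens, p ∈ U ∧ ∀ J : X.Modules, J.IsFlasque → J.SupportedOn U →
    Function.Bijective fun φ : E ⟶ J ↦
      x.comp (Abelian.Ext.mk₀ ((Scheme.Modules.pushforward f).map φ)) (add_zero n)

/-- For `n ≤ c` the factorial is a nonzero scalar of `k`. For `n > c` it may vanish in `k`, but then
there are no nonzero forms on the chart and both sides are zero. -/
lemma NormalChart.factorial_smul_bijective {k : Type u} [Field k] [X.Over (Spec (.of k))]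
    {i : X ⟶ X'} {j : X' ⟶ Y} [IsClosedImmersion i] [IsClosedImmersion j] {V : X'.Modules}
    {N : X.Modules} {ν : V ⟶ (Scheme.Modules.pushforward i).obj N}
    {β : V ⟶ altSheaf (idealModule i) ((Scheme.Modules.pushforward i).obj (structureSheaf X)) 1}
    {g : Z ⟶ Y} [IsOpenImmersion g] {c : ℕ} {a : Fin c → Γ(Z, ⊤)} (h : NormalChart i j ν β g a)
    (hchar : ringChar k = 0 ∨ c < ringChar k) {J : X.Modules} (hJ : J.SupportedOn (i ⁻¹ᵁ h.dom))
    (n : ℕ) :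
    Function.Bijective fun φ : altSheaf N (structureSheaf X) n ⟶ J ↦ n.factorial • φ := by
  by_cases hn : n ≤ c
  · exact Scheme.Modules.factorial_smul_bijective (k := k) (hchar.imp_right fun h ↦ by omega)
  · have h1 : IsEmpty (Set.powersetCard (Fin c) n) := ⟨fun s ↦ hn (by
      have h2 := Finset.card_le_univ s.1
      rw [s.2, Fintype.card_fin] at h2
      exact h2)⟩
    have h2 (φ ψ : altSheaf N (structureSheaf X) n ⟶ J) : φ = ψ :=
      (h.isFrameN.alt n).hom_injective hJ fun s ↦ h1.elim s
    exact ⟨fun φ ψ _ ↦ h2 φ ψ, fun φ ↦ ⟨φ, h2 _ _⟩⟩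

/-- The class is global because it is made from the extension `V`, the conormal sheaf and the
pairing alone; charts serve only to verify that it is universal. The isomorphisms `e₀` and `u`
adjust its source and target. -/
theorem exists_isUniversalClass_of_comp {k : Type u} [Field k] [X.Over (Spec (.of k))]
    (i : X ⟶ X') (j : X' ⟶ Y) (f : X ⟶ Y) (hf : i ≫ j = f) [IsClosedImmersion i]
    [IsClosedImmersion j] (hker : j.ker = f.ker ^ 2) (hlci : IsLCI f)
    (hchar : ringChar k = 0 ∨ ∀ (x : X) (c : ℕ), HasCodimAt f x c → c < ringChar k)
    {V : X'.Modules} (hV : V.LocallyFramed)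
    (e : (Scheme.Modules.pullback i).obj V ≅ normalSheaf f) (n : ℕ) :
    ∃ x : Abelian.Ext (pushforwardStructureSheaf f) ((Scheme.Modules.pushforward f).obj
      (altSheaf (normalSheaf f) (structureSheaf X) n)) n, IsUniversalClass f x := by
  subst hf
  let ν := pullbackUnit i V ≫ (Scheme.Modules.pushforward i).map e.hom
  have := isIso_altComparison (preservesFrames_of_iso e) hV n
  obtain ⟨κ⟩ := nonempty_dual_iso (conormalSheaf (i ≫ j))
  obtain ⟨γ, hγ⟩ := exists_conormalMap i j hker
  let y := (contractClass hV (shortExact_idealSequence i) (normalPairing i ν κ γ)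
    n).mapExactFunctor (Scheme.Modules.pushforward j)
  let e₀ : pushforwardStructureSheaf (i ≫ j) ≅ (Scheme.Modules.pushforward j).obj
      (altSheaf V ((Scheme.Modules.pushforward i).obj (structureSheaf X)) 0) :=
    ((pushforwardComp i j).app (structureSheaf X)).symm ≪≫
      (Scheme.Modules.pushforward j).mapIso
        (asIso (altZero V ((Scheme.Modules.pushforward i).obj (structureSheaf X))))
  let E := altSheaf (normalSheaf (i ≫ j)) (structureSheaf X) n
  let u := (Scheme.Modules.pushforward j).map (inv (altComparison i ν n)) ≫
    (pushforwardComp i j).hom.app E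
  refine ⟨((Abelian.Ext.mk₀ e₀.hom).comp y (zero_add n)).comp (Abelian.Ext.mk₀ u) (add_zero n),
    fun p ↦ ?_⟩
  obtain ⟨c, hc⟩ := hlci p
  obtain ⟨Z, g, hg, a, ⟨h⟩, hp⟩ := exists_normalChart i j hV ν κ γ hγ hc
  refine ⟨i ⁻¹ᵁ h.dom, by simpa using hp, fun J hJ hJ' ↦ ?_⟩
  have h1 := h.contractClass_comp_bijective hV hJ hJ' n
    (h.factorial_smul_bijective (hchar.imp_right fun h' ↦ h' p c hc) hJ' n)
  refine ((Abelian.Ext.comp_iso_bijective ((pushforwardComp i j).app J) n).comp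
    ((Abelian.Ext.iso_comp_bijective e₀ n).comp h1)).congr_fun fun φ ↦ ?_
  have h2 : u ≫ (Scheme.Modules.pushforward (i ≫ j)).map φ =
      (Scheme.Modules.pushforward j).map (inv (altComparison i ν n) ≫
        (Scheme.Modules.pushforward i).map φ) ≫ (pushforwardComp i j).hom.app J := by
    have h3 := (pushforwardComp i j).hom.naturality φ
    rw [Functor.map_comp, Category.assoc, Category.assoc, ← h3]
    rfl
  change _ = ((Abelian.Ext.mk₀ e₀.hom).comp (y.comp (Abelian.Ext.mk₀
    ((Scheme.Modules.pushforward j).map (inv (altComparison i ν n) ≫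
      (Scheme.Modules.pushforward i).map φ))) (add_zero n)) (zero_add n)).comp
    (Abelian.Ext.mk₀ ((pushforwardComp i j).hom.app J)) (add_zero n)
  rw [← Abelian.Ext.comp_assoc (Abelian.Ext.mk₀ e₀.hom) y _ (zero_add n) (add_zero n) (by omega),
    Abelian.Ext.comp_assoc _ _ _ (add_zero n) (add_zero 0) (by omega),
    Abelian.Ext.comp_assoc _ _ _ (add_zero n) (add_zero 0) (by omega),
    Abelian.Ext.mk₀_comp_mk₀, Abelian.Ext.mk₀_comp_mk₀, h2]

theorem exists_isUniversalClass {k : Type u} [Field k] [X.Over (Spec (.of k))]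
    (f : X ⟶ Y) [IsClosedImmersion f] (hlci : IsLCI f)
    (hchar : ringChar k = 0 ∨ ∀ (x : X) (c : ℕ), HasCodimAt f x c → c < ringChar k)
    (hN : NormalBundleExtends f) (n : ℕ) :
    ∃ x : Abelian.Ext (pushforwardStructureSheaf f) ((Scheme.Modules.pushforward f).obj
      (altSheaf (normalSheaf f) (structureSheaf X) n)) n, IsUniversalClass f x := by
  obtain ⟨V, hV, ⟨e⟩⟩ := hN
  have h1 : toFirstNeighborhood f ≫ firstNeighborhoodι f = f := IsClosedImmersion.lift_fac _ _ _
  have : IsClosedImmersion (toFirstNeighborhood f ≫ firstNeighborhoodι f) := by rwa [h1]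
  have : IsClosedImmersion (toFirstNeighborhood f) := .of_comp _ (firstNeighborhoodι f)
  exact exists_isUniversalClass_of_comp (k := k) (toFirstNeighborhood f) (firstNeighborhoodι f) f h1
    (Scheme.IdealSheafData.ker_subschemeι _) hlci hchar hV.locallyFramed e n

lemma locallyFramed_normalSheaf (f : X ⟶ Y) [IsClosedImmersion f] (hN : NormalBundleExtends f) :
    (normalSheaf f).LocallyFramed := by
  obtain ⟨V, hV, ⟨e⟩⟩ := hN
  exact (hV.locallyFramed.pullback _).of_iso e

end AlgebraicGeometry.Scheme.Modules

/-! ### Degeneration of spectral objects. -/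

namespace CategoryTheory.Abelian.SpectralObject

open ComposableArrows

variable {k : Type*} [Ring k] (S : SpectralObject (ModuleCat.{v} k) EInt)

/-- The map of the spectral object given by inequalities. -/
def mapH (n : ℤ) {a b a' b' : EInt} (h : a ≤ b) (h' : a' ≤ b') (ha : a ≤ a') (hb : b ≤ b') :
    (S.H n).obj (mk₁ (homOfLE h)) →ₗ[k] (S.H n).obj (mk₁ (homOfLE h')) :=
  ((S.H n).map (homMk₁ (homOfLE ha) (homOfLE hb) : mk₁ (homOfLE h) ⟶ mk₁ (homOfLE h'))).hom

lemma map_eq_mapH (n : ℤ) {a b a' b' : EInt} (h : a ≤ b) (h' : a' ≤ b') (ha : a ≤ a') (hb : b ≤ b')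
    (φ : mk₁ (homOfLE h) ⟶ mk₁ (homOfLE h')) : ((S.H n).map φ).hom = S.mapH n h h' ha hb :=
  congrArg (fun φ ↦ ((S.H n).map φ).hom) (NatTrans.ext (funext fun _ ↦ Subsingleton.elim _ _))

lemma mapH_mapH (n : ℤ) {a b a' b' a'' b'' : EInt} (h : a ≤ b) (h' : a' ≤ b') (h'' : a'' ≤ b'')
    (ha : a ≤ a') (hb : b ≤ b') (ha' : a' ≤ a'') (hb' : b' ≤ b'') (x) :
    S.mapH n h' h'' ha' hb' (S.mapH n h h' ha hb x) =
      S.mapH n h h'' (ha.trans ha') (hb.trans hb') x := by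
  rw [← S.map_eq_mapH n h h'' (ha.trans ha') (hb.trans hb')
    ((homMk₁ (homOfLE ha) (homOfLE hb) : mk₁ (homOfLE h) ⟶ mk₁ (homOfLE h')) ≫
      (homMk₁ (homOfLE ha') (homOfLE hb') : mk₁ (homOfLE h') ⟶ mk₁ (homOfLE h''))),
    Functor.map_comp]
  rfl

lemma mapH_self (n : ℤ) {a b : EInt} (h : a ≤ b) (x) : S.mapH n h h le_rfl le_rfl x = x := by
  rw [← S.map_eq_mapH n h h le_rfl le_rfl (𝟙 _), Functor.map_id]
  rfl

section

variable {a b c : EInt} (hab : a ≤ b) (hbc : b ≤ c)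

/-- The connecting map of a spectral object. -/
def del (n n' : ℤ) (hn : n + 1 = n') :
    (S.H n).obj (mk₁ (homOfLE hbc)) →ₗ[k] (S.H n').obj (mk₁ (homOfLE hab)) :=
  (S.δ (homOfLE hab) (homOfLE hbc) n n' hn).hom

lemma exists_of_mapH_eq_zero (n : ℤ) (x : (S.H n).obj (mk₁ (homOfLE (hab.trans hbc))))
    (hx : S.mapH n (hab.trans hbc) hbc hab le_rfl x = 0) :
    ∃ y, S.mapH n hab (hab.trans hbc) le_rfl hbc y = x := by
  have h := (ShortComplex.moduleCat_exact_iff _).1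
    (S.exact₂ (homOfLE hab) (homOfLE hbc) (homOfLE (hab.trans hbc)) rfl n) x
    ((DFunLike.congr_fun (S.map_eq_mapH n (hab.trans hbc) hbc hab le_rfl _) x).trans hx)
  obtain ⟨y, hy⟩ := h
  exact ⟨y, (DFunLike.congr_fun (S.map_eq_mapH n hab (hab.trans hbc) le_rfl hbc _) y).symm.trans hy⟩

lemma mapH_mapH_eq_zero (n : ℤ) (y : (S.H n).obj (mk₁ (homOfLE hab))) :
    S.mapH n (hab.trans hbc) hbc hab le_rfl (S.mapH n hab (hab.trans hbc) le_rfl hbc y) = 0 := by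
  have h := congrArg (fun f ↦ f.hom y)
    (S.zero₂ (homOfLE hab) (homOfLE hbc) (homOfLE (hab.trans hbc)) rfl n)
  refine Eq.trans ?_ h
  rw [← S.map_eq_mapH n hab (hab.trans hbc) le_rfl hbc (twoδ₂Toδ₁ _ _ _ rfl),
    ← S.map_eq_mapH n (hab.trans hbc) hbc hab le_rfl (twoδ₁Toδ₀ _ _ _ rfl)]
  rfl

lemma del_mapH (n n' : ℤ) (hn : n + 1 = n') (x) :
    S.del hab hbc n n' hn (S.mapH n (hab.trans hbc) hbc hab le_rfl x) = 0 := by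
  have h := congrArg (fun f ↦ f.hom x)
    (S.zero₃ (homOfLE hab) (homOfLE hbc) (homOfLE (hab.trans hbc)) rfl n n' hn)
  refine Eq.trans ?_ h
  rw [← S.map_eq_mapH n (hab.trans hbc) hbc hab le_rfl (twoδ₁Toδ₀ _ _ _ rfl)]
  rfl

lemma exists_of_del_eq_zero (n n' : ℤ) (hn : n + 1 = n') (x)
    (hx : S.del hab hbc n n' hn x = 0) : ∃ y, S.mapH n (hab.trans hbc) hbc hab le_rfl y = x := by
  obtain ⟨y, hy⟩ := (ShortComplex.moduleCat_exact_iff _).1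
    (S.exact₃ (homOfLE hab) (homOfLE hbc) (homOfLE (hab.trans hbc)) rfl n n' hn) x hx
  exact ⟨y, (DFunLike.congr_fun (S.map_eq_mapH n (hab.trans hbc) hbc hab le_rfl _) y).symm.trans hy⟩

lemma exists_del_of_mapH_eq_zero (n n' : ℤ) (hn : n + 1 = n') (x)
    (hx : S.mapH n' hab (hab.trans hbc) le_rfl hbc x = 0) :
    ∃ y, S.del hab hbc n n' hn y = x :=
  (ShortComplex.moduleCat_exact_iff _).1
    (S.exact₁ (homOfLE hab) (homOfLE hbc) (homOfLE (hab.trans hbc)) rfl n n' hn) x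
    ((DFunLike.congr_fun (S.map_eq_mapH n' hab (hab.trans hbc) le_rfl hbc _) x).trans hx)

lemma del_naturality {a' b' c' : EInt} (hab' : a' ≤ b') (hbc' : b' ≤ c') (ha : a ≤ a')
    (hb : b ≤ b') (hc : c ≤ c') (n n' : ℤ) (hn : n + 1 = n') (x) :
    S.del hab' hbc' n n' hn (S.mapH n hbc hbc' hb hc x) =
      S.mapH n' hab hab' ha hb (S.del hab hbc n n' hn x) :=
  congrArg (fun f ↦ f.hom x) (S.δ_naturality (homOfLE hab) (homOfLE hbc) (homOfLE hab')
    (homOfLE hbc') (homMk₁ (homOfLE ha) (homOfLE hb)) (homMk₁ (homOfLE hb) (homOfLE hc)) n n'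
    (Subsingleton.elim _ _) hn)

end

section Degenerate

/-- The truncations of the spectral object are split off from its abutment. -/
def IsDegenerate : Prop := ∀ (n : ℤ) (b : EInt),
  Function.Surjective (S.mapH n (bot_le : (⊥ : EInt) ≤ ⊤) (le_top : b ≤ ⊤) bot_le le_rfl)

variable {S}

/-- Map the class to index `⊤` and lift it to the abutment. By naturality its boundary is the image
of the boundary of a class that comes from the abutment, which is zero. -/
lemma IsDegenerate.del_eq_zero (hS : S.IsDegenerate) {a b c : EInt} (hab : a ≤ b) (hbc : b ≤ c)
    (n n' : ℤ) (hn : n + 1 = n') : S.del hab hbc n n' hn = 0 := by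
  refine LinearMap.ext fun x ↦ ?_
  obtain ⟨y, hy⟩ := hS n b (S.mapH n hbc le_top le_rfl le_top x)
  have h1 : S.del hab le_top n n' hn (S.mapH n hbc le_top le_rfl le_top x) =
      S.del hab hbc n n' hn x := by
    rw [S.del_naturality hab hbc hab le_top le_rfl le_rfl le_top, mapH_self]
  have h2 := S.del_naturality (bot_le : ⊥ ≤ b) (le_top : b ≤ ⊤) hab le_top bot_le le_rfl le_rfl
    n n' hn (S.mapH n hbc le_top le_rfl le_top x)
  rw [mapH_self, h1, ← hy] at h2
  rw [h2, S.del_mapH bot_le le_top, map_zero, LinearMap.zero_apply]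

lemma IsDegenerate.δ_eq_zero (hS : S.IsDegenerate) {a b c : EInt} (f : a ⟶ b) (g : b ⟶ c)
    (n n' : ℤ) (hn : n + 1 = n') : S.δ f g n n' hn = 0 :=
  ModuleCat.hom_ext (hS.del_eq_zero (leOfHom f) (leOfHom g) n n' hn)

lemma IsDegenerate.mapH_surjective (hS : S.IsDegenerate) {a b c : EInt} (hab : a ≤ b) (hbc : b ≤ c)
    (n : ℤ) : Function.Surjective (S.mapH n (hab.trans hbc) hbc hab le_rfl) := fun x ↦
  S.exists_of_del_eq_zero hab hbc n (n + 1) rfl x (by rw [hS.del_eq_zero]; rfl)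

lemma IsDegenerate.mapH_injective (hS : S.IsDegenerate) {a b c : EInt} (hab : a ≤ b) (hbc : b ≤ c)
    (n : ℤ) : Function.Injective (S.mapH n hab (hab.trans hbc) le_rfl hbc) := by
  rw [injective_iff_map_eq_zero]
  intro x hx
  obtain ⟨y, rfl⟩ := S.exists_del_of_mapH_eq_zero hab hbc (n - 1) n (by omega) x hx
  rw [hS.del_eq_zero]
  rfl

/-- Differentials of all pages are induced by connecting maps on cycles. -/
lemma IsDegenerate.d_eq_zero (hS : S.IsDegenerate) {i₀ i₁ i₂ i₃ i₄ i₅ : EInt} (f₁ : i₀ ⟶ i₁)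
    (f₂ : i₁ ⟶ i₂) (f₃ : i₂ ⟶ i₃) (f₄ : i₃ ⟶ i₄) (f₅ : i₄ ⟶ i₅) (n₀ n₁ n₂ n₃ : ℤ)
    (hn₁ : n₀ + 1 = n₁) (hn₂ : n₁ + 1 = n₂) (hn₃ : n₂ + 1 = n₃) :
    S.d f₁ f₂ f₃ f₄ f₅ n₀ n₁ n₂ n₃ hn₁ hn₂ hn₃ = 0 := by
  rw [← cancel_epi (S.πE f₃ f₄ f₅ n₀ n₁ n₂ hn₁ hn₂),
    ← cancel_epi (S.toCycles f₃ f₄ _ rfl n₁),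
    S.toCycles_πE_d f₁ f₂ f₃ f₄ f₅ _ rfl _ rfl n₀ n₁ n₂ n₃ hn₁ hn₂ hn₃, hS.δ_eq_zero,
    zero_comp, comp_zero, comp_zero]

lemma IsDegenerate.page_d_eq_zero (hS : S.IsDegenerate) (r : ℤ) (hr : 2 ≤ r) (pq pq' : ℤ × ℤ) :
    (S.E₂SpectralSequence.page r hr).d pq pq' = 0 := by
  by_cases hpq : (ComplexShape.up' (⟨r, 1 - r⟩ : ℤ × ℤ)).Rel pq pq'
  · refine (S.spectralSequence_page_d_eq coreE₂Cohomological r hr pq pq' hpq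
      (homOfLE (coreE₂Cohomological.le₀₁ r pq'))
      (homOfLE (coreE₂Cohomological.le₁₂' pq' rfl (coreE₂Cohomological.hc₀₂ r pq pq' hpq)))
      (homOfLE (coreE₂Cohomological.le₀₁ r pq)) (homOfLE (coreE₂Cohomological.le₁₂ pq))
      (homOfLE (coreE₂Cohomological.le₂₃ r pq)) rfl rfl rfl rfl rfl rfl
      (coreE₂Cohomological.deg pq - 1) (coreE₂Cohomological.deg pq)
      (coreE₂Cohomological.deg pq + 1) (coreE₂Cohomological.deg pq + 2) rfl).trans ?_
    rw [hS.d_eq_zero, zero_comp, comp_zero]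
  · exact HomologicalComplex.shape _ _ _ hpq

/-- Descending induction on `b`: lift the image of a class in the part of index at least `b + 1`;
the remaining difference comes from the single piece of index `b`, where `h₁` applies. -/
lemma isDegenerate_of_mem_range (h₀ : ∀ (n b : ℤ), n < b →
      Subsingleton ((S.H n).obj (mk₁ (homOfLE (le_top : (b : EInt) ≤ ⊤)))))
    (h₁ : ∀ (n b : ℤ) (hb : (b : EInt) ≤ ((b + 1 : ℤ) : EInt)) (y),
      S.mapH n hb (le_top : (b : EInt) ≤ ⊤) le_rfl le_top y ∈
        LinearMap.range (S.mapH n (bot_le : (⊥ : EInt) ≤ ⊤) (le_top : (b : EInt) ≤ ⊤) bot_le le_rfl)) :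
    S.IsDegenerate := by
  intro n b
  induction b using WithBotTop.rec with
  | bot => exact fun x ↦ ⟨x, S.mapH_self n _ x⟩
  | top =>
    have h := S.isZero_H_map_mk₁_of_isIso n (𝟙 (⊤ : EInt))
    exact fun x ↦ ⟨0, (ModuleCat.subsingleton_of_isZero h).elim _ _⟩
  | coe b =>
    -- For `m = 0` the index `b` exceeds `n`, and the target vanishes by `h₀`.
    obtain ⟨m, hm⟩ : ∃ m : ℕ, n + 1 - b ≤ m := ⟨(n + 1 - b).toNat, Int.self_le_toNat _⟩
    induction m generalizing b with
    | zero =>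
      have := h₀ n b (by omega)
      exact fun x ↦ ⟨0, Subsingleton.elim _ _⟩
    | succ m ih =>
      intro x
      have hb : (b : EInt) ≤ ((b + 1 : ℤ) : EInt) := WithBotTop.coe_le_coe.2 (by omega)
      obtain ⟨z, hz⟩ := ih (b + 1) (by omega) (S.mapH n le_top le_top hb le_rfl x)
      obtain ⟨y, hy⟩ := S.exists_of_mapH_eq_zero hb le_top n
        (x - S.mapH n bot_le le_top bot_le le_rfl z) (by
          rw [map_sub, mapH_mapH, hz, sub_self])
      obtain ⟨z', hz'⟩ := h₁ n b hb y
      refine ⟨z + z', ?_⟩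
      rw [map_add, hz', hy, add_sub_cancel]

end Degenerate

end CategoryTheory.Abelian.SpectralObject

namespace CategoryTheory.Abelian.SpectralObject

open ComposableArrows

variable {k : Type*} [Ring k] (S : SpectralObject (ModuleCat.{v} k) EInt)

lemma coe_le_succ (q : ℤ) : (q : EInt) ≤ ((q + 1 : ℤ) : EInt) := WithBotTop.coe_le_coe.2 (by omega)

/-- The objects of the first page are the values of the spectral object at `q ≤ q + 1`. -/
def pageTwoEquiv (n p q : ℤ) (h : p + q = n) :
    (S.E₂SpectralSequence.page 2 le_rfl).X (p, q) ≃ₗ[k] (S.H n).obj (mk₁ (homOfLE (coe_le_succ q))) :=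
  (S.spectralSequenceFirstPageXIso coreE₂Cohomological (p, q) q ((q + 1 : ℤ) : EInt) rfl rfl n
    h.symm).toLinearEquiv

lemma isZero_page_two (n p q : ℤ) (h : p + q = n)
    (hS : Subsingleton ((S.H n).obj (mk₁ (homOfLE (coe_le_succ q))))) :
    IsZero ((S.E₂SpectralSequence.page 2 le_rfl).X (p, q)) := by
  have := (S.pageTwoEquiv n p q h).toEquiv.subsingleton
  exact ModuleCat.isZero_of_subsingleton _

lemma filtration_eq_range (n q : ℤ) : S.filtration n q =
    LinearMap.range (S.mapH n (bot_le : ⊥ ≤ ((q + 1 : ℤ) : EInt)) (bot_le : (⊥ : EInt) ≤ ⊤) le_rfl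
      le_top) :=
  congrArg LinearMap.range (S.map_eq_mapH n _ _ le_rfl le_top _)

lemma filtration_eq_bot (n q : ℤ)
    (hS : Subsingleton ((S.H n).obj (mk₁ (homOfLE (bot_le : ⊥ ≤ ((q + 1 : ℤ) : EInt)))))) :
    S.filtration n q = ⊥ := by
  refine (S.filtration_eq_range n q).trans (LinearMap.range_eq_bot.2 (LinearMap.ext fun x ↦ ?_))
  rw [Subsingleton.elim x 0, map_zero, map_zero]

lemma filtration_eq_top (n q : ℤ)
    (hS : Subsingleton ((S.H n).obj (mk₁ (homOfLE (le_top : ((q + 1 : ℤ) : EInt) ≤ ⊤))))) :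
    S.filtration n q = ⊤ :=
  (S.filtration_eq_range n q).trans (LinearMap.range_eq_top.2 fun x ↦
    S.exists_of_mapH_eq_zero bot_le le_top n x (Subsingleton.elim _ _))

variable {S} in
-- Degeneracy makes the part of index at most `q` a subspace of the abutment that maps onto the
-- piece of index `q`, with kernel the part of index at most `q - 1`.
lemma IsDegenerate.nonempty_graded_equiv (hS : S.IsDegenerate) (n q : ℤ) :
    Nonempty (S.graded n q ≃ₗ[k] (S.H n).obj (mk₁ (homOfLE (coe_le_succ q)))) := by
  let F := S.mapH n (bot_le : ⊥ ≤ ((q + 1 : ℤ) : EInt)) (bot_le : (⊥ : EInt) ≤ ⊤) le_rfl le_top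
  have hF : Function.Injective F := hS.mapH_injective bot_le le_top n
  let G := S.mapH n (bot_le : ⊥ ≤ ((q + 1 : ℤ) : EInt)) (coe_le_succ q) bot_le le_rfl
  have hG : Function.Surjective G := hS.mapH_surjective bot_le (coe_le_succ q) n
  let e : (S.H n).obj (mk₁ (homOfLE (bot_le : ⊥ ≤ ((q + 1 : ℤ) : EInt)))) ≃ₗ[k] S.filtration n q :=
    (LinearEquiv.ofInjective F hF).trans (LinearEquiv.ofEq _ _ (S.filtration_eq_range n q).symm)
  have he (z) : (e z : S.abutment n) = F z := rfl
  let g : S.filtration n q →ₗ[k] (S.H n).obj (mk₁ (homOfLE (coe_le_succ q))) := G ∘ₗ e.symm.toLinearMap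
  have hg : Function.Surjective g := hG.comp e.symm.surjective
  have hq : q - 1 + 1 = q := sub_add_cancel q 1
  have key : S.filtration n (q - 1) = LinearMap.range
      (S.mapH n (bot_le : ⊥ ≤ (q : EInt)) (bot_le : (⊥ : EInt) ≤ ⊤) le_rfl le_top) := by
    rw [filtration_eq_range]
    generalize q - 1 + 1 = q' at hq
    subst hq
    rfl
  have hker : (S.filtration n (q - 1)).submoduleOf (S.filtration n q) = LinearMap.ker g := by
    ext x
    obtain ⟨z, rfl⟩ := e.surjective x
    change F z ∈ S.filtration n (q - 1) ↔ G (e.symm (e z)) = 0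
    rw [LinearEquiv.symm_apply_apply, key]
    constructor
    · rintro ⟨y, hy⟩
      have : z = S.mapH n bot_le bot_le le_rfl (coe_le_succ q) y :=
        hF (hy.symm.trans (S.mapH_mapH n _ _ _ _ _ _ _ y).symm)
      rw [this]
      exact S.mapH_mapH_eq_zero bot_le (coe_le_succ q) n y
    · intro hz
      obtain ⟨y, hy⟩ := S.exists_of_mapH_eq_zero bot_le (coe_le_succ q) n z hz
      exact ⟨y, by rw [← hy]; exact (S.mapH_mapH n _ _ _ _ _ _ _ y).symm⟩
  exact ⟨(Submodule.quotEquivOfEq _ _ hker).trans (g.quotKerEquivOfSurjective hg)⟩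

variable (h₀ : ∀ (n b : ℤ), n < b →
      Subsingleton ((S.H n).obj (mk₁ (homOfLE (le_top : (b : EInt) ≤ ⊤)))))

include h₀ in
-- The neighbouring terms of the exact sequence are the parts of index at least `n + 1` in degrees
-- `n` and `n - 1`, both zero.
lemma mapH_bijective_of_subsingleton (n : ℤ) :
    Function.Bijective (S.mapH n (coe_le_succ n) (le_top : (n : EInt) ≤ ⊤) le_rfl le_top) := by
  have h1 := h₀ n (n + 1) (by omega)
  have h2 := h₀ (n - 1) (n + 1) (by omega)
  refine ⟨?_, fun x ↦ S.exists_of_mapH_eq_zero (coe_le_succ n) le_top n x (Subsingleton.elim _ _)⟩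
  rw [injective_iff_map_eq_zero]
  intro x hx
  obtain ⟨y, rfl⟩ := S.exists_del_of_mapH_eq_zero (coe_le_succ n) le_top (n - 1) n (by omega) x hx
  rw [Subsingleton.elim y 0, map_zero]

lemma subsingleton_bot_of_subsingleton
    (h₁ : ∀ n b : ℤ, b < n → Subsingleton ((S.H n).obj (mk₁ (homOfLE (coe_le_succ b)))))
    (h₂ : ∀ n : ℤ, Subsingleton ((S.H n).obj (mk₁ (homOfLE (bot_le : ⊥ ≤ ((0 : ℤ) : EInt))))))
    (b : ℕ) (n : ℤ) (hb : b ≤ n) :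
    Subsingleton ((S.H n).obj (mk₁ (homOfLE (bot_le : ⊥ ≤ ((b : ℤ) : EInt))))) := by
  induction b with
  | zero => exact h₂ n
  | succ b ih =>
    have h1 := ih (by omega)
    have h2 := h₁ n b (by omega)
    refine subsingleton_of_forall_eq 0 fun x ↦ ?_
    obtain ⟨y, hy⟩ := S.exists_of_mapH_eq_zero bot_le (coe_le_succ b) n x (Subsingleton.elim _ _)
    rw [← hy, Subsingleton.elim y 0, map_zero]

/-- The neighbouring terms are the parts of index below `n` in degrees `n` and `n + 1`, which are
built from vanishing pieces. -/
lemma mapH_bijective_of_subsingleton'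
    (h₁ : ∀ n b : ℤ, b < n → Subsingleton ((S.H n).obj (mk₁ (homOfLE (coe_le_succ b)))))
    (h₂ : ∀ n : ℤ, Subsingleton ((S.H n).obj (mk₁ (homOfLE (bot_le : ⊥ ≤ ((0 : ℤ) : EInt))))))
    (n : ℕ) :
    Function.Bijective (S.mapH n (bot_le : (⊥ : EInt) ≤ ⊤) (le_top : ((n : ℤ) : EInt) ≤ ⊤) bot_le
      le_rfl) := by
  have h3 := S.subsingleton_bot_of_subsingleton h₁ h₂ n n le_rfl
  have h4 := S.subsingleton_bot_of_subsingleton h₁ h₂ n (n + 1) (by omega)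
  refine ⟨?_, fun x ↦ S.exists_of_del_eq_zero bot_le le_top n (n + 1) rfl x (Subsingleton.elim _ _)⟩
  rw [injective_iff_map_eq_zero]
  intro x hx
  obtain ⟨y, rfl⟩ := S.exists_of_mapH_eq_zero bot_le le_top n x hx
  rw [Subsingleton.elim y 0, map_zero]

end CategoryTheory.Abelian.SpectralObject

/-! ### Truncation pieces in the derived category. -/

open Pretriangulated Triangulated ComposableArrows

namespace CategoryTheory.Triangulated.TStructure

variable {C : Type u} [Category.{v} C] [Preadditive C] [HasZeroObject C] [HasShift C ℤ]
  [∀ n : ℤ, (shiftFunctor C n).Additive] [Pretriangulated C] [IsTriangulated C]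
  (k : Type w) [Ring k] [Linear k C] [∀ n : ℤ, (shiftFunctor C n).Linear k]
  (t : TStructure C) (A B : C)

/-- The truncation of `A` to degrees `-q` with `a ≤ q < b`. -/
abbrev truncPiece {a b : EInt} (h : a ≤ b) : C :=
  (t.ω₁.obj (mk₁ (homOfLE (EInt.rev_le_rev h)))).obj A

/-- The transition maps between truncations. -/
abbrev truncPieceMap {a b a' b' : EInt} (h : a ≤ b) (h' : a' ≤ b') (ha : a ≤ a') (hb : b ≤ b') :
    t.truncPiece A h' ⟶ t.truncPiece A h :=
  (t.ω₁.map (homMk₁ (homOfLE (EInt.rev_le_rev hb)) (homOfLE (EInt.rev_le_rev ha)) :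
    mk₁ (homOfLE (EInt.rev_le_rev h')) ⟶ mk₁ (homOfLE (EInt.rev_le_rev h)))).app A

/-- The reversal sends `a` to `1 - a`, and truncation strictly below `1 - a` means degrees at most
`-a`. -/
lemma isLE_truncPiece (a : ℤ) {b : EInt} (h : (a : EInt) ≤ b) : t.IsLE (t.truncPiece A h) (-a) := by
  have : t.IsLE ((t.eTruncLT.obj (EInt.rev a)).obj A) (-a) :=
    t.isLE_eTruncLT_obj_obj (-a) (EInt.rev a) (WithBotTop.coe_le_coe.2 (by omega)) A
  exact inferInstanceAs (t.IsLE ((t.eTruncGE.obj (EInt.rev b)).obj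
    ((t.eTruncLT.obj (EInt.rev a)).obj A)) (-a))

lemma isGE_truncPiece {a : EInt} (b : ℤ) (h : a ≤ ((b + 1 : ℤ) : EInt)) :
    t.IsGE (t.truncPiece A h) (-b) :=
  t.isGE_eTruncGE_obj_obj (-b) (EInt.rev ((b + 1 : ℤ) : EInt)) (WithBotTop.coe_le_coe.2 (by omega)) _

lemma isZero_truncPiece [t.IsLE A 0] {a : EInt} (b : ℤ) (h : a ≤ b) (hb : b ≤ 0) :
    IsZero (t.truncPiece A h) :=
  t.isZero_eTruncGE_obj_obj ((t.eTruncLT.obj (EInt.rev a)).obj A) 0 (EInt.rev b)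
    (WithBotTop.coe_lt_coe.2 (by omega))

lemma subsingleton_of_lt [t.IsGE B 0] (n a : ℤ) {b : EInt} (h : (a : EInt) ≤ b) (hn : n < a) :
    Subsingleton (((homSpectralObject k t A B).H n).obj (mk₁ (homOfLE h))) := by
  have := t.isLE_truncPiece A a h
  have := t.isGE_shift B 0 n (-n)
  exact ⟨fun (x y : t.truncPiece A h ⟶ B⟦n⟧) ↦
    (t.zero x (-a) (-n) (by omega)).trans (t.zero y (-a) (-n) (by omega)).symm⟩

lemma subsingleton_of_nonpos [t.IsLE A 0] (n b : ℤ) {a : EInt} (h : a ≤ b) (hb : b ≤ 0) :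
    Subsingleton (((homSpectralObject k t A B).H n).obj (mk₁ (homOfLE h))) := by
  have := t.isZero_truncPiece A b h hb
  exact ⟨fun (x y : t.truncPiece A h ⟶ B⟦n⟧) ↦ this.eq_of_src x y⟩

/-- The abutment of the spectral object is given by the morphisms from `A`. -/
def abutmentEquiv (n : ℤ) : (homSpectralObject k t A B).abutment n ≃ₗ[k] (A ⟶ B⟦n⟧) :=
  LinearEquiv.refl k (A ⟶ B⟦n⟧)

end CategoryTheory.Triangulated.TStructure

namespace DerivedCategory

open TStructure

variable {C : Type u} [Category.{v} C] [Abelian C] [HasDerivedCategory.{w} C]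

/-- A morphism of objects as a morphism of shifted complexes. -/
abbrev shiftMap (b : ℤ) {M N : C} (g : M ⟶ N) :
    ((singleFunctor C 0).obj M)⟦b⟧ ⟶ ((singleFunctor C 0).obj N)⟦b⟧ :=
  ((singleFunctor C 0).map g)⟦b⟧'

lemma shiftMap_bijective (b : ℤ) (M N : C) :
    Function.Bijective (fun g : M ⟶ N ↦ shiftMap b g) :=
  ((Functor.FullyFaithful.ofFullyFaithful (singleFunctor C 0)).comp
    (Functor.FullyFaithful.ofFullyFaithful (shiftFunctor (DerivedCategory C) b))).homEquiv.bijective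

lemma exists_iso_shift (P : DerivedCategory C) (b : ℤ) [P.IsGE (-b)] [P.IsLE (-b)] :
    ∃ M : C, Nonempty (P ≅ ((singleFunctor C 0).obj M)⟦b⟧) := by
  obtain ⟨M, ⟨e⟩⟩ := exists_iso_singleFunctor_obj_of_isGE_of_isLE P (-b)
  exact ⟨M, ⟨e ≪≫ (((singleFunctors C).shiftIso b (-b) 0 (by omega)).app M).symm⟩⟩

/-- After shifting back this is a class in Ext of positive degree `m - b` into an injective object.
-/
lemma shift_hom_eq_zero [HasExt.{z} C] (M J : C) [Injective J] (b m : ℤ) (hbm : b < m)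
    (f : ((singleFunctor C 0).obj M)⟦b⟧ ⟶ ((singleFunctor C 0).obj J)⟦m⟧) : f = 0 := by
  obtain ⟨n, rfl⟩ : ∃ n : ℕ, m = ((n + 1 : ℕ) : ℤ) + b := ⟨(m - b - 1).toNat, by omega⟩
  obtain ⟨g, hg⟩ := (shiftFunctor (DerivedCategory C) b).map_surjective
    (f ≫ (shiftFunctorAdd' (DerivedCategory C) _ b _ rfl).hom.app _)
  have hg0 : g = 0 := by
    obtain ⟨e, rfl⟩ := (Abelian.Ext.homEquiv (X := M) (Y := J) (n := n + 1)).surjective g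
    rw [e.eq_zero_of_injective]
    exact map_zero Abelian.Ext.homAddEquiv
  rw [hg0, Functor.map_zero] at hg
  exact (cancel_mono ((shiftFunctorAdd' (DerivedCategory C) _ b _ rfl).hom.app _)).1
    (hg.symm.trans zero_comp.symm)

section

variable (k : Type*) [Field k] [Linear k C] [HasExt.{z} C] (A : DerivedCategory C) [A.IsLE 0]

/-- The piece of degree `-b` of `A`. -/
abbrev pieceAt (b : ℤ) : DerivedCategory C := t.truncPiece A (Abelian.SpectralObject.coe_le_succ b)

instance (b : ℤ) : (pieceAt A b).IsLE (-b) := t.isLE_truncPiece A b _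

instance (b : ℤ) : (pieceAt A b).IsGE (-b) := t.isGE_truncPiece A b _

/-- The map from the truncation of `A` in degrees `≤ -b` to the piece of degree `-b`. -/
abbrev truncToPieceAt (b : ℤ) : t.truncPiece A (le_top : (b : EInt) ≤ ⊤) ⟶ pieceAt A b :=
  t.truncPieceMap A (Abelian.SpectralObject.coe_le_succ b) (le_top : (b : EInt) ≤ ⊤) le_rfl le_top

/-- The map from the truncation of `A` in degrees `≤ -b` to `A`. -/
abbrev truncTo (b : ℤ) : t.truncPiece A (le_top : (b : EInt) ≤ ⊤) ⟶
    t.truncPiece A (bot_le : (⊥ : EInt) ≤ ⊤) :=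
  t.truncPieceMap A bot_le (le_top : (b : EInt) ≤ ⊤) bot_le le_rfl

include k in
lemma truncToPieceAt_comp_bijective (b : ℤ) (B : DerivedCategory C) [B.IsGE 0] :
    Function.Bijective (fun v : pieceAt A b ⟶ B⟦b⟧ ↦ truncToPieceAt A b ≫ v) :=
  (t.homSpectralObject k A B).mapH_bijective_of_subsingleton
    (fun n a h ↦ t.subsingleton_of_lt k A B n a _ h) b

lemma subsingleton_pieceAt_hom (J : C) [Injective J] (m b : ℤ) (h : b < m) :
    Subsingleton (pieceAt A b ⟶ ((singleFunctor C 0).obj J)⟦m⟧) := by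
  obtain ⟨M, ⟨e⟩⟩ := exists_iso_shift (pieceAt A b) b
  refine ⟨fun x y ↦ (cancel_epi e.inv).1 ?_⟩
  rw [shift_hom_eq_zero M J b m h (e.inv ≫ x), shift_hom_eq_zero M J b m h (e.inv ≫ y)]

include k in
-- The pieces of cohomological degree above `-b` have no morphisms to `J[b]` or `J[b + 1]`, since
-- these are Ext groups of positive degree into an injective object.
lemma truncTo_comp_bijective (b : ℕ) (J : C) [Injective J] :
    Function.Bijective (fun v : t.truncPiece A (bot_le : (⊥ : EInt) ≤ ⊤) ⟶
      ((singleFunctor C 0).obj J)⟦(b : ℤ)⟧ ↦ truncTo A b ≫ v) :=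
  (t.homSpectralObject k A ((singleFunctor C 0).obj J)).mapH_bijective_of_subsingleton'
    (fun n a h ↦ subsingleton_pieceAt_hom A J n a h)
    (fun n ↦ t.subsingleton_of_nonpos k A _ n 0 _ le_rfl) b

include k in
-- On `τ^{≤-b}A` the morphism `ψ` factors through the top cohomology `M`, giving `w`. For injective
-- `J`, both `Hom(M, J)` and `Hom(A, J[b])` are `Hom(τ^{≤-b}A, J[b])`, so composition with `w` is
-- bijective as soon as composition with `ψ` is.
lemma exists_piece_hom (b : ℕ) (E : C)
    (ψ : t.truncPiece A (bot_le : (⊥ : EInt) ≤ ⊤) ⟶ ((singleFunctor C 0).obj E)⟦(b : ℤ)⟧) :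
    ∃ (M : C) (e : pieceAt A b ≅ ((singleFunctor C 0).obj M)⟦(b : ℤ)⟧) (w : M ⟶ E),
      truncToPieceAt A b ≫ e.hom ≫ shiftMap b w = truncTo A b ≫ ψ ∧
      ∀ J : C, Injective J → Function.Bijective (fun g : E ⟶ J ↦ ψ ≫ shiftMap b g) →
        Function.Bijective (fun g : E ⟶ J ↦ w ≫ g) := by
  obtain ⟨M, ⟨e⟩⟩ := exists_iso_shift (pieceAt A b) b
  obtain ⟨v, hv⟩ := (truncToPieceAt_comp_bijective k A b ((singleFunctor C 0).obj E)).2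
    (truncTo A b ≫ ψ)
  obtain ⟨w, hw⟩ := (shiftMap_bijective b M E).2 (e.inv ≫ v)
  have hz : e.hom ≫ shiftMap b w = v := by
    rw [← Iso.eq_inv_comp]
    exact hw
  have key : truncToPieceAt A b ≫ e.hom ≫ shiftMap b w = truncTo A b ≫ ψ := by
    rw [hz]
    exact hv
  refine ⟨M, e, w, key, fun J hJ hψ ↦ ?_⟩
  have h1 : Function.Bijective (fun g : M ⟶ J ↦ truncToPieceAt A b ≫ e.hom ≫ shiftMap b g) :=
    (truncToPieceAt_comp_bijective k A b ((singleFunctor C 0).obj J)).comp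
      ((e.homFromEquiv (Z := ((singleFunctor C 0).obj J)⟦(b : ℤ)⟧)).symm.bijective.comp
        (shiftMap_bijective b M J))
  have h2 : Function.Bijective (fun g : E ⟶ J ↦ truncTo A b ≫ ψ ≫ shiftMap b g) :=
    (truncTo_comp_bijective k A b J).comp hψ
  refine (Function.Bijective.of_comp_iff' h1 _).1 ?_
  refine h2.congr_fun fun g ↦ ?_
  simp only [Function.comp_apply, shiftMap, Functor.map_comp]
  rw [reassoc_of% key]

end

end DerivedCategory

open Pretriangulated Triangulated ComposableArrows

namespace DerivedCategory

open TStructure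

section

variable {C : Type u} [Category.{v} C] [Abelian C] [HasDerivedCategory.{w} C]
  (k : Type*) [Field k] [Linear k C] (A : DerivedCategory C) [A.IsLE 0]

/-- A morphism `y` on the piece of index `b` extends to all of `A` as `ψ ≫ e.inv ≫ y`; this is the
criterion for degeneracy. -/
lemma isDegenerate_homSpectralObject (B : DerivedCategory C) [B.IsGE 0]
    (h : ∀ b : ℕ, ∃ (Q : DerivedCategory C) (e : pieceAt A b ≅ Q)
      (ψ : t.truncPiece A (bot_le : (⊥ : EInt) ≤ ⊤) ⟶ Q),
      truncToPieceAt A b ≫ e.hom = truncTo A b ≫ ψ) :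
    (t.homSpectralObject k A B).IsDegenerate := by
  refine Abelian.SpectralObject.isDegenerate_of_mem_range
    (fun n a h ↦ t.subsingleton_of_lt k A B n a _ h) fun n b hb y ↦ ?_
  rcases lt_or_ge b 0 with hb' | hb'
  · have := t.subsingleton_of_nonpos k A B n (b + 1) hb (by omega)
    rw [Subsingleton.elim y 0, map_zero]
    exact Submodule.zero_mem _
  · lift b to ℕ using hb'
    obtain ⟨Q, e, ψ, he⟩ := h b
    refine ⟨(ψ ≫ e.inv ≫ y : t.truncPiece A (bot_le : (⊥ : EInt) ≤ ⊤) ⟶ B⟦n⟧), ?_⟩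
    have key (y : pieceAt A b ⟶ B⟦n⟧) : truncTo A b ≫ ψ ≫ e.inv ≫ y = truncToPieceAt A b ≫ y := by
      rw [← reassoc_of% he, Iso.hom_inv_id_assoc]
    exact key y

end

section

variable {C : Type u} [Category.{v} C] [Abelian C] [HasDerivedCategory.{w} C]
  {D : Type*} [Category* D] [Abelian D] [HasDerivedCategory.{w} D]
  (F : C ⥤ D) [F.Additive] [PreservesFiniteLimits F] [PreservesFiniteColimits F]

lemma isGE_mapDerivedCategory (G : DerivedCategory C) (n : ℤ) [G.IsGE n] :
    (F.mapDerivedCategory.obj G).IsGE n := by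
  obtain ⟨K, hK, ⟨e⟩⟩ := G.exists_iso_Q_obj_of_isGE n
  have : CochainComplex.IsStrictlyGE ((F.mapHomologicalComplex (.up ℤ)).obj K) n :=
    inferInstanceAs (((F.mapHomologicalComplex _).obj K).IsStrictlySupported _)
  have : (Q.obj ((F.mapHomologicalComplex (.up ℤ)).obj K)).IsGE n := inferInstance
  exact t.isGE_of_iso (X := Q.obj ((F.mapHomologicalComplex (.up ℤ)).obj K)) (F.mapDerivedCategory.mapIso e ≪≫ F.mapDerivedCategoryFactors.app K).symm n

/-- The comparison of the image of a shifted complex concentrated in degree `0`. -/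
def mapShiftIso (b : ℤ) (E : C) : F.mapDerivedCategory.obj (((singleFunctor C 0).obj E)⟦b⟧) ≅
    ((singleFunctor D 0).obj (F.obj E))⟦b⟧ :=
  (F.mapDerivedCategory.commShiftIso b).app _ ≪≫
    (shiftFunctor _ b).mapIso ((F.mapDerivedCategorySingleFunctor 0).app E)

lemma mapShiftIso_hom_naturality (b : ℤ) {E J : C} (g : E ⟶ J) :
    F.mapDerivedCategory.map (shiftMap b g) ≫ (mapShiftIso F b J).hom =
      (mapShiftIso F b E).hom ≫ shiftMap b (F.map g) := by
  have h := congrArg (fun f ↦ f⟦b⟧') ((F.mapDerivedCategorySingleFunctor 0).hom.naturality g)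
  simp only [Functor.map_comp] at h
  dsimp [mapShiftIso]
  rw [F.mapDerivedCategory.commShiftIso_hom_naturality_assoc, Category.assoc]
  exact congrArg (_ ≫ ·) h

variable {Z : D} {A : DerivedCategory C}
  (r : (F.mapDerivedCategory ⋙ coyoneda.obj (op ((singleFunctor D 0).obj Z))).CorepresentableBy A)

include r in
-- Orthogonality: morphisms from `A` to an object in degrees at least one are morphisms from an
-- object in degree zero to its image, which also lives in degrees at least one.
lemma isLE_of_corepresentableBy : A.IsLE 0 := by
  refine (t.isLE_iff_orthogonal 0 1 rfl A).2 fun G f hG ↦ ?_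
  have := isGE_mapDerivedCategory F G 1
  have h0 (g : (singleFunctor D 0).obj Z ⟶ F.mapDerivedCategory.obj G) : g = 0 := t.zero g 0 1
  exact r.homEquiv.injective ((h0 _).trans (h0 _).symm)

lemma homEquiv_comp {G G' : DerivedCategory C} (φ : A ⟶ G) (g : G ⟶ G') :
    r.homEquiv (φ ≫ g) = (show (singleFunctor D 0).obj Z ⟶ F.mapDerivedCategory.obj G from
      r.homEquiv φ) ≫ F.mapDerivedCategory.map g :=
  r.homEquiv_comp g φ

lemma homEquiv_eq {G : DerivedCategory C} (φ : A ⟶ G) :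
    r.homEquiv φ = (show (singleFunctor D 0).obj Z ⟶ F.mapDerivedCategory.obj A from
      r.homEquiv (𝟙 A)) ≫ F.mapDerivedCategory.map φ := by
  rw [← homEquiv_comp, Category.id_comp]

/-- The universal property of the derived inverse image in terms of `Ext`. -/
def extLinearEquiv (k : Type*) [Field k] [Linear k C] [Linear k D] [F.Linear k] [HasExt.{z} D]
    (B : C) (n : ℕ) :
    (A ⟶ ((singleFunctor C 0).obj B)⟦(n : ℤ)⟧) ≃ₗ[k] Abelian.Ext Z (F.obj B) n :=
  LinearEquiv.trans
    { toEquiv := (r.homEquiv (Y := ((singleFunctor C 0).obj B)⟦(n : ℤ)⟧)).trans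
        ((mapShiftIso F n B).homToEquiv (Z := (singleFunctor D 0).obj Z))
      map_add' x y := by
        change r.homEquiv (x + y) ≫ (mapShiftIso F n B).hom = r.homEquiv x ≫ (mapShiftIso F n B).hom +
          r.homEquiv y ≫ (mapShiftIso F n B).hom
        rw [homEquiv_eq F r (x + y), homEquiv_eq F r x, homEquiv_eq F r y, Functor.map_add,
          Preadditive.comp_add, Preadditive.add_comp]
      map_smul' c x := by
        change r.homEquiv (c • x) ≫ (mapShiftIso F n B).hom =
          c • (r.homEquiv x ≫ (mapShiftIso F n B).hom)
        rw [homEquiv_eq F r (c • x), homEquiv_eq F r x, Functor.map_smul,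
          Linear.comp_smul, Linear.smul_comp] }
    (Abelian.Ext.homLinearEquiv (R := k) (X := Z) (Y := F.obj B) (n := n)).symm

variable [HasExt.{z} D]

include r in
-- The morphism adjoint to `x`; naturality of the adjunction turns composition with `x` into
-- composition with `ψ`.
lemma exists_hom_of_ext {E : C} {b : ℕ} (x : Abelian.Ext Z (F.obj E) b) :
    ∃ ψ : A ⟶ ((singleFunctor C 0).obj E)⟦(b : ℤ)⟧, ∀ J : C,
      Function.Bijective (fun g : E ⟶ J ↦ x.comp (Abelian.Ext.mk₀ (F.map g)) (add_zero b)) →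
      Function.Bijective (fun g : E ⟶ J ↦ ψ ≫ shiftMap b g) := by
  refine ⟨r.homEquiv.symm (x.hom ≫ (mapShiftIso F b E).inv :), fun J hJ ↦ ?_⟩
  have h1 : Function.Bijective (fun φ : A ⟶ ((singleFunctor C 0).obj J)⟦(b : ℤ)⟧ ↦
      (show (singleFunctor D 0).obj Z ⟶ F.mapDerivedCategory.obj _ from r.homEquiv φ) ≫
        (mapShiftIso F b J).hom) :=
    ((mapShiftIso F b J).homToEquiv (Z := (singleFunctor D 0).obj Z)).bijective.comp
      r.homEquiv.bijective
  refine (Function.Bijective.of_comp_iff' h1 _).1 ?_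
  refine (Abelian.Ext.homEquiv.bijective.comp hJ).congr_fun fun g ↦ ?_
  change (show (singleFunctor D 0).obj Z ⟶ F.mapDerivedCategory.obj _ from
    r.homEquiv (_ ≫ shiftMap b g)) ≫ (mapShiftIso F b J).hom =
      (x.comp (Abelian.Ext.mk₀ (F.map g)) (add_zero b)).hom
  rw [Abelian.Ext.comp_hom, Abelian.Ext.mk₀_hom, ShiftedHom.comp_mk₀, homEquiv_comp,
    Equiv.apply_symm_apply]
  change ((x.hom ≫ (mapShiftIso F b E).inv) ≫ F.mapDerivedCategory.map (shiftMap b g)) ≫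
    (mapShiftIso F b J).hom = _
  rw [Category.assoc, mapShiftIso_hom_naturality, Category.assoc, Iso.inv_hom_id_assoc]

end

end DerivedCategory

/-! ### Detecting isomorphisms by injective objects on small open sets. -/

open Pretriangulated Triangulated ComposableArrows

lemma CategoryTheory.isIso_of_injective_test {C : Type*} [Category* C] [Abelian C]
    [EnoughInjectives C] {M N : C} (w : M ⟶ N)
    (h : ∀ J : C, Injective J → Function.Bijective (fun g : N ⟶ J ↦ w ≫ g)) : IsIso w := by
  have : Mono w := by
    obtain ⟨g, hg⟩ := (h (Injective.under M) inferInstance).2 (Injective.ι M)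
    have : Mono (w ≫ g) := by rw [show w ≫ g = Injective.ι M from hg]; infer_instance
    exact mono_of_mono w g
  have : Epi w := Preadditive.epi_of_cancel_zero w fun {Z} c hc ↦ by
    have := (h (Injective.under Z) inferInstance).1 (a₁ := c ≫ Injective.ι Z) (a₂ := 0) (by
      dsimp only
      rw [reassoc_of% hc, zero_comp, comp_zero])
    exact (cancel_mono (Injective.ι Z)).1 (this.trans zero_comp.symm)
  exact isIso_of_mono_of_epi w

namespace AlgebraicGeometry.Scheme.Modules

variable {X Y : Scheme.{u}}

/-- Being an isomorphism is local, and maps to the direct image of an injective module on `U` are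
maps from the restriction to `U`. So test modules supported on small open sets suffice. -/
lemma isIso_of_injective_test {M N : X.Modules} (w : M ⟶ N)
    (h : ∀ p : X, ∃ U : X.Opens, p ∈ U ∧ ∀ J : U.toScheme.Modules, Injective J →
      Function.Bijective (fun g : N ⟶ (Scheme.Modules.pushforward U.ι).obj J ↦ w ≫ g)) :
    IsIso w := by
  refine isIso_of_locally w fun V x hx ↦ ?_
  obtain ⟨U, hxU, hU⟩ := h x
  have : IsIso ((restrictFunctor U.ι).map w) := CategoryTheory.isIso_of_injective_test _ fun J hJ ↦ by
    refine (Function.Bijective.of_comp_iff'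
      ((restrictAdjunction U.ι).homEquiv M J).bijective _).1 ?_
    refine ((hU J hJ).comp ((restrictAdjunction U.ι).homEquiv N J).bijective).congr_fun fun g ↦ ?_
    exact (restrictAdjunction U.ι).homEquiv_naturality_left w g
  exact ⟨U.ι ''ᵁ (U.ι ⁻¹ᵁ V), fun _ ⟨_, hy, e⟩ ↦ e ▸ hy, ⟨⟨x, hxU⟩, hx, rfl⟩,
    bijective_of_isIso ((restrictFunctor U.ι).map w) (U.ι ⁻¹ᵁ V)⟩

/-- Direct images of injective modules from small open sets are injective, flasque and supported
there. On them the universal class induces bijections, so the map from the cohomology sheaf of `A`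
to `E` is an isomorphism. -/
lemma exists_pieceAt_iso {k : Type u} [Field k] [X.Over (Spec (.of k))] {f : X ⟶ Y}
    [IsClosedImmersion f] {Z : Y.Modules} {A : DerivedCategory X.Modules}
    (r : DerivedPullback f (single₀ Z) A) {E : X.Modules} {b : ℕ}
    {x : Abelian.Ext Z ((Scheme.Modules.pushforward f).obj E) b} (hx : IsUniversalClass f x) :
    ∃ (e : A.pieceAt b ≅ (single₀ E)⟦(b : ℤ)⟧)
      (ψ : DerivedCategory.TStructure.t.truncPiece A (bot_le : (⊥ : EInt) ≤ ⊤) ⟶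
        (single₀ E)⟦(b : ℤ)⟧),
      A.truncToPieceAt b ≫ e.hom = A.truncTo b ≫ ψ := by
  have hA := DerivedCategory.isLE_of_corepresentableBy _ r
  obtain ⟨ψ, hψ⟩ := DerivedCategory.exists_hom_of_ext _ r x
  obtain ⟨M, e, w, hw, hJ⟩ := DerivedCategory.exists_piece_hom k A b E ψ
  have : IsIso w := isIso_of_injective_test w fun p ↦ by
    obtain ⟨U, hpU, hU⟩ := hx p
    refine ⟨U, hpU, fun J _ ↦ hJ _ ?_ (hψ _ (hU _ ?_ (supportedOn_pushforward U J)))⟩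
    · exact Functor.PreservesInjectiveObjects.injective_obj inferInstance
    · exact (isFlasque_of_injective J).pushforward U.ι
  exact ⟨e ≪≫ (shiftFunctor _ (b : ℤ)).mapIso ((DerivedCategory.singleFunctor _ 0).mapIso (asIso w)),
    ψ, hw⟩

end AlgebraicGeometry.Scheme.Modules

/-! ### Flasqueness is local. -/

namespace AlgebraicGeometry.Scheme.Modules

variable {X : Scheme.{u}}

lemma exists_glue_pair (M : X.Modules) {U V : X.Opens} (s : Γ(M, U)) (t : Γ(M, V))
    (h : M.res (inf_le_left : U ⊓ V ≤ U) s = M.res (inf_le_right : U ⊓ V ≤ V) t) :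
    ∃ r : Γ(M, U ⊔ V), M.res le_sup_left r = s ∧ M.res le_sup_right r = t := by
  obtain ⟨r, hr⟩ := M.exists_glue (ι := ULift.{u} Bool) (U := U ⊔ V)
    (fun i ↦ bif i.down then U else V)
    (fun ⟨i⟩ ↦ by cases i; exacts [le_sup_right, le_sup_left])
    (sup_le (le_iSup (fun i : ULift.{u} Bool ↦ bif i.down then U else V) ⟨true⟩)
      (le_iSup (fun i : ULift.{u} Bool ↦ bif i.down then U else V) ⟨false⟩))
    (fun ⟨i⟩ ↦ match i with | true => s | false => t) (by
      rintro ⟨_ | _⟩ ⟨_ | _⟩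
      · rfl
      · have := congrArg (M.res (show V ⊓ U ≤ U ⊓ V from inf_comm V U ▸ le_rfl)) h.symm
        rwa [res_res, res_res] at this
      · exact h
      · rfl)
  exact ⟨r, hr ⟨true⟩, hr ⟨false⟩⟩

/-- Zorn's lemma on extensions of a given section: chains glue, and a maximal extension is defined
on all of `U`. -/
lemma isFlasque_of_locally (M : X.Modules) (hM : ∀ x : X, ∃ U : X.Opens, x ∈ U ∧
    ∀ ⦃V W : X.Opens⦄ (h : V ≤ W), W ≤ U → Function.Surjective (M.res h)) : M.IsFlasque := by
  intro U V hVU s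
  let P := {p : Σ W : X.Opens, Γ(M, W) // ∃ h : V ≤ p.1, p.1 ≤ U ∧ M.res h p.2 = s}
  let r : P → P → Prop := fun p q ↦ ∃ h : p.1.1 ≤ q.1.1, M.res h q.1.2 = p.1.2
  have : Nonempty P := ⟨⟨⟨V, s⟩, le_rfl, hVU, M.res_self _ _⟩⟩
  obtain ⟨⟨⟨W, t⟩, hVW, hWU, ht⟩, hmax⟩ := exists_maximal_of_nonempty_chains_bounded (r := r) (by
    intro c hc ⟨p₀, hp₀⟩
    have hle (p : c) : p.1.1.1 ≤ ⨆ p : c, p.1.1.1 := le_iSup (fun p : c ↦ p.1.1.1) p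
    obtain ⟨t, ht⟩ := M.exists_glue (fun p : c ↦ p.1.1.1) hle le_rfl (fun p ↦ p.1.1.2) (by
      intro p q
      by_cases hpq : p = q
      · subst hpq
        rfl
      obtain ⟨h, e⟩ | ⟨h, e⟩ := hc p.2 q.2 (fun h ↦ hpq (Subtype.ext h))
      · rw [← e, res_res]
      · rw [← e, res_res])
    have h₀ := p₀.2
    refine ⟨⟨⟨_, t⟩, h₀.choose.trans (hle ⟨p₀, hp₀⟩), iSup_le fun p ↦ p.1.2.choose_spec.1, ?_⟩,
      fun p hp ↦ ⟨hle ⟨p, hp⟩, ht ⟨p, hp⟩⟩⟩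
    have := congrArg (M.res h₀.choose) (ht ⟨p₀, hp₀⟩)
    rw [res_res] at this
    exact this.trans h₀.choose_spec.2) (by
    rintro a b c ⟨h, e⟩ ⟨h', e'⟩
    refine ⟨h.trans h', ?_⟩
    rw [← e, ← e', res_res])
  -- Near a point outside `W`, the local hypothesis extends the restriction of `t` to the overlap;
  -- gluing would enlarge the maximal extension.
  have hUW : U ≤ W := by
    intro x hx
    obtain ⟨V', hxV', hV'⟩ := hM x
    obtain ⟨t', ht'⟩ := hV' (V := W ⊓ (V' ⊓ U)) (W := V' ⊓ U) inf_le_right inf_le_left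
      (M.res inf_le_left t)
    obtain ⟨r, hr, -⟩ := M.exists_glue_pair t t' ht'.symm
    have hVr : M.res (hVW.trans le_sup_left) r = s := by
      rw [← ht, ← hr, res_res]
    obtain ⟨h, -⟩ := hmax ⟨⟨W ⊔ (V' ⊓ U), r⟩, hVW.trans le_sup_left, sup_le hWU inf_le_right, hVr⟩
      ⟨le_sup_left, hr⟩
    exact h (Or.inr ⟨hxV', hx⟩)
  obtain rfl : W = U := le_antisymm hWU hUW
  exact ⟨t, ht⟩

lemma LocallyFramed.isFlasque_alt {M : X.Modules} (hM : M.LocallyFramed) (q : ℕ) {T : X.Modules}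
    (hT : T.IsFlasque) : (altSheaf M T q).IsFlasque := by
  refine isFlasque_of_locally _ fun x ↦ ?_
  obtain ⟨U, hxU, n, b, hb⟩ := hM x
  refine ⟨U, hxU, fun V W h hWU φ ↦ ?_⟩
  choose t ht using fun s : Set.powersetCard (Fin n) q ↦ hT h (altEval le_rfl φ
    (fun i ↦ (hb.res (h.trans hWU)).basis le_rfl (Set.powersetCard.ofFinEmbEquiv.symm s i)))
  obtain ⟨ψ, hψ⟩ := (hb.res hWU).exists_altEval_eq t
  refine ⟨ψ, (hb.res (h.trans hWU)).altEval_injective ?_⟩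
  refine AlternatingMap.ext_powersetCard ((hb.res (h.trans hWU)).basis le_rfl) fun s ↦ ?_
  refine Eq.trans ?_ (ht s)
  rw [← hψ s]
  refine Eq.trans ?_ (altEval_comp_res le_rfl h ψ _)
  refine congrArg (altEval h ψ) (funext fun i ↦ ?_)
  rw [Function.comp_apply, IsFrame.basis_apply, IsFrame.basis_apply, Function.comp_apply,
    Function.comp_apply, res_res, res_res, res_res]

end AlgebraicGeometry.Scheme.Modules

/-! ### Ext groups of locally free modules as sheaf cohomology. -/

namespace AlgebraicGeometry.Scheme.Modules

variable {X : Scheme.{u}}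

section

variable (k : Type u) [Field k] [X.Over (Spec (.of k))]

lemma smul_id_appₗ (M : X.Modules) (c : k) (U : X.Opens) (m : Γ(M, U)) :
    (c • 𝟙 M : M ⟶ M).appₗ U m = resₒ (le_top : U ≤ ⊤) (scalars k X c) • m := rfl

lemma altMap_smul_id (E M : X.Modules) (q : ℕ) (c : k) :
    altMap E q (c • 𝟙 M) = c • 𝟙 (altSheaf E M q) := hom_extₗ fun U φ ↦ altSheaf_ext fun V hV m ↦ by
  rw [altEval_altMap, smul_id_appₗ, smul_id_appₗ, altEval_smul]
  refine congrArg (· • altEval hV φ m) ?_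
  exact (map_map_eq le_top hV _).symm

end

/-- The identity of `E` as a form with values in `E`. -/
def idForm (E : X.Modules) : Γ(altSheaf E E 1, ⊤) :=
  altMk (fun V _ ↦ AlternatingMap.ofSubsingleton Γ(X, V) Γ(E, V) Γ(E, V) (0 : Fin 1) LinearMap.id)
    fun _ _ _ _ _ ↦ rfl

lemma altMap_idForm_bijective (E M : X.Modules) :
    Function.Bijective (fun f : E ⟶ M ↦ (altMap E 1 f).appₗ ⊤ (idForm E)) := by
  refine ⟨fun f g h ↦ hom_extₗ fun U m ↦ ?_, fun φ ↦ ?_⟩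
  · exact congrArg (fun φ : Γ(altSheaf E M 1, ⊤) ↦ altEval (le_top : U ≤ ⊤) φ fun _ ↦ m) h
  · let g (U : X.Opens) : Γ(E, U) →ₗ[Γ(X, U)] Γ(M, U) :=
      (AlternatingMap.ofSubsingleton Γ(X, U) Γ(E, U) Γ(M, U) (0 : Fin 1)).symm (altEval le_top φ)
    refine ⟨homOfAppₗ g fun {U V} h m ↦ altEval_comp_res le_top h φ fun _ ↦ m, ?_⟩
    refine altSheaf_ext fun V hV m ↦ ?_
    change altEval le_top φ (fun _ ↦ m 0) = altEval hV φ m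
    exact congrArg (altEval hV φ) (funext fun i ↦ congrArg m (Subsingleton.elim _ _))

/-- The constant sheaf `ℤ`. -/
abbrev constantZ (X : Scheme.{u}) : Sheaf (Opens.grothendieckTopology X) AddCommGrpCat.{u} :=
  (constantSheaf (Opens.grothendieckTopology X) AddCommGrpCat.{u}).obj
    (AddCommGrpCat.of (ULift.{u} ℤ))

/-- Global sections are morphisms from the constant sheaf. -/
def globalSection {F : Sheaf (Opens.grothendieckTopology X) AddCommGrpCat.{u}}
    (a : constantZ X ⟶ F) : F.obj.obj (op ⊤) :=
  Sheaf.H.equiv₀ F (T := (⊤ : X.Opens)) isTerminalTop (Abelian.Ext.mk₀ a)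

lemma globalSection_bijective (F : Sheaf (Opens.grothendieckTopology X) AddCommGrpCat.{u}) :
    Function.Bijective (fun a : constantZ X ⟶ F ↦ globalSection a) :=
  (Sheaf.H.equiv₀ F (T := (⊤ : X.Opens)) isTerminalTop).bijective.comp
    (Abelian.Ext.mk₀_bijective _ _)

lemma globalSection_comp {F G : Sheaf (Opens.grothendieckTopology X) AddCommGrpCat.{u}}
    (a : constantZ X ⟶ F) (g : F ⟶ G) :
    globalSection (a ≫ g) = g.hom.app (op ⊤) (globalSection a) := by
  refine Eq.trans ?_ (Sheaf.H.equiv₀_naturality (T := (⊤ : X.Opens)) isTerminalTop g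
    (Abelian.Ext.mk₀ a)).symm
  rw [Sheaf.H.map_apply, Abelian.Ext.mk₀_comp_mk₀]
  rfl

/-- The morphism from the constant sheaf to the endomorphism sheaf given by the identity. -/
def idSection (E : X.Modules) : constantZ X ⟶ (altFunctor E 1 ⋙ toAbSheaf X).obj E :=
  ((globalSection_bijective ((altFunctor E 1 ⋙ toAbSheaf X).obj E)).2 (idForm E)).choose

lemma globalSection_idSection (E : X.Modules) : globalSection (idSection E) = idForm E :=
  ((globalSection_bijective ((altFunctor E 1 ⋙ toAbSheaf X).obj E)).2 (idForm E)).choose_spec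

/-- In degree zero, morphisms from `E` to `M` are the global sections of the sheaf of 1-forms.
Higher degrees follow by dimension shifting: for injective `M` that sheaf is flasque, as `E` is
locally free of finite rank. -/
lemma LocallyFramed.comparison_bijective {E : X.Modules} (hE : E.LocallyFramed)
    [PreservesFiniteLimits (altFunctor E 1)] [PreservesFiniteColimits (altFunctor E 1)]
    (M : X.Modules) (n : ℕ) :
    Function.Bijective (Abelian.Ext.comparison (altFunctor E 1 ⋙ toAbSheaf X) (idSection E) M n) := by
  refine Abelian.Ext.comparison_bijective _ _ (fun _ ↦ True) (fun M _ ↦ ?_) (fun M _ ↦ ?_) M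
    trivial n
  · refine (Function.Bijective.of_comp_iff' (globalSection_bijective _) _).1 ?_
    refine (altMap_idForm_bijective E M).congr_fun fun f ↦ ?_
    refine (globalSection_comp (idSection E) _).trans ?_
    rw [globalSection_idSection]
    rfl
  · refine ⟨_, _, _, _, _, injectiveEmbedding_shortExact M, trivial, trivial,
      fun n x ↦ Abelian.Ext.eq_zero_of_injective x, fun n x ↦ ?_⟩
    exact H_eq_zero_of_isFlasque _ (hE.isFlasque_alt 1 (isFlasque_of_injective _)) n x

/-- Functoriality of cohomology. -/
def Cohomology.map {M N : X.Modules} (f : M ⟶ N) (n : ℕ) : M.Cohomology n →+ N.Cohomology n :=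
  Sheaf.H.map ((toAbSheaf X).map f) n

lemma Cohomology.map_id {M : X.Modules} (n : ℕ) (x : M.Cohomology n) :
    Cohomology.map (𝟙 M) n x = x :=
  (congrArg (fun f ↦ Sheaf.H.map f n x) ((toAbSheaf X).map_id M)).trans (Sheaf.H.map_id_apply _)

lemma Cohomology.map_comp {M N P : X.Modules} (f : M ⟶ N) (g : N ⟶ P) (n : ℕ)
    (x : M.Cohomology n) : Cohomology.map (f ≫ g) n x = Cohomology.map g n (Cohomology.map f n x) :=
  (congrArg (fun f ↦ Sheaf.H.map f n x) ((toAbSheaf X).map_comp f g)).trans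
    (Sheaf.H.map_comp_apply _ _ _)

lemma Cohomology.smul_eq {k : Type u} [Field k] [X.Over (Spec (.of k))] {M : X.Modules} {n : ℕ}
    (c : k) (x : M.Cohomology n) : c • x = Cohomology.map (c • 𝟙 M) n x := rfl

/-- Cohomology is invariant under isomorphisms. -/
def cohomologyEquiv (k : Type u) [Field k] [X.Over (Spec (.of k))] {M N : X.Modules} (e : M ≅ N)
    (n : ℕ) : M.Cohomology n ≃ₗ[k] N.Cohomology n where
  toFun := Cohomology.map e.hom n
  invFun := Cohomology.map e.inv n
  left_inv x := by rw [← Cohomology.map_comp, e.hom_inv_id, Cohomology.map_id]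
  right_inv x := by rw [← Cohomology.map_comp, e.inv_hom_id, Cohomology.map_id]
  map_add' := map_add _
  map_smul' c x := by
    rw [RingHom.id_apply, Cohomology.smul_eq, Cohomology.smul_eq, ← Cohomology.map_comp,
      ← Cohomology.map_comp, Linear.smul_comp, Linear.comp_smul, Category.id_comp, Category.comp_id]

/-- The extension groups of a locally framed module as sheaf cohomology. -/
lemma LocallyFramed.nonempty_ext_equiv (k : Type u) [Field k] [X.Over (Spec (.of k))]
    {E : X.Modules} (hE : E.LocallyFramed) (M : X.Modules) (n : ℕ) :
    Nonempty (Abelian.Ext E M n ≃ₗ[k] (altSheaf E M 1).Cohomology n) := by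
  have := hE.preservesFiniteLimits 1
  have := hE.preservesFiniteColimits 1
  let F : Abelian.Ext E M n →+ (altSheaf E M 1).Cohomology n :=
    Abelian.Ext.comparison (altFunctor E 1 ⋙ toAbSheaf X) (idSection E) M n
  have hF (c : k) (x : Abelian.Ext E M n) : F (c • x) = c • F x := by
    rw [Cohomology.smul_eq, ← altMap_smul_id, Abelian.Ext.smul_eq_comp_mk₀]
    refine (Abelian.Ext.comparison_comp _ _ _ _ _).trans ?_
    rw [Abelian.Ext.mapExactFunctor_mk₀]
    rfl
  exact ⟨LinearEquiv.ofBijective { toFun := F, map_add' := F.map_add, map_smul' := hF }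
    (hE.comparison_bijective M n)⟩

end AlgebraicGeometry.Scheme.Modules

/-! ### Exterior powers as duals of sheaves of alternating forms. -/

namespace AlgebraicGeometry.Scheme.Modules

variable {X : Scheme.{u}}

/-- A map to a sheaf that is bijective on arbitrarily small open sets identifies the target with the
sheafification; the presheaf `P` need not satisfy any gluing. -/
lemma nonempty_sheafify_iso (P : X.PresheafOfModules) (G : X.Modules) (h : P ⟶ G.val)
    (hbij : ∀ (U : X.Opens), ∀ x ∈ U, ∃ V ≤ U, x ∈ V ∧ Function.Bijective (h.app (op V))) :
    Nonempty (sheafify P ≅ G) := by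
  let J := Opens.grothendieckTopology X
  let η := toSheafify J P.presheaf
  let a : sheafify P ⟶ G :=
    ((PresheafOfModules.sheafificationAdjunction (𝟙 X.ringCatSheaf.obj)).homEquiv P G).symm h
  have ha : η ≫ (PresheafOfModules.toPresheaf _).map a.val =
      (PresheafOfModules.toPresheaf _).map h :=
    congrArg (PresheafOfModules.toPresheaf _).map
      (((PresheafOfModules.sheafificationAdjunction (𝟙 X.ringCatSheaf.obj)).homEquiv P
        G).apply_symm_apply h)
  have ha' (U : X.Opens) (p : P.presheaf.obj (op U)) :
      a.app U (η.app (op U) p) = h.app (op U) p :=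
    ConcreteCategory.congr_hom (NatTrans.congr_app ha (op U)) p
  have hη {U V : X.Opens} (i : V ≤ U) (p : P.presheaf.obj (op U)) :
      η.app (op V) (P.presheaf.map (homOfLE i).op p) = (sheafify P).res i (η.app (op U) p) :=
    ConcreteCategory.congr_hom (η.naturality (homOfLE i).op) p
  have hh {U V : X.Opens} (i : V ≤ U) (p : P.presheaf.obj (op U)) :
      h.app (op V) (P.presheaf.map (homOfLE i).op p) = G.res i (h.app (op U) p) := by
    refine (ha' V _).symm.trans ?_
    refine (congrArg (a.app V) (hη i p)).trans ?_
    refine (a.appₗ_res i _).trans ?_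
    exact congrArg (G.res i) (ha' U p)
  have hinj (U : X.Opens) : Function.Injective (a.appₗ U) := by
    rw [injective_iff_map_eq_zero]
    intro s hs
    refine (sheafify P).eq_of_res_eq fun x hx ↦ ?_
    obtain ⟨V, i, ⟨p, hp⟩, hxV⟩ := Presheaf.imageSieve_mem J η s x hx
    obtain ⟨W, hW, hxW, hb⟩ := hbij V x hxV
    refine ⟨W, hW.trans (leOfHom i), hxW, ?_⟩
    have hp' : η.app (op V) p = (sheafify P).res (leOfHom i) s := hp
    have h1 : h.app (op V) p = 0 := by
      refine (ha' V p).symm.trans ?_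
      refine (congrArg (a.app V) hp').trans ?_
      refine (a.appₗ_res (leOfHom i) s).trans ?_
      exact (congrArg (G.res (leOfHom i)) hs).trans (map_zero (G.res (leOfHom i)))
    have h2 : P.presheaf.map (homOfLE hW).op p = 0 := hb.1 (by
      refine (hh hW p).trans ?_
      refine (congrArg (G.res hW) h1).trans ?_
      exact (map_zero (G.res hW)).trans (map_zero (h.app (op W)).hom).symm)
    rw [map_zero, ← (sheafify P).res_res (leOfHom i) hW, ← hp']
    refine (hη hW p).symm.trans ?_
    rw [h2]
    exact map_zero (η.app (op W)).hom
  have hsurj : LocallySurjective a := by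
    intro U s x hx
    obtain ⟨V, hV, hxV, hb⟩ := hbij U x hx
    obtain ⟨p, hp⟩ := hb.2 (G.res hV s)
    exact ⟨V, hV, hxV, η.app (op V) p, (ha' V p).trans hp⟩
  have := mono_of_injective a hinj
  have := hsurj.epi
  have := isIso_of_mono_of_epi a
  exact ⟨asIso a⟩

end AlgebraicGeometry.Scheme.Modules

namespace exteriorPower

variable {R N T : Type*} [CommRing R] [AddCommGroup N] [Module R N] [AddCommGroup T] [Module R T]

/-- Evaluation of alternating maps at an element of the exterior power. -/
def evalAlt (q : ℕ) : ⋀[R]^q N →ₗ[R] (N [⋀^Fin q]→ₗ[R] T) →ₗ[R] T :=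
  (alternatingMapLinearEquiv (R := R) (M := N) (N := T) (n := q)).toLinearMap.flip

lemma evalAlt_apply (q : ℕ) (x : ⋀[R]^q N) (f : N [⋀^Fin q]→ₗ[R] T) :
    evalAlt q x f = alternatingMapLinearEquiv f x := rfl

/-- Alternating maps are the dual of the exterior power, which is finite free and hence reflexive;
`e` replaces the base ring by a copy `T`, such as the sections of the structure sheaf. -/
lemma evalAlt_bijective [Module.Finite R N] [Module.Free R N] (e : R ≃ₗ[R] T) (q : ℕ) :
    Function.Bijective (evalAlt (R := R) (N := N) (T := T) q) := by
  let e' : Module.Dual R (⋀[R]^q N) ≃ₗ[R] (N [⋀^Fin q]→ₗ[R] T) :=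
    (LinearEquiv.arrowCongr (.refl R (⋀[R]^q N)) e).trans alternatingMapLinearEquiv.symm
  let g : Module.Dual R (Module.Dual R (⋀[R]^q N)) ≃ₗ[R] ((N [⋀^Fin q]→ₗ[R] T) →ₗ[R] T) :=
    LinearEquiv.arrowCongr e' e
  refine (g.bijective.comp (Module.evalEquiv R (⋀[R]^q N)).bijective).congr_fun fun x ↦ ?_
  refine LinearMap.ext fun f ↦ ?_
  rw [evalAlt_apply]
  simp [g, e', LinearEquiv.arrowCongr_apply]

section

variable {R' N' : Type*} [CommRing R'] [AddCommGroup N'] [Module R' N'] {σ : R' →+* R}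

lemma evalAlt_mapₛₗ_add (q : ℕ) (g : N' →ₛₗ[σ] N) (x y : ⋀[R']^q N') (f : N [⋀^Fin q]→ₗ[R] T) :
    evalAlt q (mapₛₗ q g (x + y)) f = evalAlt q (mapₛₗ q g x) f + evalAlt q (mapₛₗ q g y) f := by
  rw [map_add, map_add, LinearMap.add_apply]

lemma evalAlt_mapₛₗ_smul (q : ℕ) (g : N' →ₛₗ[σ] N) (r : R') (x : ⋀[R']^q N')
    (f : N [⋀^Fin q]→ₗ[R] T) :
    evalAlt q (mapₛₗ q g (r • x)) f = σ r • evalAlt q (mapₛₗ q g x) f := by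
  rw [map_smulₛₗ, _root_.map_smul, LinearMap.smul_apply]

end

end exteriorPower

namespace AlgebraicGeometry.Scheme.Modules

variable {X : Scheme.{u}} (N T : X.Modules) (q : ℕ)

lemma mapₛₗ_res_res {U V W : X.Opens} (h : V ≤ U) (h' : W ≤ V) (x : ⋀[Γ(X, U)]^q Γ(N, U)) :
    exteriorPower.mapₛₗ q (N.res h') (exteriorPower.mapₛₗ q (N.res h) x) =
      exteriorPower.mapₛₗ q (N.res (h'.trans h)) x := by
  refine DFunLike.congr_fun (exteriorPower.addHom_ext (R := Γ(X, U)) q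
    (f := (exteriorPower.mapₛₗ q (N.res h')).toAddMonoidHom.comp
      (exteriorPower.mapₛₗ q (N.res h)).toAddMonoidHom)
    (g := (exteriorPower.mapₛₗ q (N.res (h'.trans h))).toAddMonoidHom) fun c m ↦ ?_) x
  rw [AddMonoidHom.comp_apply, exteriorPower.mapₛₗ_smul_ιMulti, exteriorPower.mapₛₗ_smul_ιMulti,
    exteriorPower.mapₛₗ_smul_ιMulti]
  have h1 : N.res h' ∘ N.res h ∘ m = N.res (h'.trans h) ∘ m := funext fun i ↦ N.res_res h h' _
  exact congrArg₂ (fun (a : Γ(X, W)) b ↦ a • exteriorPower.ιMulti Γ(X, W) q b)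
    (map_map_eq h h' c) h1

variable {N T q} in
lemma evalAlt_res {U V : X.Opens} (h : V ≤ U) (φ : Γ(altSheaf N T q, U))
    (x : ⋀[Γ(X, U)]^q Γ(N, U)) :
    exteriorPower.evalAlt q (exteriorPower.mapₛₗ q (N.res h) x) (altEval h φ) =
      T.res h (exteriorPower.evalAlt q x (altEval le_rfl φ)) := by
  refine DFunLike.congr_fun (exteriorPower.addHom_ext (R := Γ(X, U)) q
    (f := ((exteriorPower.alternatingMapLinearEquiv (altEval h φ)).toAddMonoidHom).comp
      (exteriorPower.mapₛₗ q (N.res h)).toAddMonoidHom)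
    (g := (T.res h).toAddMonoidHom.comp
      (exteriorPower.alternatingMapLinearEquiv (altEval le_rfl φ)).toAddMonoidHom) fun c m ↦ ?_) x
  rw [AddMonoidHom.comp_apply, AddMonoidHom.comp_apply, exteriorPower.mapₛₗ_smul_ιMulti]
  change exteriorPower.alternatingMapLinearEquiv (altEval h φ) (_ • _) =
    T.res h (exteriorPower.alternatingMapLinearEquiv (altEval le_rfl φ) (c • _))
  rw [_root_.map_smul, _root_.map_smul, map_smulₛₗ, exteriorPower.alternatingMapLinearEquiv_apply_ιMulti,
    exteriorPower.alternatingMapLinearEquiv_apply_ιMulti]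
  exact congrArg (_ • ·) (altEval_comp_res le_rfl h φ m)

/-- Evaluation of forms at a section of the presheaf of exterior powers. -/
def evalForm (U : X.Opens) :
    ⋀[Γ(X, U)]^q Γ(N, U) →ₗ[Γ(X, U)] Γ(altSheaf (altSheaf N T q) T 1, U) where
  toFun x := altMk (fun V hV ↦ AlternatingMap.ofSubsingleton Γ(X, V) Γ(altSheaf N T q, V) Γ(T, V)
      (0 : Fin 1) ((exteriorPower.evalAlt q (exteriorPower.mapₛₗ q (N.res hV) x)).comp (altEvalₗ V)))
    fun V W hV h m ↦ by
      change exteriorPower.evalAlt q (exteriorPower.mapₛₗ q (N.res (h.trans hV)) x)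
        (altEval h (m 0)) = _
      rw [← mapₛₗ_res_res N q hV h]
      exact evalAlt_res h (m 0) _
  map_add' x y := altSheaf_ext fun V hV m ↦
    exteriorPower.evalAlt_mapₛₗ_add q (N.res hV) x y (altEval le_rfl (m 0))
  map_smul' r x := altSheaf_ext fun V hV m ↦
    exteriorPower.evalAlt_mapₛₗ_smul q (N.res hV) r x (altEval le_rfl (m 0))

lemma altEval_evalForm {U V : X.Opens} (hV : V ≤ U) (x : ⋀[Γ(X, U)]^q Γ(N, U))
    (m : Fin 1 → Γ(altSheaf N T q, V)) : altEval hV (evalForm N T q U x) m =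
      exteriorPower.evalAlt q (exteriorPower.mapₛₗ q (N.res hV) x) (altEval le_rfl (m 0)) := rfl

lemma evalForm_res {U V : X.Opens} (h : V ≤ U) (x : ⋀[Γ(X, U)]^q Γ(N, U)) :
    evalForm N T q V (exteriorPower.mapₛₗ q (N.res h) x) =
      (altSheaf (altSheaf N T q) T 1).res h (evalForm N T q U x) :=
  altSheaf_ext fun W hW m ↦ by
    rw [altEval_res, altEval_evalForm, altEval_evalForm, mapₛₗ_res_res]

lemma mapₛₗ_res_self {U : X.Opens} (x : ⋀[Γ(X, U)]^q Γ(N, U)) :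
    exteriorPower.mapₛₗ q (N.res (le_refl U)) x = x :=
  ConcreteCategory.congr_hom ((exteriorPowerPresheaf N q).presheaf.map_id (op U)) x

variable {N} in
lemma IsFrame.evalForm_bijective {U : X.Opens} {n : ℕ} {b : Fin n → Γ(N, U)} (hb : IsFrame N U b) :
    Function.Bijective (evalForm N (structureSheaf X) q U) := by
  have := Module.Free.of_basis (hb.basis le_rfl)
  have := Module.Finite.of_basis (hb.basis le_rfl)
  have h1 := exteriorPower.evalAlt_bijective (N := Γ(N, U)) (sec U) q
  let e : (Γ(altSheaf N (structureSheaf X) q, U) →ₗ[Γ(X, U)] Γ(structureSheaf X, U)) ≃ₗ[Γ(X, U)]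
      ((Γ(N, U) [⋀^Fin q]→ₗ[Γ(X, U)] Γ(structureSheaf X, U)) →ₗ[Γ(X, U)] Γ(structureSheaf X, U)) :=
    LinearEquiv.arrowCongr (hb.altEquiv (T := structureSheaf X) (q := q))
      (LinearEquiv.refl Γ(X, U) Γ(structureSheaf X, U))
  have h2 : Function.Bijective fun φ : Γ(altSheaf (altSheaf N (structureSheaf X) q)
      (structureSheaf X) 1, U) ↦ e ((AlternatingMap.ofSubsingleton Γ(X, U) _ _ (0 : Fin 1)).symm
        (altEval le_rfl φ)) :=
    e.bijective.comp ((AlternatingMap.ofSubsingleton Γ(X, U) _ _ (0 : Fin 1)).symm.bijective.comp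
      ((hb.alt q).altEquiv (T := structureSheaf X) (q := 1)).bijective)
  refine (Function.Bijective.of_comp_iff' h2 _).1 (h1.congr_fun fun x ↦ LinearMap.ext fun f ↦ ?_)
  change exteriorPower.evalAlt q (exteriorPower.mapₛₗ q (N.res (le_refl U)) x)
    (altEval le_rfl (hb.altEquiv.symm f)) = exteriorPower.evalAlt q x f
  rw [mapₛₗ_res_self, altEval_altEquiv_symm]

variable {N} in
-- Evaluation of forms is bijective on framed open sets, which are arbitrarily small. This turns the
-- dual of the sheaf of forms into the exterior power on the second page.
lemma LocallyFramed.nonempty_exteriorPower_iso (hN : N.LocallyFramed) :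
    Nonempty (N.exteriorPower q ≅
      altSheaf (altSheaf N (structureSheaf X) q) (structureSheaf X) 1) := by
  refine nonempty_sheafify_iso _ _ (PresheafOfModules.homMk
    { app U := AddCommGrpCat.ofHom (evalForm N (structureSheaf X) q (unop U)).toAddMonoidHom
      naturality U V i := by
        ext x
        exact evalForm_res N (structureSheaf X) q (leOfHom i.unop) x }
    fun U r x ↦ (evalForm N (structureSheaf X) q (unop U)).map_smul r x) fun U x hx ↦ ?_
  obtain ⟨V, hV, hxV, n, b, hb⟩ := hN.exists_frame hx
  exact ⟨V, hV, hxV, hb.evalForm_bijective q⟩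

end AlgebraicGeometry.Scheme.Modules

/-! ### Splitting of filtrations and assembly of the result. -/

namespace LinearEquiv

/-- A product over `Fin (n + 1)` as the product of the last factor and the other ones. -/
def piFinSnoc (k : Type*) [Semiring k] {n : ℕ} (G : Fin (n + 1) → Type*)
    [∀ i, AddCommMonoid (G i)] [∀ i, Module k (G i)] :
    (∀ i, G i) ≃ₗ[k] G (Fin.last n) × ∀ i, G (Fin.castSucc i) where
  toEquiv := (Fin.snocEquiv G).symm
  map_add' _ _ := rfl
  map_smul' _ _ := rfl

end LinearEquiv

lemma Submodule.nonempty_equiv_quotient_prod {k V : Type*} [Field k] [AddCommGroup V] [Module k V]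
    (p : Submodule k V) : Nonempty (V ≃ₗ[k] (V ⧸ p) × p) := by
  obtain ⟨q, hq⟩ := p.exists_isCompl
  exact ⟨(q.prodEquivOfIsCompl p hq.symm).symm.trans
    ((p.quotientEquivOfIsCompl q hq).symm.prodCongr (.refl k p))⟩

/-- A finite filtration of a vector space splits. -/
lemma Submodule.nonempty_equiv_pi_of_filtration {k V : Type*} [Field k] [AddCommGroup V] [Module k V]
    (F : ℤ → Submodule k V) (hF : Monotone F) (h0 : F (-1) = ⊥) (G : ℕ → Type*)
    [∀ q, AddCommGroup (G q)] [∀ q, Module k (G q)] (m : ℕ)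
    (hG : ∀ q < m, Nonempty ((F q ⧸ (F (q - 1)).submoduleOf (F q)) ≃ₗ[k] G q)) :
    Nonempty (F (m - 1) ≃ₗ[k] ∀ q : Fin m, G q) := by
  induction m with
  | zero =>
    have : Subsingleton (F ((0 : ℕ) - 1)) := by
      rw [show ((0 : ℕ) : ℤ) - 1 = -1 from rfl, h0]
      infer_instance
    exact ⟨⟨0, 0, fun _ ↦ Subsingleton.elim _ _, fun _ ↦ Subsingleton.elim _ _⟩⟩
  | succ m ih =>
    obtain ⟨e⟩ := ih fun q hq ↦ hG q (hq.trans m.lt_succ_self)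
    obtain ⟨g⟩ := hG m m.lt_succ_self
    -- Over a field each step of the filtration splits off its graded piece.
    obtain ⟨s⟩ := ((F (m - 1)).submoduleOf (F m)).nonempty_equiv_quotient_prod
    rw [show ((m + 1 : ℕ) : ℤ) - 1 = m by push_cast; ring]
    exact ⟨s.trans ((g.prodCongr ((Submodule.submoduleOfEquivOfLe (hF (by omega))).trans e)).trans
      (LinearEquiv.piFinSnoc k fun q : Fin (m + 1) ↦ G q).symm)⟩

lemma CategoryTheory.Abelian.SpectralObject.filtration_monotone {k : Type*} [Ring k]
    (S : SpectralObject (ModuleCat.{v} k) EInt) (n : ℤ) : Monotone (S.filtration n) := by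
  intro q q' h
  have h' : ((q + 1 : ℤ) : EInt) ≤ ((q' + 1 : ℤ) : EInt) := WithBotTop.coe_le_coe.2 (by omega)
  rw [filtration_eq_range, filtration_eq_range]
  rintro _ ⟨x, rfl⟩
  exact ⟨S.mapH n bot_le bot_le le_rfl h' x, S.mapH_mapH n bot_le bot_le bot_le le_rfl h' le_rfl le_top x⟩

/-- Indexing the pairs of natural numbers with sum `n` by the second component. -/
def Finset.finEquivAntidiagonal (n : ℕ) :
    Fin (n + 1) ≃ {pq : ℕ × ℕ // pq ∈ Finset.HasAntidiagonal.antidiagonal n} where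
  toFun q := ⟨(n - q, q), Finset.HasAntidiagonal.mem_antidiagonal.2 (by dsimp; omega)⟩
  invFun pq := ⟨pq.1.2, by have := Finset.HasAntidiagonal.mem_antidiagonal.1 pq.2; omega⟩
  left_inv _ := rfl
  right_inv pq := Subtype.ext (Prod.ext (by have := Finset.HasAntidiagonal.mem_antidiagonal.1 pq.2; dsimp; omega) rfl)

namespace DerivedCategory

variable {C : Type u} [Category.{v} C] [Abelian C] [HasDerivedCategory.{w} C]
  (k : Type*) [Field k] [Linear k C] [HasExt.{z} C]

/-- Morphisms between shifted objects in terms of `Ext`. -/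
def shiftExtLinearEquiv (M N : C) (p q : ℕ) :
    (((singleFunctor C 0).obj M)⟦(q : ℤ)⟧ ⟶ ((singleFunctor C 0).obj N)⟦(p + q : ℤ)⟧) ≃ₗ[k]
      Abelian.Ext M N p :=
  ((Linear.homCongr k (Iso.refl _)
      ((shiftFunctorAdd' (DerivedCategory C) (p : ℤ) q _ rfl).app ((singleFunctor C 0).obj N))).trans
    (LinearEquiv.ofBijective ((shiftFunctor (DerivedCategory C) (q : ℤ)).mapLinearMap k
        (X := (singleFunctor C 0).obj M) (Y := ((singleFunctor C 0).obj N)⟦(p : ℤ)⟧))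
      ⟨(shiftFunctor (DerivedCategory C) (q : ℤ)).map_injective,
        (shiftFunctor (DerivedCategory C) (q : ℤ)).map_surjective⟩).symm).trans
    (Abelian.Ext.homLinearEquiv (R := k) (X := M) (Y := N) (n := p)).symm

end DerivedCategory

namespace AlgebraicGeometry.Scheme.Modules

variable (k : Type u) [Field k] {X Y : Scheme.{u}} [X.Over (Spec (.of k))] [Y.Over (Spec (.of k))]

lemma app_scalars (f : X ⟶ Y) [f.IsOver (Spec (.of k))] (c : k) :
    f.appTop (scalars k Y c) = scalars k X c := by
  have h := Scheme.Hom.comp_appTop f (Y ↘ Spec (.of k))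
  rw [comp_over] at h
  exact (DFunLike.congr_fun (congrArg CommRingCat.Hom.hom h) ((Scheme.ΓSpecIso (.of k)).inv c)).symm

instance (f : X ⟶ Y) [f.IsOver (Spec (.of k))] : (Scheme.Modules.pushforward f).Linear k where
  map_smul {M N} φ c := by
    ext U x
    have h : (X.presheaf.map (homOfLE le_top : f ⁻¹ᵁ U ⟶ ⊤).op) (scalars k X c) =
        f.app U (Y.presheaf.map (homOfLE le_top : U ⟶ ⊤).op (scalars k Y c)) := by
      rw [← app_scalars k f]
      exact (ConcreteCategory.congr_hom (f.naturality (homOfLE le_top : U ⟶ ⊤).op) (scalars k Y c)).symm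
    exact congrArg (fun r : Γ(X, f ⁻¹ᵁ U) ↦ φ.app (f ⁻¹ᵁ U) (r • (show Γ(M, f ⁻¹ᵁ U) from x))) h

end AlgebraicGeometry.Scheme.Modules

namespace AlgebraicGeometry.Scheme.Modules

variable {k : Type u} [Field k] {X Y : Scheme.{u}}
    [X.Over (Spec (.of k))] [Y.Over (Spec (.of k))]

/-- The pieces of the truncation filtration of the derived inverse image, split off from it. -/
lemma exists_pieceAt_iso_altSheaf (i : X ⟶ Y) [i.IsOver (Spec (.of k))] [IsClosedImmersion i]
    (hlci : IsLCI i)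
    (hchar : ringChar k = 0 ∨ ∀ (x : X) (c : ℕ), HasCodimAt i x c → c < ringChar k)
    (hN : NormalBundleExtends i) {A : DerivedCategory X.Modules}
    (r : DerivedPullback i (single₀ (pushforwardStructureSheaf i)) A) (b : ℕ) :
    ∃ (e : A.pieceAt b ≅ (single₀ (altSheaf (normalSheaf i) (structureSheaf X) b))⟦(b : ℤ)⟧)
      (ψ : DerivedCategory.TStructure.t.truncPiece A (bot_le : (⊥ : EInt) ≤ ⊤) ⟶
        (single₀ (altSheaf (normalSheaf i) (structureSheaf X) b))⟦(b : ℤ)⟧),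
      A.truncToPieceAt b ≫ e.hom = A.truncTo b ≫ ψ := by
  obtain ⟨x, hx⟩ := exists_isUniversalClass (k := k) i hlci hchar hN b
  exact exists_pieceAt_iso (k := k) r hx

variable (k) in
-- The piece of index `q` is a shifted locally free module, so the second page is an Ext group of
-- that module, hence cohomology of its dual, which is the exterior power of `N`.
lemma LocallyFramed.nonempty_pageTwo_equiv {N : X.Modules} (hN : N.LocallyFramed)
    {A : DerivedCategory X.Modules} (p q : ℕ)
    (e : A.pieceAt q ≅ (single₀ (altSheaf N (structureSheaf X) q))⟦(q : ℤ)⟧) :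
    Nonempty (((homSpectralSequence k A (single₀ (structureSheaf X))).page 2 le_rfl).X (p, q) ≃ₗ[k]
      (N.exteriorPower q).Cohomology p) := by
  obtain ⟨e₁⟩ := (hN.alt (q := q)).nonempty_ext_equiv k (structureSheaf X) p
  obtain ⟨e₂⟩ := hN.nonempty_exteriorPower_iso q
  exact ⟨((homSpectralObject k A (single₀ (structureSheaf X))).pageTwoEquiv _ p q rfl).trans
    ((Linear.homCongr k e (Iso.refl ((single₀ (structureSheaf X))⟦(p + q : ℤ)⟧))).trans
      ((DerivedCategory.shiftExtLinearEquiv k _ _ p q).trans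
        (e₁.trans (cohomologyEquiv k e₂ p).symm)))⟩

lemma isDegenerate_homSpectralObject (i : X ⟶ Y) [i.IsOver (Spec (.of k))] [IsClosedImmersion i]
    (hlci : IsLCI i)
    (hchar : ringChar k = 0 ∨ ∀ (x : X) (c : ℕ), HasCodimAt i x c → c < ringChar k)
    (hN : NormalBundleExtends i) {A : DerivedCategory X.Modules}
    (r : DerivedPullback i (single₀ (pushforwardStructureSheaf i)) A) :
    (homSpectralObject k A (single₀ (structureSheaf X))).IsDegenerate := by
  have := DerivedCategory.isLE_of_corepresentableBy (Scheme.Modules.pushforward i) r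
  exact DerivedCategory.isDegenerate_homSpectralObject k A _ fun b ↦
    ⟨_, exists_pieceAt_iso_altSheaf i hlci hchar hN r b⟩

section

variable (k) (A : DerivedCategory X.Modules) [A.IsLE 0]

lemma homSpectralSequence_isZero (p q : ℤ) (h : p < 0 ∨ q < 0) :
    IsZero (((homSpectralSequence k A (single₀ (structureSheaf X))).page 2 le_rfl).X (p, q)) := by
  refine (homSpectralObject k A (single₀ (structureSheaf X))).isZero_page_two (p + q) p q rfl ?_
  rcases h with h | h
  · exact DerivedCategory.TStructure.t.subsingleton_of_lt k A _ _ q _ (by omega)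
  · exact DerivedCategory.TStructure.t.subsingleton_of_nonpos k A _ _ (q + 1) _ (by omega)

lemma filtration_neg_one (n : ℤ) :
    (homSpectralObject k A (single₀ (structureSheaf X))).filtration n (-1) = ⊥ :=
  (homSpectralObject k A (single₀ (structureSheaf X))).filtration_eq_bot n (-1)
    (DerivedCategory.TStructure.t.subsingleton_of_nonpos k A _ n (-1 + 1) _ (by omega))

lemma filtration_self (n : ℤ) :
    (homSpectralObject k A (single₀ (structureSheaf X))).filtration n n = ⊤ :=
  (homSpectralObject k A (single₀ (structureSheaf X))).filtration_eq_top n n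
    (DerivedCategory.TStructure.t.subsingleton_of_lt k A _ n (n + 1) _ (by omega))

/-- The filtration of the abutment is finite, from index `-1`, where it is zero, to index `n`, where
it is everything. Its graded pieces are those of the second page, so the abutment is their sum. -/
lemma nonempty_abutment_equiv_directSum (n : ℕ) (G : ℕ → ℕ → Type*)
    [∀ p q, AddCommGroup (G p q)] [∀ p q, Module k (G p q)]
    (hG : ∀ p q : ℕ, Nonempty
      (((homSpectralSequence k A (single₀ (structureSheaf X))).page 2 le_rfl).X (p, q) ≃ₗ[k] G p q))
    (hdeg : (homSpectralObject k A (single₀ (structureSheaf X))).IsDegenerate) :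
    Nonempty ((homSpectralObject k A (single₀ (structureSheaf X))).abutment n ≃ₗ[k]
      DirectSum {pq : ℕ × ℕ // pq ∈ Finset.HasAntidiagonal.antidiagonal n} fun pq ↦
        G pq.1.1 pq.1.2) := by
  let S := homSpectralObject k A (single₀ (structureSheaf X))
  obtain ⟨e⟩ := Submodule.nonempty_equiv_pi_of_filtration (S.filtration n) (S.filtration_monotone n)
    (filtration_neg_one k A n) (fun q ↦ G (n - q) q) (n + 1) fun q hq ↦ by
      obtain ⟨e₁⟩ := hdeg.nonempty_graded_equiv n q
      obtain ⟨e₂⟩ := hG (n - q) q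
      exact ⟨e₁.trans ((S.pageTwoEquiv n ((n - q : ℕ) : ℤ) q (by omega)).symm.trans e₂)⟩
  rw [show ((n + 1 : ℕ) : ℤ) - 1 = n by push_cast; ring, filtration_self k A n] at e
  exact ⟨Submodule.topEquiv.symm.trans (e.trans ((LinearEquiv.piCongrLeft k
    (fun pq : {pq : ℕ × ℕ // pq ∈ Finset.HasAntidiagonal.antidiagonal n} ↦ G pq.1.1 pq.1.2)
    (Finset.finEquivAntidiagonal n)).trans (DirectSum.linearEquivFunOnFintype k _ _).symm))⟩

end

end AlgebraicGeometry.Scheme.Modules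

end

theorem corollary2 {k : Type u} [Field k] {X Y : Scheme.{u}}
    [X.Over (Spec (.of k))] [Y.Over (Spec (.of k))]
    (i : X ⟶ Y) [i.IsOver (Spec (.of k))] [IsClosedImmersion i]
    (hlci : IsLCI i)
    (hchar : ringChar k = 0 ∨ ∀ (x : X) (c : ℕ), HasCodimAt i x c → c < ringChar k)
    (hN : NormalBundleExtends i) :
    (∃ A : DerivedCategory X.Modules,
      Nonempty (DerivedPullback i (single₀ (pushforwardStructureSheaf i)) A)) ∧
    (∀ A : DerivedCategory X.Modules,
      Nonempty (DerivedPullback i (single₀ (pushforwardStructureSheaf i)) A) →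
      (∀ p q : ℕ, Nonempty
        (((homSpectralSequence k A (single₀ (structureSheaf X))).page 2 le_rfl).X (p, q) ≃ₗ[k]
          ((normalSheaf i).exteriorPower q).Cohomology p)) ∧
      (∀ p q : ℤ, p < 0 ∨ q < 0 →
        IsZero (((homSpectralSequence k A (single₀ (structureSheaf X))).page 2 le_rfl).X (p, q))) ∧
      (∀ n : ℤ, Nonempty ((homSpectralObject k A (single₀ (structureSheaf X))).abutment n ≃ₗ[k]
        (A ⟶ (single₀ (structureSheaf X))⟦n⟧))) ∧
      (∀ n : ℕ, Nonempty ((A ⟶ (single₀ (structureSheaf X))⟦(n : ℤ)⟧) ≃ₗ[k]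
        Abelian.Ext (pushforwardStructureSheaf i) (pushforwardStructureSheaf i) n)) ∧
      (∀ n : ℤ,
        (homSpectralObject k A (single₀ (structureSheaf X))).filtration n (-1) = ⊥ ∧
        (homSpectralObject k A (single₀ (structureSheaf X))).filtration n n = ⊤ ∧
        ∀ q : ℤ, Nonempty ((homSpectralObject k A (single₀ (structureSheaf X))).graded n q ≃ₗ[k]
          ((homSpectralSequence k A (single₀ (structureSheaf X))).page 2 le_rfl).X (n - q, q))) ∧
      (∀ (r : ℤ) (hr : 2 ≤ r) (pq pq' : ℤ × ℤ),
        ((homSpectralSequence k A (single₀ (structureSheaf X))).page r hr).d pq pq' = 0)) ∧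
    (∀ n : ℕ, Nonempty
      (Abelian.Ext (pushforwardStructureSheaf i) (pushforwardStructureSheaf i) n ≃ₗ[k]
        DirectSum {pq : ℕ × ℕ // pq ∈ Finset.HasAntidiagonal.antidiagonal n} fun pq ↦
          ((normalSheaf i).exteriorPower pq.1.2).Cohomology pq.1.1)) := by
  have hframed := locallyFramed_normalSheaf i hN
  have hpage (A : DerivedCategory X.Modules)
      (r : DerivedPullback i (single₀ (pushforwardStructureSheaf i)) A) (p q : ℕ) :=
    hframed.nonempty_pageTwo_equiv k p q (exists_pieceAt_iso_altSheaf i hlci hchar hN r q).choose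
  refine ⟨exists_derivedPullback i _, fun A ⟨r⟩ ↦ ?_, fun n ↦ ?_⟩
  · have := DerivedCategory.isLE_of_corepresentableBy (Scheme.Modules.pushforward i) r
    have hdeg := isDegenerate_homSpectralObject i hlci hchar hN r
    refine ⟨hpage A r, homSpectralSequence_isZero k A, fun n ↦ ⟨?_⟩, fun n ↦ ⟨?_⟩,
      fun n ↦ ⟨filtration_neg_one k A n, filtration_self k A n, fun q ↦ ?_⟩, hdeg.page_d_eq_zero⟩
    · exact Triangulated.TStructure.abutmentEquiv k DerivedCategory.TStructure.t A _ n
    · exact DerivedCategory.extLinearEquiv (Scheme.Modules.pushforward i) r k (structureSheaf X) n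
    · obtain ⟨e⟩ := hdeg.nonempty_graded_equiv n q
      exact ⟨e.trans ((homSpectralObject k A (single₀ (structureSheaf X))).pageTwoEquiv n (n - q) q
        (by omega)).symm⟩
  -- The Ext groups on `Y` do not involve a choice of derived pull-back; any one serves to compute
  -- them.
  · obtain ⟨A, ⟨r⟩⟩ := exists_derivedPullback i (pushforwardStructureSheaf i)
    have := DerivedCategory.isLE_of_corepresentableBy (Scheme.Modules.pushforward i) r
    obtain ⟨e⟩ := nonempty_abutment_equiv_directSum k A n
      (fun p q ↦ ((normalSheaf i).exteriorPower q).Cohomology p) (hpage A r)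
      (isDegenerate_homSpectralObject i hlci hchar hN r)
    exact ⟨(DerivedCategory.extLinearEquiv (Scheme.Modules.pushforward i) r k (structureSheaf X)
      n).symm.trans ((Triangulated.TStructure.abutmentEquiv k DerivedCategory.TStructure.t A _
        n).symm.trans e)⟩
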